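/- **Theorem (Existence, uniqueness and stability for the hybridized FOSPG method).** Let $d\in\{2,3\}$, $p\ge 0$, and let $\Omega\subset\mathbb R^d$ be a bounded polygonal/polyhedral domain (open, connected, equal to the interior of its closure). Let $A\in L^\infty(\Omega;\mathbb R^{d\times d})$ be symmetric with eigenvalues between two positive constants, and let $f\in L^2(\Omega)$. Let $\Upsilon:\Omega\times\mathbb R\to\mathbb R$ be a Carathéodory function such that, for a.e. $x$, $\Upsilon(x,\cdot)$ is an increasing bijection from $\mathbb R$ onto $(\underline u(x),\overline u(x))$ (infinite bounds are allowed), and such that $\Upsilon(\cdot,z)\in L^1(\Omega)$ for every constant $z$. Put $\mathcal U(\psi)(x)=\Upsilon(x,\psi(x))$. *Mesh and spaces.* Let $\mathcal T_h$ be a conforming mesh of $\Omega$ whose elements $T=\Phi_T(\hat T)$ are affine images of the unit simplex, or else all are affine images of the unit cube, and whose facets $E=\Phi_E(\hat E)$ are affine images of the $(d-1)$-dimensional reference element of the same kind. Let $\mathcal E_h$ be the set of all facets, including those on $\partial\Omega$, let $h_T,h_E$ be the diameters, and let $\boldsymbol n$ be the outward unit normal on $\partial T$. Let $\mathcal P_p$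 be the polynomials of total degree $\le p$ (simplex) or of degree $\le p$ in each variable (cube). Let $\mathrm{RT}_p(\hat T)$ be the Raviart–Thomas space: $[\mathcal P_p]^d+\mathbf x\,\mathcal P_p$ on the simplex, and on the cube the fields whose $i$-th component has degree $\le p+1$ in $x_i$ and $\le p$ in the other variables. Then - $V_h^p$ is the space of $v$ with $v|_T=\hat v\circ\Phi_T^{-1}$, $\hat v\in\mathcal P_p(\hat T)$, for all $T$; - $\boldsymbol\Sigma_h^p$ is the space of $\boldsymbol r$ with $\boldsymbol r|_T=(\det\Phi_T')^{-1}\Phi_T'\,\hat{\boldsymbol r}\circ\Phi_T^{-1}$, $\hat{\boldsymbol r}\in\mathrm{RT}_p(\hat T)$, for all $T$; - $\boldsymbol\Sigma_{h,\mathrm{div}}^p$ is the subspace of $\boldsymbol\Sigma_h^p$ of fields with continuous normal components across interior facets; - for $g\in L^2(\partial\Omega)$, $M_{h,g}^p$ is the set of facet functions $\mu$ with $\mu|_E=\hat\mu\circ\Phi_E^{-1}$, $\hat\mu\in\mathcal P_p(\hat E)$, for all $E$, and with $\mu|_E$ equal to the $L^2(E)$-projection of $g$ onto these polynomials on every boundary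 facet. Write $(\cdot,\cdot)$ for the (elementwise) $L^2(\Omega)$ inner product, $(a,b)_{\partial\mathcal T_h}=\sum_T\int_{\partial T}ab\,ds$, $\nabla_h$ for the broken gradient, and $$\mathcal B_h(\boldsymbol q,(v,\hat v))=(\boldsymbol q,\nabla_hv)-(v-\hat v,\boldsymbol q\cdot\boldsymbol n)_{\partial\mathcal T_h}.$$ *Subproblems.* For $\alpha^k>0$ and $\psi_h^{k-1}\in V_h^p$, the **hybridized subproblem** is: find $(\boldsymbol q_h^k,u_h^k,\hat u_h^k,\psi_h^k)\in\boldsymbol\Sigma_h^p\times V_h^p\times M_{h,g}^p\times V_h^p$ such that $$-\alpha^k\mathcal B_h(\boldsymbol q_h^k,(v,\hat v))+(\psi_h^k,v)=\alpha^k(f,v)+(\psi_h^{k-1},v),$$ $$(A^{-1}\boldsymbol q_h^k,\boldsymbol r)+\mathcal B_h(\boldsymbol r,(u_h^k,\hat u_h^k))=0,\qquad (u_h^k,w)-(\mathcal U(\psi_h^k),w)=0$$ for all $(v,\hat v)\in V_h^p\times M_{h,0}^p$, $\boldsymbol r\in\boldsymbol\Sigma_h^p$, $w\in V_h^p$. The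 **mixed subproblem** is: find $(\boldsymbol q_h^k,u_h^k,\psi_h^k)\in\boldsymbol\Sigma_{h,\mathrm{div}}^p\times V_h^p\times V_h^p$ such that $$\alpha^k(\nabla\cdot\boldsymbol q_h^k,v)+(\psi_h^k,v)=\alpha^k(f,v)+(\psi_h^{k-1},v),$$ $$(A^{-1}\boldsymbol q_h^k,\boldsymbol r)-(\nabla\cdot\boldsymbol r,u_h^k)=-\langle g,\boldsymbol r\cdot\boldsymbol n\rangle_{\partial\Omega},\qquad (u_h^k,w)-(\mathcal U(\psi_h^k),w)=0$$ for all $v,w\in V_h^p$, $\boldsymbol r\in\boldsymbol\Sigma_{h,\mathrm{div}}^p$. *Norms.* Let $H^1(\mathcal T_h)$ be the broken $H^1$ space, $[w]$ the jump across an interior facet and the trace on a boundary facet, and $$\|w\|_{\mathrm{DG}}^2=\sum_T\|A^{1/2}\nabla w\|_{L^2(T)}^2+\sum_{E\in\mathcal E_h}h_E^{-1}\|[w]\|_{L^2(E)}^2,\qquad \|v\|_{H^1(\mathcal T_h)^*}=\sup_{0\ne w\in H^1(\mathcal T_h)}\frac{(v,w)}{\|w\|_{\mathrm{DG}}},$$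 $$|||(\boldsymbol q,v,\hat v)|||^2=\|A^{-1/2}\boldsymbol q\|_{L^2(\Omega)}^2+\|A^{1/2}\nabla_hv\|_{L^2(\Omega)}^2+\sum_Th_T^{-1}\|v-\hat v\|_{L^2(\partial T)}^2 .$$ **(i) Existence and uniqueness.** For every such mesh, every $g\in L^2(\partial\Omega)$ (in particular every $g\in H^{1/2}(\partial\Omega)$), every $\alpha^k>0$ and every $\psi_h^{k-1}\in V_h^p$ (hence for every $k\ge1$ along the iteration), the hybridized subproblem has a unique solution $(\boldsymbol q_h^k,u_h^k,\hat u_h^k,\psi_h^k)$; the mixed subproblem has a unique solution, and it is $(\boldsymbol q_h^k,u_h^k,\psi_h^k)$. **(ii) Stability.** Let $g=0$, and let $\sigma,K$ be given. There is a constant $C_0$ such that for every mesh as above that is shape regular with constant $\sigma$ (every $T$ contains a ball of some radius $r>0$ with $h_T\le\sigma r$), every sequence of step sizes $\alpha^\ell>0$, every $\psi_h^0\in V_h^p$ with $\mathcal U(\psi_h^0)\in H^1(\mathcal T_h)$ and $\|\mathcal U(\psi_h^0)\|_{\mathrm{DG}}+\|\psi_h^0\|_{L^\infty(\Omega)}\le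 K$, and every $k\ge1$, the iterates of the hybridized method satisfy $$|||(\boldsymbol q_h^k,u_h^k,\hat u_h^k)|||+\frac{\|\psi_h^k\|_{H^1(\mathcal T_h)^*}}{\|\psi_h^0\|_{L^2(\Omega)}+\sum_{\ell=1}^k\alpha^\ell}\le C_0 .$$ If, in addition, one of the following holds: - $\underline u<0<\overline u$ are real constants and $\Upsilon(x,z)$ does not depend on $x$; put $\underline{\phi_0}=\tfrac12(\overline u-\underline u)$; or - $\Upsilon(x,z)=\phi_0(x)\Upsilon_0(z)+\phi_1(x)$ with $\phi_0\in L^\infty(\Omega)$, $\phi_0\ge\underline{\phi_0}>0$ a.e., $\phi_1\in L^\infty(\Omega)\cap H^1_0(\Omega)$, and $\Upsilon_0$ an increasing bijection from $\mathbb R$ onto $(-1,1)$ with $\Upsilon_0(0)=0$; then there is a constant $C_1$ such that, for all the same meshes, step sizes, initial guesses and $k\ge1$, $$\underline{\phi_0}\,\|\psi_h^k\|_{L^1(\Omega)}\le C_1\Big(1+\sum_{\ell=1}^k\alpha^\ell\Big).$$ The constants $C_0,C_1$ do not depend on the mesh (in particular on $h$), on $k$, or on the step sizes; they may depend on $d,p,\Omega,A,f,\Upsilon,\sigma,K$,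 on the kind of reference element and, for $C_1$, on $\underline{\phi_0}$. -/

import Mathlib

open MeasureTheory Set Filter Topology
open scoped ENNReal NNReal ContDiff

namespace FOSPG

noncomputable section

/-- `ℝ^d` with its Euclidean norm. -/
abbrev Euc (d : ℕ) : Type := EuclideanSpace ℝ (Fin d)

/-! ### Reference elements, reference facets, polynomial spaces -/

/-- The two families of meshes: simplices, or parallelograms / parallelepipeds. -/
inductive CellKind : Type
  | simplex
  | cube

/-- The reference element: the unit simplex or the unit cube of `ℝ^m`.  The reference facet of a
mesh of `ℝ^(n+1)` is the reference element of the same kind in `ℝ^n`. -/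
def refCell : (κ : CellKind) → (m : ℕ) → Set (Euc m)
  | CellKind.simplex, _ => {x | (∀ i, 0 ≤ x i) ∧ ∑ i, x i ≤ 1}
  | CellKind.cube, _ => {x | ∀ i, 0 ≤ x i ∧ x i ≤ 1}

/-- Labels of the facets of the reference element of `ℝ^d`.  Simplex: `some i` is the facet
`x_i = 0`, and `none` is the facet `∑ x_i = 1`.  Cube: `(i, false)` is the facet `x_i = 0`, and
`(i, true)` is the facet `x_i = 1`. -/
def LocalFacet : CellKind → ℕ → Type
  | CellKind.simplex, d => Option (Fin d)
  | CellKind.cube, d => Fin d × Bool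

instance instFintypeLocalFacet : (κ : CellKind) → (d : ℕ) → Fintype (LocalFacet κ d)
  | CellKind.simplex, d => inferInstanceAs (Fintype (Option (Fin d)))
  | CellKind.cube, d => inferInstanceAs (Fintype (Fin d × Bool))

/-- The facets of the reference element, as sets. -/
def refFacet : (κ : CellKind) → {d : ℕ} → LocalFacet κ d → Set (Euc d)
  | CellKind.simplex, d, none => {x | x ∈ refCell CellKind.simplex d ∧ ∑ i, x i = 1}
  | CellKind.simplex, d, some i => {x | x ∈ refCell CellKind.simplex d ∧ x i = 0}
  | CellKind.cube, d, (i, false) => {x | x ∈ refCell CellKind.cube d ∧ x i = 0}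
  | CellKind.cube, d, (i, true) => {x | x ∈ refCell CellKind.cube d ∧ x i = 1}

/-- An outward (not necessarily unit) normal vector of each facet of the reference element. -/
def refNormal : (κ : CellKind) → {d : ℕ} → LocalFacet κ d → Euc d
  | CellKind.simplex, _, none => WithLp.toLp 2 (fun _ => 1)
  | CellKind.simplex, _, some i => -EuclideanSpace.single i 1
  | CellKind.cube, _, (i, false) => -EuclideanSpace.single i 1
  | CellKind.cube, _, (i, true) => EuclideanSpace.single i 1

/-- `𝒫_p` on the reference element of `ℝ^m`: polynomials of total degree at most `p` (simplex), or
of degree at most `p` in each variable (cube). -/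
def polySpace : (κ : CellKind) → (m p : ℕ) → Set (Euc m → ℝ)
  | CellKind.simplex, m, p => {f | ∃ P ∈ MvPolynomial.restrictTotalDegree (Fin m) ℝ p,
      ∀ x, f x = MvPolynomial.eval (fun i => x i) P}
  | CellKind.cube, m, p => {f | ∃ P ∈ MvPolynomial.restrictDegree (Fin m) ℝ p,
      ∀ x, f x = MvPolynomial.eval (fun i => x i) P}

/-- The Raviart–Thomas space of degree `p` on the reference element: `[ℙ_p]^d + x ℙ_p` on the
simplex, and the fields whose `i`-th component has degree at most `p + 1` in `x_i` and at most `p`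
in the other variables, that is `a_i + x_i b_i` with `a_i, b_i ∈ ℚ_p`, on the cube. -/
def rtSpace : (κ : CellKind) → (d p : ℕ) → Set (Euc d → Euc d)
  | CellKind.simplex, d, p => {r | ∃ a : Fin d → Euc d → ℝ, ∃ b : Euc d → ℝ,
      (∀ i, a i ∈ polySpace CellKind.simplex d p) ∧ b ∈ polySpace CellKind.simplex d p ∧
      ∀ x i, r x i = a i x + x i * b x}
  | CellKind.cube, d, p => {r | ∃ a b : Fin d → Euc d → ℝ,
      (∀ i, a i ∈ polySpace CellKind.cube d p) ∧ (∀ i, b i ∈ polySpace CellKind.cube d p) ∧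
      ∀ x i, r x i = a i x + x i * b i x}

/-! ### Domains, coefficients, latent maps -/

/-- Bounded domains that are the interior of their closure.  (That the domain is polygonal or
polyhedral is expressed by the existence of a mesh.) -/
structure IsRegularDomain {d : ℕ} (Ω : Set (Euc d)) : Prop where
  isOpen : IsOpen Ω
  isConnected : IsConnected Ω
  isBounded : Bornology.IsBounded Ω
  interior_closure : interior (closure Ω) = Ω

/-- The bilinear form `u · B v` of a matrix; in particular `|A^{1/2} v|² = v · A v` and
`|A^{-1/2} v|² = v · A⁻¹ v` for symmetric positive definite `A`. -/
def matForm {d : ℕ} (B : Matrix (Fin d) (Fin d) ℝ) (u v : Euc d) : ℝ :=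
  u.ofLp ⬝ᵥ B.mulVec v.ofLp

/-- Symmetric diffusion tensors in `L^∞(Ω)` whose eigenvalues lie between two positive constants. -/
structure IsDiffusionTensor {d : ℕ} (Ω : Set (Euc d)) (A : Euc d → Matrix (Fin d) (Fin d) ℝ) :
    Prop where
  measurable : ∀ i j, AEStronglyMeasurable (fun x => A x i j) (volume.restrict Ω)
  symm : ∀ᵐ x ∂(volume.restrict Ω), (A x).IsSymm
  elliptic : ∃ a₀ a₁ : ℝ, 0 < a₀ ∧ ∀ᵐ x ∂(volume.restrict Ω), ∀ ξ : Euc d,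
    a₀ * ‖ξ‖ ^ 2 ≤ matForm (A x) ξ ξ ∧ matForm (A x) ξ ξ ≤ a₁ * ‖ξ‖ ^ 2

/-- `Υ` is a Carathéodory function such that `Υ(x, ·)` is an increasing bijection from `ℝ` onto the
open interval `(lo x, hi x)` for a.e. `x` (the bounds may be infinite), and the superposition
operator `𝒰(ψ)(x) = Υ(x, ψ(x))` sends constants to integrable functions. -/
structure IsLatentMap {d : ℕ} (Ω : Set (Euc d)) (lo hi : Euc d → EReal) (Υ : Euc d → ℝ → ℝ) :
    Prop where
  continuous : ∀ᵐ x ∂(volume.restrict Ω), Continuous (Υ x)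
  strictMono : ∀ᵐ x ∂(volume.restrict Ω), StrictMono (Υ x)
  range_eq : ∀ᵐ x ∂(volume.restrict Ω),
    range (Υ x) = {y : ℝ | lo x < (y : EReal) ∧ (y : EReal) < hi x}
  integrable : ∀ z : ℝ, Integrable (fun x => Υ x z) (volume.restrict Ω)

/-- The space `H^1_0(Ω)`: the functions `w ∈ L²(Ω)` that are limits of `C_c^∞(Ω)` functions in the
`H^1` norm; `G` is the weak gradient. -/
def MemH10 {d : ℕ} (Ω : Set (Euc d)) (w : Euc d → ℝ) : Prop :=
  ∃ G : Euc d → Euc d, MemLp w 2 (volume.restrict Ω) ∧ MemLp G 2 (volume.restrict Ω) ∧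
    ∃ φ : ℕ → Euc d → ℝ,
      (∀ j, ContDiff ℝ ∞ (φ j) ∧ HasCompactSupport (φ j) ∧ tsupport (φ j) ⊆ Ω) ∧
      Tendsto (fun j => eLpNorm (φ j - w) 2 (volume.restrict Ω)) atTop (𝓝 0) ∧
      Tendsto (fun j => eLpNorm (gradient (φ j) - G) 2 (volume.restrict Ω)) atTop (𝓝 0)

/-- Constant obstacles `a < 0 < b`, with `Υ(x, z)` independent of `x`. -/
def IsConstObstacle {d : ℕ} (Ω : Set (Euc d)) (Υ : Euc d → ℝ → ℝ) (a b : ℝ) : Prop :=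
  a < 0 ∧ 0 < b ∧ ∃ Υc : ℝ → ℝ, StrictMono Υc ∧ range Υc = Ioo a b ∧
    ∀ᵐ x ∂(volume.restrict Ω), ∀ z, Υ x z = Υc z

/-- `Υ(x, z) = φ₀(x) Υ₀(z) + φ₁(x)` with `φ₀ ∈ L^∞(Ω)`, `φ₀ ≥ c > 0`, `φ₁ ∈ L^∞(Ω) ∩ H^1_0(Ω)`,
and `Υ₀` an increasing bijection from `ℝ` onto `(-1, 1)` with `Υ₀(0) = 0`. -/
def IsAffineLatentMap {d : ℕ} (Ω : Set (Euc d)) (Υ : Euc d → ℝ → ℝ) (c : ℝ) : Prop :=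
  0 < c ∧ ∃ (φ₀ φ₁ : Euc d → ℝ) (Υ₀ : ℝ → ℝ),
    MemLp φ₀ ∞ (volume.restrict Ω) ∧ (∀ᵐ x ∂(volume.restrict Ω), c ≤ φ₀ x) ∧
    MemLp φ₁ ∞ (volume.restrict Ω) ∧ MemH10 Ω φ₁ ∧
    StrictMono Υ₀ ∧ range Υ₀ = Ioo (-1) 1 ∧ Υ₀ 0 = 0 ∧
    ∀ᵐ x ∂(volume.restrict Ω), ∀ z, Υ x z = φ₀ x * Υ₀ z + φ₁ x

/-! ### Meshes -/

/-- A conforming mesh of `Ω ⊆ ℝ^(n+1)`: the elements are affine images of the reference element,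
the facets are affine images of the reference facet, the elements have disjoint interiors, cover
`closure Ω`, and any two of them meet in a (possibly empty) common face.  `facetOf T i` is the
(global) facet that carries the `i`-th facet of the element `T`. -/
structure Mesh (κ : CellKind) (n : ℕ) (Ω : Set (Euc (n + 1))) where
  Cell : Type
  Facet : Type
  fintypeCell : Fintype Cell
  fintypeFacet : Fintype Facet
  cellMap : Cell → (Euc (n + 1) ≃ᵃ[ℝ] Euc (n + 1))
  facetMap : Facet → (Euc n →ᵃ[ℝ] Euc (n + 1))
  facetOf : Cell → LocalFacet κ (n + 1) → Facet
  facetMap_injective : ∀ F, Function.Injective (facetMap F)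
  image_facet : ∀ T i, facetMap (facetOf T i) '' refCell κ n = cellMap T '' refFacet κ i
  facet_ext : ∀ F F', facetMap F '' refCell κ n = facetMap F' '' refCell κ n → F = F'
  facet_surj : ∀ F, ∃ T i, facetOf T i = F
  cover : (⋃ T, cellMap T '' refCell κ (n + 1)) = closure Ω
  disjoint_interior : ∀ T T', T ≠ T' →
    Disjoint (interior (cellMap T '' refCell κ (n + 1))) (interior (cellMap T' '' refCell κ (n + 1)))
  conforming : ∀ T T', T ≠ T' →
    IsExposed ℝ (cellMap T '' refCell κ (n + 1))
      ((cellMap T '' refCell κ (n + 1)) ∩ (cellMap T' '' refCell κ (n + 1)))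

attribute [instance] Mesh.fintypeCell Mesh.fintypeFacet

section MeshDefs

variable {κ : CellKind} {n : ℕ} {Ω : Set (Euc (n + 1))} (M : Mesh κ n Ω)

/-- The element `T` as a set. -/
def Mesh.cell (T : M.Cell) : Set (Euc (n + 1)) := M.cellMap T '' refCell κ (n + 1)

/-- The diameter `h_T`. -/
def Mesh.hCell (T : M.Cell) : ℝ := Metric.diam (M.cell T)

/-- The diameter `h_E`. -/
def Mesh.hFacet (F : M.Facet) : ℝ := Metric.diam (M.facetMap F '' refCell κ n)

/-- Shape regularity with constant `σ`: each element contains a ball of radius `r` with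
`h_T ≤ σ r`. -/
def Mesh.ShapeRegular (σ : ℝ) : Prop :=
  ∀ T, ∃ c r, 0 < r ∧ Metric.closedBall c r ⊆ M.cell T ∧ M.hCell T ≤ σ * r

/-- A boundary facet is a facet of exactly one element. -/
def Mesh.IsBoundary (F : M.Facet) : Prop :=
  ∃! s : M.Cell × LocalFacet κ (n + 1), M.facetOf s.1 s.2 = F

/-- The outward unit normal of the element `T` on its `i`-th facet: the normalized image of the
reference normal under the inverse transpose of the Jacobian `Φ_T'`. -/
def Mesh.normal (T : M.Cell) (i : LocalFacet κ (n + 1)) : Euc (n + 1) :=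
  let N := LinearMap.adjoint ((M.cellMap T).linear.symm : Euc (n + 1) →ₗ[ℝ] Euc (n + 1))
    (refNormal κ i)
  ‖N‖⁻¹ • N

/-- The surface integral over the facet `F` of a function given by its pull-back to the reference
facet: `∫_F h ds = √det(Φ_F'ᵀ Φ_F') ∫ h(Φ_F(y)) dy`. -/
def Mesh.facetInt (F : M.Facet) (h : Euc n → ℝ) : ℝ :=
  Real.sqrt (LinearMap.det (LinearMap.adjoint (M.facetMap F).linear ∘ₗ (M.facetMap F).linear)) *
    ∫ y in refCell κ n, h y

/-- The sum over the elements `T` of the integrals over `∂T`; the integrand on the `i`-th facet of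
`T` is given by its pull-back to the reference facet. -/
def Mesh.bdryInt (h : M.Cell → LocalFacet κ (n + 1) → Euc n → ℝ) : ℝ :=
  ∑ T, ∑ i, M.facetInt (M.facetOf T i) (h T i)

/-- The integral over `∂Ω`. -/
def Mesh.domainBdryInt (h : M.Cell → LocalFacet κ (n + 1) → Euc n → ℝ) : ℝ :=
  open Classical in
  ∑ T, ∑ i, if M.IsBoundary (M.facetOf T i) then M.facetInt (M.facetOf T i) (h T i) else 0

/-- The point of `ℝ^(n+1)` that corresponds to the point `y` of the reference facet, on the `i`-th
facet of `T`. -/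
def Mesh.pt (T : M.Cell) (i : LocalFacet κ (n + 1)) (y : Euc n) : Euc (n + 1) :=
  M.facetMap (M.facetOf T i) y

/-! A broken function is a family `(v_T)_T`, where only the values of `v_T` on `T` matter; a broken
polynomial is represented by the family of the polynomials (on all of `ℝ^(n+1)`) that it equals on
the elements. -/

/-- The `L²(Ω)` inner product of broken functions. -/
def Mesh.ip (v w : M.Cell → Euc (n + 1) → ℝ) : ℝ := ∑ T, ∫ x in M.cell T, v T x * w T x

/-- The `L²(Ω)` norm. -/
def Mesh.l2Norm (v : M.Cell → Euc (n + 1) → ℝ) : ℝ := Real.sqrt (M.ip v v)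

/-- The `L¹(Ω)` norm. -/
def Mesh.l1Norm (v : M.Cell → Euc (n + 1) → ℝ) : ℝ := ∑ T, ∫ x in M.cell T, |v T x|

/-- The weighted inner product `(B q, r)` of broken vector fields. -/
def Mesh.ipMat (B : Euc (n + 1) → Matrix (Fin (n + 1)) (Fin (n + 1)) ℝ)
    (q r : M.Cell → Euc (n + 1) → Euc (n + 1)) : ℝ :=
  ∑ T, ∫ x in M.cell T, matForm (B x) (r T x) (q T x)

/-- The broken gradient of a piecewise smooth function. -/
def Mesh.brokenGrad (v : M.Cell → Euc (n + 1) → ℝ) : M.Cell → Euc (n + 1) → Euc (n + 1) :=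
  fun T x => gradient (v T) x

/-- The divergence of a smooth vector field. -/
def divergence {d : ℕ} (r : Euc d → Euc d) (x : Euc d) : ℝ :=
  ∑ i, (fderiv ℝ r x (EuclideanSpace.single i 1)) i

/-- The broken divergence of a piecewise smooth vector field. -/
def Mesh.brokenDiv (r : M.Cell → Euc (n + 1) → Euc (n + 1)) : M.Cell → Euc (n + 1) → ℝ :=
  fun T x => divergence (r T) x

/-- The superposition operator `𝒰(ψ)(x) = Υ(x, ψ(x))`. -/
def Mesh.superpose (Υ : Euc (n + 1) → ℝ → ℝ) (ψ : M.Cell → Euc (n + 1) → ℝ) :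
    M.Cell → Euc (n + 1) → ℝ :=
  fun T x => Υ x (ψ T x)

/-- A function on `Ω` as a broken function. -/
def Mesh.toBroken (f : Euc (n + 1) → ℝ) : M.Cell → Euc (n + 1) → ℝ := fun _ => f

/-! ### Finite element spaces -/

/-- The space `V_h^p`. -/
def Mesh.VSpace (p : ℕ) : Set (M.Cell → Euc (n + 1) → ℝ) :=
  {v | ∀ T, ∃ w ∈ polySpace κ (n + 1) p, ∀ x, v T x = w ((M.cellMap T).symm x)}

/-- The space `Σ_h^p`, through the Piola transform `r = (det Φ_T')⁻¹ Φ_T' r̂ ∘ Φ_T⁻¹`. -/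
def Mesh.SigmaSpace (p : ℕ) : Set (M.Cell → Euc (n + 1) → Euc (n + 1)) :=
  {r | ∀ T, ∃ w ∈ rtSpace κ (n + 1) p, ∀ x,
    r T x = (LinearMap.det ((M.cellMap T).linear : Euc (n + 1) →ₗ[ℝ] Euc (n + 1)))⁻¹ •
      (M.cellMap T).linear (w ((M.cellMap T).symm x))}

/-- The space `Σ_{h,div}^p`: the fields of `Σ_h^p` whose normal components are continuous across
the interior facets (the two outward normals on an interior facet are opposite). -/
def Mesh.SigmaDivSpace (p : ℕ) : Set (M.Cell → Euc (n + 1) → Euc (n + 1)) :=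
  {r | r ∈ M.SigmaSpace p ∧ ∀ T i T' i', (T, i) ≠ (T', i') → M.facetOf T i = M.facetOf T' i' →
    ∀ y ∈ refCell κ n, inner ℝ (r T (M.pt T i y)) (M.normal T i)
      + inner ℝ (r T' (M.pt T' i' y)) (M.normal T' i') = 0}

/-- `g` belongs to `L²(∂Ω)`. -/
def Mesh.MemL2Boundary (g : Euc (n + 1) → ℝ) : Prop :=
  ∀ F, M.IsBoundary F → MemLp (fun y => g (M.facetMap F y)) 2 (volume.restrict (refCell κ n))

/-- The space `M_{h,g}^p`.  A facet function `μ` is represented by its pull-backs `μ|_F ∘ Φ_F` to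
the reference facet, which are polynomials; on a boundary facet, `μ` is the `L²(F)`-projection of
`g`. -/
def Mesh.MSpace (p : ℕ) (g : Euc (n + 1) → ℝ) : Set (M.Facet → Euc n → ℝ) :=
  {μ | (∀ F, μ F ∈ polySpace κ n p) ∧ ∀ F, M.IsBoundary F → ∀ η ∈ polySpace κ n p,
    M.facetInt F (fun y => μ F y * η y) = M.facetInt F (fun y => g (M.facetMap F y) * η y)}

/-- The form `ℬ_h(q, (v, v̂)) = (q, ∇_h v) - (v - v̂, q · n)_{∂𝒯_h}`. -/
def Mesh.Bh (q : M.Cell → Euc (n + 1) → Euc (n + 1)) (v : M.Cell → Euc (n + 1) → ℝ)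
    (vh : M.Facet → Euc n → ℝ) : ℝ :=
  (∑ T, ∫ x in M.cell T, inner ℝ (q T x) (M.brokenGrad v T x)) -
    M.bdryInt (fun T i y =>
      (v T (M.pt T i y) - vh (M.facetOf T i) y) * inner ℝ (q T (M.pt T i y)) (M.normal T i))

/-! ### The subproblems -/

/-- `(q, u, û, ψ)` solves the hybridized FOSPG subproblem with step size `α` and previous latent
variable `ψ₀`. -/
structure Mesh.SolvesHybrid (p : ℕ) (A : Euc (n + 1) → Matrix (Fin (n + 1)) (Fin (n + 1)) ℝ)
    (f g : Euc (n + 1) → ℝ) (Υ : Euc (n + 1) → ℝ → ℝ) (α : ℝ)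
    (ψ₀ : M.Cell → Euc (n + 1) → ℝ)
    (q : M.Cell → Euc (n + 1) → Euc (n + 1)) (u : M.Cell → Euc (n + 1) → ℝ)
    (uh : M.Facet → Euc n → ℝ) (ψ : M.Cell → Euc (n + 1) → ℝ) : Prop where
  mem_q : q ∈ M.SigmaSpace p
  mem_u : u ∈ M.VSpace p
  mem_uh : uh ∈ M.MSpace p g
  mem_psi : ψ ∈ M.VSpace p
  balance : ∀ v ∈ M.VSpace p, ∀ vh ∈ M.MSpace p (fun _ => 0),
    -α * M.Bh q v vh + M.ip ψ v = α * M.ip (M.toBroken f) v + M.ip ψ₀ v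
  flux : ∀ r ∈ M.SigmaSpace p, M.ipMat (fun x => (A x)⁻¹) q r + M.Bh r u uh = 0
  latent : ∀ w ∈ M.VSpace p, M.ip u w - M.ip (M.superpose Υ ψ) w = 0

/-- `(q, u, ψ)` solves the mixed FOSPG subproblem with step size `α` and previous latent variable
`ψ₀`. -/
structure Mesh.SolvesMixed (p : ℕ) (A : Euc (n + 1) → Matrix (Fin (n + 1)) (Fin (n + 1)) ℝ)
    (f g : Euc (n + 1) → ℝ) (Υ : Euc (n + 1) → ℝ → ℝ) (α : ℝ)
    (ψ₀ : M.Cell → Euc (n + 1) → ℝ)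
    (q : M.Cell → Euc (n + 1) → Euc (n + 1)) (u : M.Cell → Euc (n + 1) → ℝ)
    (ψ : M.Cell → Euc (n + 1) → ℝ) : Prop where
  mem_q : q ∈ M.SigmaDivSpace p
  mem_u : u ∈ M.VSpace p
  mem_psi : ψ ∈ M.VSpace p
  balance : ∀ v ∈ M.VSpace p,
    α * M.ip (M.brokenDiv q) v + M.ip ψ v = α * M.ip (M.toBroken f) v + M.ip ψ₀ v
  flux : ∀ r ∈ M.SigmaDivSpace p,
    M.ipMat (fun x => (A x)⁻¹) q r - M.ip (M.brokenDiv r) u =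
      -M.domainBdryInt (fun T i y => g (M.pt T i y) * inner ℝ (r T (M.pt T i y)) (M.normal T i))
  latent : ∀ w ∈ M.VSpace p, M.ip u w - M.ip (M.superpose Υ ψ) w = 0

/-! ### The broken space `H^1(𝒯_h)` and the norms -/

/-- `G` is the weak gradient of `w` in the interior of the set `S`. -/
def IsWeakGrad {d : ℕ} (S : Set (Euc d)) (w : Euc d → ℝ) (G : Euc d → Euc d) : Prop :=
  ∀ φ : Euc d → Euc d, ContDiff ℝ ∞ φ → HasCompactSupport φ → tsupport φ ⊆ interior S →
    ∫ x in S, w x * divergence φ x = -∫ x in S, inner ℝ (G x) (φ x)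

/-- `γ` is the trace on `∂T` of the `H^1(T)` function `w` with weak gradient `G`: Green's formula
holds against all smooth vector fields. -/
def Mesh.IsTrace (T : M.Cell) (w : Euc (n + 1) → ℝ) (G : Euc (n + 1) → Euc (n + 1))
    (γ : LocalFacet κ (n + 1) → Euc n → ℝ) : Prop :=
  ∀ φ : Euc (n + 1) → Euc (n + 1), ContDiff ℝ ∞ φ →
    ∫ x in M.cell T, w x * divergence φ x =
      -(∫ x in M.cell T, inner ℝ (G x) (φ x)) +
        ∑ i, M.facetInt (M.facetOf T i)
          (fun y => γ i y * inner ℝ (φ (M.pt T i y)) (M.normal T i))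

/-- Elements of the broken space `H^1(𝒯_h)`, together with their broken weak gradient and their
traces on the boundaries of the elements, which they determine almost everywhere. -/
structure Mesh.BrokenH1 where
  val : M.Cell → Euc (n + 1) → ℝ
  grad : M.Cell → Euc (n + 1) → Euc (n + 1)
  trace : M.Cell → LocalFacet κ (n + 1) → Euc n → ℝ
  memLp_val : ∀ T, MemLp (val T) 2 (volume.restrict (M.cell T))
  memLp_grad : ∀ T, MemLp (grad T) 2 (volume.restrict (M.cell T))
  memLp_trace : ∀ T i, MemLp (trace T i) 2 (volume.restrict (refCell κ n))
  isWeakGrad : ∀ T, IsWeakGrad (M.cell T) (val T) (grad T)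
  isTrace : ∀ T, M.IsTrace T (val T) (grad T) (trace T)

/-- `‖[w]‖²_{L²(F)}`: on a boundary facet the jump is the trace; on an interior facet, which has
two sides `s ≠ s'`, the double sum counts `‖w_s - w_{s'}‖²` twice. -/
def Mesh.jumpSq (w : M.BrokenH1) (F : M.Facet) : ℝ :=
  open Classical in
  if M.IsBoundary F then
    ∑ s : M.Cell × LocalFacet κ (n + 1),
      if M.facetOf s.1 s.2 = F then M.facetInt F (fun y => (w.trace s.1 s.2 y) ^ 2) else 0
  else
    (1 / 2) * ∑ s : M.Cell × LocalFacet κ (n + 1), ∑ s' : M.Cell × LocalFacet κ (n + 1),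
      if M.facetOf s.1 s.2 = F ∧ M.facetOf s'.1 s'.2 = F then
        M.facetInt F (fun y => (w.trace s.1 s.2 y - w.trace s'.1 s'.2 y) ^ 2) else 0

/-- The norm `‖w‖_DG`, with
`‖w‖_DG² = ∑_T ‖A^{1/2} ∇w‖²_{L²(T)} + ∑_E h_E⁻¹ ‖[w]‖²_{L²(E)}`. -/
def Mesh.dgNorm (A : Euc (n + 1) → Matrix (Fin (n + 1)) (Fin (n + 1)) ℝ) (w : M.BrokenH1) : ℝ :=
  Real.sqrt (M.ipMat A w.grad w.grad + ∑ F, (M.hFacet F)⁻¹ * M.jumpSq w F)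

/-- The dual norm `‖v‖_{H^1(𝒯_h)*} = sup_w (v, w) / ‖w‖_DG`, with values in `[0, ∞]` (the sign of
`w` is free; `w = 0` contributes `0`). -/
def Mesh.dualNorm (A : Euc (n + 1) → Matrix (Fin (n + 1)) (Fin (n + 1)) ℝ)
    (v : M.Cell → Euc (n + 1) → ℝ) : ℝ≥0∞ :=
  ⨆ w : M.BrokenH1, ENNReal.ofReal (M.ip v w.val / M.dgNorm A w)

/-- The energy norm of `(q, v, v̂)`, whose square is
`‖A^{-1/2} q‖² + ‖A^{1/2} ∇_h v‖² + ∑_T h_T⁻¹ ‖v - v̂‖²_{L²(∂T)}`. -/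
def Mesh.tripleNorm (A : Euc (n + 1) → Matrix (Fin (n + 1)) (Fin (n + 1)) ℝ)
    (q : M.Cell → Euc (n + 1) → Euc (n + 1)) (v : M.Cell → Euc (n + 1) → ℝ)
    (vh : M.Facet → Euc n → ℝ) : ℝ :=
  Real.sqrt (M.ipMat (fun x => (A x)⁻¹) q q + M.ipMat A (M.brokenGrad v) (M.brokenGrad v) +
    ∑ T, (M.hCell T)⁻¹ * ∑ i, M.facetInt (M.facetOf T i)
      (fun y => (v T (M.pt T i y) - vh (M.facetOf T i) y) ^ 2))

/-- The initial guess `ψ₀ ∈ V_h^p` satisfies `𝒰(ψ₀) ∈ H^1(𝒯_h)` with `‖𝒰(ψ₀)‖_DG + ‖ψ₀‖_∞ ≤ K`. -/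
def Mesh.InitialGuess (p : ℕ) (A : Euc (n + 1) → Matrix (Fin (n + 1)) (Fin (n + 1)) ℝ)
    (Υ : Euc (n + 1) → ℝ → ℝ) (K : ℝ) (ψ₀ : M.Cell → Euc (n + 1) → ℝ) : Prop :=
  ψ₀ ∈ M.VSpace p ∧ ∃ (w : M.BrokenH1) (m : ℝ),
    (∀ T, ∀ᵐ x ∂(volume.restrict (M.cell T)), w.val T x = M.superpose Υ ψ₀ T x) ∧
    (∀ T, ∀ x ∈ M.cell T, |ψ₀ T x| ≤ m) ∧ M.dgNorm A w + m ≤ K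

/-- `(q^k, u^k, û^k, ψ^k)`, `k ≥ 1`, are iterates of the hybridized FOSPG method with step sizes
`α^k`, `k ≥ 1`, and initial guess `ψ^0`. -/
def Mesh.IsHybridIterates (p : ℕ) (A : Euc (n + 1) → Matrix (Fin (n + 1)) (Fin (n + 1)) ℝ)
    (f g : Euc (n + 1) → ℝ) (Υ : Euc (n + 1) → ℝ → ℝ) (α : ℕ → ℝ)
    (q : ℕ → M.Cell → Euc (n + 1) → Euc (n + 1)) (u : ℕ → M.Cell → Euc (n + 1) → ℝ)
    (uh : ℕ → M.Facet → Euc n → ℝ) (ψ : ℕ → M.Cell → Euc (n + 1) → ℝ) : Prop :=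
  ∀ k, 1 ≤ k → M.SolvesHybrid p A f g Υ (α k) (ψ (k - 1)) (q k) (u k) (uh k) (ψ k)

end MeshDefs

end

end FOSPG

open FOSPG

namespace FOSPG

noncomputable section

/-! ### Riesz representation, inf-sup conditions and convex minimization in finite dimensions. -/

section

/-! ### Linear algebra in finite dimensions -/

section LinearAlgebra

variable {X : Type*} [AddCommGroup X] [Module ℝ X] [FiniteDimensional ℝ X]

/-! Existence and uniqueness. All spaces are finite-dimensional, and two of the three unknowns of
the mixed subproblem can be eliminated. Since `∇·q` lies in `V_h^p`, the balance equation says `ψ =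
ψ₀ - α ∇·q`, where `ψ₀` is the Riesz representative of the right-hand side, and the latent equation
makes `u` the Riesz representative of `w ↦ (𝒰(ψ), w)`. The flux equation that remains is the
Euler–Lagrange equation on `Σ_{h,div}^p` of the strictly convex and coercive functional `½ (A⁻¹ q,
q) + α⁻¹ E(ψ₀ - α ∇·q) - G(q)`, where `E(ψ) = ∫_Ω ∫_0^ψ Υ(x, t) dt dx` and `G` carries the boundary
data (`Mesh.exists_potential`, `exists_saddle`, `exists_minimizer`). Surjectivity of the divergence
is not needed. Uniqueness follows by testing the difference of two solutions with itself and using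
that `Υ(x, ·)` is strictly increasing (`Mesh.IsMixedSol.unique`).

The hybridized subproblem is the same problem with a Lagrange multiplier. Testing its balance
equation with facet functions says that the normal components of `q` are continuous. Conversely, the
residual of the mixed flux equation vanishes on `Σ_{h,div}^p`, which is the kernel of the pairing of
fluxes with facet functions, so it is represented by a facet function (`exists_of_forall_ker`). That
function is unique because normal traces of `Σ_h^p` realize every family of facet polynomials, one
side at a time (`Mesh.exists_Sig_extension`).

Stability. Testing the balance equation with the increment of `(u, û)` and using monotonicity of `𝒰`
shows that `½ ‖A^{-1/2} q^k‖² - (f, u^k)` does not increase with `k` (`Mesh.IsHybridSol.energy_le`).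
To start the recursion, the initial guess is completed to a discrete triple by projecting `𝒰(ψ^0)`
and the averages of its traces (`Mesh.exists_projection`, `Mesh.exists_initial`). The flux equation
bounds `ℬ_h(r, (u, û))` by `‖q‖ ‖r‖`. The inf-sup condition turns this into a bound for the mesh
dependent norm of `(u, û)`, and a discrete Poincaré inequality bounds `‖u‖`, so that the load term
can be absorbed (`Mesh.exists_inf_sup`, `Mesh.exists_poincare`, `Mesh.exists_energy_bound`). The
inf-sup condition is local, because `Σ_h^p` is discontinuous; it is proved on the reference element
with explicit Raviart–Thomas fields and then scaled. The Poincaré inequality comes from Green's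
formula with the field `x`.

Summing the balance equations gives `(ψ^k, v) = (ψ^0, v) + ∑ α^l ((f, v) + ℬ_h(q^l, (v, v̂)))`. With
the projection of an arbitrary broken `H^1` function as test function this is the dual norm estimate
(`Mesh.exists_dual_bound`). With `(u^k, û^k)` as test function it bounds `(ψ^k, u^k) = (𝒰(ψ^k),
ψ^k)` linearly in `∑ α^l` (`Mesh.IsIter.fV_le`). Under the additional structure of `Υ` one has `Υ(x,
z) z ≥ β |z| + g(x) z - Z` with `g ∈ H^1_0` (`IsCoercive`). The term `(ψ^k, g)` is controlled by the
dual norm estimate and density of smooth functions, and the `L^1` bound follows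
(`exists_l1_stability`). -/

theorem continuous_bilin_diag {V : Type*} [NormedAddCommGroup V] [NormedSpace ℝ V]
    [FiniteDimensional ℝ V] (B : V →ₗ[ℝ] V →ₗ[ℝ] ℝ) : Continuous fun x => B x x := by
  let B' : V →L[ℝ] V →L[ℝ] ℝ :=
    LinearMap.toContinuousLinearMap
      ((LinearMap.toContinuousLinearMap : (V →ₗ[ℝ] ℝ) ≃ₗ[ℝ] (V →L[ℝ] ℝ)).toLinearMap ∘ₗ B)
  have : (fun x => B x x) = fun x => B' x x := rfl
  rw [this]
  fun_prop

theorem exists_pos_lower_bound {V : Type*} [NormedAddCommGroup V] [NormedSpace ℝ V]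
    [FiniteDimensional ℝ V] (B : V →ₗ[ℝ] V →ₗ[ℝ] ℝ) (hB : ∀ x, x ≠ 0 → 0 < B x x) :
    ∃ c : ℝ, 0 < c ∧ ∀ x, c * ‖x‖ ^ 2 ≤ B x x := by
  -- In a trivial space the unit sphere is empty and carries no minimizer.
  by_cases hV : ∃ x : V, x ≠ 0
  · obtain ⟨x₀, hx₀⟩ := hV
    have hne : (Metric.sphere (0 : V) 1).Nonempty :=
      ⟨‖x₀‖⁻¹ • x₀, by simp [norm_smul, norm_ne_zero_iff.mpr hx₀]⟩
    obtain ⟨z, hz, hmin⟩ := (isCompact_sphere (0 : V) 1).exists_isMinOn hne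
      (continuous_bilin_diag B).continuousOn
    have hz0 : z ≠ 0 := by
      rintro rfl
      simp at hz
    refine ⟨B z z, hB z hz0, fun x => ?_⟩
    by_cases hx : x = 0
    · simp [hx]
    have hn : ‖x‖ ≠ 0 := norm_ne_zero_iff.mpr hx
    have := hmin (show ‖x‖⁻¹ • x ∈ Metric.sphere (0 : V) 1 by simp [norm_smul, hn])
    simp only [mem_ofPred_eq, map_smul, LinearMap.smul_apply, smul_eq_mul] at this
    calc B z z * ‖x‖ ^ 2 ≤ (‖x‖⁻¹ * (‖x‖⁻¹ * B x x)) * ‖x‖ ^ 2 := by gcongr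
      _ = B x x := by field_simp
  · push Not at hV
    exact ⟨1, one_pos, fun x => by simp [hV x]⟩

theorem exists_upper_bound {V : Type*} [NormedAddCommGroup V] [NormedSpace ℝ V]
    [FiniteDimensional ℝ V] (B : V →ₗ[ℝ] V →ₗ[ℝ] ℝ) :
    ∃ c : ℝ, 0 ≤ c ∧ ∀ x, B x x ≤ c * ‖x‖ ^ 2 := by
  let B' : V →L[ℝ] V →L[ℝ] ℝ :=
    LinearMap.toContinuousLinearMap
      ((LinearMap.toContinuousLinearMap : (V →ₗ[ℝ] ℝ) ≃ₗ[ℝ] (V →L[ℝ] ℝ)).toLinearMap ∘ₗ B)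
  refine ⟨‖B'‖, B'.opNorm_nonneg, fun x => ?_⟩
  have h := B'.le_opNorm₂ x x
  have : B x x ≤ ‖B' x x‖ := le_abs_self (B' x x)
  nlinarith

/-- A positive definite form on a finite-dimensional space dominates every bilinear form. -/
theorem exists_bilin_le_mul (B₁ B₂ : X →ₗ[ℝ] X →ₗ[ℝ] ℝ) (h : ∀ x, x ≠ 0 → 0 < B₂ x x) :
    ∃ C : ℝ, 0 ≤ C ∧ ∀ x, B₁ x x ≤ C * B₂ x x := by
  -- `X` has no norm of its own; a basis transports the question to a Euclidean space, where spheres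
  -- are compact.
  let e := (Module.finBasis ℝ X).equivFun.trans
    (WithLp.linearEquiv 2 ℝ (Fin (Module.finrank ℝ X) → ℝ)).symm
  let s := e.symm.toLinearMap
  obtain ⟨c, hc, hcx⟩ := exists_pos_lower_bound (B₂.compl₁₂ s s) (fun x hx => by
    simpa [s] using h (e.symm x) (by simpa using hx))
  obtain ⟨C, hC, hCx⟩ := exists_upper_bound (B₁.compl₁₂ s s)
  refine ⟨C / c, by positivity, fun x => ?_⟩
  have h1 := hcx (e x)
  have h2 := hCx (e x)
  simp only [LinearMap.compl₁₂_apply, s, LinearEquiv.coe_coe, LinearEquiv.symm_apply_apply] at h1 h2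
  calc B₁ x x ≤ C * ‖e x‖ ^ 2 := h2
    _ = C / c * (c * ‖e x‖ ^ 2) := by field_simp
    _ ≤ C / c * B₂ x x := by gcongr

/-- Symmetry is not needed: `h` makes `B : X → X*` injective, and the two spaces have equal
dimension. -/
theorem exists_riesz (B : X →ₗ[ℝ] X →ₗ[ℝ] ℝ) (h : ∀ x, B x x = 0 → x = 0) (ℓ : X →ₗ[ℝ] ℝ) :
    ∃ x, ∀ y, B x y = ℓ y := by
  have hinj : Function.Injective B := by
    rw [← LinearMap.ker_eq_bot, LinearMap.ker_eq_bot']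
    intro x hx
    exact h x (by simp [hx])
  have hsurj := (LinearMap.injective_iff_surjective_of_finrank_eq_finrank
    (by simp) : Function.Injective B ↔ _).1 hinj
  obtain ⟨x, hx⟩ := hsurj ℓ
  exact ⟨x, fun y => by rw [hx]⟩

/-- A finite-dimensional inf-sup condition: a form `b` whose kernel is contained in the kernel of
`N` controls `N`. -/
theorem exists_inf_sup {R : Type*} [AddCommGroup R] [Module ℝ R] [FiniteDimensional ℝ R]
    (BR : R →ₗ[ℝ] R →ₗ[ℝ] ℝ) (hR : ∀ r, r ≠ 0 → 0 < BR r r) (b : X →ₗ[ℝ] R →ₗ[ℝ] ℝ)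
    (N : X →ₗ[ℝ] X →ₗ[ℝ] ℝ) (hN : ∀ x y, N x y = N y x)
    (hker : ∀ x, (∀ r, b x r = 0) → ∀ y, N x y = 0) :
    ∃ C : ℝ, 0 ≤ C ∧ ∀ x, ∃ r, b x r = BR r r ∧ N x x ≤ C * BR r r := by
  have h0 : ∀ r, BR r r = 0 → r = 0 := fun r hr => by
    by_contra hne
    exact (hR r hne).ne' hr
  have hinj : Function.Injective BR := by
    rw [← LinearMap.ker_eq_bot, LinearMap.ker_eq_bot']
    intro x hx
    exact h0 x (by simp [hx])
  have hsurj := (LinearMap.injective_iff_surjective_of_finrank_eq_finrank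
    (by simp) : Function.Injective BR ↔ _).1 hinj
  let e : R ≃ₗ[ℝ] (R →ₗ[ℝ] ℝ) := LinearEquiv.ofBijective BR ⟨hinj, hsurj⟩
  -- `S x` represents `b x` with respect to `BR`, so the choice `r = S x` gives `b x r = BR r r`.
  let S : X →ₗ[ℝ] R := e.symm.toLinearMap ∘ₗ b
  have hS : ∀ x r, BR (S x) r = b x r := fun x r => by
    have : e (S x) = b x := by simp [S]
    exact congrArg (fun f : R →ₗ[ℝ] ℝ => f r) this
  -- On a complement of `ker S` the form `BR (S ·) (S ·)` is positive definite and therefore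
  -- dominates `N`; the component in `ker S` does not contribute to `N` by `hker`.
  obtain ⟨Y, hY⟩ := (LinearMap.ker S).exists_isCompl
  obtain ⟨C, hC, hCx⟩ := exists_bilin_le_mul (X := Y) (N.compl₁₂ Y.subtype Y.subtype)
    (BR.compl₁₂ (S ∘ₗ Y.subtype) (S ∘ₗ Y.subtype)) (fun y hy => by
      refine hR _ fun hSy => hy ?_
      have : (y : X) ∈ LinearMap.ker S ⊓ Y := ⟨hSy, y.2⟩
      rw [hY.inf_eq_bot] at this
      exact Subtype.ext (by simpa using this))
  refine ⟨C, hC, fun x => ⟨S x, (hS x _).symm, ?_⟩⟩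
  obtain ⟨k, hk, y, hy, rfl⟩ := Submodule.mem_sup.1
    (show x ∈ LinearMap.ker S ⊔ Y by rw [hY.sup_eq_top]; trivial)
  have hk' : ∀ z, N k z = 0 := hker k fun r => by
    rw [← hS, LinearMap.mem_ker.1 hk]
    simp
  have h1 : N (k + y) (k + y) = N y y := by
    simp [hk', hN y k]
  have h2 : S (k + y) = S y := by
    rw [map_add, LinearMap.mem_ker.1 hk, zero_add]
  rw [h1, h2]
  simpa using hCx ⟨y, hy⟩

/-- In finite dimensions the range of `c` is the annihilator of its own annihilator. This is the
existence of Lagrange multipliers, applied later to the facet unknown. -/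
theorem exists_of_forall_ker {S : Type*} [AddCommGroup S] [Module ℝ S] [FiniteDimensional ℝ S]
    (c : X →ₗ[ℝ] S →ₗ[ℝ] ℝ) (ℓ : S →ₗ[ℝ] ℝ) (h : ∀ s, (∀ x, c x s = 0) → ℓ s = 0) :
    ∃ x, ∀ s, ℓ s = c x s := by
  have : ℓ ∈ LinearMap.range c := by
    rw [← Subspace.dualCoannihilator_dualAnnihilator_eq (W := LinearMap.range c)]
    rw [Submodule.mem_dualAnnihilator]
    intro s hs
    rw [Submodule.mem_dualCoannihilator] at hs
    exact h s fun x => hs _ ⟨x, rfl⟩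
  obtain ⟨x, hx⟩ := this
  exact ⟨x, fun s => by rw [hx]⟩

/-- The solution is a minimizer of `J x = B x x / 2 + E x - ℓ x`. A function with a subgradient at
every point is convex, hence continuous in finite dimensions, and `J` is coercive because `E` is
bounded below by an affine function while `B` grows quadratically. -/
theorem exists_minimizer_aux {V : Type*} [NormedAddCommGroup V] [NormedSpace ℝ V]
    [FiniteDimensional ℝ V] (B : V →ₗ[ℝ] V →ₗ[ℝ] ℝ) (hsymm : ∀ x y, B x y = B y x)
    (hB : ∀ x, x ≠ 0 → 0 < B x x) (ℓ : V →ₗ[ℝ] ℝ) (E : V → ℝ) (U : V → V →ₗ[ℝ] ℝ)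
    (hE : ∀ x y, E x + U x (y - x) ≤ E y)
    (hU : ∀ x y, Tendsto (fun t : ℝ => U (x + t • y) y) (𝓝[>] 0) (𝓝 (U x y))) :
    ∃ x, ∀ y, B x y + U x y = ℓ y := by
  obtain ⟨c, hc, hcx⟩ := exists_pos_lower_bound B hB
  -- The weighted sum of the subgradient inequalities at `z = a x + b y` is the convexity
  -- inequality, since the linear terms cancel.
  have hconv : ConvexOn ℝ univ E := by
    refine ⟨convex_univ, fun x _ y _ a b ha hb hab => ?_⟩
    set z := a • x + b • y
    have h1 := hE z x
    have h2 := hE z y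
    have h3 : a • (x - z) + b • (y - z) = 0 := by
      have : a • (x - z) + b • (y - z) = (a • x + b • y) - (a + b) • z := by module
      rw [this, hab, one_smul]
      exact sub_self _
    have h4 : a * U z (x - z) + b * U z (y - z) = 0 := by
      have := congrArg (U z) h3
      simpa using this
    have h5 : E z = a * E z + b * E z := by rw [← add_mul, hab, one_mul]
    simp only [smul_eq_mul]
    nlinarith [mul_le_mul_of_nonneg_left h1 ha, mul_le_mul_of_nonneg_left h2 hb]
  have hEc : Continuous E := by
    rw [← continuousOn_univ]
    exact hconv.continuousOn isOpen_univ
  let J : V → ℝ := fun x => B x x / 2 + E x - ℓ x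
  have hJc : Continuous J := by
    have h1 : Continuous fun x => ℓ x := LinearMap.continuous_of_finiteDimensional ℓ
    have h2 := continuous_bilin_diag B
    exact ((h2.div_const 2).add hEc).sub h1
  let m : V →L[ℝ] ℝ := LinearMap.toContinuousLinearMap (U 0 - ℓ)
  have hJ : ∀ x, c / 2 * ‖x‖ ^ 2 - ‖m‖ * ‖x‖ + E 0 ≤ J x := fun x => by
    have h1 := hE 0 x
    have h2 : |U 0 x - ℓ x| ≤ ‖m‖ * ‖x‖ := m.le_opNorm x
    have h3 := neg_le_of_abs_le h2
    have h4 := hcx x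
    simp only [sub_zero] at h1
    simp only [J]
    linarith
  have hlim : Tendsto J (cocompact V) atTop := by
    refine tendsto_atTop_mono hJ ?_
    have h1 : Tendsto (fun t : ℝ => c / 2 * t ^ 2 - ‖m‖ * t + E 0) atTop atTop := by
      have : (fun t : ℝ => c / 2 * t ^ 2 - ‖m‖ * t + E 0) =
          fun t => t * (c / 2 * t - ‖m‖) + E 0 := by
        ext t
        ring
      rw [this]
      refine tendsto_atTop_add_const_right _ _ (tendsto_id.atTop_mul_atTop₀ ?_)
      exact tendsto_atTop_add_const_right _ _ (tendsto_id.const_mul_atTop (by positivity))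
    exact h1.comp (tendsto_norm_cocompact_atTop)
  obtain ⟨x, hx⟩ := hJc.exists_forall_le hlim
  have key : ∀ y, 0 ≤ B x y + U x y - ℓ y := fun y => by
    -- `E` is not assumed differentiable. The increment `E (x + t y) - E x` is bounded from above by
    -- the subgradient at the perturbed point, and hemicontinuity brings that subgradient back to
    -- `x` as `t → 0`.
    have hpos : ∀ t : ℝ, 0 < t → 0 ≤ B x y + t / 2 * B y y + U (x + t • y) y - ℓ y := fun t ht => by
      have h1 := hx (x + t • y)
      have h2 := hE (x + t • y) x
      have h3 : x - (x + t • y) = -(t • y) := by abel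
      rw [h3] at h2
      simp only [map_neg, map_smul, smul_eq_mul] at h2
      simp only [J, map_add, map_smul, LinearMap.add_apply, LinearMap.smul_apply,
        smul_eq_mul, hsymm y x] at h1
      have h4 : 0 ≤ t * (B x y + t / 2 * B y y + U (x + t • y) y - ℓ y) := by nlinarith
      exact nonneg_of_mul_nonneg_right h4 ht
    have hl : Tendsto (fun t : ℝ => B x y + t / 2 * B y y + U (x + t • y) y - ℓ y) (𝓝[>] 0)
        (𝓝 (B x y + 0 / 2 * B y y + U x y - ℓ y)) := by
      refine Tendsto.sub_const (Tendsto.add (Tendsto.const_add _ ?_) (hU x y)) _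
      refine Tendsto.mul_const _ (Tendsto.div_const ?_ _)
      exact tendsto_nhdsWithin_of_tendsto_nhds tendsto_id
    have := ge_of_tendsto hl (eventually_mem_nhdsWithin.mono fun t ht => hpos t ht)
    linarith
  refine ⟨x, fun y => ?_⟩
  have h1 := key y
  have h2 := key (-y)
  simp only [map_neg] at h2
  linarith

/-- Solvability of `B x + U x = ℓ` for a positive definite symmetric form `B` and a
(hemicontinuous) subgradient `U` of a function `E`. -/
theorem exists_minimizer (B : X →ₗ[ℝ] X →ₗ[ℝ] ℝ) (hsymm : ∀ x y, B x y = B y x)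
    (hB : ∀ x, x ≠ 0 → 0 < B x x) (ℓ : X →ₗ[ℝ] ℝ) (E : X → ℝ) (U : X → X →ₗ[ℝ] ℝ)
    (hE : ∀ x y, E x + U x (y - x) ≤ E y)
    (hU : ∀ x y, Tendsto (fun t : ℝ => U (x + t • y) y) (𝓝[>] 0) (𝓝 (U x y))) :
    ∃ x, ∀ y, B x y + U x y = ℓ y := by
  let e := (Module.finBasis ℝ X).equivFun.trans
    (WithLp.linearEquiv 2 ℝ (Fin (Module.finrank ℝ X) → ℝ)).symm
  let s := e.symm.toLinearMap
  obtain ⟨x, hx⟩ := exists_minimizer_aux (B.compl₁₂ s s) (fun x y => hsymm _ _)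
    (fun x hx => by simpa [s] using hB (e.symm x) (by simpa using hx)) (ℓ ∘ₗ s)
    (fun x => E (s x)) (fun x => U (s x) ∘ₗ s) (fun x y => by simpa using hE (s x) (s y))
    (fun x y => by simpa using hU (s x) (s y))
  refine ⟨s x, fun y => ?_⟩
  simpa [s] using hx (e y)

end LinearAlgebra

end

/-! ### Polynomials, degree counting and Raviart–Thomas fields. -/

section

/-! ### Polynomial functions -/

/-- The polynomial function of a polynomial, as a linear map. -/
def evalMap (m : ℕ) : MvPolynomial (Fin m) ℝ →ₗ[ℝ] (Euc m → ℝ) where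
  toFun P x := MvPolynomial.eval (fun i => x i) P
  map_add' P Q := by ext x; simp
  map_smul' c P := by ext x; simp [MvPolynomial.smul_eval]

theorem evalMap_apply {m : ℕ} (P : MvPolynomial (Fin m) ℝ) (x : Euc m) :
    evalMap m P x = MvPolynomial.eval (fun i => x i) P := rfl

theorem evalMap_mul {m : ℕ} (P Q : MvPolynomial (Fin m) ℝ) :
    evalMap m (P * Q) = evalMap m P * evalMap m Q := by
  ext x; simp [evalMap_apply]

theorem contDiff_coord {m : ℕ} {k : WithTop ℕ∞} (i : Fin m) : ContDiff ℝ k fun x : Euc m => x i :=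
  (EuclideanSpace.proj (𝕜 := ℝ) i : Euc m →L[ℝ] ℝ).contDiff

theorem contDiff_evalMap {m : ℕ} {k : WithTop ℕ∞} (P : MvPolynomial (Fin m) ℝ) :
    ContDiff ℝ k (evalMap m P) := by
  induction P using MvPolynomial.induction_on with
  | C a =>
    have : evalMap m (MvPolynomial.C a) = fun _ => a := by ext x; simp [evalMap_apply]
    rw [this]
    exact contDiff_const
  | add p q hp hq => rw [map_add]; exact hp.add hq
  | mul_X p i hp =>
    rw [evalMap_mul]
    refine hp.mul ?_
    have : evalMap m (MvPolynomial.X i) = fun x => x i := by ext x; simp [evalMap_apply]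
    rw [this]
    exact contDiff_coord i

theorem fderiv_evalMap {m : ℕ} (P : MvPolynomial (Fin m) ℝ) (x v : Euc m) :
    fderiv ℝ (evalMap m P) x v = ∑ i, v i * evalMap m (MvPolynomial.pderiv i P) x := by
  induction P using MvPolynomial.induction_on with
  | C a =>
    have : evalMap m (MvPolynomial.C a) = fun _ => a := by ext x; simp [evalMap_apply]
    rw [this]
    simp
  | add p q hp hq =>
    rw [map_add, fderiv_add ((contDiff_evalMap p).differentiable one_ne_zero x)
      ((contDiff_evalMap q).differentiable one_ne_zero x)]
    simp [hp, hq, mul_add, Finset.sum_add_distrib]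
  | mul_X p i hp =>
    have hX : evalMap m (MvPolynomial.X i) = fun x => x i := by ext x; simp [evalMap_apply]
    have hX' : HasFDerivAt (evalMap m (MvPolynomial.X i))
        (EuclideanSpace.proj (𝕜 := ℝ) i : Euc m →L[ℝ] ℝ) x := by
      rw [hX]
      exact (EuclideanSpace.proj (𝕜 := ℝ) i : Euc m →L[ℝ] ℝ).hasFDerivAt
    have hp' := ((contDiff_evalMap (k := 1) p).differentiable one_ne_zero x).hasFDerivAt
    rw [evalMap_mul, (hp'.mul hX').fderiv]
    simp only [add_apply, smul_apply, hp, smul_eq_mul,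
      Derivation.leibniz, map_add, evalMap_mul, Pi.add_apply, Pi.mul_apply, mul_add,
      Finset.sum_add_distrib, MvPolynomial.pderiv_X]
    congr 1
    · rw [Finset.sum_eq_single i]
      · simp [evalMap_apply, mul_comm]
      · intro j _ hj
        simp [evalMap_apply, hj.symm]
      · simp
    · rw [Finset.mul_sum]
      refine Finset.sum_congr rfl fun j _ => ?_
      simp only [evalMap_apply, MvPolynomial.eval_X]
      ring

/-- An open set contains a product of intervals, and a polynomial that vanishes on a product of
infinite sets is zero. -/
theorem evalMap_eq_zero_of_isOpen {m : ℕ} {P : MvPolynomial (Fin m) ℝ} {s : Set (Euc m)}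
    (hs : IsOpen s) (hne : s.Nonempty) (h : ∀ x ∈ s, evalMap m P x = 0) : P = 0 := by
  obtain ⟨x₀, hx₀⟩ := hne
  have hs' : IsOpen ((WithLp.toLp 2 : (Fin m → ℝ) → Euc m) ⁻¹' s) :=
    hs.preimage (PiLp.continuous_toLp 2 _)
  obtain ⟨ε, hε, hball⟩ := Metric.isOpen_iff.1 hs' x₀.ofLp (by simpa using hx₀)
  refine MvPolynomial.funext_set (fun i => Metric.ball (x₀.ofLp i) ε) (fun i => ?_) fun x hx => ?_
  · rw [Real.ball_eq_Ioo]
    exact Ioo_infinite (by linarith)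
  · rw [map_zero]
    refine h (WithLp.toLp 2 x) (hball ?_)
    rw [ball_pi _ hε]
    exact hx

/-- The polynomials that define `polySpace`. -/
def polyMv : (κ : CellKind) → (m p : ℕ) → Submodule ℝ (MvPolynomial (Fin m) ℝ)
  | CellKind.simplex, m, p => MvPolynomial.restrictTotalDegree (Fin m) ℝ p
  | CellKind.cube, m, p => MvPolynomial.restrictDegree (Fin m) ℝ p

/-- `polySpace` as a submodule. -/
def polySub (κ : CellKind) (m p : ℕ) : Submodule ℝ (Euc m → ℝ) := (polyMv κ m p).map (evalMap m)

instance (κ : CellKind) (m p : ℕ) : FiniteDimensional ℝ (polyMv κ m p) := by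
  cases κ
  · exact inferInstanceAs (Module.Finite ℝ (MvPolynomial.restrictTotalDegree (Fin m) ℝ p))
  · exact inferInstanceAs (Module.Finite ℝ (MvPolynomial.restrictDegree (Fin m) ℝ p))

instance (κ : CellKind) (m p : ℕ) : FiniteDimensional ℝ (polySub κ m p) := by
  unfold polySub
  infer_instance

theorem mem_polySub_iff {κ : CellKind} {m p : ℕ} {f : Euc m → ℝ} :
    f ∈ polySub κ m p ↔ ∃ P ∈ polyMv κ m p, evalMap m P = f := Iff.rfl

theorem mem_polySub {κ : CellKind} {m p : ℕ} {f : Euc m → ℝ} :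
    f ∈ polySub κ m p ↔ f ∈ polySpace κ m p := by
  rw [mem_polySub_iff]
  cases κ <;>
  exact ⟨fun ⟨P, hP, h⟩ => ⟨P, hP, fun x => by rw [← h]; rfl⟩,
    fun ⟨P, hP, h⟩ => ⟨P, hP, by ext x; exact (h x).symm⟩⟩

theorem contDiff_of_mem_polySub {κ : CellKind} {m p : ℕ} {k : WithTop ℕ∞} {f : Euc m → ℝ}
    (hf : f ∈ polySub κ m p) : ContDiff ℝ k f := by
  obtain ⟨P, -, rfl⟩ := hf
  exact contDiff_evalMap P

theorem eq_zero_of_mem_polySub {κ : CellKind} {m p : ℕ} {f : Euc m → ℝ} (hf : f ∈ polySub κ m p)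
    {s : Set (Euc m)} (hs : IsOpen s) (hne : s.Nonempty) (h : ∀ x ∈ s, f x = 0) : f = 0 := by
  obtain ⟨P, -, rfl⟩ := hf
  rw [evalMap_eq_zero_of_isOpen hs hne h, map_zero]

/-- Both degree conditions are closed under lowering exponents, which is what differentiation needs.
-/
theorem monomial_mem_polyMv_of_le {κ : CellKind} {m p : ℕ} {s t : Fin m →₀ ℕ} (hst : s ≤ t)
    (c : ℝ) (ht : MvPolynomial.monomial t (1 : ℝ) ∈ polyMv κ m p) :
    MvPolynomial.monomial s c ∈ polyMv κ m p := by
  cases κ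
  · simp only [polyMv, MvPolynomial.restrictTotalDegree,
      MvPolynomial.monomial_mem_restrictSupport, one_ne_zero, or_false] at ht ⊢
    left
    simp only [mem_ofPred_eq, Finsupp.sum_fintype, implies_true] at ht ⊢
    exact (Finset.sum_le_sum fun i _ => hst i).trans ht
  · simp only [polyMv, MvPolynomial.restrictDegree,
      MvPolynomial.monomial_mem_restrictSupport, one_ne_zero, or_false] at ht ⊢
    left
    exact fun i => (hst i).trans (ht i)

/-- Both polynomial spaces are spanned by the monomials they contain, so inclusions under linear
maps need only be checked on monomials. -/
theorem polyMv_induction {κ : CellKind} {m p : ℕ} {S : Submodule ℝ (MvPolynomial (Fin m) ℝ)}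
    {f : MvPolynomial (Fin m) ℝ →ₗ[ℝ] MvPolynomial (Fin m) ℝ}
    (h : ∀ s, MvPolynomial.monomial s (1 : ℝ) ∈ polyMv κ m p → f (MvPolynomial.monomial s 1) ∈ S)
    {P : MvPolynomial (Fin m) ℝ} (hP : P ∈ polyMv κ m p) : f P ∈ S := by
  have key : ∀ I : Set (Fin m →₀ ℕ), polyMv κ m p = MvPolynomial.restrictSupport ℝ I →
      polyMv κ m p ≤ S.comap f := by
    intro I hI
    rw [hI, MvPolynomial.restrictSupport_eq_span, Submodule.span_le]
    rintro _ ⟨s, hs, rfl⟩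
    exact h s (by rw [hI]; simp [hs])
  cases κ
  · exact key _ rfl hP
  · exact key _ rfl hP

theorem pderiv_mem_polyMv {κ : CellKind} {m p : ℕ} {P : MvPolynomial (Fin m) ℝ}
    (hP : P ∈ polyMv κ m p) (i : Fin m) : MvPolynomial.pderiv i P ∈ polyMv κ m p := by
  refine polyMv_induction (f := (MvPolynomial.pderiv i).toLinearMap) (fun s hs => ?_) hP
  change MvPolynomial.pderiv i (MvPolynomial.monomial s 1) ∈ polyMv κ m p
  rw [MvPolynomial.pderiv_monomial]
  exact monomial_mem_polyMv_of_le tsub_le_self _ hs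

/-- The Euler operator `x_i ∂_i` multiplies each monomial by its exponent. For this reason
divergences of Raviart–Thomas fields do not gain a degree, and the bubble fields below are
Raviart–Thomas fields. -/
theorem X_mul_pderiv_mem_polyMv {κ : CellKind} {m p : ℕ} {P : MvPolynomial (Fin m) ℝ}
    (hP : P ∈ polyMv κ m p) (i : Fin m) :
    MvPolynomial.X i * MvPolynomial.pderiv i P ∈ polyMv κ m p := by
  refine polyMv_induction (f := (LinearMap.mulLeft ℝ (MvPolynomial.X i)) ∘ₗ
    (MvPolynomial.pderiv i).toLinearMap) (fun s hs => ?_) hP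
  change MvPolynomial.X i * MvPolynomial.pderiv i (MvPolynomial.monomial s 1) ∈ polyMv κ m p
  rw [MvPolynomial.X_mul_pderiv_monomial]
  exact nsmul_mem hs _

/-- The partial derivative. -/
def pd {m : ℕ} (i : Fin m) (f : Euc m → ℝ) (x : Euc m) : ℝ :=
  fderiv ℝ f x (EuclideanSpace.single i 1)

theorem pd_evalMap {m : ℕ} (i : Fin m) (P : MvPolynomial (Fin m) ℝ) :
    pd i (evalMap m P) = evalMap m (MvPolynomial.pderiv i P) := by
  ext x
  rw [pd, fderiv_evalMap, Finset.sum_eq_single i]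
  · simp
  · intro j _ hj
    simp [hj]
  · simp

theorem fderiv_eq_sum_pd {m : ℕ} (f : Euc m → ℝ) (x v : Euc m) :
    fderiv ℝ f x v = ∑ i, v i * pd i f x := by
  conv_lhs => rw [← (EuclideanSpace.basisFun (Fin m) ℝ).sum_repr v]
  simp [pd]

theorem pd_mem_polySub {κ : CellKind} {m p : ℕ} {f : Euc m → ℝ} (hf : f ∈ polySub κ m p)
    (i : Fin m) : pd i f ∈ polySub κ m p := by
  obtain ⟨P, hP, rfl⟩ := hf
  exact ⟨_, pderiv_mem_polyMv hP i, (pd_evalMap i P).symm⟩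

theorem coord_mul_pd_mem_polySub {κ : CellKind} {m p : ℕ} {f : Euc m → ℝ}
    (hf : f ∈ polySub κ m p) (i : Fin m) : (fun x => x i * pd i f x) ∈ polySub κ m p := by
  obtain ⟨P, hP, rfl⟩ := hf
  refine ⟨_, X_mul_pderiv_mem_polyMv hP i, ?_⟩
  ext x
  rw [pd_evalMap, evalMap_mul]
  simp [evalMap_apply]

/-- Polynomial maps between reference spaces whose composition preserves `polySpace`: affine maps
for simplices, and maps whose components depend on different single variables for cubes. -/
def IsCellMap (κ : CellKind) {k m : ℕ} (Θ : Euc k → Euc m) : Prop :=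
  ∃ ℓ : Fin m → MvPolynomial (Fin k) ℝ, (∀ x j, Θ x j = evalMap k (ℓ j) x) ∧
    match κ with
    | CellKind.simplex => ∀ j, (ℓ j).totalDegree ≤ 1
    | CellKind.cube => ∀ i, ∑ j, (ℓ j).degreeOf i ≤ 1

/-- For simplices the substituted polynomials are affine, so total degrees do not increase. For
cubes the degree of `∏ ℓ_j ^ s_j` in the variable `i` is at most `p ∑_j deg_i ℓ_j ≤ p`, which is why
the sum over `j` is restricted in the cube case. -/
theorem bind_mem_polyMv {κ : CellKind} {k m p : ℕ} {ℓ : Fin m → MvPolynomial (Fin k) ℝ}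
    (hℓ : match κ with
      | CellKind.simplex => ∀ j, (ℓ j).totalDegree ≤ 1
      | CellKind.cube => ∀ i, ∑ j, (ℓ j).degreeOf i ≤ 1) {P : MvPolynomial (Fin m) ℝ}
    (hP : P ∈ polyMv κ m p) : MvPolynomial.bind₁ ℓ P ∈ polyMv κ k p := by
  have key : ∀ I : Set (Fin m →₀ ℕ), polyMv κ m p = MvPolynomial.restrictSupport ℝ I →
      (∀ s ∈ I, (∏ j, ℓ j ^ s j) ∈ polyMv κ k p) → MvPolynomial.bind₁ ℓ P ∈ polyMv κ k p := by
    intro I hI hs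
    have : polyMv κ m p ≤ (polyMv κ k p).comap (MvPolynomial.bind₁ ℓ).toLinearMap := by
      rw [hI, MvPolynomial.restrictSupport_eq_span, Submodule.span_le]
      rintro _ ⟨s, hsI, rfl⟩
      have := hs s hsI
      rw [← Finsupp.prod_fintype s (fun j e => ℓ j ^ e) (by simp)] at this
      simpa [MvPolynomial.bind₁_monomial, Finsupp.prod] using this
    exact this hP
  cases κ
  · refine key _ rfl fun s hs => ?_
    rw [polyMv, MvPolynomial.mem_restrictTotalDegree]
    simp only [mem_ofPred_eq, Finsupp.sum_fintype, implies_true] at hs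
    refine (MvPolynomial.totalDegree_finsetProd _ _).trans ((Finset.sum_le_sum fun j _ => ?_).trans hs)
    refine (MvPolynomial.totalDegree_pow _ _).trans ?_
    calc s j * (ℓ j).totalDegree ≤ s j * 1 := Nat.mul_le_mul_left _ (hℓ j)
      _ = s j := mul_one _
  · refine key _ rfl fun s hs => ?_
    simp only [polyMv]
    rw [MvPolynomial.mem_restrictDegree]
    intro t ht i
    refine (MvPolynomial.degreeOf_le_iff.1 ?_ t ht :)
    refine (MvPolynomial.degreeOf_prod_le _ _ _).trans ?_
    calc ∑ j, (ℓ j ^ s j).degreeOf i ≤ ∑ j, p * (ℓ j).degreeOf i :=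
          Finset.sum_le_sum fun j _ => (MvPolynomial.degreeOf_pow_le _ _ _).trans
            (Nat.mul_le_mul_right _ (hs j))
      _ = p * ∑ j, (ℓ j).degreeOf i := by rw [Finset.mul_sum]
      _ ≤ p * 1 := Nat.mul_le_mul_left _ (hℓ i)
      _ = p := mul_one _

theorem IsCellMap.comp_mem {κ : CellKind} {k m p : ℕ} {Θ : Euc k → Euc m} (hΘ : IsCellMap κ Θ)
    {f : Euc m → ℝ} (hf : f ∈ polySub κ m p) : (fun x => f (Θ x)) ∈ polySub κ k p := by
  obtain ⟨ℓ, hℓ, hd⟩ := hΘ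
  obtain ⟨P, hP, rfl⟩ := hf
  refine ⟨_, bind_mem_polyMv hd hP, ?_⟩
  ext x
  simp only [evalMap_apply, hℓ]
  exact MvPolynomial.eval₂Hom_bind₁ _ _ _ _

theorem isCellMap_simplex {k m : ℕ} {Θ : Euc k → Euc m} (c : Fin m → ℝ)
    (a : Fin m → Fin k → ℝ) (h : ∀ x j, Θ x j = c j + ∑ i, a j i * x i) :
    IsCellMap CellKind.simplex Θ := by
  refine ⟨fun j => MvPolynomial.C (c j) + ∑ i, MvPolynomial.C (a j i) * MvPolynomial.X i,
    fun x j => by simp [h, evalMap_apply], fun j => ?_⟩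
  refine (MvPolynomial.totalDegree_add _ _).trans (max_le (by simp) ?_)
  refine MvPolynomial.totalDegree_finsetSum_le fun i _ => ?_
  exact (MvPolynomial.totalDegree_mul _ _).trans (by simp)

theorem isCellMap_simplex_of_affine {k m : ℕ} (Θ : Euc k →ᵃ[ℝ] Euc m) :
    IsCellMap CellKind.simplex Θ := by
  refine isCellMap_simplex (fun j => Θ 0 j) (fun j i => Θ.linear (EuclideanSpace.single i 1) j)
    fun x j => ?_
  have h1 : Θ x = Θ.linear x + Θ 0 := by
    have := Θ.map_vadd 0 x
    simpa using this
  have h2 : Θ.linear x = ∑ i, x i • Θ.linear (EuclideanSpace.single i 1) := by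
    conv_lhs => rw [← (EuclideanSpace.basisFun (Fin k) ℝ).sum_repr x]
    simp
  rw [h1, h2]
  simp [add_comm, mul_comm]

/-- Each variable may enter at most one component. Components with vanishing coefficient are
constant, so `τ` need not be injective at their indices. -/
theorem isCellMap_cube {k m : ℕ} {Θ : Euc k → Euc m} (c a : Fin m → ℝ) (τ : Fin m → Fin k)
    (hτ : ∀ j j', a j ≠ 0 → a j' ≠ 0 → τ j = τ j' → j = j')
    (h : ∀ x j, Θ x j = c j + a j * x (τ j)) : IsCellMap CellKind.cube Θ := by
  refine ⟨fun j => MvPolynomial.C (c j) + MvPolynomial.C (a j) * MvPolynomial.X (τ j),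
    fun x j => by simp [h, evalMap_apply], fun i => ?_⟩
  have hle : ∀ j, (MvPolynomial.C (c j) + MvPolynomial.C (a j) * MvPolynomial.X (τ j)
      : MvPolynomial (Fin k) ℝ).degreeOf i ≤ if a j ≠ 0 ∧ τ j = i then 1 else 0 := by
    intro j
    refine (MvPolynomial.degreeOf_add_le _ _ _).trans (max_le (by simp) ?_)
    split_ifs with hj
    · refine (MvPolynomial.degreeOf_mul_le _ _ _).trans ?_
      simp [MvPolynomial.degreeOf_X]
      split_ifs <;> simp
    · by_cases ha : a j = 0
      · simp [ha]
      · refine (MvPolynomial.degreeOf_mul_le _ _ _).trans ?_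
        have : i ≠ τ j := fun h => hj ⟨ha, h.symm⟩
        simp [MvPolynomial.degreeOf_X, this]
  refine (Finset.sum_le_sum fun j _ => hle j).trans ?_
  rw [← Finset.card_filter]
  refine Finset.card_le_one.2 fun j hj j' hj' => ?_
  simp only [Finset.mem_filter, Finset.mem_univ, true_and] at hj hj'
  exact hτ j j' hj.1 hj'.1 (hj.2.trans hj'.2.symm)

/-! ### The Raviart–Thomas space -/

/-- `rtSpace` as a submodule. -/
def rtSub (κ : CellKind) (d p : ℕ) : Submodule ℝ (Euc d → Euc d) where
  carrier := rtSpace κ d p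
  add_mem' := by
    rintro r r' hr hr'
    cases κ
    · obtain ⟨a, b, ha, hb, h⟩ := hr
      obtain ⟨a', b', ha', hb', h'⟩ := hr'
      simp only [← mem_polySub] at ha hb ha' hb'
      refine ⟨a + a', b + b', fun i => ?_, ?_, fun x i => ?_⟩
      · rw [← mem_polySub]; exact add_mem (ha i) (ha' i)
      · rw [← mem_polySub]; exact add_mem hb hb'
      · simp [h, h']; ring
    · obtain ⟨a, b, ha, hb, h⟩ := hr
      obtain ⟨a', b', ha', hb', h'⟩ := hr'
      simp only [← mem_polySub] at ha hb ha' hb'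
      refine ⟨a + a', b + b', fun i => ?_, fun i => ?_, fun x i => ?_⟩
      · rw [← mem_polySub]; exact add_mem (ha i) (ha' i)
      · rw [← mem_polySub]; exact add_mem (hb i) (hb' i)
      · simp [h, h']; ring
  zero_mem' := by
    cases κ
    · refine ⟨0, 0, fun i => ?_, ?_, fun x i => by simp⟩
      · rw [← mem_polySub]; exact zero_mem _
      · rw [← mem_polySub]; exact zero_mem _
    · refine ⟨0, 0, fun i => ?_, fun i => ?_, fun x i => by simp⟩
      · rw [← mem_polySub]; exact zero_mem _
      · rw [← mem_polySub]; exact zero_mem _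
  smul_mem' := by
    rintro c r hr
    cases κ
    · obtain ⟨a, b, ha, hb, h⟩ := hr
      simp only [← mem_polySub] at ha hb
      refine ⟨c • a, c • b, fun i => ?_, ?_, fun x i => ?_⟩
      · rw [← mem_polySub]; exact Submodule.smul_mem _ _ (ha i)
      · rw [← mem_polySub]; exact Submodule.smul_mem _ _ hb
      · simp [h]; ring
    · obtain ⟨a, b, ha, hb, h⟩ := hr
      simp only [← mem_polySub] at ha hb
      refine ⟨c • a, c • b, fun i => ?_, fun i => ?_, fun x i => ?_⟩
      · rw [← mem_polySub]; exact Submodule.smul_mem _ _ (ha i)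
      · rw [← mem_polySub]; exact Submodule.smul_mem _ _ (hb i)
      · simp [h]; ring

/-- The components of a Raviart–Thomas field are `a_i + x_i b_i`. -/
theorem exists_of_mem_rtSub {κ : CellKind} {d p : ℕ} {r : Euc d → Euc d} (hr : r ∈ rtSub κ d p) :
    ∃ a b : Fin d → Euc d → ℝ, (∀ i, a i ∈ polySub κ d p) ∧ (∀ i, b i ∈ polySub κ d p) ∧
      (κ = CellKind.simplex → ∀ i j, b i = b j) ∧ ∀ x i, r x i = a i x + x i * b i x := by
  cases κ
  · obtain ⟨a, b, ha, hb, h⟩ := hr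
    exact ⟨a, fun _ => b, fun i => mem_polySub.2 (ha i), fun _ => mem_polySub.2 hb,
      fun _ _ _ => rfl, h⟩
  · obtain ⟨a, b, ha, hb, h⟩ := hr
    exact ⟨a, b, fun i => mem_polySub.2 (ha i), fun i => mem_polySub.2 (hb i), by simp, h⟩

theorem component_eq_evalMap {κ : CellKind} {d p : ℕ} {r : Euc d → Euc d} (hr : r ∈ rtSub κ d p)
    (i : Fin d) : ∃ P, (fun x => r x i) = evalMap d P := by
  obtain ⟨a, b, ha, hb, -, h⟩ := exists_of_mem_rtSub hr
  obtain ⟨P, -, hP⟩ := ha i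
  obtain ⟨Q, -, hQ⟩ := hb i
  refine ⟨P + MvPolynomial.X i * Q, ?_⟩
  ext x
  rw [h, ← hP, ← hQ, map_add, evalMap_mul]
  simp [evalMap_apply]

theorem contDiff_euc {V : Type*} [NormedAddCommGroup V] [NormedSpace ℝ V] {d : ℕ}
    {k : WithTop ℕ∞} {r : V → Euc d} (h : ∀ i, ContDiff ℝ k fun x => r x i) : ContDiff ℝ k r :=
  contDiff_euclidean.2 h

theorem contDiff_of_mem_rtSub {κ : CellKind} {d p : ℕ} {k : WithTop ℕ∞} {r : Euc d → Euc d}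
    (hr : r ∈ rtSub κ d p) : ContDiff ℝ k r := by
  refine contDiff_euc fun i => ?_
  obtain ⟨P, hP⟩ := component_eq_evalMap hr i
  rw [hP]
  exact contDiff_evalMap P

theorem eq_zero_of_mem_rtSub {κ : CellKind} {d p : ℕ} {r : Euc d → Euc d} (hr : r ∈ rtSub κ d p)
    {s : Set (Euc d)} (hs : IsOpen s) (hne : s.Nonempty) (h : ∀ x ∈ s, r x = 0) : r = 0 := by
  ext x i
  obtain ⟨P, hP⟩ := component_eq_evalMap hr i
  have : P = 0 := evalMap_eq_zero_of_isOpen hs hne fun x hx => by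
    rw [← hP]
    simp [h x hx]
  simpa [this] using congrFun hP x

instance (κ : CellKind) (d p : ℕ) : FiniteDimensional ℝ (rtSub κ d p) := by
  -- All pairs `(a, b)` with independent `b_i` are admitted, which covers both kinds of elements: on
  -- a simplex the range may be larger than the Raviart–Thomas space.
  let F : (Fin d → polySub κ d p) × (Fin d → polySub κ d p) →ₗ[ℝ] (Euc d → Euc d) :=
    { toFun := fun ab x => WithLp.toLp 2 fun i => (ab.1 i : Euc d → ℝ) x + x i * (ab.2 i : Euc d → ℝ) x
      map_add' := fun ab cd => by ext x i; simp; ring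
      map_smul' := fun c ab => by ext x i; simp; ring }
  have hle : rtSub κ d p ≤ LinearMap.range F := by
    intro r hr
    obtain ⟨a, b, ha, hb, -, h⟩ := exists_of_mem_rtSub hr
    refine ⟨(fun i => ⟨a i, ha i⟩, fun i => ⟨b i, hb i⟩), ?_⟩
    ext x i
    simp [F, h]
  exact Submodule.finiteDimensional_of_le hle

theorem fderiv_component {d : ℕ} {V : Type*} [NormedAddCommGroup V] [NormedSpace ℝ V]
    {r : V → Euc d} {x : V} (hr : DifferentiableAt ℝ r x) (i : Fin d) (v : V) :
    fderiv ℝ r x v i = fderiv ℝ (fun y => r y i) x v := by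
  have := ((EuclideanSpace.proj (𝕜 := ℝ) i : Euc d →L[ℝ] ℝ).hasFDerivAt.comp x
    hr.hasFDerivAt).fderiv
  have h2 : (fun y => r y i) = (EuclideanSpace.proj (𝕜 := ℝ) i : Euc d →L[ℝ] ℝ) ∘ r := rfl
  rw [h2, this]
  rfl

theorem divergence_eq_sum_pd {d : ℕ} {r : Euc d → Euc d} {x : Euc d}
    (hr : DifferentiableAt ℝ r x) : divergence r x = ∑ i, pd i (fun y => r y i) x := by
  simp only [divergence, pd]
  exact Finset.sum_congr rfl fun i _ => fderiv_component hr i _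

/-- The derivative of the term that could raise the degree is `∂_i (x_i b_i) = b_i + x_i ∂_i b_i`,
and `x_i ∂_i` preserves the polynomial space. -/
theorem divergence_mem_polySub {κ : CellKind} {d p : ℕ} {r : Euc d → Euc d}
    (hr : r ∈ rtSub κ d p) : divergence r ∈ polySub κ d p := by
  obtain ⟨a, b, ha, hb, -, h⟩ := exists_of_mem_rtSub hr
  have : divergence r = ∑ i, (pd i (a i) + (b i + fun x => x i * pd i (b i) x)) := by
    ext x
    rw [divergence_eq_sum_pd ((contDiff_of_mem_rtSub hr (k := 1)).differentiable one_ne_zero x)]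
    simp only [Finset.sum_apply]
    refine Finset.sum_congr rfl fun i _ => ?_
    have h1 : (fun y => r y i) = fun y => a i y + y i * b i y := by ext y; exact h y i
    have ha' := ((contDiff_of_mem_polySub (k := 1) (ha i)).differentiable one_ne_zero x).hasFDerivAt
    have hb' := ((contDiff_of_mem_polySub (k := 1) (hb i)).differentiable one_ne_zero x).hasFDerivAt
    have hx : HasFDerivAt (fun y : Euc d => y i) (EuclideanSpace.proj (𝕜 := ℝ) i : Euc d →L[ℝ] ℝ) x :=
      (EuclideanSpace.proj (𝕜 := ℝ) i : Euc d →L[ℝ] ℝ).hasFDerivAt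
    rw [pd, h1, (ha'.fun_add (hx.fun_mul hb')).fderiv]
    simp [pd]
    ring
  rw [this]
  exact sum_mem fun i _ => add_mem (pd_mem_polySub (ha i) i)
    (add_mem (hb i) (coord_mul_pd_mem_polySub (hb i) i))

end

/-! ### Convex geometry and affine automorphisms of the reference element. -/

section

/-! ### Geometry of the reference element -/

/-- The right-hand sides of the inequalities `n_i · x ≤ b_i` that define the reference element. -/
def refBound : (κ : CellKind) → {d : ℕ} → LocalFacet κ d → ℝ
  | CellKind.simplex, _, none => 1
  | CellKind.simplex, _, some _ => 0
  | CellKind.cube, _, (_, false) => 0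
  | CellKind.cube, _, (_, true) => 1

theorem inner_euc {d : ℕ} (x y : Euc d) : inner ℝ x y = ∑ i, x i * y i := by
  simp [PiLp.inner_apply, mul_comm]

theorem mem_refCell_iff {κ : CellKind} {d : ℕ} {x : Euc d} :
    x ∈ refCell κ d ↔ ∀ i : LocalFacet κ d, inner ℝ (refNormal κ i) x ≤ refBound κ i := by
  cases κ
  · have h1 : (∀ i : LocalFacet CellKind.simplex d, inner ℝ (refNormal CellKind.simplex i) x ≤
        refBound CellKind.simplex i) ↔ ∀ i : Option (Fin d),
        inner ℝ (refNormal CellKind.simplex i) x ≤ refBound CellKind.simplex i := Iff.rfl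
    rw [h1, Option.forall]
    simp [refCell, refNormal, refBound, inner_euc, and_comm]
  · have h1 : (∀ i : LocalFacet CellKind.cube d, inner ℝ (refNormal CellKind.cube i) x ≤
        refBound CellKind.cube i) ↔ ∀ i : Fin d × Bool,
        inner ℝ (refNormal CellKind.cube i) x ≤ refBound CellKind.cube i := Iff.rfl
    rw [h1, Prod.forall]
    simp [refCell, refNormal, refBound, inner_euc]

theorem mem_refFacet_iff {d : ℕ} {x : Euc d} : (κ : CellKind) → (i : LocalFacet κ d) →
    (x ∈ refFacet κ i ↔ x ∈ refCell κ d ∧ inner ℝ (refNormal κ i) x = refBound κ i)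
  | CellKind.simplex, none => by simp [refFacet, refNormal, refBound, inner_euc]
  | CellKind.simplex, some i => by simp [refFacet, refNormal, refBound, inner_euc]
  | CellKind.cube, (i, false) => by simp [refFacet, refNormal, refBound, inner_euc]
  | CellKind.cube, (i, true) => by simp [refFacet, refNormal, refBound, inner_euc]

theorem refNormal_ne_zero {n : ℕ} : (κ : CellKind) → (i : LocalFacet κ (n + 1)) →
    refNormal κ i ≠ 0
  | CellKind.simplex, none => fun h => by
      simpa [refNormal] using congrArg (fun v : Euc (n + 1) => v 0) h
  | CellKind.simplex, some i => by simp [refNormal]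
  | CellKind.cube, (i, false) => by simp [refNormal]
  | CellKind.cube, (i, true) => by simp [refNormal]

/-- The interior of the reference element. -/
def refOpen (κ : CellKind) (d : ℕ) : Set (Euc d) :=
  {x | ∀ i : LocalFacet κ d, inner ℝ (refNormal κ i) x < refBound κ i}

theorem isOpen_refOpen (κ : CellKind) (d : ℕ) : IsOpen (refOpen κ d) := by
  have : refOpen κ d = ⋂ i : LocalFacet κ d, {x | inner ℝ (refNormal κ i) x < refBound κ i} := by
    ext x; simp [refOpen]
  rw [this]
  exact isOpen_iInter_of_finite fun i => isOpen_lt (by fun_prop) continuous_const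

theorem refOpen_subset (κ : CellKind) (d : ℕ) : refOpen κ d ⊆ refCell κ d :=
  fun _ hx => mem_refCell_iff.2 fun i => (hx i).le

theorem mem_refOpen_simplex {d : ℕ} {x : Euc d} :
    x ∈ refOpen CellKind.simplex d ↔ (∀ i, 0 < x i) ∧ ∑ i, x i < 1 := by
  have h1 : x ∈ refOpen CellKind.simplex d ↔ ∀ i : Option (Fin d),
      inner ℝ (refNormal CellKind.simplex i) x < refBound CellKind.simplex i := Iff.rfl
  rw [h1, Option.forall]
  simp [refNormal, refBound, inner_euc, and_comm]

theorem mem_refOpen_cube {d : ℕ} {x : Euc d} :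
    x ∈ refOpen CellKind.cube d ↔ ∀ i, 0 < x i ∧ x i < 1 := by
  have h1 : x ∈ refOpen CellKind.cube d ↔ ∀ i : Fin d × Bool,
      inner ℝ (refNormal CellKind.cube i) x < refBound CellKind.cube i := Iff.rfl
  rw [h1, Prod.forall]
  simp [refNormal, refBound, inner_euc]

theorem refOpen_nonempty (κ : CellKind) (d : ℕ) : (refOpen κ d).Nonempty := by
  refine ⟨WithLp.toLp 2 fun _ => ((d : ℝ) + 1)⁻¹ / 2, ?_⟩
  have h0 : (0 : ℝ) < (d : ℝ) + 1 := by positivity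
  have h1 : ((d : ℝ) + 1)⁻¹ ≤ 1 := inv_le_one_of_one_le₀ (by linarith [(Nat.cast_nonneg d : (0 : ℝ) ≤ d)])
  cases κ
  · rw [mem_refOpen_simplex]
    refine ⟨fun i => by simp only; positivity, ?_⟩
    simp only [Finset.sum_const, Finset.card_univ, Fintype.card_fin, nsmul_eq_mul]
    have : (d : ℝ) * ((d : ℝ) + 1)⁻¹ < 1 := by
      rw [mul_inv_lt_iff₀ h0]
      linarith
    have h2 : 0 ≤ (d : ℝ) * ((d : ℝ) + 1)⁻¹ := by positivity
    linarith
  · rw [mem_refOpen_cube]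
    exact fun i => ⟨by simp only; positivity, by simp only; linarith⟩

theorem convex_refCell (κ : CellKind) (d : ℕ) : Convex ℝ (refCell κ d) := by
  have : refCell κ d = ⋂ i : LocalFacet κ d, {x | inner ℝ (refNormal κ i) x ≤ refBound κ i} := by
    ext x; simp [mem_refCell_iff]
  rw [this]
  exact convex_iInter fun i => convex_halfSpace_le (f := fun x => inner ℝ (refNormal κ i) x)
    ⟨fun x y => inner_add_right _ _ _, fun c x => by simp [inner_smul_right]⟩ _

theorem isClosed_refCell (κ : CellKind) (d : ℕ) : IsClosed (refCell κ d) := by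
  have : refCell κ d = ⋂ i : LocalFacet κ d, {x | inner ℝ (refNormal κ i) x ≤ refBound κ i} := by
    ext x; simp [mem_refCell_iff]
  rw [this]
  exact isClosed_iInter fun i => isClosed_le (by fun_prop) continuous_const

theorem coord_mem_of_mem_refCell {κ : CellKind} {d : ℕ} {x : Euc d} (hx : x ∈ refCell κ d)
    (i : Fin d) : 0 ≤ x i ∧ x i ≤ 1 := by
  cases κ
  · exact ⟨hx.1 i, (Finset.single_le_sum (fun j _ => hx.1 j) (Finset.mem_univ i)).trans hx.2⟩
  · exact hx i

theorem isBounded_refCell (κ : CellKind) (d : ℕ) : Bornology.IsBounded (refCell κ d) := by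
  refine (Metric.isBounded_closedBall (x := (0 : Euc d)) (r := √d)).subset fun x hx => ?_
  rw [mem_closedBall_zero_iff, EuclideanSpace.norm_eq]
  refine Real.sqrt_le_sqrt ?_
  calc ∑ i, ‖x i‖ ^ 2 ≤ ∑ i : Fin d, (1 : ℝ) := Finset.sum_le_sum fun i _ => by
        obtain ⟨h1, h2⟩ := coord_mem_of_mem_refCell hx i
        rw [Real.norm_eq_abs, sq_abs]
        nlinarith
    _ = d := by simp

theorem isCompact_refCell (κ : CellKind) (d : ℕ) : IsCompact (refCell κ d) :=
  Metric.isCompact_of_isClosed_isBounded (isClosed_refCell κ d) (isBounded_refCell κ d)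

theorem refOpen_subset_interior (κ : CellKind) (d : ℕ) : refOpen κ d ⊆ interior (refCell κ d) :=
  interior_maximal (refOpen_subset κ d) (isOpen_refOpen κ d)

theorem interior_refCell_nonempty (κ : CellKind) (d : ℕ) : (interior (refCell κ d)).Nonempty :=
  (refOpen_nonempty κ d).mono (refOpen_subset_interior κ d)

/-- A point at which some inequality is active leaves the element when it is moved along the
corresponding outward normal. -/
theorem interior_refCell (κ : CellKind) (d : ℕ) : interior (refCell κ d) = refOpen κ d := by
  -- In dimension zero the normal of the facet `∑ x_i = 1` is the zero vector and cannot be used;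
  -- there the space is a single point.
  rcases d with _ | n
  · obtain ⟨x₀, hx₀⟩ := refOpen_nonempty κ 0
    refine (refOpen_subset_interior κ _).antisymm' fun x _ => ?_
    rwa [Subsingleton.elim x x₀]
  refine (refOpen_subset_interior κ _).antisymm' fun x hx i => ?_
  by_contra hge
  push Not at hge
  have hc : Continuous fun t : ℝ => x + t • refNormal κ i := by fun_prop
  have hmem : ∀ᶠ t in 𝓝 (0 : ℝ), x + t • refNormal κ i ∈ interior (refCell κ (n + 1)) :=
    hc.continuousAt.eventually_mem (by simpa using isOpen_interior.mem_nhds hx)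
  obtain ⟨t, ht, htpos⟩ := ((hmem.filter_mono nhdsWithin_le_nhds).and
    (self_mem_nhdsWithin : Ioi (0 : ℝ) ∈ 𝓝[>] 0)).exists
  have h1 := mem_refCell_iff.1 (interior_subset ht) i
  rw [inner_add_right, inner_smul_right] at h1
  have h2 : 0 < inner ℝ (refNormal κ i) (refNormal κ i) :=
    real_inner_self_pos.2 (refNormal_ne_zero κ i)
  have h3 := mul_pos (show (0 : ℝ) < t from htpos) h2
  linarith

theorem volume_refCell_pos (κ : CellKind) (d : ℕ) : 0 < volume (refCell κ d) :=
  (isOpen_interior.measure_pos volume (interior_refCell_nonempty κ d)).trans_le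
    (measure_mono interior_subset)

theorem volume_refCell_lt_top (κ : CellKind) (d : ℕ) : volume (refCell κ d) < ⊤ :=
  (isCompact_refCell κ d).measure_lt_top

theorem measurableSet_refCell (κ : CellKind) (d : ℕ) : MeasurableSet (refCell κ d) :=
  (isClosed_refCell κ d).measurableSet

/-! ### Affine changes of variables -/

theorem setIntegral_affine_image {d : ℕ} {V : Type*} [NormedAddCommGroup V] [NormedSpace ℝ V]
    (Φ : Euc d ≃ᵃ[ℝ] Euc d) {s : Set (Euc d)} (hs : MeasurableSet s) (h : Euc d → V) :
    ∫ x in Φ '' s, h x =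
      |LinearMap.det (Φ.linear : Euc d →ₗ[ℝ] Euc d)| • ∫ x in s, h (Φ x) := by
  let L : Euc d →L[ℝ] Euc d := LinearMap.toContinuousLinearMap (Φ.linear : Euc d →ₗ[ℝ] Euc d)
  have hΦ : ∀ x, Φ x = L x + Φ 0 := fun x => by
    have := Φ.map_vadd 0 x
    change Φ x = Φ.linear x + Φ 0
    simpa using this
  have hd : ∀ x ∈ s, HasFDerivWithinAt Φ L s x := fun x _ => by
    have h1 : (Φ : Euc d → Euc d) = fun x => L x + Φ 0 := funext hΦ
    rw [h1]
    exact (L.hasFDerivAt.add_const _).hasFDerivWithinAt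
  rw [integral_image_eq_integral_abs_det_fderiv_smul volume hs hd Φ.injective.injOn,
    integral_smul]
  rfl

/-- The reference element has interior points, so its affine span is the whole space. -/
theorem affineMap_eq_of_eqOn {κ : CellKind} {d : ℕ} {V : Type*} [AddCommGroup V] [Module ℝ V]
    {Ψ Ψ' : Euc d →ᵃ[ℝ] V} (h : ∀ x ∈ refCell κ d, Ψ x = Ψ' x) : Ψ = Ψ' := by
  have hspan : affineSpan ℝ (refCell κ d) = ⊤ :=
    (convex_refCell κ d).interior_nonempty_iff_affineSpan_eq_top.1 (interior_refCell_nonempty κ d)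
  exact AffineMap.ext_on hspan h

/-- The automorphism preserves a set of positive and finite volume. -/
theorem abs_det_eq_one {κ : CellKind} {d : ℕ} {σ : Euc d ≃ᵃ[ℝ] Euc d}
    (hσ : σ '' refCell κ d = refCell κ d) :
    |LinearMap.det (σ.linear : Euc d →ₗ[ℝ] Euc d)| = 1 := by
  have := setIntegral_affine_image σ (measurableSet_refCell κ d) (fun _ => (1 : ℝ))
  rw [hσ] at this
  simp only [integral_const, MeasurableSet.univ, measureReal_restrict_apply, univ_inter,
    smul_eq_mul, mul_one] at this
  have hpos : 0 < volume.real (refCell κ d) :=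
    ENNReal.toReal_pos (volume_refCell_pos κ d).ne' (volume_refCell_lt_top κ d).ne
  exact (mul_right_cancel₀ hpos.ne' (by rw [one_mul]; exact this)).symm

theorem setIntegral_comp_aut {κ : CellKind} {d : ℕ} {V : Type*} [NormedAddCommGroup V]
    [NormedSpace ℝ V] {σ : Euc d ≃ᵃ[ℝ] Euc d} (hσ : σ '' refCell κ d = refCell κ d)
    (h : Euc d → V) : ∫ y in refCell κ d, h (σ y) = ∫ y in refCell κ d, h y := by
  conv_rhs => rw [← hσ, setIntegral_affine_image σ (measurableSet_refCell κ d), abs_det_eq_one hσ,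
    one_smul]

/-- Two affine parametrizations of the same image of the reference element differ by an affine
automorphism of the reference element. -/
theorem exists_aut {κ : CellKind} {n m : ℕ} {Ψ Ψ' : Euc n →ᵃ[ℝ] Euc m}
    (hΨ : Function.Injective Ψ) (hΨ' : Function.Injective Ψ')
    (h : Ψ' '' refCell κ n = Ψ '' refCell κ n) :
    ∃ σ : Euc n ≃ᵃ[ℝ] Euc n, σ '' refCell κ n = refCell κ n ∧ ∀ y, Ψ' y = Ψ (σ y) := by
  have hlin : Function.Injective Ψ.linear := Ψ.linear_injective_iff.2 hΨ
  -- A left inverse of the linear part yields an affine left inverse `π` of `Ψ`, and the transition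
  -- map is `π ∘ Ψ'`.
  obtain ⟨P, hP⟩ := LinearMap.exists_leftInverse_of_injective Ψ.linear
    (LinearMap.ker_eq_bot.2 hlin)
  have hP' : ∀ y, P (Ψ.linear y) = y := fun y => LinearMap.congr_fun hP y
  have hΨ0 : ∀ y, Ψ y = Ψ.linear y + Ψ 0 := fun x => by
    have := Ψ.map_vadd 0 x
    simpa using this
  let π : Euc m →ᵃ[ℝ] Euc n := P.toAffineMap.comp (AffineMap.id ℝ _ - AffineMap.const ℝ _ (Ψ 0))
  have hπ : ∀ y, π (Ψ y) = y := fun y => by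
    simp only [π, AffineMap.comp_apply, LinearMap.coe_toAffineMap]
    have : (AffineMap.id ℝ (Euc m) - AffineMap.const ℝ (Euc m) (Ψ 0)) (Ψ y) = Ψ.linear y := by
      simp [hΨ0 y]
    rw [this, hP']
  let τ : Euc n →ᵃ[ℝ] Euc n := π.comp Ψ'
  -- On the reference element this holds because the images agree; an affine identity there extends
  -- to the whole space.
  have hcomp : Ψ' = Ψ.comp τ := by
    refine affineMap_eq_of_eqOn (κ := κ) fun y hy => ?_
    obtain ⟨z, hz, hzy⟩ : Ψ' y ∈ Ψ '' refCell κ n := h ▸ mem_image_of_mem _ hy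
    simp [τ, ← hzy, hπ]
  have hinj : Function.Injective τ := fun y z hyz => hΨ' (by
    rw [hcomp]
    simp [hyz])
  have hbij : Function.Bijective τ := by
    refine ⟨hinj, ?_⟩
    rw [← AffineMap.linear_surjective_iff]
    exact LinearMap.injective_iff_surjective.1 (τ.linear_injective_iff.2 hinj)
  refine ⟨AffineEquiv.ofBijective hbij, ?_, fun y => ?_⟩
  · have h1 : Ψ '' (τ '' refCell κ n) = Ψ '' refCell κ n := by
      rw [← h, image_image]
      exact image_congr fun y _ => by rw [hcomp]; rfl
    exact hΨ.image_injective h1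
  · rw [hcomp]
    rfl

theorem setIntegral_eq_of_image_eq {κ : CellKind} {n m : ℕ} {Ψ Ψ' : Euc n →ᵃ[ℝ] Euc m}
    (hΨ : Function.Injective Ψ) (hΨ' : Function.Injective Ψ')
    (h : Ψ' '' refCell κ n = Ψ '' refCell κ n) (f : Euc m → ℝ) :
    ∫ y in refCell κ n, f (Ψ' y) = ∫ y in refCell κ n, f (Ψ y) := by
  obtain ⟨σ, hσ, hy⟩ := exists_aut hΨ hΨ' h
  simp only [hy]
  exact setIntegral_comp_aut hσ fun y => f (Ψ y)

/-! ### Automorphisms of the cube -/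

theorem affineEquiv_apply_coord {n m : ℕ} (σ : Euc n →ᵃ[ℝ] Euc m) (x : Euc n) (j : Fin m) :
    σ x j = σ 0 j + ∑ i, σ.linear (EuclideanSpace.single i 1) j * x i := by
  have h1 : σ x = σ.linear x + σ 0 := by
    have := σ.map_vadd 0 x
    simpa using this
  have h2 : σ.linear x = ∑ i, x i • σ.linear (EuclideanSpace.single i 1) := by
    conv_lhs => rw [← (EuclideanSpace.basisFun (Fin n) ℝ).sum_repr x]
    simp
  rw [h1, h2]
  simp [add_comm, mul_comm]

/-- The `j`-th coordinate is largest and smallest at the two opposite vertices selected by the signs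
of the coefficients. The difference of these values is the sum of absolute values, and both lie in
`[0, 1]`. -/
theorem sum_abs_le_one_of_mapsTo {n m : ℕ} {σ : Euc n →ᵃ[ℝ] Euc m}
    (h : ∀ x ∈ refCell CellKind.cube n, σ x ∈ refCell CellKind.cube m) (j : Fin m) :
    ∑ i, |σ.linear (EuclideanSpace.single i 1) j| ≤ 1 := by
  set a : Fin n → ℝ := fun i => σ.linear (EuclideanSpace.single i 1) j with ha
  have h1 := h (WithLp.toLp 2 fun i => if 0 < a i then 1 else 0)
    (fun i => by simp only; split_ifs <;> simp) j
  have h2 := h (WithLp.toLp 2 fun i => if 0 < a i then 0 else 1)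
    (fun i => by simp only; split_ifs <;> simp) j
  rw [affineEquiv_apply_coord] at h1 h2
  have h3 : ∑ i, |a i| = ∑ i, a i * (if 0 < a i then 1 else 0) - ∑ i, a i * (if 0 < a i then 0 else 1) := by
    rw [← Finset.sum_sub_distrib]
    refine Finset.sum_congr rfl fun i _ => ?_
    split_ifs with hi
    · simp [abs_of_pos hi]
    · simp [abs_of_nonpos (not_lt.1 hi)]
  simp only at h1 h2
  change ∑ i, |a i| ≤ 1
  rw [h3]
  linarith [h1.2, h2.1]

/-- For simplices every affine map will do. An affine automorphism of the cube permutes and reflects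
coordinates: the matrices of `σ` and of its inverse both have rows of `ℓ¹` norm at most one, and
this forces each to have a single nonzero entry per row and column. Without this fact the spaces of
polynomials on a facet would depend on its parametrization. -/
theorem isCellMap_aut {κ : CellKind} {n : ℕ} {σ : Euc n ≃ᵃ[ℝ] Euc n}
    (hσ : σ '' refCell κ n = refCell κ n) : IsCellMap κ σ := by
  cases κ
  · exact isCellMap_simplex_of_affine σ.toAffineMap
  have hσ' : ∀ x ∈ refCell CellKind.cube n, σ.symm x ∈ refCell CellKind.cube n := fun x hx => by
    rw [← hσ] at hx
    obtain ⟨y, hy, rfl⟩ := hx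
    simpa using hy
  set a : Fin n → Fin n → ℝ := fun j i => σ.linear (EuclideanSpace.single i 1) j with ha
  set b : Fin n → Fin n → ℝ := fun j i => σ.symm.linear (EuclideanSpace.single i 1) j with hb
  have hasum : ∀ j, ∑ i, |a j i| ≤ 1 := sum_abs_le_one_of_mapsTo (σ := σ.toAffineMap) fun x hx => by
    have := mem_image_of_mem σ hx
    rwa [hσ] at this
  have hbsum : ∀ j, ∑ i, |b j i| ≤ 1 := sum_abs_le_one_of_mapsTo (σ := σ.symm.toAffineMap) hσ'
  have lin : ∀ (L : Euc n ≃ₗ[ℝ] Euc n) (x : Euc n) (j : Fin n),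
      L x j = ∑ i, L (EuclideanSpace.single i 1) j * x i := fun L x j => by
    conv_lhs => rw [← (EuclideanSpace.basisFun (Fin n) ℝ).sum_repr x]
    simp [mul_comm]
  have hab : ∀ j, ∑ k, a j k * b k j = 1 := fun j => by
    have h1 := lin σ.linear (σ.symm.linear (EuclideanSpace.single j 1)) j
    have h2 : σ.linear (σ.symm.linear (EuclideanSpace.single j 1)) = EuclideanSpace.single j 1 :=
      σ.linear.apply_symm_apply _
    rw [h2] at h1
    refine Eq.trans ?_ (h1.symm.trans (by simp))
    rfl
  have hba : ∀ j, ∑ k, b j k * a k j = 1 := fun j => by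
    have h1 := lin σ.symm.linear (σ.linear (EuclideanSpace.single j 1)) j
    have h2 : σ.symm.linear (σ.linear (EuclideanSpace.single j 1)) = EuclideanSpace.single j 1 :=
      σ.linear.symm_apply_apply _
    rw [h2] at h1
    refine Eq.trans ?_ (h1.symm.trans (by simp))
    rfl
  -- The diagonal identity `1 = ∑ a_jk b_kj ≤ ∑ |a_jk| |b_kj| ≤ ∑ |a_jk| ≤ 1` is an equality
  -- throughout. Hence `|b_kj| = 1` whenever `a_jk ≠ 0`, which exhausts row `k` of `b`.
  have key : ∀ a b : Fin n → Fin n → ℝ, (∀ j, ∑ i, |a j i| ≤ 1) → (∀ j, ∑ i, |b j i| ≤ 1) →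
      (∀ j, ∑ k, a j k * b k j = 1) → ∀ j k, a j k ≠ 0 → b k j ≠ 0 ∧ ∀ l, l ≠ j → b k l = 0 := by
    intro a b ha hb hab j k hjk
    have hble : ∀ k l, |b k l| ≤ 1 := fun k l =>
      (Finset.single_le_sum (f := fun i => |b k i|) (fun i _ => abs_nonneg _)
        (Finset.mem_univ l)).trans (hb k)
    have h1 : ∑ i, |a j i| * (1 - |b i j|) ≤ 0 := by
      have : (1 : ℝ) ≤ ∑ i, |a j i| * |b i j| := by
        rw [← hab j]
        exact Finset.sum_le_sum fun i _ => (le_abs_self _).trans (abs_mul _ _).le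
      simp only [mul_sub, mul_one, Finset.sum_sub_distrib]
      linarith [ha j]
    have hnn : ∀ i ∈ Finset.univ, 0 ≤ |a j i| * (1 - |b i j|) := fun i _ =>
      mul_nonneg (abs_nonneg _) (by linarith [hble i j])
    have h2 := (Finset.sum_eq_zero_iff_of_nonneg hnn).1
      (le_antisymm h1 (Finset.sum_nonneg hnn)) k (Finset.mem_univ k)
    have h3 : |b k j| = 1 := by
      rcases mul_eq_zero.1 h2 with h | h
      · exact absurd (abs_eq_zero.1 h) hjk
      · linarith
    refine ⟨fun h => by simp [h] at h3, fun l hl => ?_⟩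
    have h4 := hb k
    have h5 : |b k j| + |b k l| ≤ ∑ i, |b k i| := by
      rw [← Finset.sum_pair (f := fun i => |b k i|) hl.symm]
      exact Finset.sum_le_sum_of_subset_of_nonneg (Finset.subset_univ _) fun i _ _ => abs_nonneg _
    exact abs_eq_zero.1 (le_antisymm (by linarith) (abs_nonneg _))
  have hA := key a b hasum hbsum hab
  have hB := key b a hbsum hasum hba
  have hcol : ∀ j j' k, a j k ≠ 0 → a j' k ≠ 0 → j = j' := fun j j' k h h' => by
    by_contra hne
    exact (hA j' k h').1 ((hA j k h).2 j' (Ne.symm hne))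
  have hrow : ∀ j k k', a j k ≠ 0 → a j k' ≠ 0 → k = k' := fun j k k' h h' => by
    by_contra hne
    have := (hB k j (hA j k h).1).2 k' (Ne.symm hne)
    exact h' this
  classical
  -- The default value `j` does no harm: it is used only if row `j` of `a` vanishes, and then the
  -- coefficient `a j (τ j)` is zero.
  let τ : Fin n → Fin n := fun j => if h : ∃ k, a j k ≠ 0 then h.choose else j
  have hτ : ∀ j k, a j k ≠ 0 → τ j = k := fun j k h => by
    have hex : ∃ k, a j k ≠ 0 := ⟨k, h⟩
    simp only [τ, dif_pos hex]
    exact hrow j _ _ hex.choose_spec h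
  refine isCellMap_cube (fun j => σ 0 j) (fun j => a j (τ j)) τ (fun j j' h h' he => ?_)
    fun x j => ?_
  · rw [← he] at h'
    exact hcol j j' _ h h'
  · have h1 := affineEquiv_apply_coord σ.toAffineMap x j
    have h2 : ∑ i, a j i * x i = a j (τ j) * x (τ j) := by
      refine Finset.sum_eq_single _ (fun k _ hk => ?_) (by simp)
      by_contra hne
      exact hk (hτ j k (left_ne_zero_of_mul hne)).symm
    rw [← h2]
    exact h1

end

/-! ### Parametrized reference facets and integration by parts. -/

section

/-! ### Standard parametrizations of the reference facets -/

/-- The point with `i`-th coordinate `t` and remaining coordinates `y`. -/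
def ins {n : ℕ} (i : Fin (n + 1)) (t : ℝ) (y : Euc n) : Euc (n + 1) :=
  WithLp.toLp 2 (Fin.insertNth i t y.ofLp : Fin (n + 1) → ℝ)

@[simp] theorem ins_same {n : ℕ} (i : Fin (n + 1)) (t : ℝ) (y : Euc n) : ins i t y i = t := by
  simp [ins]

@[simp] theorem ins_succAbove {n : ℕ} (i : Fin (n + 1)) (t : ℝ) (y : Euc n) (j : Fin n) :
    ins i t y (i.succAbove j) = y j := by
  simp [ins]

/-- Removal of the `i`-th coordinate. -/
def rem {n : ℕ} (i : Fin (n + 1)) (x : Euc (n + 1)) : Euc n :=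
  WithLp.toLp 2 fun j => x (i.succAbove j)

@[simp] theorem rem_apply {n : ℕ} (i : Fin (n + 1)) (x : Euc (n + 1)) (j : Fin n) :
    rem i x j = x (i.succAbove j) := rfl

@[simp] theorem rem_ins {n : ℕ} (i : Fin (n + 1)) (t : ℝ) (y : Euc n) : rem i (ins i t y) = y := by
  ext j; simp

@[simp] theorem ins_rem {n : ℕ} (i : Fin (n + 1)) (x : Euc (n + 1)) : ins i (x i) (rem i x) = x := by
  ext j
  rcases Fin.eq_self_or_eq_succAbove i j with rfl | ⟨k, rfl⟩ <;> simp

/-- The largest admissible value of a coordinate, in terms of the others. -/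
def refTop : (κ : CellKind) → {n : ℕ} → Euc n → ℝ
  | CellKind.simplex, _, y => 1 - ∑ j, y j
  | CellKind.cube, _, _ => 1

/-- Every line parallel to a coordinate axis meets the reference element in a segment `[0, refTop κ
y]` over the lower dimensional reference element. This is the form in which Fubini's theorem is
applied. -/
theorem ins_mem_refCell {κ : CellKind} {n : ℕ} {i : Fin (n + 1)} {t : ℝ} {y : Euc n} :
    ins i t y ∈ refCell κ (n + 1) ↔ y ∈ refCell κ n ∧ 0 ≤ t ∧ t ≤ refTop κ y := by
  cases κ
  · simp only [refCell, mem_ofPred_eq, Fin.forall_iff_succAbove i, ins_same, ins_succAbove,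
      Fin.sum_univ_succAbove _ i, refTop]
    exact ⟨fun ⟨⟨h1, h2⟩, h3⟩ => ⟨⟨h2, by linarith⟩, h1, by linarith⟩,
      fun ⟨⟨h1, h2⟩, h3, h4⟩ => ⟨⟨h3, h1⟩, by linarith⟩⟩
  · simp only [refCell, mem_ofPred_eq, Fin.forall_iff_succAbove i, ins_same, ins_succAbove, refTop]
    exact and_comm

theorem refTop_nonneg {κ : CellKind} {n : ℕ} {y : Euc n} (hy : y ∈ refCell κ n) :
    0 ≤ refTop κ y := by
  cases κ
  · simp only [refTop]
    linarith [hy.2]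
  · simp [refTop]

/-- The coordinate that is eliminated in the standard parametrization of a facet. -/
def facetIdx : (κ : CellKind) → {n : ℕ} → LocalFacet κ (n + 1) → Fin (n + 1)
  | CellKind.simplex, _, none => 0
  | CellKind.simplex, _, some i => i
  | CellKind.cube, _, (i, _) => i

/-- The linear part of the eliminated coordinate. -/
def facetSlope : (κ : CellKind) → {n : ℕ} → LocalFacet κ (n + 1) → ℝ
  | CellKind.simplex, _, none => -1
  | CellKind.simplex, _, some _ => 0
  | CellKind.cube, _, (_, _) => 0

/-- The linear part of the standard parametrization of a reference facet. -/
def stdFacetLin (κ : CellKind) {n : ℕ} (i : LocalFacet κ (n + 1)) : Euc n →ₗ[ℝ] Euc (n + 1) where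
  toFun y := ins (facetIdx κ i) (facetSlope κ i * ∑ j, y j) y
  map_add' y z := by
    ext j
    rcases Fin.eq_self_or_eq_succAbove (facetIdx κ i) j with rfl | ⟨k, rfl⟩
    · simp [Finset.sum_add_distrib, mul_add]
    · simp
  map_smul' c y := by
    ext j
    rcases Fin.eq_self_or_eq_succAbove (facetIdx κ i) j with rfl | ⟨k, rfl⟩
    · simp [← Finset.mul_sum]; ring
    · simp

/-- The standard parametrization of a reference facet by the reference element of one dimension
less. -/
def stdFacet (κ : CellKind) {n : ℕ} (i : LocalFacet κ (n + 1)) : Euc n →ᵃ[ℝ] Euc (n + 1) where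
  toFun y := ins (facetIdx κ i) (refBound κ i + facetSlope κ i * ∑ j, y j) y
  linear := stdFacetLin κ i
  map_vadd' y z := by
    ext j
    rcases Fin.eq_self_or_eq_succAbove (facetIdx κ i) j with rfl | ⟨k, rfl⟩
    · simp [stdFacetLin, Finset.sum_add_distrib, mul_add]; ring
    · simp [stdFacetLin]

@[simp] theorem stdFacet_linear {κ : CellKind} {n : ℕ} (i : LocalFacet κ (n + 1)) :
    (stdFacet κ i).linear = stdFacetLin κ i := rfl

theorem rem_stdFacet {κ : CellKind} {n : ℕ} (i : LocalFacet κ (n + 1)) (y : Euc n) :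
    rem (facetIdx κ i) (stdFacet κ i y) = y := rem_ins _ _ _

theorem stdFacet_injective {κ : CellKind} {n : ℕ} (i : LocalFacet κ (n + 1)) :
    Function.Injective (stdFacet κ i) :=
  Function.LeftInverse.injective (rem_stdFacet i)

/-- The facet `∑ x_i = 1` of the simplex. -/
def fTop {d : ℕ} : LocalFacet CellKind.simplex d := (none : Option (Fin d))

/-- The facet `x_i = 0` of the simplex. -/
def fCoord {d : ℕ} (i : Fin d) : LocalFacet CellKind.simplex d := (some i : Option (Fin d))

/-- The facets of the cube. -/
def fCube {d : ℕ} (i : Fin d) (b : Bool) : LocalFacet CellKind.cube d := ((i, b) : Fin d × Bool)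

/-- The type of facets depends on the kind of element, so the motive ranges over both at once. -/
theorem localFacet_cases {d : ℕ} {motive : ∀ κ, LocalFacet κ d → Prop}
    (h1 : motive CellKind.simplex fTop) (h2 : ∀ i, motive CellKind.simplex (fCoord i))
    (h3 : ∀ i, motive CellKind.cube (fCube i false))
    (h4 : ∀ i, motive CellKind.cube (fCube i true)) : (κ : CellKind) → (i : LocalFacet κ d) → motive κ i
  | CellKind.simplex, none => h1
  | CellKind.simplex, some i => h2 i
  | CellKind.cube, (i, false) => h3 i
  | CellKind.cube, (i, true) => h4 i

theorem sum_localFacet_simplex {d : ℕ} {V : Type*} [AddCommMonoid V]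
    (f : LocalFacet CellKind.simplex d → V) : ∑ i, f i = f fTop + ∑ i, f (fCoord i) :=
  Fintype.sum_option (α := Fin d) f

theorem sum_localFacet_cube {d : ℕ} {V : Type*} [AddCommMonoid V]
    (f : LocalFacet CellKind.cube d → V) :
    ∑ i, f i = ∑ i, (f (fCube i true) + f (fCube i false)) :=
  (Fintype.sum_prod_type (α₁ := Fin d) (α₂ := Bool) f).trans
    (Finset.sum_congr rfl fun _ _ => Fintype.sum_bool _)

theorem inner_refNormal_fTop {d : ℕ} (x : Euc d) :
    inner ℝ (refNormal CellKind.simplex fTop) x = ∑ i, x i := by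
  simp [refNormal, fTop, inner_euc]

theorem inner_refNormal_fCoord {d : ℕ} (i : Fin d) (x : Euc d) :
    inner ℝ (refNormal CellKind.simplex (fCoord i)) x = -x i := by
  simp [refNormal, fCoord, inner_euc]

theorem inner_refNormal_fCube_false {d : ℕ} (i : Fin d) (x : Euc d) :
    inner ℝ (refNormal CellKind.cube (fCube i false)) x = -x i := by
  simp [refNormal, fCube, inner_euc]

theorem inner_refNormal_fCube_true {d : ℕ} (i : Fin d) (x : Euc d) :
    inner ℝ (refNormal CellKind.cube (fCube i true)) x = x i := by
  simp [refNormal, fCube, inner_euc]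

theorem stdFacet_fTop {n : ℕ} (y : Euc n) :
    stdFacet CellKind.simplex fTop y = ins 0 (1 - ∑ j, y j) y :=
  congrArg (fun t => ins 0 t y) (show 1 + (-1) * ∑ j, y j = 1 - ∑ j, y j by ring)

theorem stdFacet_fCoord {n : ℕ} (i : Fin (n + 1)) (y : Euc n) :
    stdFacet CellKind.simplex (fCoord i) y = ins i 0 y :=
  congrArg (fun t => ins i t y) (show 0 + 0 * ∑ j, y j = 0 by ring)

theorem stdFacet_fCube_false {n : ℕ} (i : Fin (n + 1)) (y : Euc n) :
    stdFacet CellKind.cube (fCube i false) y = ins i 0 y :=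
  congrArg (fun t => ins i t y) (show 0 + 0 * ∑ j, y j = 0 by ring)

theorem stdFacet_fCube_true {n : ℕ} (i : Fin (n + 1)) (y : Euc n) :
    stdFacet CellKind.cube (fCube i true) y = ins i 1 y :=
  congrArg (fun t => ins i t y) (show 1 + 0 * ∑ j, y j = 1 by ring)

theorem inner_refNormal_stdFacet {n : ℕ} (κ : CellKind) (i : LocalFacet κ (n + 1)) :
    ∀ y, inner ℝ (refNormal κ i) (stdFacet κ i y) = refBound κ i := by
  refine localFacet_cases (motive := fun κ i =>
    ∀ y, inner ℝ (refNormal κ i) (stdFacet κ i y) = refBound κ i) ?_ ?_ ?_ ?_ κ i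
  · intro y
    rw [inner_refNormal_fTop, stdFacet_fTop, Fin.sum_univ_succAbove _ (0 : Fin (n + 1))]
    simp only [ins_same, ins_succAbove]
    simp [refBound, fTop]
  · intro i y
    rw [inner_refNormal_fCoord, stdFacet_fCoord]
    simp [refBound, fCoord]
  · intro i y
    rw [inner_refNormal_fCube_false, stdFacet_fCube_false]
    simp [refBound, fCube]
  · intro i y
    rw [inner_refNormal_fCube_true, stdFacet_fCube_true]
    simp [refBound, fCube]

theorem stdFacet_rem {n : ℕ} (κ : CellKind) (i : LocalFacet κ (n + 1)) :
    ∀ x, inner ℝ (refNormal κ i) x = refBound κ i → stdFacet κ i (rem (facetIdx κ i) x) = x := by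
  refine localFacet_cases (motive := fun κ i => ∀ x, inner ℝ (refNormal κ i) x = refBound κ i →
    stdFacet κ i (rem (facetIdx κ i) x) = x) ?_ ?_ ?_ ?_ κ i
  · intro x hx
    rw [inner_refNormal_fTop, Fin.sum_univ_succAbove _ (0 : Fin (n + 1))] at hx
    rw [stdFacet_fTop]
    conv_rhs => rw [← ins_rem 0 x]
    simp only [refBound, fTop] at hx
    simp only [facetIdx, fTop, rem_apply]
    congr 1
    linarith
  · intro i x hx
    rw [inner_refNormal_fCoord] at hx
    rw [stdFacet_fCoord]
    simp only [refBound, fCoord, neg_eq_zero] at hx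
    conv_rhs => rw [← ins_rem i x, hx]
    rfl
  · intro i x hx
    rw [inner_refNormal_fCube_false] at hx
    rw [stdFacet_fCube_false]
    simp only [refBound, fCube, neg_eq_zero] at hx
    conv_rhs => rw [← ins_rem i x, hx]
    rfl
  · intro i x hx
    rw [inner_refNormal_fCube_true] at hx
    rw [stdFacet_fCube_true]
    simp only [refBound, fCube] at hx
    conv_rhs => rw [← ins_rem i x, hx]
    rfl

theorem stdFacet_mem_refCell {n : ℕ} (κ : CellKind) (i : LocalFacet κ (n + 1)) :
    ∀ y, (stdFacet κ i y ∈ refCell κ (n + 1) ↔ y ∈ refCell κ n) := by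
  refine localFacet_cases (motive := fun κ i =>
    ∀ y, (stdFacet κ i y ∈ refCell κ (n + 1) ↔ y ∈ refCell κ n)) ?_ ?_ ?_ ?_ κ i
  · intro y
    rw [stdFacet_fTop, ins_mem_refCell]
    simp only [refTop, le_refl, and_true]
    exact ⟨fun h => h.1, fun h => ⟨h, by linarith [h.2]⟩⟩
  · intro i y
    rw [stdFacet_fCoord, ins_mem_refCell]
    exact ⟨fun h => h.1, fun h => ⟨h, le_rfl, refTop_nonneg h⟩⟩
  · intro i y
    rw [stdFacet_fCube_false, ins_mem_refCell]
    exact ⟨fun h => h.1, fun h => ⟨h, le_rfl, refTop_nonneg h⟩⟩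
  · intro i y
    rw [stdFacet_fCube_true, ins_mem_refCell]
    simp [refTop]

theorem image_stdFacet {κ : CellKind} {n : ℕ} (i : LocalFacet κ (n + 1)) :
    stdFacet κ i '' refCell κ n = refFacet κ i := by
  ext x
  rw [mem_refFacet_iff]
  constructor
  · rintro ⟨y, hy, rfl⟩
    exact ⟨(stdFacet_mem_refCell κ i y).2 hy, inner_refNormal_stdFacet κ i y⟩
  · rintro ⟨hx, hb⟩
    have := stdFacet_rem κ i x hb
    refine ⟨rem (facetIdx κ i) x, ?_, this⟩
    rw [← stdFacet_mem_refCell κ i, this]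
    exact hx

theorem inner_stdFacetLin {κ : CellKind} {n : ℕ} (i : LocalFacet κ (n + 1)) (y : Euc n) :
    inner ℝ (refNormal κ i) (stdFacetLin κ i y) = 0 := by
  have h1 := inner_refNormal_stdFacet κ i y
  have h2 := inner_refNormal_stdFacet κ i 0
  have h3 : stdFacet κ i y = stdFacetLin κ i y + stdFacet κ i 0 := by
    have := (stdFacet κ i).map_vadd 0 y
    simpa using this
  rw [h3, inner_add_right, h2] at h1
  linarith

/-! ### Integration over the reference element -/

/-- Separation of the `i`-th coordinate, as a measurable equivalence. -/
def insEquiv {n : ℕ} (i : Fin (n + 1)) : ℝ × Euc n ≃ᵐ Euc (n + 1) :=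
  ((MeasurableEquiv.refl ℝ).prodCongr (MeasurableEquiv.toLp 2 (Fin n → ℝ)).symm).trans
    ((MeasurableEquiv.piFinSuccAbove (fun _ => ℝ) i).symm.trans
      (MeasurableEquiv.toLp 2 (Fin (n + 1) → ℝ)))

theorem measurePreserving_insEquiv {n : ℕ} (i : Fin (n + 1)) :
    MeasurePreserving (insEquiv (n := n) i) := by
  have h1 : MeasurePreserving ((MeasurableEquiv.refl ℝ).prodCongr
      (MeasurableEquiv.toLp 2 (Fin n → ℝ)).symm : ℝ × Euc n ≃ᵐ ℝ × (Fin n → ℝ)) :=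
    (MeasurePreserving.id volume).prod (PiLp.volume_preserving_ofLp (Fin n))
  have h2 := (volume_preserving_piFinSuccAbove (fun _ : Fin (n + 1) => ℝ) i).symm
  have h3 := PiLp.volume_preserving_toLp (Fin (n + 1))
  exact h3.comp (h2.comp h1)

theorem integral_eq_integral_ins {n : ℕ} (i : Fin (n + 1)) {F : Euc (n + 1) → ℝ}
    (hF : Integrable F) : ∫ x, F x = ∫ y : Euc n, ∫ t : ℝ, F (ins i t y) := by
  have h1 := (measurePreserving_insEquiv i).integral_comp' F
  have h2 : Integrable (fun z : ℝ × Euc n => F (insEquiv i z)) :=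
    (measurePreserving_insEquiv i).integrable_comp_of_integrable hF
  rw [← h1]
  exact integral_prod_symm _ h2

theorem hasDerivAt_ins {n : ℕ} {φ : Euc (n + 1) → ℝ} (i : Fin (n + 1)) (y : Euc n) (t : ℝ)
    (hφ : DifferentiableAt ℝ φ (ins i t y)) :
    HasDerivAt (fun s => φ (ins i s y)) (pd i φ (ins i t y)) t := by
  have h0 : ∀ s, ins i s y = ins i 0 y + s • EuclideanSpace.single i (1 : ℝ) := fun s => by
    ext j
    rcases Fin.eq_self_or_eq_succAbove i j with rfl | ⟨k, rfl⟩ <;> simp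
  have h1 : HasDerivAt (fun s => ins i s y) (EuclideanSpace.single i (1 : ℝ)) t := by
    have h2 : (fun s => ins i s y) = fun s => ins i 0 y + s • EuclideanSpace.single i (1 : ℝ) :=
      funext h0
    rw [h2]
    simpa using ((hasDerivAt_id t).smul_const (EuclideanSpace.single i (1 : ℝ))).const_add (ins i 0 y)
  exact hφ.hasFDerivAt.comp_hasDerivAt t h1

theorem continuous_ins {n : ℕ} (i : Fin (n + 1)) (y : Euc n) : Continuous fun t => ins i t y := by
  have h2 : (fun s => ins i s y) = fun s => ins i 0 y + s • EuclideanSpace.single i (1 : ℝ) := by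
    ext s j
    rcases Fin.eq_self_or_eq_succAbove i j with rfl | ⟨k, rfl⟩ <;> simp
  rw [h2]
  fun_prop

theorem continuous_pd {m : ℕ} {φ : Euc m → ℝ} (hφ : ContDiff ℝ 1 φ) (i : Fin m) :
    Continuous (pd i φ) :=
  (hφ.continuous_fderiv one_ne_zero).clm_apply continuous_const

/-- Fubini's theorem in the `i`-th coordinate, followed by the fundamental theorem of calculus on
each slice. -/
theorem integral_pd_refCell {κ : CellKind} {n : ℕ} {φ : Euc (n + 1) → ℝ} (hφ : ContDiff ℝ 1 φ)
    (i : Fin (n + 1)) :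
    ∫ x in refCell κ (n + 1), pd i φ x =
      ∫ y in refCell κ n, (φ (ins i (refTop κ y) y) - φ (ins i 0 y)) := by
  have hint : IntegrableOn (pd i φ) (refCell κ (n + 1)) :=
    (continuous_pd hφ i).continuousOn.integrableOn_compact (isCompact_refCell κ _)
  rw [← integral_indicator (measurableSet_refCell κ _),
    integral_eq_integral_ins i (hint.integrable_indicator (measurableSet_refCell κ _)),
    ← integral_indicator (measurableSet_refCell κ _)]
  congr 1
  ext y
  by_cases hy : y ∈ refCell κ n
  · have h0 := refTop_nonneg hy
    have h1 : (fun t => (refCell κ (n + 1)).indicator (pd i φ) (ins i t y)) =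
        (Icc 0 (refTop κ y)).indicator fun t => pd i φ (ins i t y) := by
      ext t
      by_cases ht : t ∈ Icc 0 (refTop κ y)
      · rw [indicator_of_mem ht, indicator_of_mem (ins_mem_refCell.2 ⟨hy, ht⟩)]
      · rw [indicator_of_notMem ht, indicator_of_notMem fun h => ht (ins_mem_refCell.1 h).2]
    rw [h1, indicator_of_mem hy, integral_indicator measurableSet_Icc, integral_Icc_eq_integral_Ioc,
      ← intervalIntegral.integral_of_le h0]
    refine intervalIntegral.integral_eq_sub_of_hasDerivAt
      (fun t _ => hasDerivAt_ins i y t (hφ.differentiable one_ne_zero _)) ?_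
    exact ((continuous_pd hφ i).comp (continuous_ins i y)).intervalIntegrable _ _
  · have h1 : (fun t => (refCell κ (n + 1)).indicator (pd i φ) (ins i t y)) = fun _ => 0 := by
      ext t
      exact indicator_of_notMem (fun h => hy (ins_mem_refCell.1 h).1) _
    rw [h1, indicator_of_notMem hy]
    simp

theorem continuous_stdFacet {κ : CellKind} {n : ℕ} (i : LocalFacet κ (n + 1)) :
    Continuous (stdFacet κ i) :=
  (stdFacet κ i).continuous_of_finiteDimensional

/-- The affine map `y ↦ ins i (1 - ∑ y) y`. -/
def topMap {n : ℕ} (i : Fin (n + 1)) : Euc n →ᵃ[ℝ] Euc (n + 1) where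
  toFun y := ins i (1 - ∑ j, y j) y
  linear :=
    { toFun := fun y => ins i (-∑ j, y j) y
      map_add' := fun y z => by
        ext j
        rcases Fin.eq_self_or_eq_succAbove i j with rfl | ⟨k, rfl⟩
        · simp [Finset.sum_add_distrib]; ring
        · simp
      map_smul' := fun c y => by
        ext j
        rcases Fin.eq_self_or_eq_succAbove i j with rfl | ⟨k, rfl⟩
        · simp [← Finset.mul_sum]
        · simp }
  map_vadd' y z := by
    ext j
    rcases Fin.eq_self_or_eq_succAbove i j with rfl | ⟨k, rfl⟩
    · simp [Finset.sum_add_distrib]; ring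
    · simp

theorem topMap_apply {n : ℕ} (i : Fin (n + 1)) (y : Euc n) :
    topMap i y = ins i (1 - ∑ j, y j) y := rfl

/-- The oblique facet of the simplex can be parametrized by eliminating any coordinate. The partial
derivative in direction `i` produces the parametrization that eliminates `i`, whereas `stdFacet`
always eliminates the coordinate `0`. -/
theorem image_topMap {n : ℕ} (i : Fin (n + 1)) :
    topMap i '' refCell CellKind.simplex n = refFacet CellKind.simplex (fTop : LocalFacet CellKind.simplex (n + 1)) := by
  ext x
  constructor
  · rintro ⟨y, hy, rfl⟩
    refine ⟨?_, ?_⟩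
    · rw [topMap_apply, ins_mem_refCell]
      exact ⟨hy, by linarith [hy.2], le_rfl⟩
    · rw [topMap_apply]
      simp [Fin.sum_univ_succAbove _ i]
  · rintro ⟨hx, hsum⟩
    have h1 : topMap i (rem i x) = x := by
      rw [topMap_apply]
      conv_rhs => rw [← ins_rem i x]
      congr 1
      rw [Fin.sum_univ_succAbove _ i] at hsum
      simp only [rem_apply]
      linarith
    refine ⟨rem i x, ?_, h1⟩
    rw [← h1, topMap_apply] at hx
    exact (ins_mem_refCell.1 hx).1

theorem integrableOn_stdFacet {κ : CellKind} {n : ℕ} {V : Type*} [NormedAddCommGroup V]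
    {f : Euc n → V} (hf : Continuous f) : IntegrableOn f (refCell κ n) :=
  hf.continuousOn.integrableOn_compact (isCompact_refCell κ _)

/-- The divergence theorem on the reference element. -/
theorem integral_divergence_refCell {κ : CellKind} {n : ℕ} {φ : Euc (n + 1) → Euc (n + 1)}
    (hφ : ContDiff ℝ 1 φ) :
    ∫ x in refCell κ (n + 1), divergence φ x =
      ∑ i, ∫ y in refCell κ n, inner ℝ (φ (stdFacet κ i y)) (refNormal κ i) := by
  have hc : ∀ j, ContDiff ℝ 1 fun x => φ x j := fun j => (contDiff_coord j).comp hφ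
  have h1 : ∫ x in refCell κ (n + 1), divergence φ x =
      ∑ j, ∫ x in refCell κ (n + 1), pd j (fun y => φ y j) x := by
    rw [← integral_finsetSum]
    · refine setIntegral_congr_fun (measurableSet_refCell κ _) fun x _ => ?_
      exact divergence_eq_sum_pd (hφ.differentiable one_ne_zero x)
    · exact fun j _ => integrableOn_stdFacet (continuous_pd (hc j) j)
  have h2 : ∀ j (Ψ : Euc n →ᵃ[ℝ] Euc (n + 1)),
      IntegrableOn (fun y => φ (Ψ y) j) (refCell κ n) := fun j Ψ =>
    integrableOn_stdFacet (((hc j).continuous).comp Ψ.continuous_of_finiteDimensional)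
  rw [h1]
  simp only [integral_pd_refCell (hc _)]
  cases κ
  · rw [sum_localFacet_simplex]
    -- The normal of the oblique facet is `(1, …, 1)`, so its contribution splits into the
    -- components of `φ`. For each component the parametrization may be changed, since two
    -- parametrizations differ by an automorphism of the reference simplex, which preserves
    -- integrals.
    have h3 : ∫ y in refCell CellKind.simplex n,
        inner ℝ (φ (stdFacet CellKind.simplex fTop y)) (refNormal CellKind.simplex fTop) =
        ∑ j, ∫ y in refCell CellKind.simplex n, φ (topMap j y) j := by
      simp only [real_inner_comm, inner_refNormal_fTop]
      rw [integral_finsetSum _ fun j _ => h2 j _]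
      refine Finset.sum_congr rfl fun j _ => ?_
      refine (setIntegral_eq_of_image_eq (Ψ' := topMap j) (stdFacet_injective _) ?_ ?_
        fun x => φ x j).symm
      · exact Function.LeftInverse.injective (g := rem j) fun y => by simp [topMap_apply]
      · rw [image_topMap, image_stdFacet]
    rw [h3, ← Finset.sum_add_distrib]
    refine Finset.sum_congr rfl fun j _ => ?_
    have h4 := integral_sub (h2 j (topMap j)) (h2 j (stdFacet CellKind.simplex (fCoord j)))
    simp only [real_inner_comm, inner_refNormal_fCoord]
    rw [integral_neg, ← sub_eq_add_neg, ← h4]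
    refine setIntegral_congr_fun (measurableSet_refCell _ _) fun y _ => ?_
    simp only [stdFacet_fCoord]
    rfl
  · rw [sum_localFacet_cube]
    refine Finset.sum_congr rfl fun j _ => ?_
    have h4 := integral_sub (h2 j (stdFacet CellKind.cube (fCube j true)))
      (h2 j (stdFacet CellKind.cube (fCube j false)))
    simp only [real_inner_comm, inner_refNormal_fCube_true, inner_refNormal_fCube_false]
    rw [integral_neg, ← sub_eq_add_neg, ← h4]
    refine setIntegral_congr_fun (measurableSet_refCell _ _) fun y _ => ?_
    simp only [stdFacet_fCube_true, stdFacet_fCube_false]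
    rfl

end

/-! ### Surface elements, and transfer of the divergence theorem to mesh elements. -/

section

/-! ### The surface element of a facet -/

/-- The endomorphism `x ↦ x_0 m + W (x_1, …, x_n)`. -/
def augment {n : ℕ} (m : Euc (n + 1)) (W : Euc n →ₗ[ℝ] Euc (n + 1)) :
    Euc (n + 1) →ₗ[ℝ] Euc (n + 1) where
  toFun x := x 0 • m + W (rem 0 x)
  map_add' x y := by
    have : rem 0 (x + y) = rem 0 x + rem 0 y := by ext j; simp
    rw [this, map_add]
    simp only [PiLp.add_apply]
    module
  map_smul' c x := by
    have : rem 0 (c • x) = c • rem 0 x := by ext j; simp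
    rw [this, map_smul]
    simp only [PiLp.smul_apply, smul_eq_mul, RingHom.id_apply]
    module

theorem augment_single_zero {n : ℕ} (m : Euc (n + 1)) (W : Euc n →ₗ[ℝ] Euc (n + 1)) :
    augment m W (EuclideanSpace.single 0 1) = m := by
  have : rem 0 (EuclideanSpace.single (0 : Fin (n + 1)) (1 : ℝ)) = 0 := by ext j; simp
  simp [augment, this]

theorem augment_single_succ {n : ℕ} (m : Euc (n + 1)) (W : Euc n →ₗ[ℝ] Euc (n + 1)) (j : Fin n) :
    augment m W (EuclideanSpace.single j.succ 1) = W (EuclideanSpace.single j 1) := by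
  have : rem 0 (EuclideanSpace.single j.succ (1 : ℝ)) = EuclideanSpace.single j 1 := by
    ext k
    simp
  simp [augment, this]

/-- The matrix of `W* W'` in the standard basis is the Gram matrix of the images of the basis
vectors. -/
theorem det_adjoint_comp {n m : ℕ} (W W' : Euc n →ₗ[ℝ] Euc m) :
    LinearMap.det (LinearMap.adjoint W ∘ₗ W') = (Matrix.of fun j k =>
      inner ℝ (W (EuclideanSpace.single j 1)) (W' (EuclideanSpace.single k 1))).det := by
  rw [← LinearMap.det_toMatrix (EuclideanSpace.basisFun (Fin n) ℝ).toBasis]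
  congr 1
  ext j k
  rw [LinearMap.toMatrix_apply]
  rw [Matrix.of_apply, ← LinearMap.adjoint_inner_right]
  simp [inner_euc]

theorem det_adjoint_euc {n : ℕ} (W : Euc n →ₗ[ℝ] Euc n) :
    LinearMap.det (LinearMap.adjoint W) = LinearMap.det W := by
  have h1 := det_adjoint_comp W LinearMap.id
  have h2 := det_adjoint_comp LinearMap.id W
  rw [LinearMap.comp_id] at h1
  have h3 : LinearMap.adjoint (LinearMap.id : Euc n →ₗ[ℝ] Euc n) = LinearMap.id :=
    (LinearMap.eq_adjoint_iff _ _).2 (fun x y => rfl) |>.symm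
  rw [h3, LinearMap.id_comp] at h2
  rw [h1, h2, ← Matrix.det_transpose]
  congr 1
  ext j k
  simp [real_inner_comm]

/-- A Gram determinant formula. -/
theorem det_augment_mul {n : ℕ} {m : Euc (n + 1)} {W : Euc n →ₗ[ℝ] Euc (n + 1)}
    (hm : ∀ y, inner ℝ m (W y) = 0) (h : Euc (n + 1)) :
    LinearMap.det (augment m W) * LinearMap.det (augment h W) =
      inner ℝ m h * LinearMap.det (LinearMap.adjoint W ∘ₗ W) := by
  -- As `m` is orthogonal to the range of `W`, the first row of this Gram matrix is `(⟨m, h⟩, 0, …,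
  -- 0)`, and expansion along it leaves the Gram determinant of `W`.
  rw [← det_adjoint_euc (augment m W), ← LinearMap.det_comp, det_adjoint_comp, det_adjoint_comp,
    Matrix.det_succ_row_zero, Finset.sum_eq_single 0]
  · simp only [Fin.val_zero, pow_zero, one_mul, Matrix.of_apply, augment_single_zero]
    congr 2
    ext j k
    simp [augment_single_succ]
  · intro j _ hj
    obtain ⟨k, rfl⟩ := Fin.exists_succ_eq.2 hj
    simp [augment_single_zero, augment_single_succ, hm]
  · simp

theorem inner_ins {n : ℕ} (i : Fin (n + 1)) (s t : ℝ) (y z : Euc n) :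
    inner ℝ (ins i s y) (ins i t z) = s * t + inner ℝ y z := by
  simp [inner_euc, Fin.sum_univ_succAbove _ i]

/-- The Gram matrix is a rank-one perturbation of the identity, with determinant `1 + n s²` for the
slope `s` of the eliminated coordinate; for each facet this number is the squared length of the
reference normal. -/
theorem det_gram_stdFacetLin {κ : CellKind} {n : ℕ} (i : LocalFacet κ (n + 1)) :
    LinearMap.det (LinearMap.adjoint (stdFacetLin κ i) ∘ₗ stdFacetLin κ i) =
      ‖refNormal κ i‖ ^ 2 := by
  have h1 : LinearMap.det (LinearMap.adjoint (stdFacetLin κ i) ∘ₗ stdFacetLin κ i) =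
      1 + n * facetSlope κ i ^ 2 := by
    rw [det_adjoint_comp]
    have h2 : (Matrix.of fun j k => inner ℝ (stdFacetLin κ i (EuclideanSpace.single j 1))
        (stdFacetLin κ i (EuclideanSpace.single k 1))) =
        1 + Matrix.replicateCol Unit (fun _ : Fin n => facetSlope κ i) *
          Matrix.replicateRow Unit (fun _ => facetSlope κ i) := by
      ext j k
      have h3 : ∀ j : Fin n, stdFacetLin κ i (EuclideanSpace.single j 1) =
          ins (facetIdx κ i) (facetSlope κ i) (EuclideanSpace.single j 1) := fun j => by
        simp [stdFacetLin]
      rw [Matrix.of_apply, h3, h3, inner_ins]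
      simp [Matrix.mul_apply, Matrix.one_apply, inner_euc, add_comm, eq_comm]
    rw [h2, Matrix.det_one_add_replicateCol_mul_replicateRow]
    simp [dotProduct, sq]
  rw [h1]
  refine localFacet_cases (motive := fun κ i => 1 + n * facetSlope κ i ^ 2 = ‖refNormal κ i‖ ^ 2)
    ?_ ?_ ?_ ?_ κ i
  · rw [← real_inner_self_eq_norm_sq, inner_refNormal_fTop]
    simp [facetSlope, fTop, refNormal, add_comm]
  · intro i
    simp [facetSlope, fCoord, refNormal]
  · intro i
    simp [facetSlope, fCube, refNormal]
  · intro i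
    simp [facetSlope, fCube, refNormal]

theorem inner_adjoint_symm {d : ℕ} (L : Euc d ≃ₗ[ℝ] Euc d) (x y : Euc d) :
    inner ℝ (LinearMap.adjoint (L.symm : Euc d →ₗ[ℝ] Euc d) x) (L y) = inner ℝ x y := by
  rw [LinearMap.adjoint_inner_left]
  simp

theorem adjoint_symm_ne_zero {d : ℕ} (L : Euc d ≃ₗ[ℝ] Euc d) {x : Euc d} (hx : x ≠ 0) :
    LinearMap.adjoint (L.symm : Euc d →ₗ[ℝ] Euc d) x ≠ 0 := fun h => by
  have := inner_adjoint_symm L x x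
  rw [h, inner_zero_left] at this
  exact hx (inner_self_eq_zero.1 this.symm)

/-- Nanson's formula: a linear map `L` scales the area of a hyperplane piece with normal `N` by
`|det L| |L⁻ᵀ N| / |N|`, and the factor `|N|` is the area of the standard parametrization. -/
theorem det_gram_comp {κ : CellKind} {n : ℕ} (i : LocalFacet κ (n + 1))
    (L : Euc (n + 1) ≃ₗ[ℝ] Euc (n + 1)) :
    LinearMap.det (LinearMap.adjoint (L.toLinearMap ∘ₗ stdFacetLin κ i) ∘ₗ
        (L.toLinearMap ∘ₗ stdFacetLin κ i)) =
      (LinearMap.det L.toLinearMap * ‖LinearMap.adjoint L.symm.toLinearMap (refNormal κ i)‖) ^ 2 := by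
  set W := stdFacetLin κ i
  set N := refNormal κ i
  set m := LinearMap.adjoint L.symm.toLinearMap N with hm
  have hm0 : m ≠ 0 := adjoint_symm_ne_zero L (refNormal_ne_zero κ i)
  -- The Gram formula is used for the pairs `(N, N)`, `(N, L⁻¹ m)` and `(m, m)`. The auxiliary
  -- determinants `a` and `b` drop out of the resulting identities.
  have h1 := det_augment_mul (inner_stdFacetLin i) N
  have h2 := det_augment_mul (inner_stdFacetLin i) (L.symm m)
  have h3 := det_augment_mul (m := m) (W := L.toLinearMap ∘ₗ W)
    (fun y => (inner_adjoint_symm L N (W y)).trans (inner_stdFacetLin i y)) m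
  have h4 : augment m (L.toLinearMap ∘ₗ W) = L.toLinearMap ∘ₗ augment (L.symm m) W := by
    ext x : 1
    simp [augment]
  have h5 : inner ℝ N (L.symm m) = ‖m‖ ^ 2 := by
    rw [← real_inner_self_eq_norm_sq, ← inner_adjoint_symm L N (L.symm m)]
    simp [hm]
  rw [det_gram_stdFacetLin] at h1 h2
  rw [h5] at h2
  rw [real_inner_self_eq_norm_sq] at h1 h3
  rw [h4, LinearMap.det_comp] at h3
  have hN : ‖N‖ ^ 2 ≠ 0 := by
    have := norm_ne_zero_iff.2 (refNormal_ne_zero κ i)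
    positivity
  have hmm : ‖m‖ ^ 2 ≠ 0 := by
    have := norm_ne_zero_iff.2 hm0
    positivity
  set a := LinearMap.det (augment N W)
  set b := LinearMap.det (augment (L.symm m) W)
  set δ := LinearMap.det L.toLinearMap
  set g := LinearMap.det (LinearMap.adjoint (L.toLinearMap ∘ₗ W) ∘ₗ (L.toLinearMap ∘ₗ W))
  change a * a = ‖N‖ ^ 2 * ‖N‖ ^ 2 at h1
  change a * b = ‖m‖ ^ 2 * ‖N‖ ^ 2 at h2
  change g = _
  have h6 : (‖m‖ ^ 2 * (‖N‖ ^ 2 * ‖N‖ ^ 2)) * g = (‖m‖ ^ 2 * (‖N‖ ^ 2 * ‖N‖ ^ 2)) * (δ * ‖m‖) ^ 2 := by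
    calc (‖m‖ ^ 2 * (‖N‖ ^ 2 * ‖N‖ ^ 2)) * g = (a * a) * (‖m‖ ^ 2 * g) := by rw [h1]; ring
      _ = δ ^ 2 * (a * b) ^ 2 := by rw [← h3]; ring
      _ = _ := by rw [h2]; ring
  exact mul_left_cancel₀ (by positivity) h6

/-! ### Elements and facets of a mesh -/

variable {κ : CellKind} {n : ℕ} {Ω : Set (Euc (n + 1))} (M : Mesh κ n Ω)

/-- The Jacobian determinant of the element map. -/
def Mesh.jac (T : M.Cell) : ℝ :=
  LinearMap.det ((M.cellMap T).linear : Euc (n + 1) →ₗ[ℝ] Euc (n + 1))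

theorem Mesh.jac_ne_zero (T : M.Cell) : M.jac T ≠ 0 :=
  (LinearEquiv.isUnit_det' (M.cellMap T).linear).ne_zero

/-- The (not normalized) outward normal of an element. -/
def Mesh.nvec (T : M.Cell) (i : LocalFacet κ (n + 1)) : Euc (n + 1) :=
  LinearMap.adjoint ((M.cellMap T).linear.symm : Euc (n + 1) →ₗ[ℝ] Euc (n + 1)) (refNormal κ i)

theorem Mesh.normal_eq (T : M.Cell) (i : LocalFacet κ (n + 1)) :
    M.normal T i = ‖M.nvec T i‖⁻¹ • M.nvec T i := rfl

theorem Mesh.nvec_ne_zero (T : M.Cell) (i : LocalFacet κ (n + 1)) : M.nvec T i ≠ 0 :=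
  adjoint_symm_ne_zero _ (refNormal_ne_zero κ i)

theorem Mesh.norm_nvec_pos (T : M.Cell) (i : LocalFacet κ (n + 1)) : 0 < ‖M.nvec T i‖ :=
  norm_pos_iff.2 (M.nvec_ne_zero T i)

theorem Mesh.inner_nvec (T : M.Cell) (i : LocalFacet κ (n + 1)) (x : Euc (n + 1)) :
    inner ℝ ((M.cellMap T).linear x) (M.nvec T i) = inner ℝ x (refNormal κ i) := by
  rw [real_inner_comm, real_inner_comm (refNormal κ i) x]
  exact inner_adjoint_symm _ _ _

theorem Mesh.exists_aut (T : M.Cell) (i : LocalFacet κ (n + 1)) :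
    ∃ σ : Euc n ≃ᵃ[ℝ] Euc n, σ '' refCell κ n = refCell κ n ∧
      ∀ y, M.facetMap (M.facetOf T i) y = M.cellMap T (stdFacet κ i (σ y)) := by
  have := FOSPG.exists_aut (κ := κ)
    (Ψ := ((M.cellMap T) : Euc (n + 1) →ᵃ[ℝ] Euc (n + 1)).comp (stdFacet κ i))
    (Ψ' := M.facetMap (M.facetOf T i))
    ((M.cellMap T).injective.comp (stdFacet_injective i)) (M.facetMap_injective _) (by
      rw [M.image_facet, ← image_stdFacet, image_image]
      rfl)
  exact this

/-- The change of parameters between a facet of the mesh and the standard parametrization of the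
corresponding facet of the reference element. -/
def Mesh.aut (T : M.Cell) (i : LocalFacet κ (n + 1)) : Euc n ≃ᵃ[ℝ] Euc n := (M.exists_aut T i).choose

theorem Mesh.image_aut (T : M.Cell) (i : LocalFacet κ (n + 1)) :
    M.aut T i '' refCell κ n = refCell κ n := (M.exists_aut T i).choose_spec.1

theorem Mesh.pt_eq (T : M.Cell) (i : LocalFacet κ (n + 1)) (y : Euc n) :
    M.pt T i y = M.cellMap T (stdFacet κ i (M.aut T i y)) := (M.exists_aut T i).choose_spec.2 y

theorem Mesh.setIntegral_aut (T : M.Cell) (i : LocalFacet κ (n + 1)) (h : Euc n → ℝ) :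
    ∫ y in refCell κ n, h (M.aut T i y) = ∫ y in refCell κ n, h y :=
  setIntegral_comp_aut (M.image_aut T i) h

/-- The surface element computed from the global parametrization of a facet agrees with the one
computed from an adjacent element, because the two parametrizations differ by an automorphism of
determinant `±1`. -/
theorem Mesh.facetInt_eq (T : M.Cell) (i : LocalFacet κ (n + 1)) (h : Euc n → ℝ) :
    M.facetInt (M.facetOf T i) h = |M.jac T| * ‖M.nvec T i‖ * ∫ y in refCell κ n, h y := by
  rw [Mesh.facetInt]
  congr 1
  set σ := M.aut T i
  have h1 : M.facetMap (M.facetOf T i) =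
      (((M.cellMap T) : Euc (n + 1) →ᵃ[ℝ] Euc (n + 1)).comp (stdFacet κ i)).comp
        (σ : Euc n →ᵃ[ℝ] Euc n) := by
    ext1 y
    exact M.pt_eq T i y
  set W' : Euc n →ₗ[ℝ] Euc (n + 1) := (M.cellMap T).linear.toLinearMap ∘ₗ stdFacetLin κ i with hW'
  have h2 : (M.facetMap (M.facetOf T i)).linear = W' ∘ₗ σ.linear.toLinearMap := by
    rw [h1]; rfl
  have h3 : LinearMap.adjoint (W' ∘ₗ σ.linear.toLinearMap) ∘ₗ (W' ∘ₗ σ.linear.toLinearMap) =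
      LinearMap.adjoint σ.linear.toLinearMap ∘ₗ (LinearMap.adjoint W' ∘ₗ W') ∘ₗ
        σ.linear.toLinearMap := by
    rw [LinearMap.adjoint_comp]
    rfl
  rw [h2, h3, LinearMap.det_comp, LinearMap.det_comp, det_adjoint_euc, hW', det_gram_comp]
  have h4 := abs_det_eq_one (M.image_aut T i)
  have h5 : LinearMap.det σ.linear.toLinearMap * LinearMap.det σ.linear.toLinearMap = 1 := by
    rw [← abs_mul_abs_self, h4, one_mul]
  rw [mul_comm, mul_assoc, h5, mul_one, Real.sqrt_sq_eq_abs, abs_mul, abs_norm]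
  rfl

/-- The factor of `facetInt`. -/
def Mesh.area (F : M.Facet) : ℝ :=
  Real.sqrt (LinearMap.det (LinearMap.adjoint (M.facetMap F).linear ∘ₗ (M.facetMap F).linear))

theorem Mesh.facetInt_def (F : M.Facet) (h : Euc n → ℝ) :
    M.facetInt F h = M.area F * ∫ y in refCell κ n, h y := rfl

theorem Mesh.area_facetOf (T : M.Cell) (i : LocalFacet κ (n + 1)) :
    M.area (M.facetOf T i) = |M.jac T| * ‖M.nvec T i‖ := by
  have h1 := M.facetInt_eq T i (fun _ => 1)
  rw [M.facetInt_def] at h1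
  have hpos : (0 : ℝ) < ∫ _ in refCell κ n, (1 : ℝ) := by
    simp only [integral_const, MeasurableSet.univ, measureReal_restrict_apply, univ_inter,
      smul_eq_mul, mul_one]
    exact ENNReal.toReal_pos (volume_refCell_pos κ n).ne' (volume_refCell_lt_top κ n).ne
  exact mul_right_cancel₀ hpos.ne' h1

theorem Mesh.area_pos (F : M.Facet) : 0 < M.area F := by
  obtain ⟨T, i, rfl⟩ := M.facet_surj F
  rw [M.area_facetOf]
  have := M.jac_ne_zero T
  have := M.norm_nvec_pos T i
  positivity

theorem setIntegral_cell {V : Type*} [NormedAddCommGroup V] [NormedSpace ℝ V] (T : M.Cell)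
    (h : Euc (n + 1) → V) :
    ∫ x in M.cell T, h x = |M.jac T| • ∫ x in refCell κ (n + 1), h (M.cellMap T x) :=
  setIntegral_affine_image (M.cellMap T) (measurableSet_refCell κ _) h

/-! ### The divergence theorem and Green's formula on a mesh element. -/

theorem divergence_eq_trace {d : ℕ} (r : Euc d → Euc d) (x : Euc d) :
    divergence r x = LinearMap.trace ℝ (Euc d) (fderiv ℝ r x : Euc d →ₗ[ℝ] Euc d) := by
  rw [LinearMap.trace_eq_matrix_trace ℝ (EuclideanSpace.basisFun (Fin d) ℝ).toBasis, Matrix.trace]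
  simp [divergence, LinearMap.toMatrix_apply]

theorem Mesh.continuous_cellMap (T : M.Cell) : Continuous (M.cellMap T) :=
  (M.cellMap T).continuous_of_finiteDimensional

theorem affineEquiv_apply {d : ℕ} (Φ : Euc d ≃ᵃ[ℝ] Euc d) (x : Euc d) :
    Φ x = Φ.linear x + Φ 0 := by
  have := Φ.map_vadd 0 x
  simpa using this

/-- The linear part of an affine equivalence, as a continuous linear equivalence. -/
def linCLE {d : ℕ} (Φ : Euc d ≃ᵃ[ℝ] Euc d) : Euc d ≃L[ℝ] Euc d := Φ.linear.toContinuousLinearEquiv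

theorem hasFDerivAt_affine {d : ℕ} (Φ : Euc d ≃ᵃ[ℝ] Euc d) (x : Euc d) :
    HasFDerivAt Φ (linCLE Φ : Euc d →L[ℝ] Euc d) x := by
  have h1 : (Φ : Euc d → Euc d) = fun x => linCLE Φ x + Φ 0 := funext (affineEquiv_apply Φ)
  rw [h1]
  exact (linCLE Φ).hasFDerivAt.add_const _

theorem contDiff_affine {d : ℕ} {k : WithTop ℕ∞} (Φ : Euc d ≃ᵃ[ℝ] Euc d) : ContDiff ℝ k Φ := by
  have h1 : (Φ : Euc d → Euc d) = fun x => linCLE Φ x + Φ 0 := funext (affineEquiv_apply Φ)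
  rw [h1]
  exact (linCLE Φ).contDiff.add contDiff_const

/-- The divergence is invariant under the transformation `φ ↦ L⁻¹ φ ∘ Φ`. -/
theorem divergence_pullback {d : ℕ} (Φ : Euc d ≃ᵃ[ℝ] Euc d) {φ : Euc d → Euc d} {x : Euc d}
    (hφ : DifferentiableAt ℝ φ (Φ x)) :
    divergence (fun y => Φ.linear.symm (φ (Φ y))) x = divergence φ (Φ x) := by
  have h1 : HasFDerivAt (fun y => (linCLE Φ).symm (φ (Φ y)))
      (((linCLE Φ).symm : Euc d →L[ℝ] Euc d) ∘L (fderiv ℝ φ (Φ x)) ∘L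
        (linCLE Φ : Euc d →L[ℝ] Euc d)) x :=
    (linCLE Φ).symm.hasFDerivAt.comp x (hφ.hasFDerivAt.comp x (hasFDerivAt_affine Φ x))
  have h2 : (fun y => Φ.linear.symm (φ (Φ y))) = fun y => (linCLE Φ).symm (φ (Φ y)) := rfl
  rw [divergence_eq_trace, divergence_eq_trace, h2, h1.fderiv]
  have h3 := LinearMap.trace_conj' (fderiv ℝ φ (Φ x) : Euc d →ₗ[ℝ] Euc d) Φ.linear.symm
  rw [← h3]
  rfl

theorem continuous_pt (T : M.Cell) (i : LocalFacet κ (n + 1)) : Continuous (M.pt T i) :=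
  (M.facetMap (M.facetOf T i)).continuous_of_finiteDimensional

/-- The divergence theorem on an element. -/
theorem Mesh.integral_divergence (T : M.Cell) {φ : Euc (n + 1) → Euc (n + 1)}
    (hφ : ContDiff ℝ 1 φ) :
    ∫ x in M.cell T, divergence φ x =
      ∑ i, M.facetInt (M.facetOf T i) (fun y => inner ℝ (φ (M.pt T i y)) (M.normal T i)) := by
  have hφ' : ContDiff ℝ 1 (fun y => (M.cellMap T).linear.symm (φ (M.cellMap T y))) :=
    (linCLE (M.cellMap T)).symm.contDiff.comp (hφ.comp (contDiff_affine _))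
  rw [setIntegral_cell]
  have h1 := integral_divergence_refCell (κ := κ) hφ'
  have h2 : ∀ x, divergence (fun y => (M.cellMap T).linear.symm (φ (M.cellMap T y))) x =
      divergence φ (M.cellMap T x) := fun x =>
    divergence_pullback _ (hφ.differentiable one_ne_zero _)
  simp only [h2] at h1
  rw [h1, smul_eq_mul, Finset.mul_sum]
  refine Finset.sum_congr rfl fun i _ => ?_
  rw [M.facetInt_eq, mul_assoc]
  congr 1
  rw [← integral_const_mul, ← M.setIntegral_aut T i]
  refine setIntegral_congr_fun (measurableSet_refCell _ _) fun y _ => ?_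
  -- The pulled-back field meets the reference normal exactly as the original field meets the
  -- unnormalized normal; the length of the latter cancels against the surface element.
  have h3 := M.inner_nvec T i ((M.cellMap T).linear.symm (φ (M.pt T i y)))
  rw [LinearEquiv.apply_symm_apply] at h3
  rw [← M.pt_eq, ← h3, M.normal_eq, inner_smul_right]
  have := (M.norm_nvec_pos T i).ne'
  field_simp

/-- Green's formula on an element. -/
theorem Mesh.green (T : M.Cell) {v : Euc (n + 1) → ℝ} {φ : Euc (n + 1) → Euc (n + 1)}
    (hv : ContDiff ℝ 1 v) (hφ : ContDiff ℝ 1 φ) :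
    ∫ x in M.cell T, v x * divergence φ x =
      -(∫ x in M.cell T, fderiv ℝ v x (φ x)) +
        ∑ i, M.facetInt (M.facetOf T i)
          (fun y => v (M.pt T i y) * inner ℝ (φ (M.pt T i y)) (M.normal T i)) := by
  have hcell : IsCompact (M.cell T) := (isCompact_refCell κ _).image (M.continuous_cellMap T)
  have h1 := M.integral_divergence T (hv.smul hφ)
  have h2 : ∀ x, divergence (fun x => v x • φ x) x = v x * divergence φ x + fderiv ℝ v x (φ x) := by
    intro x
    have hv' := (hv.differentiable one_ne_zero x).hasFDerivAt
    have hφ' := (hφ.differentiable one_ne_zero x).hasFDerivAt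
    simp only [divergence]
    rw [(hv'.fun_smul hφ').fderiv]
    simp only [add_apply, smul_apply, ContinuousLinearMap.smulRight_apply, PiLp.add_apply,
      PiLp.smul_apply, smul_eq_mul, Finset.sum_add_distrib, Finset.mul_sum]
    congr 1
    rw [fderiv_eq_sum_pd]
    simp [pd, mul_comm]
  have h3 : Continuous fun x => v x * divergence φ x := by
    refine hv.continuous.mul ?_
    have : divergence φ = fun x => ∑ i, pd i (fun y => φ y i) x := by
      ext x
      exact divergence_eq_sum_pd (hφ.differentiable one_ne_zero x)
    rw [this]
    exact continuous_finsetSum _ fun i _ => continuous_pd ((contDiff_coord i).comp hφ) i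
  have h4 : Continuous fun x => fderiv ℝ v x (φ x) :=
    (hv.continuous_fderiv one_ne_zero).clm_apply hφ.continuous
  have h5 : ∫ x in M.cell T, divergence (fun x => v x • φ x) x =
      (∫ x in M.cell T, v x * divergence φ x) + ∫ x in M.cell T, fderiv ℝ v x (φ x) := by
    simp only [h2]
    exact integral_add (h3.continuousOn.integrableOn_compact hcell)
      (h4.continuousOn.integrableOn_compact hcell)
  have h6 : (v • φ) = fun x => v x • φ x := rfl
  rw [h6, h5] at h1
  simp only [inner_smul_left, RCLike.conj_to_real] at h1
  linarith

end

section

/-! ### Traces and extensions of polynomials -/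

theorem isCellMap_ins_const {κ : CellKind} {n : ℕ} (i : Fin (n + 1)) (c : ℝ) :
    IsCellMap κ (ins (n := n) i c) := by
  classical
  cases κ
  · refine isCellMap_simplex (fun j => if j = i then c else 0)
      (fun j k => if j = i.succAbove k then 1 else 0) fun x j => ?_
    rcases Fin.eq_self_or_eq_succAbove i j with rfl | ⟨k, rfl⟩
    · simp [(Fin.succAbove_ne j _).symm]
    · simp [Fin.succAbove_ne i]
  · refine ⟨fun j => Fin.insertNth (α := fun _ => MvPolynomial (Fin n) ℝ) i (MvPolynomial.C c)
      (fun k => MvPolynomial.X k) j, fun x j => ?_, fun l => ?_⟩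
    · rcases Fin.eq_self_or_eq_succAbove i j with rfl | ⟨k, rfl⟩ <;> simp [evalMap_apply]
    · simp [Fin.sum_univ_succAbove _ i, MvPolynomial.degreeOf_X]

theorem isCellMap_stdFacet {κ : CellKind} {n : ℕ} (i : LocalFacet κ (n + 1)) :
    IsCellMap κ (stdFacet κ i) := by
  cases κ
  · exact isCellMap_simplex_of_affine _
  · have : (stdFacet CellKind.cube i : Euc n → Euc (n + 1)) =
        ins (facetIdx CellKind.cube i) (refBound CellKind.cube i) := by
      ext1 y
      refine localFacet_cases (motive := fun κ i => κ = CellKind.cube → stdFacet κ i y =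
        ins (facetIdx κ i) (refBound κ i) y) ?_ ?_ ?_ ?_ CellKind.cube i rfl
      · simp
      · simp
      · exact fun i _ => stdFacet_fCube_false i y
      · exact fun i _ => stdFacet_fCube_true i y
    rw [this]
    exact isCellMap_ins_const _ _

theorem isCellMap_rem {κ : CellKind} {n : ℕ} (i : Fin (n + 1)) : IsCellMap κ (rem (n := n) i) := by
  classical
  cases κ
  · refine isCellMap_simplex (fun _ => 0) (fun j k => if k = i.succAbove j then 1 else 0)
      fun x j => ?_
    simp
  · refine isCellMap_cube (fun _ => 0) (fun _ => 1) (fun j => i.succAbove j)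
      (fun j j' _ _ h => Fin.succAbove_right_injective h) fun x j => by simp

/-- The term of degree `p + 1` drops to degree `p` on facets: on `∑ x_i = 1` the field `x b` has
normal trace `b`, and on the other facets the coordinate in front of `b_i` is the constant `0` or
`1`. -/
theorem normalTrace_mem_polySub {κ : CellKind} {n p : ℕ} {r : Euc (n + 1) → Euc (n + 1)}
    (hr : r ∈ rtSub κ (n + 1) p) (i : LocalFacet κ (n + 1)) :
    (fun y => inner ℝ (r (stdFacet κ i y)) (refNormal κ i)) ∈ polySub κ n p := by
  revert hr r
  refine localFacet_cases (motive := fun κ i => ∀ {r : Euc (n + 1) → Euc (n + 1)},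
    r ∈ rtSub κ (n + 1) p →
    (fun y => inner ℝ (r (stdFacet κ i y)) (refNormal κ i)) ∈ polySub κ n p) ?_ ?_ ?_ ?_ κ i
  · intro r hr
    obtain ⟨a, b, ha, hb, hab, h⟩ := exists_of_mem_rtSub hr
    have h1 : (fun y => inner ℝ (r (stdFacet CellKind.simplex fTop y))
        (refNormal CellKind.simplex fTop)) =
        (∑ i, fun y => a i (stdFacet CellKind.simplex fTop y)) +
          fun y => b 0 (stdFacet CellKind.simplex fTop y) := by
      ext y
      have h2 := inner_refNormal_stdFacet CellKind.simplex (fTop : LocalFacet _ (n + 1)) y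
      rw [inner_refNormal_fTop] at h2
      rw [real_inner_comm, inner_refNormal_fTop]
      simp only [h, hab rfl _ 0, Finset.sum_add_distrib, ← Finset.sum_mul, h2, Pi.add_apply,
        Finset.sum_apply]
      exact congrArg _ (one_mul _)
    rw [h1]
    exact add_mem (sum_mem fun i _ => (isCellMap_stdFacet _).comp_mem (ha i))
      ((isCellMap_stdFacet _).comp_mem (hb 0))
  · intro i r hr
    obtain ⟨a, b, ha, hb, -, h⟩ := exists_of_mem_rtSub hr
    have h1 : (fun y => inner ℝ (r (stdFacet CellKind.simplex (fCoord i) y))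
        (refNormal CellKind.simplex (fCoord i))) =
        -fun y => a i (stdFacet CellKind.simplex (fCoord i) y) := by
      ext y
      rw [real_inner_comm, inner_refNormal_fCoord, h]
      simp [stdFacet_fCoord]
    rw [h1]
    exact neg_mem ((isCellMap_stdFacet _).comp_mem (ha i))
  · intro i r hr
    obtain ⟨a, b, ha, hb, -, h⟩ := exists_of_mem_rtSub hr
    have h1 : (fun y => inner ℝ (r (stdFacet CellKind.cube (fCube i false) y))
        (refNormal CellKind.cube (fCube i false))) =
        -fun y => a i (stdFacet CellKind.cube (fCube i false) y) := by
      ext y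
      rw [real_inner_comm, inner_refNormal_fCube_false, h]
      simp [stdFacet_fCube_false]
    rw [h1]
    exact neg_mem ((isCellMap_stdFacet _).comp_mem (ha i))
  · intro i r hr
    obtain ⟨a, b, ha, hb, -, h⟩ := exists_of_mem_rtSub hr
    have h1 : (fun y => inner ℝ (r (stdFacet CellKind.cube (fCube i true) y))
        (refNormal CellKind.cube (fCube i true))) =
        (fun y => a i (stdFacet CellKind.cube (fCube i true) y)) +
        fun y => b i (stdFacet CellKind.cube (fCube i true) y) := by
      ext y
      rw [real_inner_comm, inner_refNormal_fCube_true, h]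
      simp [stdFacet_fCube_true]
    rw [h1]
    exact add_mem ((isCellMap_stdFacet _).comp_mem (ha i)) ((isCellMap_stdFacet _).comp_mem (hb i))

theorem mem_rtSub_simplex {d p : ℕ} {r : Euc d → Euc d} {a : Fin d → Euc d → ℝ} {b : Euc d → ℝ}
    (ha : ∀ i, a i ∈ polySub CellKind.simplex d p) (hb : b ∈ polySub CellKind.simplex d p)
    (h : ∀ x i, r x i = a i x + x i * b x) : r ∈ rtSub CellKind.simplex d p :=
  ⟨a, b, fun i => mem_polySub.1 (ha i), mem_polySub.1 hb, h⟩

theorem mem_rtSub_cube {d p : ℕ} {r : Euc d → Euc d} {a b : Fin d → Euc d → ℝ}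
    (ha : ∀ i, a i ∈ polySub CellKind.cube d p) (hb : ∀ i, b i ∈ polySub CellKind.cube d p)
    (h : ∀ x i, r x i = a i x + x i * b i x) : r ∈ rtSub CellKind.cube d p :=
  ⟨a, b, fun i => mem_polySub.1 (ha i), fun i => mem_polySub.1 (hb i), h⟩

theorem smul_mem_polySub_ite {κ : CellKind} {m p : ℕ} {b : Euc m → ℝ} (hb : b ∈ polySub κ m p)
    (c : ℝ) : (fun x => c * b x) ∈ polySub κ m p :=
  Submodule.smul_mem _ c hb

/-- Raviart–Thomas fields with a prescribed polynomial normal trace on one facet and vanishing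
normal traces on the others. -/
theorem exists_rt_extension {κ : CellKind} {n p : ℕ} (i : LocalFacet κ (n + 1)) {e : Euc n → ℝ}
    (he : e ∈ polySub κ n p) :
    ∃ r ∈ rtSub κ (n + 1) p, (∀ y, inner ℝ (r (stdFacet κ i y)) (refNormal κ i) = e y) ∧
      ∀ j, j ≠ i → ∀ y, inner ℝ (r (stdFacet κ j y)) (refNormal κ j) = 0 := by
  classical
  revert he e
  refine localFacet_cases (motive := fun κ i => ∀ {e : Euc n → ℝ}, e ∈ polySub κ n p →
    ∃ r ∈ rtSub κ (n + 1) p, (∀ y, inner ℝ (r (stdFacet κ i y)) (refNormal κ i) = e y) ∧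
      ∀ j, j ≠ i → ∀ y, inner ℝ (r (stdFacet κ j y)) (refNormal κ j) = 0) ?_ ?_ ?_ ?_ κ i
  · intro e he
    -- The datum is extended constantly along the eliminated coordinate. The field `x b(x)` points
    -- away from the origin, which is the vertex opposite to this facet, so it is tangential on the
    -- other facets.
    let b : Euc (n + 1) → ℝ := fun x => e (rem 0 x)
    have hb : b ∈ polySub CellKind.simplex (n + 1) p := (isCellMap_rem 0).comp_mem he
    refine ⟨fun x => b x • x, mem_rtSub_simplex (a := 0) (b := b) (fun i => zero_mem _) hb
      (fun x i => by simp [mul_comm]), fun y => ?_, fun j hj y => ?_⟩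
    · rw [inner_smul_left, real_inner_comm, inner_refNormal_stdFacet]
      simp only [b, stdFacet_fTop, rem_ins]
      simp [refBound, fTop]
    · rw [inner_smul_left, real_inner_comm, inner_refNormal_stdFacet]
      rcases j with _ | j
      · exact absurd rfl hj
      · simp [refBound]
  · intro i e he
    let b : Euc (n + 1) → ℝ := fun x => e (rem i x)
    have hb : b ∈ polySub CellKind.simplex (n + 1) p := (isCellMap_rem i).comp_mem he
    -- The vertex opposite to the facet `x_i = 0` is `e_i`; fields along `x - e_i` are tangential on
    -- all facets through that vertex.
    refine ⟨fun x => b x • (x - EuclideanSpace.single i 1),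
      mem_rtSub_simplex (a := fun j x => (if j = i then -1 else 0) * b x) (b := b)
        (fun j => smul_mem_polySub_ite hb _) hb
        (fun x j => by simp; split_ifs <;> ring), fun y => ?_, fun j hj y => ?_⟩
    · rw [inner_smul_left, real_inner_comm, inner_refNormal_fCoord]
      simp only [b, stdFacet_fCoord, rem_ins]
      simp
    · rw [inner_smul_left, real_inner_comm, inner_sub_right, inner_refNormal_stdFacet]
      rcases j with _ | j
      · have := inner_refNormal_fTop (EuclideanSpace.single i (1 : ℝ))
        rw [fTop] at this
        rw [this]
        simp [refBound]
      · have := inner_refNormal_fCoord j (EuclideanSpace.single i (1 : ℝ))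
        rw [fCoord] at this
        rw [this]
        have hne : j ≠ i := fun h => hj (by rw [h]; rfl)
        simp [refBound, hne]
  · intro i e he
    let b : Euc (n + 1) → ℝ := fun x => e (rem i x)
    have hb : b ∈ polySub CellKind.cube (n + 1) p := (isCellMap_rem i).comp_mem he
    -- Only the faces `x_i = 0` and `x_i = 1` see the `i`-th component, and the factor `x_i - 1`
    -- removes the second one.
    refine ⟨fun x => EuclideanSpace.single i ((x i - 1) * b x),
      mem_rtSub_cube (a := fun j x => (if j = i then -1 else 0) * b x)
        (b := fun j x => (if j = i then 1 else 0) * b x)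
        (fun j => smul_mem_polySub_ite hb _) (fun j => smul_mem_polySub_ite hb _)
        (fun x j => by
          by_cases h : j = i
          · subst h; simp; ring
          · simp [h]), fun y => ?_, fun j hj y => ?_⟩
    · rw [real_inner_comm, inner_refNormal_fCube_false]
      simp only [b, stdFacet_fCube_false, rem_ins]
      simp
    · rw [real_inner_comm]
      obtain ⟨j, c⟩ := j
      by_cases h : j = i
      · subst h
        cases c
        · exact absurd rfl hj
        · have h1 := inner_refNormal_fCube_true j (EuclideanSpace.single j
            ((stdFacet CellKind.cube (fCube j true) y j - 1) *
              b (stdFacet CellKind.cube (fCube j true) y)))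
          refine h1.trans ?_
          simp [stdFacet_fCube_true]
      · cases c
        · refine (inner_refNormal_fCube_false j _).trans ?_
          simp [h]
        · refine (inner_refNormal_fCube_true j _).trans ?_
          simp [h]
  · intro i e he
    let b : Euc (n + 1) → ℝ := fun x => e (rem i x)
    have hb : b ∈ polySub CellKind.cube (n + 1) p := (isCellMap_rem i).comp_mem he
    refine ⟨fun x => EuclideanSpace.single i (x i * b x),
      mem_rtSub_cube (a := 0)
        (b := fun j x => (if j = i then 1 else 0) * b x)
        (fun j => zero_mem _) (fun j => smul_mem_polySub_ite hb _)
        (fun x j => by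
          by_cases h : j = i
          · subst h; simp
          · simp [h]), fun y => ?_, fun j hj y => ?_⟩
    · rw [real_inner_comm, inner_refNormal_fCube_true]
      simp only [b, stdFacet_fCube_true, rem_ins]
      simp
    · rw [real_inner_comm]
      obtain ⟨j, c⟩ := j
      by_cases h : j = i
      · subst h
        cases c
        · have h1 := inner_refNormal_fCube_false j (EuclideanSpace.single j
            (stdFacet CellKind.cube (fCube j false) y j *
              b (stdFacet CellKind.cube (fCube j false) y)))
          refine h1.trans ?_
          simp [stdFacet_fCube_false]
        · exact absurd rfl hj
      · cases c
        · refine (inner_refNormal_fCube_false j _).trans ?_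
          simp [h]
        · refine (inner_refNormal_fCube_true j _).trans ?_
          simp [h]

/-- For a polynomial `v`, a Raviart–Thomas field with vanishing normal traces that controls the
gradient of `v`. -/
theorem exists_rt_bubble {κ : CellKind} {n p : ℕ} {v : Euc (n + 1) → ℝ}
    (hv : v ∈ polySub κ (n + 1) p) :
    ∃ r ∈ rtSub κ (n + 1) p, (∀ j y, inner ℝ (r (stdFacet κ j y)) (refNormal κ j) = 0) ∧
      ∀ x ∈ refCell κ (n + 1), 0 ≤ fderiv ℝ v x (r x) ∧
        (x ∈ refOpen κ (n + 1) → fderiv ℝ v x (r x) = 0 → ∀ i, pd i v x = 0) := by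
  cases κ
  · refine ⟨fun x => WithLp.toLp 2 fun i => x i * pd i v x - x i * ∑ j, x j * pd j v x,
      mem_rtSub_simplex (a := fun i x => x i * pd i v x) (b := -∑ j, fun x => x j * pd j v x)
        (fun i => coord_mul_pd_mem_polySub hv i)
        (neg_mem (sum_mem fun j _ => coord_mul_pd_mem_polySub hv j))
        (fun x i => by simp [sub_eq_add_neg]), ?_, ?_⟩
    · intro j y
      have hb := inner_refNormal_stdFacet CellKind.simplex j y
      set x := stdFacet CellKind.simplex j y
      rw [real_inner_comm]
      rcases j with _ | j
      · have hb' : ∑ i, x i = 1 := (inner_refNormal_fTop x).symm.trans hb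
        refine (inner_refNormal_fTop _).trans ?_
        simp only [Finset.sum_sub_distrib, ← Finset.sum_mul, hb', one_mul, sub_self]
      · have hb' : -x j = 0 := (inner_refNormal_fCoord j x).symm.trans hb
        refine (inner_refNormal_fCoord j _).trans ?_
        simp [neg_eq_zero.1 hb']
    · intro x hx
      -- This is the variance of the values `0, ∂_1 v, …, ∂_d v` under the barycentric weights `1 -
      -- ∑ x_i, x_1, …, x_d`. In the interior all weights are positive, so it vanishes only if every
      -- derivative equals the first value, zero.
      have key : fderiv ℝ v x (WithLp.toLp 2 fun i => x i * pd i v x - x i * ∑ j, x j * pd j v x) =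
          ∑ i, x i * (pd i v x - ∑ j, x j * pd j v x) ^ 2 +
            (1 - ∑ i, x i) * (∑ j, x j * pd j v x) ^ 2 := by
        rw [fderiv_eq_sum_pd]
        set s := ∑ j, x j * pd j v x with hs
        have h1 : ∀ i, x i * (pd i v x - s) ^ 2 =
            x i * pd i v x ^ 2 - 2 * s * (x i * pd i v x) + s ^ 2 * x i := fun i => by ring
        have h2 : ∀ i, (x i * pd i v x - x i * s) * pd i v x =
            x i * pd i v x ^ 2 - s * (x i * pd i v x) := fun i => by ring
        simp only [h1, h2, Finset.sum_add_distrib, Finset.sum_sub_distrib, ← Finset.mul_sum, ← hs]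
        ring
      rw [key]
      have hn1 : ∀ i ∈ Finset.univ, 0 ≤ x i * (pd i v x - ∑ j, x j * pd j v x) ^ 2 :=
        fun i _ => mul_nonneg (hx.1 i) (sq_nonneg _)
      have hn2 : 0 ≤ (1 - ∑ i, x i) * (∑ j, x j * pd j v x) ^ 2 :=
        mul_nonneg (by linarith [hx.2]) (sq_nonneg _)
      refine ⟨add_nonneg (Finset.sum_nonneg hn1) hn2, fun hxo h0 i => ?_⟩
      obtain ⟨hx1, hx2⟩ := mem_refOpen_simplex.1 hxo
      obtain ⟨h3, h4⟩ := (add_eq_zero_iff_of_nonneg (Finset.sum_nonneg hn1) hn2).1 h0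
      have h5 : ∑ j, x j * pd j v x = 0 := by
        rcases mul_eq_zero.1 h4 with h | h
        · linarith
        · exact pow_eq_zero_iff two_ne_zero |>.1 h
      have h6 := (Finset.sum_eq_zero_iff_of_nonneg hn1).1 h3 i (Finset.mem_univ i)
      rw [h5, sub_zero] at h6
      rcases mul_eq_zero.1 h6 with h | h
      · exact absurd h (hx1 i).ne'
      · exact pow_eq_zero_iff two_ne_zero |>.1 h
  -- On the cube the one-dimensional bubbles `x_i (1 - x_i)` serve as weights of the derivatives.
  · refine ⟨fun x => WithLp.toLp 2 fun i => x i * pd i v x - x i * (x i * pd i v x),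
      mem_rtSub_cube (a := fun i x => x i * pd i v x) (b := fun i => -fun x => x i * pd i v x)
        (fun i => coord_mul_pd_mem_polySub hv i)
        (fun i => neg_mem (coord_mul_pd_mem_polySub hv i))
        (fun x i => by simp [sub_eq_add_neg]), ?_, ?_⟩
    · intro j y
      have hb := inner_refNormal_stdFacet CellKind.cube j y
      set x := stdFacet CellKind.cube j y
      rw [real_inner_comm]
      obtain ⟨j, c⟩ := j
      cases c
      · have hb' : -x j = 0 := (inner_refNormal_fCube_false j x).symm.trans hb
        refine (inner_refNormal_fCube_false j _).trans ?_
        simp [neg_eq_zero.1 hb']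
      · have hb' : x j = 1 := (inner_refNormal_fCube_true j x).symm.trans hb
        refine (inner_refNormal_fCube_true j _).trans ?_
        simp [hb']
    · intro x hx
      have key : fderiv ℝ v x (WithLp.toLp 2 fun i => x i * pd i v x - x i * (x i * pd i v x)) =
          ∑ i, (x i * (1 - x i)) * pd i v x ^ 2 := by
        rw [fderiv_eq_sum_pd]
        exact Finset.sum_congr rfl fun i _ => by simp only; ring
      rw [key]
      have hn1 : ∀ i ∈ Finset.univ, 0 ≤ (x i * (1 - x i)) * pd i v x ^ 2 := fun i _ =>
        mul_nonneg (mul_nonneg (hx i).1 (by linarith [(hx i).2])) (sq_nonneg _)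
      refine ⟨Finset.sum_nonneg hn1, fun hxo h0 i => ?_⟩
      have h6 := (Finset.sum_eq_zero_iff_of_nonneg hn1).1 h0 i (Finset.mem_univ i)
      obtain ⟨h1, h2⟩ := mem_refOpen_cube.1 hxo i
      rcases mul_eq_zero.1 h6 with h | h
      · exact absurd h (mul_pos h1 (by linarith)).ne'
      · exact pow_eq_zero_iff two_ne_zero |>.1 h

end

section

/-! ### Bilinear forms on the reference element -/

section IntForm

variable {X Y E V : Type*} [AddCommGroup X] [Module ℝ X] [AddCommGroup Y] [Module ℝ Y]
  [TopologicalSpace E] [T2Space E] [MeasurableSpace E] [BorelSpace E]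
  [NormedAddCommGroup V] [InnerProductSpace ℝ V]

/-- The bilinear form `∫_K ⟨A x, B y⟩` for continuous fields. -/
def intForm (μ : Measure E) [IsFiniteMeasureOnCompacts μ] {K : Set E} (hK : IsCompact K)
    (A : X →ₗ[ℝ] E → V) (B : Y →ₗ[ℝ] E → V) (hA : ∀ x, Continuous (A x))
    (hB : ∀ y, Continuous (B y)) : X →ₗ[ℝ] Y →ₗ[ℝ] ℝ :=
  have hint : ∀ x y, IntegrableOn (fun z => (inner ℝ (A x z) (B y z) : ℝ)) K μ := fun x y =>
    ((hA x).inner (hB y)).continuousOn.integrableOn_compact hK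
  LinearMap.mk₂ ℝ (fun x y => ∫ z in K, inner ℝ (A x z) (B y z) ∂μ)
    (fun x x' y => by
      simp only [map_add, Pi.add_apply, inner_add_left]
      exact integral_add (hint x y) (hint x' y))
    (fun c x y => by
      simp only [map_smul, Pi.smul_apply, inner_smul_left, smul_eq_mul, RCLike.conj_to_real]
      exact integral_const_mul _ _)
    (fun x y y' => by
      simp only [map_add, Pi.add_apply, inner_add_right]
      exact integral_add (hint x y) (hint x y'))
    (fun c x y => by
      simp only [map_smul, Pi.smul_apply, inner_smul_right, smul_eq_mul]
      exact integral_const_mul _ _)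

@[simp] theorem intForm_apply (μ : Measure E) [IsFiniteMeasureOnCompacts μ] {K : Set E}
    (hK : IsCompact K) (A : X →ₗ[ℝ] E → V) (B : Y →ₗ[ℝ] E → V) (hA : ∀ x, Continuous (A x))
    (hB : ∀ y, Continuous (B y)) (x : X) (y : Y) :
    intForm μ hK A B hA hB x y = ∫ z in K, inner ℝ (A x z) (B y z) ∂μ := rfl

/-- The integrand vanishes almost everywhere on the open interior, hence everywhere there by
continuity. -/
theorem eq_zero_of_setIntegral_eq_zero {d : ℕ} {K : Set (Euc d)} (hK : IsCompact K)
    {f : Euc d → ℝ} (hf : Continuous f) (h0 : ∀ x, 0 ≤ f x) (h : ∫ x in K, f x = 0) :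
    ∀ x ∈ interior K, f x = 0 := by
  have h1 : ∀ᵐ x ∂volume.restrict K, f x = 0 :=
    (setIntegral_eq_zero_iff_of_nonneg_ae (Eventually.of_forall h0)
      (hf.continuousOn.integrableOn_compact hK)).1 h
  have h2 : ∀ᵐ x ∂volume.restrict (interior K), f x = 0 :=
    ae_restrict_of_ae_restrict_of_subset interior_subset h1
  have h3 := Measure.eqOn_open_of_ae_eq (f := f) (g := fun _ => (0 : ℝ)) h2 isOpen_interior
    hf.continuousOn continuousOn_const
  exact fun x hx => h3 hx

end IntForm

theorem inner_gradient {d : ℕ} (v : Euc d → ℝ) (x y : Euc d) :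
    inner ℝ y (gradient v x) = fderiv ℝ v x y := by
  rw [real_inner_comm, gradient, InnerProductSpace.toDual_symm_apply]

theorem gradient_apply {d : ℕ} (v : Euc d → ℝ) (x : Euc d) (i : Fin d) :
    gradient v x i = pd i v x := by
  rw [pd, ← inner_gradient, inner_euc]
  simp

theorem continuous_gradient {d : ℕ} {v : Euc d → ℝ} (hv : ContDiff ℝ 1 v) :
    Continuous (gradient v) :=
  (InnerProductSpace.toDual ℝ (Euc d)).symm.continuous.comp (hv.continuous_fderiv one_ne_zero)

/-- The gradient of polynomials, as a linear map. -/
def gradMap (κ : CellKind) (m p : ℕ) : polySub κ m p →ₗ[ℝ] (Euc m → Euc m) where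
  toFun v := gradient (v : Euc m → ℝ)
  map_add' v w := by
    ext x : 1
    have hv := (contDiff_of_mem_polySub (k := 1) v.2).differentiable one_ne_zero x
    have hw := (contDiff_of_mem_polySub (k := 1) w.2).differentiable one_ne_zero x
    simp only [gradient, Submodule.coe_add, Pi.add_apply]
    rw [fderiv_add hv hw, map_add]
  map_smul' c v := by
    ext x : 1
    have hv := (contDiff_of_mem_polySub (k := 1) v.2).differentiable one_ne_zero x
    simp only [gradient, Submodule.coe_smul, Pi.smul_apply, RingHom.id_apply]
    rw [fderiv_const_smul hv, map_smul]

/-- Composition with the standard parametrization of a facet. -/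
def traceMap (κ : CellKind) (n p : ℕ) (i : LocalFacet κ (n + 1)) :
    polySub κ (n + 1) p →ₗ[ℝ] (Euc n → ℝ) where
  toFun v y := (v : Euc (n + 1) → ℝ) (stdFacet κ i y)
  map_add' _ _ := rfl
  map_smul' _ _ := rfl

/-- The (unnormalized) normal trace on a facet. -/
def normalTraceMap (κ : CellKind) (n p : ℕ) (i : LocalFacet κ (n + 1)) :
    rtSub κ (n + 1) p →ₗ[ℝ] (Euc n → ℝ) where
  toFun r y := inner ℝ ((r : Euc (n + 1) → Euc (n + 1)) (stdFacet κ i y)) (refNormal κ i)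
  map_add' r s := by ext y; simp [inner_add_left]
  map_smul' c r := by ext y; simp [inner_smul_left]

/-! ### Trace inequalities and the inf-sup condition on the reference element. -/

section Reference

variable {κ : CellKind} {n p : ℕ}

theorem continuous_of_mem_polySub {m : ℕ} {f : Euc m → ℝ} (hf : f ∈ polySub κ m p) :
    Continuous f := (contDiff_of_mem_polySub (k := 0) hf).continuous

theorem continuous_of_mem_rtSub {m : ℕ} {r : Euc m → Euc m} (hr : r ∈ rtSub κ m p) :
    Continuous r := (contDiff_of_mem_rtSub (k := 0) hr).continuous

/-- The `L²` inner product of polynomials. -/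
def polyForm (κ : CellKind) (m p : ℕ) : polySub κ m p →ₗ[ℝ] polySub κ m p →ₗ[ℝ] ℝ :=
  intForm volume (isCompact_refCell κ m) (Submodule.subtype _) (Submodule.subtype _)
    (fun x => continuous_of_mem_polySub x.2) (fun x => continuous_of_mem_polySub x.2)

/-- The `L²` inner product of Raviart–Thomas fields. -/
def rtForm (κ : CellKind) (m p : ℕ) : rtSub κ m p →ₗ[ℝ] rtSub κ m p →ₗ[ℝ] ℝ :=
  intForm volume (isCompact_refCell κ m) (Submodule.subtype _) (Submodule.subtype _)
    (fun x => continuous_of_mem_rtSub x.2) (fun x => continuous_of_mem_rtSub x.2)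

theorem polyForm_pos {m : ℕ} (f : polySub κ m p) (hf : f ≠ 0) : 0 < polyForm κ m p f f := by
  have hc := continuous_of_mem_polySub f.2
  have h0 : ∀ x, (0 : ℝ) ≤ inner ℝ ((f : Euc m → ℝ) x) ((f : Euc m → ℝ) x) := fun x =>
    real_inner_self_nonneg
  refine lt_of_le_of_ne (integral_nonneg h0) fun h => hf ?_
  have h1 := eq_zero_of_setIntegral_eq_zero (isCompact_refCell κ m) (hc.inner hc) h0 h.symm
  exact Subtype.ext (eq_zero_of_mem_polySub f.2 isOpen_interior (interior_refCell_nonempty κ m)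
    fun x hx => inner_self_eq_zero.1 (h1 x hx))

theorem rtForm_pos {m : ℕ} (r : rtSub κ m p) (hr : r ≠ 0) : 0 < rtForm κ m p r r := by
  have hc := continuous_of_mem_rtSub r.2
  have h0 : ∀ x, (0 : ℝ) ≤ inner ℝ ((r : Euc m → Euc m) x) ((r : Euc m → Euc m) x) := fun x =>
    real_inner_self_nonneg
  refine lt_of_le_of_ne (integral_nonneg h0) fun h => hr ?_
  have h1 := eq_zero_of_setIntegral_eq_zero (isCompact_refCell κ m) (hc.inner hc) h0 h.symm
  exact Subtype.ext (eq_zero_of_mem_rtSub r.2 isOpen_interior (interior_refCell_nonempty κ m)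
    fun x hx => inner_self_eq_zero.1 (h1 x hx))

theorem continuous_traceMap (i : LocalFacet κ (n + 1)) (v : polySub κ (n + 1) p) :
    Continuous (traceMap κ n p i v) :=
  (continuous_of_mem_polySub v.2).comp (continuous_stdFacet i)

theorem continuous_normalTraceMap (i : LocalFacet κ (n + 1)) (r : rtSub κ (n + 1) p) :
    Continuous (normalTraceMap κ n p i r) :=
  ((continuous_of_mem_rtSub r.2).comp (continuous_stdFacet i)).inner continuous_const

/-- A discrete trace inequality on the reference element. -/
theorem exists_trace_le (κ : CellKind) (n p : ℕ) : ∃ C : ℝ, 0 ≤ C ∧ ∀ i : LocalFacet κ (n + 1),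
    ∀ v ∈ polySub κ (n + 1) p,
      ∫ y in refCell κ n, v (stdFacet κ i y) ^ 2 ≤ C * ∫ x in refCell κ (n + 1), v x ^ 2 := by
  have h1 : ∀ i : LocalFacet κ (n + 1), ∃ C : ℝ, 0 ≤ C ∧ ∀ v ∈ polySub κ (n + 1) p,
      ∫ y in refCell κ n, v (stdFacet κ i y) ^ 2 ≤ C * ∫ x in refCell κ (n + 1), v x ^ 2 := by
    intro i
    obtain ⟨C, hC, h⟩ := exists_bilin_le_mul
      (intForm volume (isCompact_refCell κ n) (traceMap κ n p i) (traceMap κ n p i)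
        (continuous_traceMap i) (continuous_traceMap i)) (polyForm κ (n + 1) p) polyForm_pos
    refine ⟨C, hC, fun v hv => ?_⟩
    simpa [traceMap, polyForm, sq] using h ⟨v, hv⟩
  choose C hC h using h1
  refine ⟨∑ i, C i, Finset.sum_nonneg fun i _ => hC i, fun i v hv => (h i v hv).trans ?_⟩
  exact mul_le_mul_of_nonneg_right
    (Finset.single_le_sum (fun j _ => hC j) (Finset.mem_univ i))
    (integral_nonneg fun x => sq_nonneg _)

/-- A discrete normal trace inequality on the reference element. -/
theorem exists_normalTrace_le (κ : CellKind) (n p : ℕ) :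
    ∃ C : ℝ, 0 ≤ C ∧ ∀ i : LocalFacet κ (n + 1), ∀ r ∈ rtSub κ (n + 1) p,
      ∫ y in refCell κ n, (inner ℝ (r (stdFacet κ i y)) (refNormal κ i)) ^ 2 ≤
        C * ∫ x in refCell κ (n + 1), ‖r x‖ ^ 2 := by
  have h1 : ∀ i : LocalFacet κ (n + 1), ∃ C : ℝ, 0 ≤ C ∧ ∀ r ∈ rtSub κ (n + 1) p,
      ∫ y in refCell κ n, (inner ℝ (r (stdFacet κ i y)) (refNormal κ i)) ^ 2 ≤
        C * ∫ x in refCell κ (n + 1), ‖r x‖ ^ 2 := by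
    intro i
    obtain ⟨C, hC, h⟩ := exists_bilin_le_mul
      (intForm volume (isCompact_refCell κ n) (normalTraceMap κ n p i) (normalTraceMap κ n p i)
        (continuous_normalTraceMap i) (continuous_normalTraceMap i)) (rtForm κ (n + 1) p) rtForm_pos
    refine ⟨C, hC, fun r hr => ?_⟩
    have := h ⟨r, hr⟩
    simp only [intForm_apply, rtForm, normalTraceMap, Submodule.subtype_apply,
      real_inner_self_eq_norm_sq] at this
    simpa using this
  choose C hC h using h1
  refine ⟨∑ i, C i, Finset.sum_nonneg fun i _ => hC i, fun i r hr => (h i r hr).trans ?_⟩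
  exact mul_le_mul_of_nonneg_right
    (Finset.single_le_sum (fun j _ => hC j) (Finset.mem_univ i))
    (integral_nonneg fun x => sq_nonneg _)

/-- The inf-sup condition on the reference element. -/
theorem exists_inf_sup_refCell (κ : CellKind) (n p : ℕ) :
    ∃ C : ℝ, 0 ≤ C ∧ ∀ v ∈ polySub κ (n + 1) p, ∀ e : LocalFacet κ (n + 1) → Euc n → ℝ,
      (∀ i, e i ∈ polySub κ n p) → ∃ r ∈ rtSub κ (n + 1) p,
        (∫ x in refCell κ (n + 1), inner ℝ (r x) (gradient v x)) -
            ∑ i, ∫ y in refCell κ n, e i y * inner ℝ (r (stdFacet κ i y)) (refNormal κ i) =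
          ∫ x in refCell κ (n + 1), ‖r x‖ ^ 2 ∧
        (∫ x in refCell κ (n + 1), ‖gradient v x‖ ^ 2) + ∑ i, ∫ y in refCell κ n, e i y ^ 2 ≤
          C * ∫ x in refCell κ (n + 1), ‖r x‖ ^ 2 := by
  let X := polySub κ (n + 1) p × (LocalFacet κ (n + 1) → polySub κ n p)
  let G : X →ₗ[ℝ] (Euc (n + 1) → Euc (n + 1)) := gradMap κ (n + 1) p ∘ₗ LinearMap.fst ℝ _ _
  let e : LocalFacet κ (n + 1) → X →ₗ[ℝ] (Euc n → ℝ) := fun i =>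
    (Submodule.subtype _) ∘ₗ (LinearMap.proj i) ∘ₗ LinearMap.snd ℝ _ _
  have hG : ∀ x, Continuous (G x) := fun x =>
    continuous_gradient (contDiff_of_mem_polySub x.1.2)
  have he : ∀ i x, Continuous (e i x) := fun i x => continuous_of_mem_polySub (x.2 i).2
  have hR : ∀ r : rtSub κ (n + 1) p, Continuous ((rtSub κ (n + 1) p).subtype r) := fun r =>
    continuous_of_mem_rtSub r.2
  let b : X →ₗ[ℝ] rtSub κ (n + 1) p →ₗ[ℝ] ℝ :=
    intForm volume (isCompact_refCell κ (n + 1)) G (Submodule.subtype _) hG hR -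
      ∑ i, intForm volume (isCompact_refCell κ n) (e i) (normalTraceMap κ n p i) (he i)
        (continuous_normalTraceMap i)
  let N : X →ₗ[ℝ] X →ₗ[ℝ] ℝ := intForm volume (isCompact_refCell κ (n + 1)) G G hG hG +
    ∑ i, intForm volume (isCompact_refCell κ n) (e i) (e i) (he i) (he i)
  have hb : ∀ x r, b x r = (∫ z in refCell κ (n + 1), inner ℝ (r.1 z) (gradient x.1.1 z)) -
      ∑ i, ∫ y in refCell κ n, (x.2 i).1 y * inner ℝ (r.1 (stdFacet κ i y)) (refNormal κ i) := by
    intro x r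
    simp only [b, LinearMap.sub_apply, LinearMap.sum_apply, intForm_apply]
    congr 1
    · exact integral_congr_ae (Eventually.of_forall fun z => real_inner_comm _ _)
    · refine Finset.sum_congr rfl fun i _ => integral_congr_ae (Eventually.of_forall fun y => ?_)
      exact mul_comm _ _
  have hN : ∀ x, N x x = (∫ z in refCell κ (n + 1), ‖gradient x.1.1 z‖ ^ 2) +
      ∑ i, ∫ y in refCell κ n, (x.2 i).1 y ^ 2 := by
    intro x
    simp only [N, LinearMap.add_apply, LinearMap.sum_apply, intForm_apply,
      real_inner_self_eq_norm_sq]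
    congr 1
    refine Finset.sum_congr rfl fun i _ => integral_congr_ae (Eventually.of_forall fun y => ?_)
    change ‖(x.2 i).1 y‖ ^ 2 = _
    rw [Real.norm_eq_abs, sq_abs]
  obtain ⟨C, hC, h⟩ := exists_inf_sup (rtForm κ (n + 1) p) rtForm_pos b N (fun x y => by
      simp only [N, LinearMap.add_apply, LinearMap.sum_apply, intForm_apply]
      congr 1
      · exact integral_congr_ae (Eventually.of_forall fun z => real_inner_comm _ _)
      · exact Finset.sum_congr rfl fun i _ =>
          integral_congr_ae (Eventually.of_forall fun z => real_inner_comm _ _)) (by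
    intro x hx y
    -- The bubble field has no normal trace, so only the volume term survives, and it vanishes only
    -- for a constant polynomial.
    have hgrad : ∀ z, gradient x.1.1 z = 0 := by
      obtain ⟨r, hr, hr0, hpos⟩ := exists_rt_bubble x.1.2
      have h1 := hx ⟨r, hr⟩
      rw [hb] at h1
      simp only [hr0, mul_zero, integral_zero, Finset.sum_const_zero, sub_zero, inner_gradient] at h1
      have hc : Continuous fun z => fderiv ℝ x.1.1 z (r z) :=
        ((contDiff_of_mem_polySub (k := 1) x.1.2).continuous_fderiv one_ne_zero).clm_apply
          (continuous_of_mem_rtSub hr)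
      -- The integrand is nonnegative only on the reference element; its positive part is
      -- nonnegative everywhere and has the same integral.
      have h2 : ∫ z in refCell κ (n + 1), max (fderiv ℝ x.1.1 z (r z)) 0 = 0 := by
        refine Eq.trans ?_ h1
        exact setIntegral_congr_fun (measurableSet_refCell _ _) fun z hz =>
          max_eq_left (hpos z hz).1
      have h3 := eq_zero_of_setIntegral_eq_zero (isCompact_refCell κ (n + 1))
        (hc.max continuous_const) (fun z => le_max_right _ _) h2
      have h4 : ∀ i, pd i x.1.1 = 0 := fun i =>
        eq_zero_of_mem_polySub (pd_mem_polySub x.1.2 i) (isOpen_refOpen κ (n + 1))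
          (refOpen_nonempty κ (n + 1)) fun z hz => by
            have hz' := refOpen_subset κ _ hz
            have h5 := h3 z (refOpen_subset_interior κ _ hz)
            rw [max_eq_left (hpos z hz').1] at h5
            exact (hpos z hz').2 hz h5 i
      intro z
      ext i
      rw [gradient_apply, h4]
      rfl
    -- Once the gradient is gone, a field whose only nonzero normal trace is `e_i`, on facet `i`,
    -- isolates `∫ e_i²`.
    have he0 : ∀ i, x.2 i = 0 := by
      intro i
      obtain ⟨r, hr, hri, hrj⟩ := exists_rt_extension i (x.2 i).2
      have h1 := hx ⟨r, hr⟩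
      rw [hb, Finset.sum_eq_single i] at h1
      · simp only [hgrad, inner_zero_right, integral_zero, zero_sub, neg_eq_zero, hri] at h1
        by_contra hne
        exact (polyForm_pos _ hne).ne' h1
      · intro j _ hj
        simp [hrj j hj]
      · simp
    have h1 : G x = 0 := funext hgrad
    have h2 : ∀ i, e i x = 0 := fun i => by
      change (x.2 i).1 = 0
      rw [he0]
      rfl
    simp [N, h1, h2])
  refine ⟨C, hC, fun v hv e' he' => ?_⟩
  obtain ⟨r, h1, h2⟩ := h (⟨v, hv⟩, fun i => ⟨e' i, he' i⟩)
  have h3 : rtForm κ (n + 1) p r r = ∫ x in refCell κ (n + 1), ‖r.1 x‖ ^ 2 := by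
    simp only [rtForm, intForm_apply, real_inner_self_eq_norm_sq]
    rfl
  rw [hb, h3] at h1
  rw [hN, h3] at h2
  exact ⟨r.1, r.2, h1, h2⟩

end Reference

end

/-! ### Faces of the reference element, sides of mesh facets, and null sets. -/

section

/-! ### Faces of the reference element -/

section RefFaces

variable {κ : CellKind} {n : ℕ}

/-- A relative interior point of one facet lies on no other facet. -/
theorem inner_stdFacet_lt {κ : CellKind} {i j : LocalFacet κ (n + 1)} (hij : j ≠ i) {y : Euc n}
    (hy : y ∈ refOpen κ n) : inner ℝ (refNormal κ j) (stdFacet κ i y) < refBound κ j := by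
  revert hij hy j
  refine localFacet_cases (motive := fun κ i => ∀ {j : LocalFacet κ (n + 1)}, j ≠ i →
    y ∈ refOpen κ n → inner ℝ (refNormal κ j) (stdFacet κ i y) < refBound κ j) ?_ ?_ ?_ ?_ κ i
  · intro j hij hy
    obtain ⟨h1, h2⟩ := mem_refOpen_simplex.1 hy
    rcases j with _ | j
    · exact absurd rfl hij
    · refine (inner_refNormal_fCoord j _).trans_lt ?_
      rw [stdFacet_fTop]
      rcases Fin.eq_self_or_eq_succAbove 0 j with rfl | ⟨k, rfl⟩
      · simp only [ins_same, refBound]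
        linarith
      · simp only [ins_succAbove, refBound]
        linarith [h1 k]
  · intro i j hij hy
    obtain ⟨h1, h2⟩ := mem_refOpen_simplex.1 hy
    rcases j with _ | j
    · refine (inner_refNormal_fTop _).trans_lt ?_
      rw [stdFacet_fCoord, Fin.sum_univ_succAbove _ i]
      simpa [refBound] using h2
    · refine (inner_refNormal_fCoord j _).trans_lt ?_
      rw [stdFacet_fCoord]
      rcases Fin.eq_self_or_eq_succAbove i j with rfl | ⟨k, rfl⟩
      · exact absurd rfl hij
      · simp only [ins_succAbove, refBound]
        linarith [h1 k]
  · intro i j hij hy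
    have h1 := mem_refOpen_cube.1 hy
    obtain ⟨j, c⟩ := j
    rcases Fin.eq_self_or_eq_succAbove i j with rfl | ⟨k, rfl⟩
    · cases c
      · exact absurd rfl hij
      · refine (inner_refNormal_fCube_true j _).trans_lt ?_
        simp [stdFacet_fCube_false, refBound]
    · cases c
      · refine (inner_refNormal_fCube_false _ _).trans_lt ?_
        simp [stdFacet_fCube_false, refBound, h1 k]
      · refine (inner_refNormal_fCube_true _ _).trans_lt ?_
        simp [stdFacet_fCube_false, refBound, h1 k]
  · intro i j hij hy
    have h1 := mem_refOpen_cube.1 hy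
    obtain ⟨j, c⟩ := j
    rcases Fin.eq_self_or_eq_succAbove i j with rfl | ⟨k, rfl⟩
    · cases c
      · refine (inner_refNormal_fCube_false j _).trans_lt ?_
        simp [stdFacet_fCube_true, refBound]
      · exact absurd rfl hij
    · cases c
      · refine (inner_refNormal_fCube_false _ _).trans_lt ?_
        simp [stdFacet_fCube_true, refBound, h1 k]
      · refine (inner_refNormal_fCube_true _ _).trans_lt ?_
        simp [stdFacet_fCube_true, refBound, h1 k]

theorem eventually_lineMap_mem_refCell {d : ℕ} {y : Euc d} (hy : y ∈ interior (refCell κ d))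
    (w : Euc d) : ∃ t : ℝ, 0 < t ∧ y + t • w ∈ refCell κ d := by
  have hc : Continuous fun t : ℝ => y + t • w := by fun_prop
  have hmem : ∀ᶠ t in 𝓝 (0 : ℝ), y + t • w ∈ interior (refCell κ d) :=
    hc.continuousAt.eventually_mem (by simpa using isOpen_interior.mem_nhds hy)
  obtain ⟨t, ht, htpos⟩ := ((hmem.filter_mono nhdsWithin_le_nhds).and
    (self_mem_nhdsWithin : Ioi (0 : ℝ) ∈ 𝓝[>] 0)).exists
  exact ⟨t, htpos, interior_subset ht⟩

theorem affineMap_apply {n m : ℕ} (Θ : Euc n →ᵃ[ℝ] Euc m) (y w : Euc n) :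
    Θ (y + w) = Θ y + Θ.linear w := by
  have := Θ.map_vadd y w
  rw [vadd_eq_add, vadd_eq_add] at this
  rw [add_comm y, this, add_comm]

/-- An affine function that attains its maximum over the reference element in the interior is
constant. -/
theorem inner_linear_eq_zero {m : ℕ} {Θ : Euc n →ᵃ[ℝ] Euc m} {u : Euc m} {c : ℝ}
    (hle : ∀ z ∈ refCell κ n, inner ℝ u (Θ z) ≤ c) {y : Euc n} (hy : y ∈ interior (refCell κ n))
    (heq : inner ℝ u (Θ y) = c) (w : Euc n) : inner ℝ u (Θ.linear w) = 0 := by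
  have key : ∀ w, inner ℝ u (Θ.linear w) ≤ 0 := fun w => by
    obtain ⟨t, ht, hmem⟩ := eventually_lineMap_mem_refCell hy w
    have := hle _ hmem
    rw [affineMap_apply, inner_add_right, heq, map_smul, inner_smul_right] at this
    exact nonpos_of_mul_nonpos_right (by linarith) ht
  refine le_antisymm (key w) ?_
  have := key (-w)
  rw [map_neg, inner_neg_right] at this
  linarith

/-- The range of `W` is a hyperplane, so its orthogonal complement is a line. -/
theorem exists_smul_eq_of_orthogonal {W : Euc n →ₗ[ℝ] Euc (n + 1)} (hW : Function.Injective W)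
    {u u' : Euc (n + 1)} (hu : ∀ w, inner ℝ u (W w) = 0) (hu' : ∀ w, inner ℝ u' (W w) = 0)
    (h0 : u' ≠ 0) : ∃ c : ℝ, c • u' = u := by
  have h1 : Module.finrank ℝ (LinearMap.range W) = n := by
    rw [LinearMap.finrank_range_of_inj hW, finrank_euclideanSpace_fin]
  have h2 : Module.finrank ℝ (LinearMap.range W)ᗮ = 1 := by
    have := (LinearMap.range W).finrank_add_finrank_orthogonal
    rw [h1, finrank_euclideanSpace_fin] at this
    omega
  have mem : ∀ v : Euc (n + 1), (∀ w, inner ℝ v (W w) = 0) → v ∈ (LinearMap.range W)ᗮ := by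
    intro v hv
    rw [Submodule.mem_orthogonal']
    rintro _ ⟨w, rfl⟩
    exact hv w
  have h3 := (finrank_eq_one_iff_of_nonzero' (⟨u', mem u' hu'⟩ : (LinearMap.range W)ᗮ)
    (fun h => h0 (congrArg Subtype.val h))).1 h2 ⟨u, mem u hu⟩
  obtain ⟨c, hc⟩ := h3
  exact ⟨c, congrArg Subtype.val hc⟩

/-- A proper exposed face of the reference element that contains a set of full dimension is a
facet. -/
theorem exists_refFacet_eq {a : Euc (n + 1)} (ha : a ≠ 0) {Θ : Euc n →ᵃ[ℝ] Euc (n + 1)}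
    (hΘ : Function.Injective Θ)
    (h : ∀ z ∈ refCell κ n, Θ z ∈ {x | x ∈ refCell κ (n + 1) ∧
      ∀ y ∈ refCell κ (n + 1), inner ℝ a y ≤ inner ℝ a x}) :
    ∃ j : LocalFacet κ (n + 1), {x | x ∈ refCell κ (n + 1) ∧
      ∀ y ∈ refCell κ (n + 1), inner ℝ a y ≤ inner ℝ a x} = refFacet κ j := by
  obtain ⟨y, hy⟩ := interior_refCell_nonempty κ n
  have hyc := interior_subset hy
  obtain ⟨x₀, hx₀⟩ := refOpen_nonempty κ (n + 1)
  -- A nonzero linear functional has no maximum at an interior point, so some inequality `j` is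
  -- active at `Θ y`.
  have hnot : Θ y ∉ refOpen κ (n + 1) := fun hmem => by
    rw [← interior_refCell] at hmem
    obtain ⟨t, ht, hmem'⟩ := eventually_lineMap_mem_refCell hmem a
    have h1 := (h y hyc).2 _ hmem'
    rw [inner_add_right, inner_smul_right] at h1
    have h2 := mul_pos ht (real_inner_self_pos.2 ha)
    linarith
  obtain ⟨j, hj⟩ : ∃ j : LocalFacet κ (n + 1), refBound κ j ≤ inner ℝ (refNormal κ j) (Θ y) := by
    by_contra hcon
    push Not at hcon
    exact hnot hcon
  have hj' : inner ℝ (refNormal κ j) (Θ y) = refBound κ j :=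
    le_antisymm (mem_refCell_iff.1 (h y hyc).1 j) hj
  have horth := inner_linear_eq_zero (fun z hz => mem_refCell_iff.1 (h z hz).1 j) hy hj'
  have horth' := inner_linear_eq_zero (u := a) (c := inner ℝ a (Θ y))
    (fun z hz => (h y hyc).2 _ (h z hz).1) hy rfl
  -- Both the functional `a` and the normal `j` attain their maximum over the image of `Θ` at the
  -- image of an interior point. They are therefore constant along that image, that is, orthogonal
  -- to one and the same hyperplane.
  obtain ⟨c, rfl⟩ := exists_smul_eq_of_orthogonal (Θ.linear_injective_iff.2 hΘ) horth' horth
    (refNormal_ne_zero κ j)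
  -- Comparison with an interior point of the reference element fixes the sign: a negative multiple
  -- would be larger there.
  have hc : 0 < c := by
    by_contra hcon
    push Not at hcon
    have h1 := (h y hyc).2 x₀ (refOpen_subset _ _ hx₀)
    rw [real_inner_smul_left, real_inner_smul_left, hj'] at h1
    have h2 : c ≠ 0 := fun h => ha (by rw [h, zero_smul])
    have h3 := mul_lt_mul_of_neg_left (hx₀ j) (lt_of_le_of_ne hcon h2)
    linarith
  refine ⟨j, ?_⟩
  ext x
  rw [mem_refFacet_iff]
  simp only [mem_ofPred_eq, real_inner_smul_left]
  refine and_congr_right fun hx => ⟨fun hmax => ?_, fun hx' z hz => ?_⟩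
  · refine le_antisymm (mem_refCell_iff.1 hx j) ?_
    have h1 := hmax _ (h y hyc).1
    rw [hj'] at h1
    exact le_of_mul_le_mul_left h1 hc
  · rw [hx']
    exact mul_le_mul_of_nonneg_left (mem_refCell_iff.1 hz j) hc.le

end RefFaces

/-! ### Geometry of a mesh -/

variable {κ : CellKind} {n : ℕ} {Ω : Set (Euc (n + 1))} (M : Mesh κ n Ω)

theorem Mesh.mem_cell {T : M.Cell} {x : Euc (n + 1)} :
    x ∈ M.cell T ↔ (M.cellMap T).symm x ∈ refCell κ (n + 1) := by
  constructor
  · rintro ⟨z, hz, rfl⟩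
    rwa [AffineEquiv.symm_apply_apply]
  · exact fun h => ⟨_, h, AffineEquiv.apply_symm_apply _ x⟩

theorem Mesh.isCompact_cell (T : M.Cell) : IsCompact (M.cell T) :=
  (isCompact_refCell κ _).image (M.continuous_cellMap T)

theorem Mesh.measurableSet_cell (T : M.Cell) : MeasurableSet (M.cell T) :=
  (M.isCompact_cell T).measurableSet

theorem Mesh.convex_cell (T : M.Cell) : Convex ℝ (M.cell T) :=
  (convex_refCell κ _).affine_image (M.cellMap T).toAffineMap

theorem Mesh.mem_interior_cell {T : M.Cell} {x : Euc (n + 1)} :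
    x ∈ interior (M.cell T) ↔ (M.cellMap T).symm x ∈ refOpen κ (n + 1) := by
  rw [← interior_refCell]
  let e : Euc (n + 1) ≃ₜ Euc (n + 1) := (AffineEquiv.toContinuousAffineEquiv (M.cellMap T)).toHomeomorph
  have h1 : M.cell T = e '' refCell κ (n + 1) := rfl
  rw [h1, ← e.image_interior]
  constructor
  · rintro ⟨y, hy, rfl⟩
    have : (M.cellMap T).symm (e y) = y := (M.cellMap T).symm_apply_apply y
    rwa [this]
  · exact fun h => ⟨_, h, (M.cellMap T).apply_symm_apply x⟩

theorem Mesh.interior_cell_nonempty (T : M.Cell) : (interior (M.cell T)).Nonempty := by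
  obtain ⟨x, hx⟩ := refOpen_nonempty κ (n + 1)
  exact ⟨M.cellMap T x, M.mem_interior_cell.2 (by simpa using hx)⟩

theorem Mesh.symm_pt (T : M.Cell) (i : LocalFacet κ (n + 1)) (y : Euc n) :
    (M.cellMap T).symm (M.pt T i y) = stdFacet κ i (M.aut T i y) := by
  rw [M.pt_eq, AffineEquiv.symm_apply_apply]

theorem Mesh.aut_mem {T : M.Cell} {i : LocalFacet κ (n + 1)} {y : Euc n} (hy : y ∈ refCell κ n) :
    M.aut T i y ∈ refCell κ n := by
  rw [← M.image_aut T i]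
  exact mem_image_of_mem _ hy

theorem Mesh.aut_mem_refOpen {T : M.Cell} {i : LocalFacet κ (n + 1)} {y : Euc n}
    (hy : y ∈ refOpen κ n) : M.aut T i y ∈ refOpen κ n := by
  rw [← interior_refCell] at hy ⊢
  let e : Euc n ≃ₜ Euc n := (AffineEquiv.toContinuousAffineEquiv (M.aut T i)).toHomeomorph
  have h1 : e '' interior (refCell κ n) = interior (refCell κ n) := by
    rw [e.image_interior]
    exact congrArg interior (M.image_aut T i)
  rw [← h1]
  exact mem_image_of_mem _ hy

theorem Mesh.pt_mem_cell {T : M.Cell} {i : LocalFacet κ (n + 1)} {y : Euc n}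
    (hy : y ∈ refCell κ n) : M.pt T i y ∈ M.cell T := by
  rw [M.mem_cell, M.symm_pt, stdFacet_mem_refCell]
  exact M.aut_mem hy

theorem Mesh.pt_notMem_interior (T : M.Cell) (i : LocalFacet κ (n + 1)) (y : Euc n) :
    M.pt T i y ∉ interior (M.cell T) := fun h => by
  have := M.mem_interior_cell.1 h i
  rw [M.symm_pt, inner_refNormal_stdFacet] at this
  exact lt_irrefl _ this

theorem affineEquiv_symm_add {d : ℕ} (Φ : Euc d ≃ᵃ[ℝ] Euc d) (x w : Euc d) :
    Φ.symm (x + w) = Φ.symm x + Φ.linear.symm w := by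
  have := Φ.symm.map_vadd x w
  rw [vadd_eq_add, vadd_eq_add] at this
  rw [add_comm x, this, add_comm]
  rfl

theorem Mesh.inner_refNormal_symm (T : M.Cell) (i : LocalFacet κ (n + 1)) (w : Euc (n + 1)) :
    inner ℝ (refNormal κ i) ((M.cellMap T).linear.symm w) = inner ℝ (M.nvec T i) w := by
  have := M.inner_nvec T i ((M.cellMap T).linear.symm w)
  rw [LinearEquiv.apply_symm_apply] at this
  rw [real_inner_comm, ← this, real_inner_comm]

theorem Mesh.norm_normal (T : M.Cell) (i : LocalFacet κ (n + 1)) : ‖M.normal T i‖ = 1 := by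
  rw [M.normal_eq, norm_smul, norm_inv, norm_norm, inv_mul_cancel₀ (M.norm_nvec_pos T i).ne']

/-- Near a relative interior point of a facet, the element contains all inward directions. -/
theorem Mesh.eventually_mem_interior {T : M.Cell} {i : LocalFacet κ (n + 1)} {y : Euc n}
    (hy : y ∈ refOpen κ n) {w : Euc (n + 1)} (hw : inner ℝ (M.normal T i) w < 0) :
    ∀ᶠ t in 𝓝[>] (0 : ℝ), M.pt T i y + t • w ∈ interior (M.cell T) := by
  have hw' : inner ℝ (M.nvec T i) w < 0 := by
    rw [M.normal_eq, real_inner_smul_left] at hw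
    by_contra hcon
    push Not at hcon
    exact absurd hw (not_lt.2 (mul_nonneg (inv_nonneg.2 (norm_nonneg _)) hcon))
  have h1 : ∀ j : LocalFacet κ (n + 1), ∀ᶠ t in 𝓝[>] (0 : ℝ), inner ℝ (refNormal κ j)
      ((M.cellMap T).symm (M.pt T i y + t • w)) < refBound κ j := by
    intro j
    have h2 : ∀ t : ℝ, inner ℝ (refNormal κ j) ((M.cellMap T).symm (M.pt T i y + t • w)) =
        inner ℝ (refNormal κ j) (stdFacet κ i (M.aut T i y)) + t * inner ℝ (M.nvec T j) w := by
      intro t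
      rw [affineEquiv_symm_add, M.symm_pt, inner_add_right, map_smul, inner_smul_right,
        M.inner_refNormal_symm]
    simp only [h2]
    by_cases hj : j = i
    · subst hj
      filter_upwards [self_mem_nhdsWithin] with t ht
      rw [inner_refNormal_stdFacet]
      have := mul_neg_of_pos_of_neg (show (0 : ℝ) < t from ht) hw'
      linarith
    · have h3 := inner_stdFacet_lt hj (M.aut_mem_refOpen (T := T) (i := i) hy)
      have h4 : ContinuousAt (fun t : ℝ => inner ℝ (refNormal κ j)
          (stdFacet κ i (M.aut T i y)) + t * inner ℝ (M.nvec T j) w) 0 := by fun_prop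
      exact (h4.eventually_lt_const (by simpa using h3)).filter_mono nhdsWithin_le_nhds
  filter_upwards [eventually_all.2 h1] with t ht
  exact M.mem_interior_cell.2 ht

theorem Mesh.pt_eq_pt {T T' : M.Cell} {i i' : LocalFacet κ (n + 1)}
    (h : M.facetOf T i = M.facetOf T' i') (y : Euc n) : M.pt T i y = M.pt T' i' y := by
  rw [Mesh.pt, Mesh.pt, h]

/-- The outward normals on the two sides of a facet are opposite. -/
theorem Mesh.normal_eq_neg {T T' : M.Cell} {i i' : LocalFacet κ (n + 1)} (hne : (T, i) ≠ (T', i'))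
    (h : M.facetOf T i = M.facetOf T' i') : M.normal T' i' = -M.normal T i := by
  obtain ⟨y, hy⟩ := refOpen_nonempty κ n
  -- Two different facets of one element never share a parametrization, because relative interiors
  -- of distinct facets are disjoint.
  have hT : T ≠ T' := by
    rintro rfl
    have hi : i' ≠ i := fun hi => hne (by rw [hi])
    have h1 := inner_stdFacet_lt hi (M.aut_mem_refOpen (T := T) (i := i) hy)
    rw [← M.symm_pt, M.pt_eq_pt h, M.symm_pt, inner_refNormal_stdFacet] at h1
    exact lt_irrefl _ h1
  by_contra hcon
  set N := M.normal T i
  set N' := M.normal T' i'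
  have hN : inner ℝ N N = (1 : ℝ) := by
    rw [real_inner_self_eq_norm_sq, M.norm_normal, one_pow]
  have hN' : inner ℝ N' N' = (1 : ℝ) := by
    rw [real_inner_self_eq_norm_sq, M.norm_normal, one_pow]
  have hpos : 0 < 1 + inner ℝ N N' := by
    have h1 : 0 < inner ℝ (N + N') (N + N') := real_inner_self_pos.2 fun h0 =>
      hcon (eq_neg_of_add_eq_zero_right h0)
    rw [real_inner_add_add_self, hN, hN'] at h1
    linarith
  -- If the unit normals are not opposite, then `1 + ⟨N, N'⟩ > 0` and `-(N + N')` points into both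
  -- elements, whose interiors would then overlap.
  have h1 := M.eventually_mem_interior (T := T) (i := i) hy (w := -(N + N')) (by
    change inner ℝ N _ < 0
    rw [inner_neg_right, inner_add_right, hN]
    linarith)
  have h2 := M.eventually_mem_interior (T := T') (i := i') hy (w := -(N + N')) (by
    change inner ℝ N' _ < 0
    rw [inner_neg_right, inner_add_right, hN', real_inner_comm]
    linarith)
  obtain ⟨t, ht1, ht2⟩ := (h1.and h2).exists
  rw [← M.pt_eq_pt h] at ht2
  exact Set.disjoint_left.1 (M.disjoint_interior T T' hT) ht1 ht2

open Classical in
/-- The sides of a facet. -/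
def Mesh.sides (F : M.Facet) : Finset (M.Cell × LocalFacet κ (n + 1)) :=
  Finset.univ.filter fun s => M.facetOf s.1 s.2 = F

theorem Mesh.mem_sides {F : M.Facet} {s : M.Cell × LocalFacet κ (n + 1)} :
    s ∈ M.sides F ↔ M.facetOf s.1 s.2 = F := by
  simp [Mesh.sides]

open Classical in
-- A third side is impossible: three unit vectors cannot be pairwise opposite.
theorem Mesh.sides_of_not_isBoundary {F : M.Facet} (hF : ¬M.IsBoundary F) :
    ∃ s s' : M.Cell × LocalFacet κ (n + 1), s ≠ s' ∧ M.sides F = {s, s'} ∧ M.normal s'.1 s'.2 = -M.normal s.1 s.2 := by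
  obtain ⟨T, i, hTi⟩ := M.facet_surj F
  obtain ⟨s', hs', hne⟩ : ∃ s', M.facetOf s'.1 s'.2 = F ∧ s' ≠ (T, i) := by
    by_contra hcon
    push Not at hcon
    exact hF ⟨(T, i), hTi, fun s hs => hcon s hs⟩
  have hopp := M.normal_eq_neg (T := T) (i := i) (T' := s'.1) (i' := s'.2) hne.symm
    (hTi.trans hs'.symm)
  refine ⟨(T, i), s', hne.symm, ?_, hopp⟩
  ext r
  rw [M.mem_sides, Finset.mem_insert, Finset.mem_singleton]
  refine ⟨fun hr => ?_, ?_⟩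
  · by_contra hcon
    push Not at hcon
    have h1 := M.normal_eq_neg (T := T) (i := i) (T' := r.1) (i' := r.2) hcon.1.symm
      (hTi.trans hr.symm)
    have h2 := M.normal_eq_neg (T := s'.1) (i := s'.2) (T' := r.1) (i' := r.2) hcon.2.symm
      (hs'.trans hr.symm)
    rw [hopp, neg_neg, h1] at h2
    have h3 : M.normal T i = 0 := by
      have h4 : (2 : ℝ) • M.normal T i = 0 := by
        rw [two_smul]
        nth_rewrite 1 [← h2]
        exact neg_add_cancel _
      simpa using h4
    have h4 := M.norm_normal T i
    rw [h3, norm_zero] at h4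
    exact zero_ne_one h4
  · rintro (rfl | rfl)
    · exact hTi
    · exact hs'

theorem Mesh.sum_sides {V : Type*} [AddCommMonoid V] (h : M.Cell → LocalFacet κ (n + 1) → V) :
    ∑ T, ∑ i, h T i = ∑ F, ∑ s ∈ M.sides F, h s.1 s.2 := by
  classical
  rw [← Fintype.sum_prod_type']
  have := Finset.sum_fiberwise_of_maps_to (s := Finset.univ) (t := Finset.univ)
    (g := fun s : M.Cell × LocalFacet κ (n + 1) => M.facetOf s.1 s.2) (fun _ _ => Finset.mem_univ _)
    (fun s => h s.1 s.2)
  rw [← this]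
  refine Finset.sum_congr rfl fun F _ => Finset.sum_congr ?_ fun _ _ => rfl
  ext s
  simp [M.mem_sides]

/-! ### Facets with one side lie on the boundary of the domain -/

theorem Mesh.exists_functional {T : M.Cell} (l : Euc (n + 1) →L[ℝ] ℝ) :
    ∃ a : Euc (n + 1), ∀ x y, l (M.cellMap T x) ≤ l (M.cellMap T y) ↔ inner ℝ a x ≤ inner ℝ a y := by
  let L : Euc (n + 1) →L[ℝ] ℝ := l ∘L (linCLE (M.cellMap T) : Euc (n + 1) →L[ℝ] Euc (n + 1))
  refine ⟨(InnerProductSpace.toDual ℝ _).symm L, fun x y => ?_⟩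
  rw [InnerProductSpace.toDual_symm_apply, InnerProductSpace.toDual_symm_apply,
    affineEquiv_apply _ x, affineEquiv_apply _ y, map_add, map_add]
  exact add_le_add_iff_right _

/-- By conformity the intersection is an exposed face. It is proper, since otherwise one element
would be contained in the other, and it contains an `n`-dimensional piece, so it is a facet. -/
theorem Mesh.exists_inter_eq_facet {T T' : M.Cell} (hT : T ≠ T') {Θ : Euc n →ᵃ[ℝ] Euc (n + 1)}
    (hΘ : Function.Injective Θ) (h : ∀ z ∈ refCell κ n, Θ z ∈ M.cell T ∩ M.cell T') :
    ∃ j, M.cell T ∩ M.cell T' = M.cellMap T '' refFacet κ j := by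
  obtain ⟨y, hy⟩ := interior_refCell_nonempty κ n
  obtain ⟨l, hl⟩ := M.conforming T T' hT ⟨Θ y, h y (interior_subset hy)⟩
  change M.cell T ∩ M.cell T' = {x | x ∈ M.cell T ∧ ∀ y ∈ M.cell T, l y ≤ l x} at hl
  obtain ⟨a, ha⟩ := M.exists_functional (T := T) l
  have hset : M.cell T ∩ M.cell T' = M.cellMap T '' {x | x ∈ refCell κ (n + 1) ∧
      ∀ y ∈ refCell κ (n + 1), inner ℝ a y ≤ inner ℝ a x} := by
    rw [hl]
    ext x
    constructor
    · rintro ⟨⟨z, hz, rfl⟩, hx⟩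
      exact ⟨z, ⟨hz, fun y hy => (ha _ _).1 (hx _ (mem_image_of_mem _ hy))⟩, rfl⟩
    · rintro ⟨z, ⟨hz, hx⟩, rfl⟩
      refine ⟨mem_image_of_mem _ hz, ?_⟩
      rintro _ ⟨y, hy, rfl⟩
      exact (ha _ _).2 (hx y hy)
  have ha0 : a ≠ 0 := by
    rintro rfl
    have h1 : M.cell T ⊆ M.cell T' := by
      have h2 : M.cell T ∩ M.cell T' = M.cell T := by
        rw [hset]
        simp only [inner_zero_left, le_refl, implies_true, and_true]
        rfl
      exact inter_eq_left.1 h2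
    obtain ⟨x, hx⟩ := M.interior_cell_nonempty T
    exact Set.disjoint_left.1 (M.disjoint_interior T T' hT) hx (interior_mono h1 hx)
  obtain ⟨j, hj⟩ := exists_refFacet_eq (κ := κ) ha0
    (Θ := ((M.cellMap T).symm : Euc (n + 1) →ᵃ[ℝ] Euc (n + 1)).comp Θ)
    ((M.cellMap T).symm.injective.comp hΘ) (fun z hz => by
      have := h z hz
      rw [hset] at this
      obtain ⟨x, hx, hxz⟩ := this
      have h1 : ((M.cellMap T).symm : Euc (n + 1) →ᵃ[ℝ] Euc (n + 1)).comp Θ z = x := by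
        simp [← hxz]
      rw [h1]
      exact hx)
  exact ⟨j, by rw [hset, hj]⟩

/-- Were the point inside the open set `Ω`, some other element `T'` would continue the mesh beyond
the facet. Conformity makes the common face a facet of both elements, and `facet_ext` identifies the
two global facets, so the facet would have two sides. -/
theorem Mesh.facetMap_notMem_of_isBoundary (hΩ : IsOpen Ω) {F : M.Facet} (hF : M.IsBoundary F)
    {y : Euc n} (hy : y ∈ refOpen κ n) : M.facetMap F y ∉ Ω := by
  intro hmem
  obtain ⟨T, i, rfl⟩ := M.facet_surj F
  change M.pt T i y ∈ Ω at hmem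
  set N := M.normal T i with hN
  have hNN : inner ℝ N N = (1 : ℝ) := by
    rw [real_inner_self_eq_norm_sq, M.norm_normal, one_pow]
  have hcont : Continuous fun t : ℝ => M.pt T i y + t • N := by fun_prop
  have hev : ∀ᶠ t in 𝓝[>] (0 : ℝ), ∃ T', M.pt T i y + t • N ∈ M.cell T' := by
    have h1 : ∀ᶠ t in 𝓝 (0 : ℝ), M.pt T i y + t • N ∈ Ω :=
      hcont.continuousAt.eventually_mem (by simpa using hΩ.mem_nhds hmem)
    filter_upwards [h1.filter_mono nhdsWithin_le_nhds] with t ht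
    have h2 := M.cover.symm ▸ subset_closure ht
    exact mem_iUnion.1 h2
  -- There are finitely many elements, so a single one contains points just beyond the facet at
  -- arbitrarily small distances; being closed, it contains the point itself.
  obtain ⟨T', hT'⟩ : ∃ T', ∃ᶠ t in 𝓝[>] (0 : ℝ), M.pt T i y + t • N ∈ M.cell T' := by
    by_contra hcon
    push Not at hcon
    obtain ⟨t, ⟨T', h1⟩, h2⟩ := (hev.and (eventually_all.2 hcon)).exists
    exact h2 T' h1
  have hP' : M.pt T i y ∈ M.cell T' := by
    have h1 : Tendsto (fun t : ℝ => M.pt T i y + t • N) (𝓝[>] 0) (𝓝 (M.pt T i y)) := by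
      have := hcont.tendsto 0
      simp only [zero_smul, add_zero] at this
      exact tendsto_nhdsWithin_of_tendsto_nhds this
    exact (M.isCompact_cell T').isClosed.mem_of_frequently_of_tendsto hT' h1
  have hne : T ≠ T' := by
    rintro rfl
    obtain ⟨t, ht, htpos⟩ := (hT'.and_eventually
      (self_mem_nhdsWithin : Ioi (0 : ℝ) ∈ 𝓝[>] 0)).exists
    have h1 := mem_refCell_iff.1 (M.mem_cell.1 ht) i
    rw [affineEquiv_symm_add, M.symm_pt, inner_add_right, inner_refNormal_stdFacet, map_smul,
      inner_smul_right, M.inner_refNormal_symm] at h1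
    have h2 : 0 < inner ℝ (M.nvec T i) N := by
      rw [hN, M.normal_eq, inner_smul_right, real_inner_self_eq_norm_sq]
      have := M.norm_nvec_pos T i
      positivity
    have h3 := mul_pos (show (0 : ℝ) < t from htpos) h2
    linarith
  -- The functional that exposes the common face is maximal at a relative interior point of the
  -- facet. If it were smaller at `z`, it would be larger slightly beyond `y` on the line from `z`
  -- through `y`; hence it is constant on the facet.
  have hsub : ∀ z ∈ refCell κ n, M.pt T i z ∈ M.cell T ∩ M.cell T' := by
    intro z hz
    have hyc := refOpen_subset _ _ hy
    obtain ⟨l, hl⟩ := M.conforming T T' hne ⟨_, M.pt_mem_cell hyc, hP'⟩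
    change M.cell T ∩ M.cell T' = {x | x ∈ M.cell T ∧ ∀ y ∈ M.cell T, l y ≤ l x} at hl
    have hP : M.pt T i y ∈ M.cell T ∩ M.cell T' := ⟨M.pt_mem_cell hyc, hP'⟩
    rw [hl] at hP ⊢
    refine ⟨M.pt_mem_cell hz, fun x hx => (hP.2 x hx).trans ?_⟩
    rw [← interior_refCell] at hy
    obtain ⟨t, ht, hmem⟩ := eventually_lineMap_mem_refCell hy (y - z)
    have h1 := hP.2 _ (M.pt_mem_cell (T := T) (i := i) hmem)
    have h2 : M.pt T i (y + t • (y - z)) = M.pt T i y + t • (M.pt T i y - M.pt T i z) := by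
      simp only [Mesh.pt]
      rw [affineMap_apply, map_smul]
      congr 2
      exact AffineMap.linearMap_vsub _ y z
    rw [h2, map_add, map_smul, map_sub, smul_eq_mul] at h1
    have h3 : t * (l (M.pt T i y) - l (M.pt T i z)) ≤ 0 := by linarith
    linarith [nonpos_of_mul_nonpos_right h3 ht]
  obtain ⟨j, hj⟩ := M.exists_inter_eq_facet hne (M.facetMap_injective (M.facetOf T i)) hsub
  obtain ⟨j', hj'⟩ := M.exists_inter_eq_facet hne.symm (M.facetMap_injective (M.facetOf T i))
    (fun z hz => (hsub z hz).symm)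
  have hij : i = j := by
    by_contra hij
    have h1 := inner_stdFacet_lt (Ne.symm hij) (M.aut_mem_refOpen (T := T) (i := i) hy)
    have h2 := hsub y (refOpen_subset _ _ hy)
    rw [hj] at h2
    obtain ⟨x, hx, hxy⟩ := h2
    have h3 : (M.cellMap T).symm (M.pt T i y) = x := by simp [← hxy]
    rw [← M.symm_pt, h3, ((mem_refFacet_iff κ j).1 hx).2] at h1
    exact lt_irrefl _ h1
  subst hij
  -- Both facets have the common face as image, and facets with equal images coincide.
  have heq : M.facetOf T i = M.facetOf T' j' := by
    refine M.facet_ext _ _ ?_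
    rw [M.image_facet, M.image_facet, ← hj, ← hj', inter_comm]
  have h4 := hF.unique (y₁ := (T, i)) (y₂ := (T', j')) rfl heq.symm
  exact hne (congrArg Prod.fst h4)

/-- Relative interior points are dense in the facet, and `Ω` is open. -/
theorem Mesh.pt_notMem_of_isBoundary (hΩ : IsOpen Ω) {T : M.Cell} {i : LocalFacet κ (n + 1)}
    (hF : M.IsBoundary (M.facetOf T i)) {y : Euc n} (hy : y ∈ refCell κ n) : M.pt T i y ∉ Ω := by
  intro hmem
  have h1 : y ∈ closure (interior (refCell κ n)) := by
    rw [(convex_refCell κ n).closure_interior_eq_closure_of_nonempty_interior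
      (interior_refCell_nonempty κ n)]
    exact subset_closure hy
  have h2 : IsOpen (M.pt T i ⁻¹' Ω) := hΩ.preimage (continuous_pt M T i)
  obtain ⟨z, hz1, hz2⟩ := mem_closure_iff.1 h1 _ h2 hmem
  rw [interior_refCell] at hz2
  exact M.facetMap_notMem_of_isBoundary hΩ hF hz2 hz1

/-! ### Measure theory of a mesh -/

theorem Mesh.volume_frontier_cell (T : M.Cell) : volume (frontier (M.cell T)) = 0 :=
  (M.convex_cell T).addHaar_frontier volume

/-- The overlap lies in the boundaries of convex sets, which are null sets. -/
theorem Mesh.aedisjoint_cell {T T' : M.Cell} (h : T ≠ T') :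
    AEDisjoint volume (M.cell T) (M.cell T') := by
  refine measure_mono_null (t := frontier (M.cell T) ∪ frontier (M.cell T')) ?_
    (measure_union_null (M.volume_frontier_cell T) (M.volume_frontier_cell T'))
  rintro x ⟨hx, hx'⟩
  by_contra hcon
  rw [mem_union, not_or] at hcon
  have h1 : x ∈ interior (M.cell T) := by
    by_contra hi
    exact hcon.1 ⟨subset_closure hx, hi⟩
  have h2 : x ∈ interior (M.cell T') := by
    by_contra hi
    exact hcon.2 ⟨subset_closure hx', hi⟩
  exact Set.disjoint_left.1 (M.disjoint_interior T T' h) h1 h2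

theorem Mesh.iUnion_cell : (⋃ T, M.cell T) = closure Ω := M.cover

/-- The elements cover the closure, which may differ from a general open set by a set of positive
measure. Here `Ω` is the interior of its closure, so points outside `Ω` are interior to no element
and lie in finitely many null boundaries. -/
theorem Mesh.ae_eq_iUnion_cell (hΩ : IsRegularDomain Ω) : (⋃ T, M.cell T) =ᵐ[volume] Ω := by
  have h1 : volume ((⋃ T, M.cell T) \ Ω) = 0 := by
    refine measure_mono_null (t := ⋃ T, frontier (M.cell T)) ?_
      (measure_iUnion_null fun T => M.volume_frontier_cell T)
    rintro x ⟨hx, hxΩ⟩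
    obtain ⟨T, hT⟩ := mem_iUnion.1 hx
    refine mem_iUnion.2 ⟨T, subset_closure hT, fun hi => hxΩ ?_⟩
    rw [← hΩ.interior_closure, ← M.iUnion_cell]
    exact interior_mono (subset_iUnion _ T) hi
  refine Filter.EventuallyLE.antisymm (ae_le_set.2 h1) (ae_le_set.2 ?_)
  rw [M.iUnion_cell, sdiff_eq_empty.2 subset_closure, measure_empty]

theorem Mesh.restrict_iUnion_cell (hΩ : IsRegularDomain Ω) :
    volume.restrict (⋃ T, M.cell T) = volume.restrict Ω :=
  Measure.restrict_congr_set (M.ae_eq_iUnion_cell hΩ)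

theorem Mesh.restrict_cell_le (hΩ : IsRegularDomain Ω) (T : M.Cell) :
    volume.restrict (M.cell T) ≤ volume.restrict Ω := by
  rw [← M.restrict_iUnion_cell hΩ]
  exact Measure.restrict_mono (subset_iUnion _ T) le_rfl

theorem Mesh.ae_cell (hΩ : IsRegularDomain Ω) {P : Euc (n + 1) → Prop}
    (h : ∀ᵐ x ∂volume.restrict Ω, P x) (T : M.Cell) : ∀ᵐ x ∂volume.restrict (M.cell T), P x :=
  ae_mono (M.restrict_cell_le hΩ T) h

theorem Mesh.sum_setIntegral_cell (hΩ : IsRegularDomain Ω) {g : Euc (n + 1) → ℝ}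
    (hg : IntegrableOn g Ω) : ∑ T, ∫ x in M.cell T, g x = ∫ x in Ω, g x := by
  have hg' : IntegrableOn g (⋃ T, M.cell T) := by
    rwa [IntegrableOn, M.restrict_iUnion_cell hΩ]
  have h1 := integral_iUnion_ae (μ := volume) (s := fun T => M.cell T) (f := g)
    (fun T => (M.measurableSet_cell T).nullMeasurableSet)
    (fun T T' h => M.aedisjoint_cell h) hg'
  rw [tsum_fintype, M.restrict_iUnion_cell hΩ] at h1
  exact h1.symm

end

/-! ### The discrete spaces as finite-dimensional subspaces of `L²`, and `ℬ_h` as a form. -/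

section

variable {κ : CellKind} {n : ℕ} {Ω : Set (Euc (n + 1))} (M : Mesh κ n Ω) (p : ℕ)

/-! ### Square integrable broken functions and boundary functions -/

theorem integrable_inner_of_memLp {E V : Type*} [MeasurableSpace E] {μ : Measure E}
    [NormedAddCommGroup V] [InnerProductSpace ℝ V] {v w : E → V} (hv : MemLp v 2 μ)
    (hw : MemLp w 2 μ) : Integrable (fun x => (inner ℝ (v x) (w x) : ℝ)) μ :=
  (hv.norm.integrable_mul hw.norm).mono' (hv.1.inner hw.1)
    (ae_of_all _ fun _ => norm_inner_le_norm _ _)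

section L2

variable (V : Type*) [NormedAddCommGroup V] [InnerProductSpace ℝ V]

/-- Broken functions that are square integrable on each element. -/
def Mesh.L2 : Submodule ℝ (M.Cell → Euc (n + 1) → V) where
  carrier := {v | ∀ T, MemLp (v T) 2 (volume.restrict (M.cell T))}
  add_mem' hv hw T := (hv T).add (hw T)
  zero_mem' _ := MemLp.zero
  smul_mem' c _ hv T := (hv T).const_smul c

/-- The `L²` inner product of broken functions. -/
def Mesh.form : M.L2 V →ₗ[ℝ] M.L2 V →ₗ[ℝ] ℝ :=
  LinearMap.mk₂ ℝ (fun v w => ∑ T, ∫ x in M.cell T, inner ℝ (v.1 T x) (w.1 T x))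
    (fun v v' w => by
      rw [← Finset.sum_add_distrib]
      refine Finset.sum_congr rfl fun T _ => ?_
      rw [← integral_add (integrable_inner_of_memLp (v.2 T) (w.2 T)) (integrable_inner_of_memLp (v'.2 T) (w.2 T))]
      exact integral_congr_ae (ae_of_all _ fun x => inner_add_left _ _ _))
    (fun c v w => by
      rw [smul_eq_mul, Finset.mul_sum]
      refine Finset.sum_congr rfl fun T _ => ?_
      rw [← integral_const_mul]
      exact integral_congr_ae (ae_of_all _ fun x => real_inner_smul_left _ _ _))
    (fun v w w' => by
      rw [← Finset.sum_add_distrib]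
      refine Finset.sum_congr rfl fun T _ => ?_
      rw [← integral_add (integrable_inner_of_memLp (v.2 T) (w.2 T)) (integrable_inner_of_memLp (v.2 T) (w'.2 T))]
      exact integral_congr_ae (ae_of_all _ fun x => inner_add_right _ _ _))
    (fun c v w => by
      rw [smul_eq_mul, Finset.mul_sum]
      refine Finset.sum_congr rfl fun T _ => ?_
      rw [← integral_const_mul]
      exact integral_congr_ae (ae_of_all _ fun x => real_inner_smul_right _ _ _))

variable {V}

theorem Mesh.form_apply (v w : M.L2 V) :
    M.form V v w = ∑ T, ∫ x in M.cell T, inner ℝ (v.1 T x) (w.1 T x) := rfl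

theorem Mesh.form_self (v : M.L2 V) : M.form V v v = ∑ T, ∫ x in M.cell T, ‖v.1 T x‖ ^ 2 := by
  simp [M.form_apply]

theorem Mesh.form_comm (v w : M.L2 V) : M.form V v w = M.form V w v := by
  simp only [M.form_apply, real_inner_comm]

theorem Mesh.form_self_nonneg (v : M.L2 V) : 0 ≤ M.form V v v := by
  rw [M.form_self]
  exact Finset.sum_nonneg fun T _ => integral_nonneg fun x => sq_nonneg _

theorem Mesh.form_sq_le (v w : M.L2 V) :
    M.form V v w ^ 2 ≤ M.form V v v * M.form V w w :=
  LinearMap.BilinForm.apply_sq_le_of_symm (M.form V) M.form_self_nonneg ⟨M.form_comm⟩ v w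

theorem Mesh.form_eq_ip (v w : M.L2 ℝ) : M.form ℝ v w = M.ip v.1 w.1 := by
  simp only [M.form_apply, Mesh.ip]
  exact Finset.sum_congr rfl fun T _ => integral_congr_ae (ae_of_all _ fun x => mul_comm _ _)

theorem Mesh.memL2_of_continuous {v : M.Cell → Euc (n + 1) → V} (h : ∀ T, Continuous (v T)) :
    v ∈ M.L2 V := fun T => by
  obtain ⟨C, hC⟩ := (M.isCompact_cell T).exists_bound_of_continuousOn (h T).continuousOn
  have : IsFiniteMeasure (volume.restrict (M.cell T)) :=
    ⟨by rw [Measure.restrict_apply_univ]; exact (M.isCompact_cell T).measure_lt_top⟩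
  refine MemLp.of_bound ?_ C ((ae_restrict_iff' (M.measurableSet_cell T)).2 (ae_of_all _ hC))
  exact (h T).continuousOn.aestronglyMeasurable_of_isCompact (M.isCompact_cell T)
    (M.measurableSet_cell T)

end L2

/-- Functions on the boundaries of the elements that are square integrable. -/
def Mesh.L2b : Submodule ℝ (M.Cell → LocalFacet κ (n + 1) → Euc n → ℝ) where
  carrier := {h | ∀ T i, MemLp (h T i) 2 (volume.restrict (refCell κ n))}
  add_mem' hv hw T i := (hv T i).add (hw T i)
  zero_mem' _ _ := MemLp.zero
  smul_mem' c _ hv T i := (hv T i).const_smul c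

theorem Mesh.facetInt_add (F : M.Facet) {a b : Euc n → ℝ} (ha : IntegrableOn a (refCell κ n))
    (hb : IntegrableOn b (refCell κ n)) :
    M.facetInt F (fun y => a y + b y) = M.facetInt F a + M.facetInt F b := by
  rw [M.facetInt_def, integral_add ha hb, mul_add, M.facetInt_def, M.facetInt_def]

theorem Mesh.facetInt_sub (F : M.Facet) {a b : Euc n → ℝ} (ha : IntegrableOn a (refCell κ n))
    (hb : IntegrableOn b (refCell κ n)) :
    M.facetInt F (fun y => a y - b y) = M.facetInt F a - M.facetInt F b := by
  rw [M.facetInt_def, integral_sub ha hb, mul_sub, M.facetInt_def, M.facetInt_def]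

theorem Mesh.facetInt_const_mul (F : M.Facet) (c : ℝ) (a : Euc n → ℝ) :
    M.facetInt F (fun y => c * a y) = c * M.facetInt F a := by
  rw [M.facetInt_def, M.facetInt_def, integral_const_mul]
  ring

theorem Mesh.facetInt_nonneg (F : M.Facet) {a : Euc n → ℝ} (ha : ∀ y, 0 ≤ a y) :
    0 ≤ M.facetInt F a := by
  rw [M.facetInt_def]
  exact mul_nonneg (M.area_pos F).le (integral_nonneg ha)

/-- The inner product of `L²(∂𝒯_h)`. -/
def Mesh.bform : M.L2b →ₗ[ℝ] M.L2b →ₗ[ℝ] ℝ :=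
  LinearMap.mk₂ ℝ (fun v w => M.bdryInt fun T i y => v.1 T i y * w.1 T i y)
    (fun v v' w => by
      simp only [Mesh.bdryInt, ← Finset.sum_add_distrib]
      refine Finset.sum_congr rfl fun T _ => Finset.sum_congr rfl fun i _ => ?_
      refine Eq.trans ?_ (M.facetInt_add _ ((v.2 T i).integrable_mul (w.2 T i))
        ((v'.2 T i).integrable_mul (w.2 T i)))
      exact congrArg _ (funext fun y => add_mul _ _ _))
    (fun c v w => by
      simp only [Mesh.bdryInt, smul_eq_mul, Finset.mul_sum, ← M.facetInt_const_mul]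
      refine Finset.sum_congr rfl fun T _ => Finset.sum_congr rfl fun i _ => ?_
      exact congrArg _ (funext fun y => mul_assoc _ _ _))
    (fun v w w' => by
      simp only [Mesh.bdryInt, ← Finset.sum_add_distrib]
      refine Finset.sum_congr rfl fun T _ => Finset.sum_congr rfl fun i _ => ?_
      refine Eq.trans ?_ (M.facetInt_add _ ((v.2 T i).integrable_mul (w.2 T i))
        ((v.2 T i).integrable_mul (w'.2 T i)))
      exact congrArg _ (funext fun y => mul_add _ _ _))
    (fun c v w => by
      simp only [Mesh.bdryInt, smul_eq_mul, Finset.mul_sum, ← M.facetInt_const_mul]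
      refine Finset.sum_congr rfl fun T _ => Finset.sum_congr rfl fun i _ => ?_
      exact congrArg _ (funext fun y => mul_left_comm _ _ _))

theorem Mesh.bform_apply (v w : M.L2b) :
    M.bform v w = M.bdryInt fun T i y => v.1 T i y * w.1 T i y := rfl

theorem Mesh.bform_comm (v w : M.L2b) : M.bform v w = M.bform w v := by
  simp only [M.bform_apply, mul_comm]

theorem Mesh.bdryInt_sq_nonneg (v : M.Cell → LocalFacet κ (n + 1) → Euc n → ℝ) :
    0 ≤ M.bdryInt fun T i y => v T i y * v T i y :=
  Finset.sum_nonneg fun _ _ => Finset.sum_nonneg fun _ _ =>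
    M.facetInt_nonneg _ fun _ => mul_self_nonneg _

theorem Mesh.bform_sq_le (v w : M.L2b) : M.bform v w ^ 2 ≤ M.bform v v * M.bform w w :=
  LinearMap.BilinForm.apply_sq_le_of_symm M.bform (fun v => M.bdryInt_sq_nonneg v.1)
    ⟨M.bform_comm⟩ v w

theorem memLp_refCell_of_continuous {a : Euc n → ℝ} (h : Continuous a) :
    MemLp a 2 (volume.restrict (refCell κ n)) := by
  obtain ⟨C, hC⟩ := (isCompact_refCell κ n).exists_bound_of_continuousOn h.continuousOn
  have : IsFiniteMeasure (volume.restrict (refCell κ n)) :=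
    ⟨by rw [Measure.restrict_apply_univ]; exact (isCompact_refCell κ n).measure_lt_top⟩
  exact MemLp.of_bound h.aestronglyMeasurable C
    ((ae_restrict_iff' (measurableSet_refCell κ n)).2 (ae_of_all _ hC))

theorem Mesh.memL2b_of_continuous {a : M.Cell → LocalFacet κ (n + 1) → Euc n → ℝ}
    (h : ∀ T i, Continuous (a T i)) : a ∈ M.L2b := fun T i => memLp_refCell_of_continuous (h T i)

/-! ### The finite element spaces as vector spaces -/

/-- The pull-back of a broken function to the reference element. -/
def Mesh.pull (T : M.Cell) : (M.Cell → Euc (n + 1) → ℝ) →ₗ[ℝ] (Euc (n + 1) → ℝ) where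
  toFun v y := v T (M.cellMap T y)
  map_add' _ _ := rfl
  map_smul' _ _ := rfl

/-- The Piola pull-back of a broken field to the reference element. -/
def Mesh.piola (T : M.Cell) :
    (M.Cell → Euc (n + 1) → Euc (n + 1)) →ₗ[ℝ] (Euc (n + 1) → Euc (n + 1)) where
  toFun r y := M.jac T • (M.cellMap T).linear.symm (r T (M.cellMap T y))
  map_add' r s := funext fun y => by
    simp only [Pi.add_apply, map_add, smul_add]
  map_smul' c r := funext fun y => by
    simp only [Pi.smul_apply, map_smul, RingHom.id_apply]
    exact smul_comm _ _ _

/-- `V_h^p` as a vector space. -/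
def Mesh.VSub : Submodule ℝ (M.Cell → Euc (n + 1) → ℝ) :=
  ⨅ T, (polySub κ (n + 1) p).comap (M.pull T)

/-- `Σ_h^p` as a vector space. -/
def Mesh.SigSub : Submodule ℝ (M.Cell → Euc (n + 1) → Euc (n + 1)) :=
  ⨅ T, (rtSub κ (n + 1) p).comap (M.piola T)

/-- The facet functions, without boundary conditions. -/
def Mesh.MSub : Submodule ℝ (M.Facet → Euc n → ℝ) := Submodule.pi univ fun _ => polySub κ n p

variable {M p}

theorem Mesh.mem_VSub {v : M.Cell → Euc (n + 1) → ℝ} :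
    v ∈ M.VSub p ↔ ∀ T, M.pull T v ∈ polySub κ (n + 1) p := by
  simp [Mesh.VSub, Submodule.mem_iInf]

theorem Mesh.mem_SigSub {r : M.Cell → Euc (n + 1) → Euc (n + 1)} :
    r ∈ M.SigSub p ↔ ∀ T, M.piola T r ∈ rtSub κ (n + 1) p := by
  simp [Mesh.SigSub, Submodule.mem_iInf]

theorem Mesh.mem_MSub {μ : M.Facet → Euc n → ℝ} : μ ∈ M.MSub p ↔ ∀ F, μ F ∈ polySub κ n p := by
  simp [Mesh.MSub, Submodule.mem_pi]

theorem Mesh.eq_pull (T : M.Cell) (v : M.Cell → Euc (n + 1) → ℝ) (x : Euc (n + 1)) :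
    v T x = M.pull T v ((M.cellMap T).symm x) :=
  congrArg (v T) ((M.cellMap T).apply_symm_apply x).symm

theorem Mesh.eq_piola (T : M.Cell) (r : M.Cell → Euc (n + 1) → Euc (n + 1)) (x : Euc (n + 1)) :
    r T x = (M.jac T)⁻¹ • (M.cellMap T).linear (M.piola T r ((M.cellMap T).symm x)) := by
  change _ = _ • (M.cellMap T).linear (M.jac T • _)
  rw [map_smul, LinearEquiv.apply_symm_apply, smul_smul, inv_mul_cancel₀ (M.jac_ne_zero T),
    one_smul, AffineEquiv.apply_symm_apply]

theorem Mesh.mem_VSpace {v : M.Cell → Euc (n + 1) → ℝ} : v ∈ M.VSpace p ↔ v ∈ M.VSub p := by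
  rw [Mesh.mem_VSub]
  refine forall_congr' fun T => ⟨?_, fun h => ⟨_, mem_polySub.1 h, M.eq_pull T v⟩⟩
  rintro ⟨w, hw, h⟩
  have : M.pull T v = w := funext fun y => by
    change v T _ = _
    rw [h, AffineEquiv.symm_apply_apply]
  rw [this]
  exact mem_polySub.2 hw

theorem Mesh.mem_SigmaSpace {r : M.Cell → Euc (n + 1) → Euc (n + 1)} :
    r ∈ M.SigmaSpace p ↔ r ∈ M.SigSub p := by
  rw [Mesh.mem_SigSub]
  refine forall_congr' fun T => ⟨?_, fun h => ⟨_, h, M.eq_piola T r⟩⟩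
  rintro ⟨w, hw, h⟩
  have : M.piola T r = w := funext fun y => by
    change M.jac T • (M.cellMap T).linear.symm (r T _) = _
    rw [h, AffineEquiv.symm_apply_apply, map_smul, LinearEquiv.symm_apply_apply, smul_smul]
    change (M.jac T * (M.jac T)⁻¹) • _ = _
    rw [mul_inv_cancel₀ (M.jac_ne_zero T), one_smul]
  rw [this]
  exact hw

instance : FiniteDimensional ℝ (M.VSub p) := by
  let f : M.VSub p →ₗ[ℝ] (M.Cell → polySub κ (n + 1) p) :=
    LinearMap.pi fun T => ((M.pull T).comp (M.VSub p).subtype).codRestrict _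
      fun v => Mesh.mem_VSub.1 v.2 T
  refine FiniteDimensional.of_injective f fun v w h => Subtype.ext (funext fun T => funext fun x => ?_)
  rw [M.eq_pull T v.1, M.eq_pull T w.1]
  exact congrFun (congrArg Subtype.val (congrFun h T)) _

instance : FiniteDimensional ℝ (M.SigSub p) := by
  let f : M.SigSub p →ₗ[ℝ] (M.Cell → rtSub κ (n + 1) p) :=
    LinearMap.pi fun T => ((M.piola T).comp (M.SigSub p).subtype).codRestrict _
      fun v => Mesh.mem_SigSub.1 v.2 T
  refine FiniteDimensional.of_injective f fun v w h => Subtype.ext (funext fun T => funext fun x => ?_)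
  rw [M.eq_piola T v.1, M.eq_piola T w.1]
  exact congrArg (fun z => (M.jac T)⁻¹ • (M.cellMap T).linear z)
    (congrFun (congrArg Subtype.val (congrFun h T)) _)

instance : FiniteDimensional ℝ (M.MSub p) := by
  let f : M.MSub p →ₗ[ℝ] (M.Facet → polySub κ n p) :=
    LinearMap.pi fun F => ((LinearMap.proj F).comp (M.MSub p).subtype).codRestrict _
      fun v => Mesh.mem_MSub.1 v.2 F
  exact FiniteDimensional.of_injective f fun v w h => Subtype.ext (funext fun F =>
    congrArg Subtype.val (congrFun h F))

theorem contDiff_affine_symm {d : ℕ} {k : WithTop ℕ∞} (Φ : Euc d ≃ᵃ[ℝ] Euc d) :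
    ContDiff ℝ k Φ.symm := contDiff_affine Φ.symm

theorem Mesh.contDiff_V {v : M.Cell → Euc (n + 1) → ℝ} (hv : v ∈ M.VSub p) (T : M.Cell)
    {k : WithTop ℕ∞} : ContDiff ℝ k (v T) := by
  rw [funext (M.eq_pull T v)]
  exact (contDiff_of_mem_polySub (Mesh.mem_VSub.1 hv T)).comp (contDiff_affine_symm _)

theorem Mesh.contDiff_Sig {r : M.Cell → Euc (n + 1) → Euc (n + 1)} (hr : r ∈ M.SigSub p)
    (T : M.Cell) {k : WithTop ℕ∞} : ContDiff ℝ k (r T) := by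
  rw [funext (M.eq_piola T r)]
  exact ((linCLE (M.cellMap T)).contDiff.comp
    ((contDiff_of_mem_rtSub (Mesh.mem_SigSub.1 hr T)).comp (contDiff_affine_symm _))).const_smul _

theorem Mesh.VSub_le : M.VSub p ≤ M.L2 ℝ := fun _ hv =>
  M.memL2_of_continuous fun T => (Mesh.contDiff_V hv T (k := 0)).continuous

theorem Mesh.SigSub_le : M.SigSub p ≤ M.L2 (Euc (n + 1)) := fun _ hv =>
  M.memL2_of_continuous fun T => (Mesh.contDiff_Sig hv T (k := 0)).continuous

variable (M p)

/-- The embedding of `V_h^p` in `L²`. -/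
def Mesh.incV : M.VSub p →ₗ[ℝ] M.L2 ℝ := Submodule.inclusion Mesh.VSub_le

/-- The embedding of `Σ_h^p` in `L²`. -/
def Mesh.incS : M.SigSub p →ₗ[ℝ] M.L2 (Euc (n + 1)) := Submodule.inclusion Mesh.SigSub_le

theorem gradient_add_smul {d : ℕ} {v w : Euc d → ℝ} {x : Euc d} (hv : DifferentiableAt ℝ v x)
    (hw : DifferentiableAt ℝ w x) : gradient (v + w) x = gradient v x + gradient w x := by
  refine ext_inner_left ℝ fun y => ?_
  rw [inner_add_right, inner_gradient, inner_gradient, inner_gradient, fderiv_add hv hw]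
  rfl

theorem gradient_smul {d : ℕ} {v : Euc d → ℝ} {x : Euc d} (c : ℝ) (hv : DifferentiableAt ℝ v x) :
    gradient (c • v) x = c • gradient v x := by
  refine ext_inner_left ℝ fun y => ?_
  rw [inner_smul_right, inner_gradient, inner_gradient, fderiv_const_smul hv]
  rfl

/-- The broken gradient on `V_h^p`. -/
def Mesh.gradV : M.VSub p →ₗ[ℝ] M.L2 (Euc (n + 1)) where
  toFun v := ⟨M.brokenGrad v.1, M.memL2_of_continuous fun T =>
    continuous_gradient (Mesh.contDiff_V v.2 T)⟩
  map_add' v w := Subtype.ext <| funext fun T => funext fun x => gradient_add_smul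
    ((Mesh.contDiff_V v.2 T (k := 1)).differentiable one_ne_zero x)
    ((Mesh.contDiff_V w.2 T (k := 1)).differentiable one_ne_zero x)
  map_smul' c v := Subtype.ext <| funext fun T => funext fun x => gradient_smul c
    ((Mesh.contDiff_V v.2 T (k := 1)).differentiable one_ne_zero x)

/-- The traces of the functions of `V_h^p`. -/
def Mesh.trV : M.VSub p →ₗ[ℝ] M.L2b where
  toFun v := ⟨fun T i y => v.1 T (M.pt T i y), M.memL2b_of_continuous fun T i =>
    (Mesh.contDiff_V v.2 T (k := 0)).continuous.comp (continuous_pt M T i)⟩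
  map_add' _ _ := rfl
  map_smul' _ _ := rfl

/-- The facet functions as functions on the boundaries of the elements. -/
def Mesh.trM : M.MSub p →ₗ[ℝ] M.L2b where
  toFun μ := ⟨fun T i y => μ.1 (M.facetOf T i) y, M.memL2b_of_continuous fun _ _ =>
    continuous_of_mem_polySub (Mesh.mem_MSub.1 μ.2 _)⟩
  map_add' _ _ := rfl
  map_smul' _ _ := rfl

/-- The normal traces of the fields of `Σ_h^p`. -/
def Mesh.nfl : M.SigSub p →ₗ[ℝ] M.L2b where
  toFun r := ⟨fun T i y => inner ℝ (r.1 T (M.pt T i y)) (M.normal T i),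
    M.memL2b_of_continuous fun T i =>
    ((Mesh.contDiff_Sig r.2 T (k := 0)).continuous.comp (continuous_pt M T i)).inner
      continuous_const⟩
  map_add' _ _ := Subtype.ext <| funext fun _ => funext fun _ => funext fun _ =>
    inner_add_left _ _ _
  map_smul' _ _ := Subtype.ext <| funext fun _ => funext fun _ => funext fun _ =>
    real_inner_smul_left _ _ _

/-- `ℬ_h` as a bilinear form. -/
def Mesh.bh : M.SigSub p →ₗ[ℝ] (M.VSub p × M.MSub p) →ₗ[ℝ] ℝ :=
  (M.form (Euc (n + 1))).compl₁₂ (M.incS p) (M.gradV p ∘ₗ LinearMap.fst ℝ _ _) -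
    M.bform.compl₁₂ (M.nfl p)
      (M.trV p ∘ₗ LinearMap.fst ℝ _ _ - M.trM p ∘ₗ LinearMap.snd ℝ _ _)

variable {M p}

theorem Mesh.bh_apply (r : M.SigSub p) (x : M.VSub p × M.MSub p) :
    M.bh p r x = M.form _ (M.incS p r) (M.gradV p x.1) -
      M.bform (M.nfl p r) (M.trV p x.1 - M.trM p x.2) := rfl

theorem Mesh.bh_eq (r : M.SigSub p) (x : M.VSub p × M.MSub p) :
    M.bh p r x = M.Bh r.1 x.1.1 x.2.1 := by
  rw [Mesh.bh_apply, M.bform_comm]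
  rfl

/-- The Piola transform turns the divergence into the reference divergence divided by the Jacobian
determinant. This membership allows `ψ` to be eliminated from the balance equation. -/
theorem Mesh.brokenDiv_mem {r : M.Cell → Euc (n + 1) → Euc (n + 1)} (hr : r ∈ M.SigSub p) :
    M.brokenDiv r ∈ M.VSub p := by
  refine Mesh.mem_VSub.2 fun T => ?_
  have h1 : (M.jac T)⁻¹ • M.piola T r ∈ rtSub κ (n + 1) p :=
    Submodule.smul_mem _ _ (Mesh.mem_SigSub.1 hr T)
  have h2 : (M.jac T)⁻¹ • M.piola T r =
      fun y => (M.cellMap T).linear.symm (r T (M.cellMap T y)) := funext fun y => by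
    change (M.jac T)⁻¹ • M.jac T • (M.cellMap T).linear.symm (r T (M.cellMap T y)) = _
    rw [smul_smul, inv_mul_cancel₀ (M.jac_ne_zero T), one_smul]
  have h3 := divergence_mem_polySub h1
  rw [h2] at h3
  convert h3 using 1
  funext y
  exact (divergence_pullback (M.cellMap T)
    ((Mesh.contDiff_Sig hr T (k := 1)).differentiable one_ne_zero _)).symm

variable (M p) in
/-- The divergence as a map from `Σ_h^p` to `V_h^p`. -/
def Mesh.divS : M.SigSub p →ₗ[ℝ] M.VSub p where
  toFun r := ⟨M.brokenDiv r.1, Mesh.brokenDiv_mem r.2⟩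
  map_add' r s := Subtype.ext <| funext fun T => funext fun x => by
    change divergence (r.1 T + s.1 T) x = divergence (r.1 T) x + divergence (s.1 T) x
    simp only [divergence]
    rw [fderiv_add ((Mesh.contDiff_Sig r.2 T (k := 1)).differentiable one_ne_zero x)
      ((Mesh.contDiff_Sig s.2 T (k := 1)).differentiable one_ne_zero x), ← Finset.sum_add_distrib]
    rfl
  map_smul' c r := Subtype.ext <| funext fun T => funext fun x => by
    change divergence (c • r.1 T) x = c * divergence (r.1 T) x
    simp only [divergence]
    rw [fderiv_const_smul ((Mesh.contDiff_Sig r.2 T (k := 1)).differentiable one_ne_zero x),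
      Finset.mul_sum]
    rfl

/-- Elementwise integration by parts: the traces of `v` cancel and only the facet function meets the
normal flux. This form links the hybridized and the mixed equations. -/
theorem Mesh.bh_eq_div (r : M.SigSub p) (x : M.VSub p × M.MSub p) :
    M.bh p r x = -M.form ℝ (M.incV p (M.divS p r)) (M.incV p x.1) +
      M.bform (M.trM p x.2) (M.nfl p r) := by
  have h : M.form ℝ (M.incV p (M.divS p r)) (M.incV p x.1) =
      -M.form _ (M.incS p r) (M.gradV p x.1) + M.bform (M.trV p x.1) (M.nfl p r) := by
    rw [M.form_apply, M.form_apply, M.bform_apply, Mesh.bdryInt, ← Finset.sum_neg_distrib,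
      ← Finset.sum_add_distrib]
    refine Finset.sum_congr rfl fun T _ => ?_
    refine (M.green T (Mesh.contDiff_V x.1.2 T) (Mesh.contDiff_Sig r.2 T)).trans ?_
    congr 2
    exact integral_congr_ae (ae_of_all _ fun z => (inner_gradient _ _ _).symm)
  rw [Mesh.bh_apply, h, map_sub, M.bform_comm, M.bform_comm (M.trM p x.2)]
  ring

/-! ### Normal traces and facet spaces -/

theorem Mesh.nfl_eq (r : M.SigSub p) (T : M.Cell) (i : LocalFacet κ (n + 1)) (y : Euc n) :
    (M.nfl p r).1 T i y = ((M.jac T)⁻¹ * ‖M.nvec T i‖⁻¹) *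
      inner ℝ (M.piola T r.1 (stdFacet κ i (M.aut T i y))) (refNormal κ i) := by
  change inner ℝ (r.1 T (M.pt T i y)) (M.normal T i) = _
  rw [M.eq_piola T r.1, M.symm_pt, M.normal_eq, real_inner_smul_left, inner_smul_right,
    M.inner_nvec, mul_assoc]

/-- The trace is computed in the standard parametrization of the element's facet. Passing to the
parametrization of the mesh facet is harmless because automorphisms of the reference facet preserve
the polynomial space. -/
theorem Mesh.nfl_mem (r : M.SigSub p) (T : M.Cell) (i : LocalFacet κ (n + 1)) :
    (M.nfl p r).1 T i ∈ polySub κ n p := by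
  rw [funext (Mesh.nfl_eq r T i)]
  exact smul_mem_polySub_ite ((isCellMap_aut (M.image_aut T i)).comp_mem
    (normalTrace_mem_polySub (Mesh.mem_SigSub.1 r.2 T) i)) _

theorem Mesh.trV_eq (v : M.VSub p) (T : M.Cell) (i : LocalFacet κ (n + 1)) (y : Euc n) :
    (M.trV p v).1 T i y = M.pull T v.1 (stdFacet κ i (M.aut T i y)) := by
  change v.1 T (M.pt T i y) = _
  rw [M.eq_pull T v.1, M.symm_pt]

theorem eq_zero_of_integral_sq {f : Euc n → ℝ} (hf : f ∈ polySub κ n p)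
    (h : ∫ y in refCell κ n, f y * f y = 0) : f = 0 := by
  by_contra hne
  have h1 := polyForm_pos (⟨f, hf⟩ : polySub κ n p) (fun h0 => hne (congrArg Subtype.val h0))
  have h2 : polyForm κ n p ⟨f, hf⟩ ⟨f, hf⟩ = ∫ y in refCell κ n, f y * f y := by
    refine integral_congr_ae (ae_of_all _ fun y => ?_)
    exact mul_comm _ _
  rw [h2, h] at h1
  exact lt_irrefl _ h1

theorem eq_zero_of_facetInt_sq {f : Euc n → ℝ} (hf : f ∈ polySub κ n p) {F : M.Facet}
    (h : M.facetInt F (fun y => f y * f y) = 0) : f = 0 := by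
  rw [M.facetInt_def] at h
  exact eq_zero_of_integral_sq hf ((mul_eq_zero.1 h).resolve_left (M.area_pos F).ne')

/-- A polynomial whose projection vanishes is zero, as seen by testing it with itself. -/
theorem Mesh.mem_MSpace_zero {μ : M.Facet → Euc n → ℝ} :
    μ ∈ M.MSpace p (fun _ => 0) ↔ μ ∈ M.MSub p ∧ ∀ F, M.IsBoundary F → μ F = 0 := by
  have hz : ∀ F, M.facetInt F (fun _ => 0) = 0 := fun F => by simp [M.facetInt_def]
  rw [Mesh.mem_MSub]
  constructor
  · rintro ⟨h1, h2⟩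
    refine ⟨fun F => mem_polySub.2 (h1 F), fun F hF => ?_⟩
    have h3 := h2 F hF _ (h1 F)
    simp only [zero_mul, hz] at h3
    exact eq_zero_of_facetInt_sq (mem_polySub.2 (h1 F)) h3
  · rintro ⟨h1, h2⟩
    refine ⟨fun F => mem_polySub.1 (h1 F), fun F hF η _ => ?_⟩
    simp [h2 F hF]

variable (M p) in
/-- `M_{h,0}^p` as a vector space. -/
def Mesh.M0 : Submodule ℝ (M.MSub p) where
  carrier := {μ | ∀ F, M.IsBoundary F → μ.1 F = 0}
  add_mem' {μ ν} h h' F hF := by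
    change μ.1 F + ν.1 F = 0
    rw [h F hF, h' F hF, add_zero]
  zero_mem' _ _ := rfl
  smul_mem' c μ h F hF := by
    change c • μ.1 F = 0
    rw [h F hF, smul_zero]

theorem Mesh.mem_MSpace_zero' {μ : M.MSub p} : μ.1 ∈ M.MSpace p (fun _ => 0) ↔ μ ∈ M.M0 p := by
  rw [Mesh.mem_MSpace_zero]
  exact ⟨fun h => h.2, fun h => ⟨μ.2, h⟩⟩

/-- The `L²` projection onto the polynomials on a reference facet. -/
theorem exists_polySub_projection (κ : CellKind) (p : ℕ) {g : Euc n → ℝ}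
    (hg : MemLp g 2 (volume.restrict (refCell κ n))) :
    ∃ e ∈ polySub κ n p, ∀ η ∈ polySub κ n p,
      ∫ y in refCell κ n, e y * η y = ∫ y in refCell κ n, g y * η y := by
  have hint : ∀ η : polySub κ n p, IntegrableOn (fun y => g y * η.1 y) (refCell κ n) := fun η =>
    hg.integrable_mul (memLp_refCell_of_continuous (continuous_of_mem_polySub η.2))
  let ℓ : polySub κ n p →ₗ[ℝ] ℝ :=
    { toFun η := ∫ y in refCell κ n, g y * η.1 y
      map_add' η ζ := by
        rw [← integral_add (hint η) (hint ζ)]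
        exact integral_congr_ae (ae_of_all _ fun y => mul_add _ _ _)
      map_smul' c η := by
        rw [RingHom.id_apply, smul_eq_mul, ← integral_const_mul]
        exact integral_congr_ae (ae_of_all _ fun y => mul_left_comm _ _ _) }
  obtain ⟨e, he⟩ := exists_riesz (polyForm κ n p) (fun x hx => by
    by_contra hne
    exact (polyForm_pos x hne).ne' hx) ℓ
  refine ⟨e.1, e.2, fun η hη => (?_ : _ = ℓ ⟨η, hη⟩)⟩
  rw [← he]
  exact integral_congr_ae (ae_of_all _ fun y => mul_comm _ _)

/-- `M_{h,g}^p` is a translate of `M_{h,0}^p`. -/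
theorem Mesh.exists_mem_MSpace (p : ℕ) {g : Euc (n + 1) → ℝ} (hg : M.MemL2Boundary g) :
    ∃ μ : M.MSub p, ∀ ν : M.MSub p, ν.1 ∈ M.MSpace p g ↔ ν - μ ∈ M.M0 p := by
  classical
  -- Only boundary values are prescribed; on interior facets the lifting is arbitrary and taken to
  -- be zero.
  have h : ∀ F, ∃ e ∈ polySub κ n p, M.IsBoundary F → ∀ η ∈ polySub κ n p,
      ∫ y in refCell κ n, e y * η y = ∫ y in refCell κ n, g (M.facetMap F y) * η y := fun F => by
    by_cases hF : M.IsBoundary F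
    · obtain ⟨e, he, h⟩ := exists_polySub_projection κ p (hg F hF)
      exact ⟨e, he, fun _ => h⟩
    · exact ⟨0, Submodule.zero_mem _, fun h => absurd h hF⟩
  choose μ hμ hμ' using h
  refine ⟨⟨μ, Mesh.mem_MSub.2 hμ⟩, fun ν => ⟨fun hν F hF => ?_, fun hν => ?_⟩⟩
  · have hd : ν.1 F - μ F ∈ polySub κ n p := Submodule.sub_mem _ (Mesh.mem_MSub.1 ν.2 F) (hμ F)
    refine eq_zero_of_facetInt_sq (M := M) (F := F) hd ?_
    have h1 := hν.2 F hF _ (mem_polySub.1 hd)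
    rw [M.facetInt_def F fun y => g (M.facetMap F y) * _, ← hμ' F hF _ hd, ← M.facetInt_def] at h1
    have hc : Continuous (ν.1 F - μ F) := continuous_of_mem_polySub hd
    have h2 := M.facetInt_sub F (a := fun y => ν.1 F y * (ν.1 F - μ F) y)
      (b := fun y => μ F y * (ν.1 F - μ F) y)
      (integrableOn_stdFacet ((continuous_of_mem_polySub (Mesh.mem_MSub.1 ν.2 F)).mul hc))
      (integrableOn_stdFacet ((continuous_of_mem_polySub (hμ F)).mul hc))
    rw [h1, sub_self] at h2
    rw [← h2]
    exact congrArg _ (funext fun y => sub_mul _ _ _)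
  · refine ⟨fun F => mem_polySub.1 (Mesh.mem_MSub.1 ν.2 F), fun F hF η hη => ?_⟩
    have h1 : ν.1 F - μ F = 0 := hν F hF
    rw [sub_eq_zero.1 h1, M.facetInt_def, M.facetInt_def, hμ' F hF η (mem_polySub.2 hη)]

end

/-! ### Normal continuity by duality, diffusion tensors, and definiteness. -/

section

/-! ### Fields with continuous normal components -/

section Div

variable {κ : CellKind} {n : ℕ} {Ω : Set (Euc (n + 1))} {M : Mesh κ n Ω} {p : ℕ}

theorem Mesh.bdryInt_eq_sum (h : M.Cell → LocalFacet κ (n + 1) → Euc n → ℝ) :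
    M.bdryInt h = ∑ F, ∑ s ∈ M.sides F, M.facetInt F (h s.1 s.2) := by
  rw [Mesh.bdryInt, M.sum_sides fun T i => M.facetInt (M.facetOf T i) (h T i)]
  exact Finset.sum_congr rfl fun F _ => Finset.sum_congr rfl fun s hs => by rw [M.mem_sides.1 hs]

variable (M p) in
/-- `Σ_{h,div}^p` as a vector space. -/
def Mesh.SDiv : Submodule ℝ (M.SigSub p) where
  carrier := {r | ∀ μ ∈ M.M0 p, M.bform (M.trM p μ) (M.nfl p r) = 0}
  add_mem' h h' μ hμ := by rw [map_add, map_add, h μ hμ, h' μ hμ, add_zero]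
  zero_mem' μ _ := by rw [map_zero, map_zero]
  smul_mem' c r h μ hμ := by rw [map_smul, map_smul, h μ hμ, smul_zero]

theorem continuous_nfl (r : M.SigSub p) (T : M.Cell) (i : LocalFacet κ (n + 1)) :
    Continuous ((M.nfl p r).1 T i) := continuous_of_mem_polySub (Mesh.nfl_mem r T i)

theorem Mesh.continuous_facet (μ : M.MSub p) (F : M.Facet) : Continuous (μ.1 F) :=
  continuous_of_mem_polySub (Mesh.mem_MSub.1 μ.2 F)

theorem Mesh.not_isBoundary_of_ne {s s' : M.Cell × LocalFacet κ (n + 1)} {F : M.Facet}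
    (h : s ≠ s') (hs : M.facetOf s.1 s.2 = F) (hs' : M.facetOf s'.1 s'.2 = F) :
    ¬M.IsBoundary F := fun hF => h (hF.unique hs hs')

open Classical in
theorem Mesh.sides_eq_pair {s s' : M.Cell × LocalFacet κ (n + 1)} {F : M.Facet}
    (h : s ≠ s') (hs : M.facetOf s.1 s.2 = F) (hs' : M.facetOf s'.1 s'.2 = F) :
    M.sides F = {s, s'} := by
  obtain ⟨t, t', hne, hsides, -⟩ := M.sides_of_not_isBoundary (Mesh.not_isBoundary_of_ne h hs hs')
  refine (Finset.eq_of_subset_of_card_le (fun x hx => ?_) ?_).symm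
  · rcases Finset.mem_insert.1 hx with rfl | hx
    · exact M.mem_sides.2 hs
    · rw [Finset.mem_singleton.1 hx]
      exact M.mem_sides.2 hs'
  · rw [hsides, Finset.card_pair hne, Finset.card_pair h]

/-- The sum of the two normal traces is itself a polynomial on the facet. Extended by zero to the
other facets, it is an admissible test function because a facet with two sides is not a boundary
facet. -/
theorem Mesh.nfl_add_eq_zero {r : M.SigSub p} (hr : r ∈ M.SDiv p)
    {s s' : M.Cell × LocalFacet κ (n + 1)} {F : M.Facet} (h : s ≠ s')
    (hs : M.facetOf s.1 s.2 = F) (hs' : M.facetOf s'.1 s'.2 = F) :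
    (M.nfl p r).1 s.1 s.2 + (M.nfl p r).1 s'.1 s'.2 = 0 := by
  classical
  set e := (M.nfl p r).1 s.1 s.2 + (M.nfl p r).1 s'.1 s'.2
  have he : e ∈ polySub κ n p := Submodule.add_mem _ (Mesh.nfl_mem r _ _) (Mesh.nfl_mem r _ _)
  let μ : M.MSub p := ⟨Pi.single F e, Mesh.mem_MSub.2 fun G => by
    by_cases hG : G = F
    · subst hG
      rwa [Pi.single_eq_same]
    · rw [Pi.single_eq_of_ne hG]
      exact Submodule.zero_mem _⟩
  have hμ : μ ∈ M.M0 p := fun G hG => Pi.single_eq_of_ne (fun hGF : G = F =>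
    Mesh.not_isBoundary_of_ne h hs hs' (hGF ▸ hG)) _
  have h1 := hr μ hμ
  have h2 : M.bform (M.trM p μ) (M.nfl p r) =
      M.bdryInt fun T i y => μ.1 (M.facetOf T i) y * (M.nfl p r).1 T i y := rfl
  rw [h2, Mesh.bdryInt_eq_sum, Finset.sum_eq_single F, Mesh.sides_eq_pair h hs hs',
    Finset.sum_pair h] at h1
  · simp only [hs, hs', μ, Pi.single_eq_same] at h1
    have h3 := M.facetInt_add F
      (integrableOn_stdFacet ((continuous_of_mem_polySub he).mul (continuous_nfl r s.1 s.2)))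
      (integrableOn_stdFacet ((continuous_of_mem_polySub he).mul (continuous_nfl r s'.1 s'.2)))
    refine eq_zero_of_facetInt_sq (M := M) (F := F) he ((Eq.trans ?_ h3).trans h1)
    exact congrArg _ (funext fun y => mul_add _ _ _)
  · intro G _ hG
    refine Finset.sum_eq_zero fun t ht => ?_
    rw [M.mem_sides.1 ht]
    simp [μ, Pi.single_eq_of_ne hG, M.facetInt_def]
  · simp

/-- For fields with continuous normal components only the boundary facets contribute to
`(μ, r · n)_{∂𝒯_h}`. -/
theorem Mesh.bform_eq_of_continuous {r : M.SigSub p} (hr : ∀ T i T' i', (T, i) ≠ (T', i') →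
    M.facetOf T i = M.facetOf T' i' → ∀ y ∈ refCell κ n,
      (M.nfl p r).1 T i y + (M.nfl p r).1 T' i' y = 0) {g : Euc (n + 1) → ℝ} {μ : M.MSub p}
    (hμ : μ.1 ∈ M.MSpace p g) : M.bform (M.trM p μ) (M.nfl p r) =
      M.domainBdryInt fun T i y => g (M.pt T i y) *
        inner ℝ (r.1 T (M.pt T i y)) (M.normal T i) := by
  classical
  have h2 : M.bform (M.trM p μ) (M.nfl p r) =
      M.bdryInt fun T i y => μ.1 (M.facetOf T i) y * (M.nfl p r).1 T i y := rfl
  rw [h2, Mesh.bdryInt_eq_sum, Mesh.domainBdryInt, M.sum_sides]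
  refine Finset.sum_congr rfl fun F _ => ?_
  by_cases hF : M.IsBoundary F
  · refine Finset.sum_congr rfl fun s hs => ?_
    have hs := M.mem_sides.1 hs
    subst hs
    rw [if_pos hF]
    exact hμ.2 _ hF _ (mem_polySub.1 (Mesh.nfl_mem r s.1 s.2))
  · have h0 : ∀ s ∈ M.sides F, (if M.IsBoundary (M.facetOf s.1 s.2) then
        M.facetInt (M.facetOf s.1 s.2) (fun y => g (M.pt s.1 s.2 y) *
          inner ℝ (r.1 s.1 (M.pt s.1 s.2 y)) (M.normal s.1 s.2)) else 0) = 0 := fun s hs => by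
      rw [M.mem_sides.1 hs, if_neg hF]
    rw [Finset.sum_eq_zero h0]
    obtain ⟨s, s', hne, hsides, -⟩ := M.sides_of_not_isBoundary hF
    have hs := M.mem_sides.1 (hsides ▸ Finset.mem_insert_self s {s'})
    have hs' := M.mem_sides.1 (hsides ▸ Finset.mem_insert_of_mem (Finset.mem_singleton_self s'))
    rw [hsides, Finset.sum_pair hne, hs, hs']
    refine (M.facetInt_add F
      (integrableOn_stdFacet ((Mesh.continuous_facet μ _).mul (continuous_nfl r _ _)))
      (integrableOn_stdFacet ((Mesh.continuous_facet μ _).mul (continuous_nfl r _ _)))).symm.trans ?_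
    rw [M.facetInt_def, setIntegral_eq_zero_of_forall_eq_zero, mul_zero]
    intro y hy
    simp only [Pi.mul_apply]
    rw [← mul_add, hr s.1 s.2 s'.1 s'.2 hne (hs.trans hs'.symm) y hy, mul_zero]

theorem Mesh.domainBdryInt_zero (r : M.SigSub p) :
    (M.domainBdryInt fun T i y => 0 * inner ℝ (r.1 T (M.pt T i y)) (M.normal T i)) = 0 := by
  simp [Mesh.domainBdryInt, M.facetInt_def]

/-- Pointwise continuity of normal components is equivalent to orthogonality to the facet functions
that vanish on the boundary, because the jumps are polynomials of the same degree. -/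
theorem Mesh.mem_SigmaDivSpace {r : M.SigSub p} : r.1 ∈ M.SigmaDivSpace p ↔ r ∈ M.SDiv p := by
  constructor
  · rintro ⟨-, h⟩ μ hμ
    rw [Mesh.bform_eq_of_continuous h (Mesh.mem_MSpace_zero'.2 hμ), Mesh.domainBdryInt_zero]
  · exact fun h => ⟨Mesh.mem_SigmaSpace.2 r.2, fun T i T' i' hne heq y _ =>
      congrFun (Mesh.nfl_add_eq_zero (s := (T, i)) (s' := (T', i')) h hne heq rfl) y⟩

theorem Mesh.bform_eq_domainBdryInt {r : M.SigSub p} (hr : r ∈ M.SDiv p) {g : Euc (n + 1) → ℝ}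
    {μ : M.MSub p} (hμ : μ.1 ∈ M.MSpace p g) : M.bform (M.trM p μ) (M.nfl p r) =
      M.domainBdryInt fun T i y => g (M.pt T i y) *
        inner ℝ (r.1 T (M.pt T i y)) (M.normal T i) :=
  Mesh.bform_eq_of_continuous (Mesh.mem_SigmaDivSpace.2 hr).2 hμ

end Div

/-! ### Diffusion tensors -/

section Tensor

variable {d : ℕ}

/-- The bilinear form of a matrix. -/
def matBil (B : Matrix (Fin d) (Fin d) ℝ) : Euc d →ₗ[ℝ] Euc d →ₗ[ℝ] ℝ :=
  LinearMap.mk₂ ℝ (matForm B)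
    (fun u u' v => by simp [matForm, add_dotProduct])
    (fun c u v => by simp [matForm, smul_dotProduct])
    (fun u v v' => by simp [matForm, Matrix.mulVec_add, dotProduct_add])
    (fun c u v => by simp [matForm, Matrix.mulVec_smul, dotProduct_smul])

theorem matForm_eq_inner (B : Matrix (Fin d) (Fin d) ℝ) (u v : Euc d) :
    matForm B u v = inner ℝ u (WithLp.toLp 2 (B.mulVec v.ofLp)) := by
  rw [inner_euc]
  rfl

theorem matForm_comm {B : Matrix (Fin d) (Fin d) ℝ} (hB : B.IsSymm) (u v : Euc d) :
    matForm B u v = matForm B v u := by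
  rw [matForm, Matrix.dotProduct_mulVec, ← Matrix.mulVec_transpose, hB.eq, dotProduct_comm, matForm]

/-- Symmetric matrices whose eigenvalues lie between `a` and `b`. -/
structure IsElliptic (a b : ℝ) (B : Matrix (Fin d) (Fin d) ℝ) : Prop where
  symm : B.IsSymm
  le : ∀ ξ : Euc d, a * ‖ξ‖ ^ 2 ≤ matForm B ξ ξ
  ge : ∀ ξ : Euc d, matForm B ξ ξ ≤ b * ‖ξ‖ ^ 2

theorem IsElliptic.sq_le {a b : ℝ} {B : Matrix (Fin d) (Fin d) ℝ} (h : IsElliptic a b B)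
    (ha : 0 < a) (u v : Euc d) : matForm B u v ^ 2 ≤ matForm B u u * matForm B v v :=
  LinearMap.BilinForm.apply_sq_le_of_symm (matBil B)
    (fun x => (mul_nonneg ha.le (sq_nonneg _)).trans (h.le x)) ⟨matForm_comm h.symm⟩ u v

/-- With `η = B⁻¹ u` one has `u · B⁻¹ u = η · B η`. The lower bound follows from `|u|⁴ = (u · B η)²
≤ (u · B u) (η · B η)`, the upper bound from `a |η|² ≤ u · η ≤ |u| |η|`. -/
theorem IsElliptic.inv {a b : ℝ} {B : Matrix (Fin d) (Fin d) ℝ} (h : IsElliptic a b B)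
    (ha : 0 < a) (hb : 0 < b) : IsElliptic b⁻¹ a⁻¹ B⁻¹ := by
  have hunit : IsUnit B := by
    rw [← Matrix.mulVec_injective_iff_isUnit]
    intro v w hvw
    have h1 := h.le (WithLp.toLp 2 (v - w))
    have h2 : matForm B (WithLp.toLp 2 (v - w)) (WithLp.toLp 2 (v - w)) = 0 := by
      simp only [matForm, Matrix.mulVec_sub, hvw, sub_self, dotProduct_zero]
    rw [h2] at h1
    have h3 : ‖WithLp.toLp 2 (v - w)‖ ^ 2 ≤ 0 := nonpos_of_mul_nonpos_right h1 ha
    have h4 : WithLp.toLp 2 (v - w) = 0 :=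
      norm_eq_zero.1 (pow_eq_zero_iff two_ne_zero |>.1 (le_antisymm h3 (sq_nonneg _)))
    exact sub_eq_zero.1 (congrArg WithLp.ofLp h4)
  have hdet : IsUnit B.det := (Matrix.isUnit_iff_isUnit_det B).1 hunit
  have key : ∀ u : Euc d, ∃ η : Euc d, matForm B⁻¹ u u = inner ℝ u η ∧
      matForm B η η = inner ℝ u η ∧ matForm B u η = ‖u‖ ^ 2 := fun u => by
    refine ⟨WithLp.toLp 2 (B⁻¹.mulVec u.ofLp), matForm_eq_inner _ _ _, ?_, ?_⟩
    · rw [matForm_eq_inner, Matrix.mulVec_mulVec, Matrix.mul_nonsing_inv _ hdet,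
        Matrix.one_mulVec, real_inner_comm]
    · rw [matForm_eq_inner, Matrix.mulVec_mulVec, Matrix.mul_nonsing_inv _ hdet,
        Matrix.one_mulVec, WithLp.toLp_ofLp, real_inner_self_eq_norm_sq]
  refine ⟨?_, fun u => ?_, fun u => ?_⟩
  · rw [Matrix.IsSymm, Matrix.transpose_nonsing_inv, h.symm.eq]
  · obtain ⟨η, h1, h2, h3⟩ := key u
    have h4 := h.sq_le ha u η
    rw [h3, h2, ← h1] at h4
    have h5 : 0 ≤ matForm B⁻¹ u u := by
      rw [h1, ← h2]
      exact (mul_nonneg ha.le (sq_nonneg _)).trans (h.le η)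
    rw [inv_mul_le_iff₀ hb]
    rcases (sq_nonneg ‖u‖).eq_or_lt with h6 | h6
    · rw [← h6]
      positivity
    · have h7 : ‖u‖ ^ 2 * ‖u‖ ^ 2 ≤ ‖u‖ ^ 2 * (b * matForm B⁻¹ u u) := by
        nlinarith [mul_le_mul_of_nonneg_right (h.ge u) h5]
      exact le_of_mul_le_mul_left h7 h6
  · obtain ⟨η, h1, h2, -⟩ := key u
    have h3 := h.le η
    rw [h2, ← h1] at h3
    have h4 : matForm B⁻¹ u u ≤ ‖u‖ * ‖η‖ := h1 ▸ real_inner_le_norm u η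
    rw [← div_eq_inv_mul, le_div_iff₀ ha]
    have h5 : 0 ≤ matForm B⁻¹ u u := (mul_nonneg ha.le (sq_nonneg _)).trans h3
    rcases h5.eq_or_lt with h6 | h6
    · rw [← h6, zero_mul]
      positivity
    · have h7 : matForm B⁻¹ u u * matForm B⁻¹ u u ≤ ‖u‖ ^ 2 * ‖η‖ ^ 2 := by
        rw [← mul_pow, sq (‖u‖ * ‖η‖)]
        exact mul_self_le_mul_self h5 h4
      have h8 : matForm B⁻¹ u u * (matForm B⁻¹ u u * a) ≤ matForm B⁻¹ u u * ‖u‖ ^ 2 := by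
        nlinarith [mul_le_mul_of_nonneg_left h3 (sq_nonneg ‖u‖),
          mul_le_mul_of_nonneg_left h7 ha.le]
      exact le_of_mul_le_mul_left h8 h6

/-- Measurable fields of symmetric matrices whose eigenvalues lie between `a` and `b`. -/
structure IsTensor (Ω : Set (Euc d)) (a b : ℝ) (B : Euc d → Matrix (Fin d) (Fin d) ℝ) : Prop where
  pos : 0 < a
  pos' : 0 < b
  measurable : ∀ i j, AEStronglyMeasurable (fun x => B x i j) (volume.restrict Ω)
  elliptic : ∀ᵐ x ∂volume.restrict Ω, IsElliptic a b (B x)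

theorem IsDiffusionTensor.isTensor {Ω : Set (Euc d)} {A : Euc d → Matrix (Fin d) (Fin d) ℝ}
    (hA : IsDiffusionTensor Ω A) : ∃ a b : ℝ, IsTensor Ω a b A := by
  obtain ⟨a, b, ha, h⟩ := hA.elliptic
  -- The given upper bound is enlarged so that it is visibly positive.
  refine ⟨a, max b 1, ha, zero_lt_one.trans_le (le_max_right _ _), hA.measurable, ?_⟩
  filter_upwards [h, hA.symm] with x hx hs
  exact ⟨hs, fun ξ => (hx ξ).1, fun ξ => (hx ξ).2.trans
    (mul_le_mul_of_nonneg_right (le_max_left _ _) (sq_nonneg _))⟩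

theorem IsTensor.inv {Ω : Set (Euc d)} {a b : ℝ} {B : Euc d → Matrix (Fin d) (Fin d) ℝ}
    (h : IsTensor Ω a b B) : IsTensor Ω b⁻¹ a⁻¹ (fun x => (B x)⁻¹) := by
  refine ⟨inv_pos.2 h.pos', inv_pos.2 h.pos, fun i j => ?_, ?_⟩
  · have h1 : AEMeasurable (fun x => fun i j => B x i j : Euc d → Fin d → Fin d → ℝ)
        (volume.restrict Ω) :=
      aemeasurable_pi_lambda _ fun i => aemeasurable_pi_lambda _ fun j =>
        (h.measurable i j).aemeasurable
    have h2 : Continuous fun C : Fin d → Fin d → ℝ => (Matrix.of C).det :=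
      Continuous.matrix_det (A := fun C : Fin d → Fin d → ℝ => Matrix.of C) continuous_id
    have h3 : Continuous fun C : Fin d → Fin d → ℝ => (Matrix.of C).adjugate i j :=
      (Continuous.matrix_adjugate (A := fun C : Fin d → Fin d → ℝ => Matrix.of C)
        continuous_id).matrix_elem i j
    -- By Cramer's rule an entry of the inverse is a cofactor divided by the determinant, hence
    -- measurable in the matrix without any invertibility assumption.
    have h4 : Measurable fun C : Fin d → Fin d → ℝ => (Matrix.of C)⁻¹ i j := by
      have h5 : (fun C : Fin d → Fin d → ℝ => (Matrix.of C)⁻¹ i j) =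
          fun C => ((Matrix.of C).det)⁻¹ * (Matrix.of C).adjugate i j := funext fun C => by
        rw [Matrix.inv_def, Matrix.smul_apply, Ring.inverse_eq_inv', smul_eq_mul]
      rw [h5]
      exact h2.measurable.inv.mul h3.measurable
    exact (h4.comp_aemeasurable h1).aestronglyMeasurable
  · filter_upwards [h.elliptic] with x hx
    exact hx.inv h.pos h.pos'

theorem aestronglyMeasurable_matForm {μ : Measure (Euc d)}
    {B : Euc d → Matrix (Fin d) (Fin d) ℝ}
    (hB : ∀ i j, AEStronglyMeasurable (fun x => B x i j) μ) {u v : Euc d → Euc d}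
    (hu : AEStronglyMeasurable u μ) (hv : AEStronglyMeasurable v μ) :
    AEStronglyMeasurable (fun x => matForm (B x) (u x) (v x)) μ := by
  have hc : ∀ {w : Euc d → Euc d} (_ : AEStronglyMeasurable w μ) (i : Fin d),
      AEStronglyMeasurable (fun x => w x i) μ := fun hw i =>
    (contDiff_coord (k := 0) i).continuous.comp_aestronglyMeasurable hw
  simp only [matForm, Matrix.mulVec, dotProduct]
  exact Finset.aestronglyMeasurable_fun_sum _ fun i _ => (hc hu i).mul
    (Finset.aestronglyMeasurable_fun_sum _ fun j _ => (hB i j).mul (hc hv j))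

end Tensor

section TensorForm

variable {κ : CellKind} {n : ℕ} {Ω : Set (Euc (n + 1))} {a b : ℝ}
  {B : Euc (n + 1) → Matrix (Fin (n + 1)) (Fin (n + 1)) ℝ}

theorem Mesh.integrable_matForm (M : Mesh κ n Ω) (hΩ : IsRegularDomain Ω) (hB : IsTensor Ω a b B)
    (T : M.Cell) {u v : Euc (n + 1) → Euc (n + 1)} (hu : MemLp u 2 (volume.restrict (M.cell T)))
    (hv : MemLp v 2 (volume.restrict (M.cell T))) :
    IntegrableOn (fun x => matForm (B x) (u x) (v x)) (M.cell T) := by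
  refine Integrable.mono' (g := fun x => b * (‖u x‖ ^ 2 + ‖v x‖ ^ 2))
    ((hu.norm.integrable_sq.add hv.norm.integrable_sq).const_mul b)
    (aestronglyMeasurable_matForm (fun i j => (hB.measurable i j).mono_measure
      (M.restrict_cell_le hΩ T)) hu.1 hv.1) ?_
  filter_upwards [M.ae_cell hΩ hB.elliptic T] with x hx
  have h1 := hx.sq_le hB.pos (u x) (v x)
  have h2 := mul_le_mul (hx.ge (u x)) (hx.ge (v x))
    ((mul_nonneg hB.pos.le (sq_nonneg _)).trans (hx.le _)) (mul_nonneg hB.pos'.le (sq_nonneg _))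
  rw [Real.norm_eq_abs]
  refine abs_le_of_sq_le_sq ?_ (mul_nonneg hB.pos'.le (by positivity))
  have h3 : 0 ≤ b ^ 2 * (‖u x‖ ^ 2 * ‖u x‖ ^ 2 + ‖v x‖ ^ 2 * ‖v x‖ ^ 2 + ‖u x‖ ^ 2 * ‖v x‖ ^ 2) := by
    positivity
  nlinarith

/-- The weighted `L²` inner product of broken fields. -/
def Mesh.matF (M : Mesh κ n Ω) (hΩ : IsRegularDomain Ω) (hB : IsTensor Ω a b B) :
    M.L2 (Euc (n + 1)) →ₗ[ℝ] M.L2 (Euc (n + 1)) →ₗ[ℝ] ℝ :=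
  LinearMap.mk₂ ℝ (fun q r => M.ipMat B q.1 r.1)
    (fun q q' r => by
      simp only [Mesh.ipMat, ← Finset.sum_add_distrib]
      refine Finset.sum_congr rfl fun T _ => ?_
      rw [← integral_add (M.integrable_matForm hΩ hB T (r.2 T) (q.2 T))
        (M.integrable_matForm hΩ hB T (r.2 T) (q'.2 T))]
      exact integral_congr_ae (ae_of_all _ fun x => map_add (matBil (B x) _) _ _))
    (fun c q r => by
      simp only [Mesh.ipMat, smul_eq_mul, Finset.mul_sum, ← integral_const_mul]
      refine Finset.sum_congr rfl fun T _ => ?_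
      exact integral_congr_ae (ae_of_all _ fun x => map_smul (matBil (B x) _) c _))
    (fun q r r' => by
      simp only [Mesh.ipMat, ← Finset.sum_add_distrib]
      refine Finset.sum_congr rfl fun T _ => ?_
      rw [← integral_add (M.integrable_matForm hΩ hB T (r.2 T) (q.2 T))
        (M.integrable_matForm hΩ hB T (r'.2 T) (q.2 T))]
      exact integral_congr_ae (ae_of_all _ fun x => LinearMap.map_add₂ (matBil (B x)) _ _ _))
    (fun c q r => by
      simp only [Mesh.ipMat, smul_eq_mul, Finset.mul_sum, ← integral_const_mul]
      refine Finset.sum_congr rfl fun T _ => ?_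
      exact integral_congr_ae (ae_of_all _ fun x => LinearMap.map_smul₂ (matBil (B x)) c _ _))

variable {M : Mesh κ n Ω} (hΩ : IsRegularDomain Ω) (hB : IsTensor Ω a b B)

theorem Mesh.matF_apply (q r : M.L2 (Euc (n + 1))) : M.matF hΩ hB q r = M.ipMat B q.1 r.1 := rfl

theorem Mesh.matF_comm (q r : M.L2 (Euc (n + 1))) : M.matF hΩ hB q r = M.matF hΩ hB r q := by
  simp only [M.matF_apply, Mesh.ipMat]
  refine Finset.sum_congr rfl fun T _ => integral_congr_ae ?_
  filter_upwards [M.ae_cell hΩ hB.elliptic T] with x hx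
  exact matForm_comm hx.symm _ _

theorem Mesh.le_matF (q : M.L2 (Euc (n + 1))) : a * M.form _ q q ≤ M.matF hΩ hB q q := by
  rw [M.matF_apply, Mesh.ipMat, M.form_self, Finset.mul_sum]
  refine Finset.sum_le_sum fun T _ => ?_
  rw [← integral_const_mul]
  refine integral_mono_ae ((q.2 T).norm.integrable_sq.const_mul a)
    (M.integrable_matForm hΩ hB T (q.2 T) (q.2 T)) ?_
  filter_upwards [M.ae_cell hΩ hB.elliptic T] with x hx
  exact hx.le _

theorem Mesh.matF_le (q : M.L2 (Euc (n + 1))) : M.matF hΩ hB q q ≤ b * M.form _ q q := by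
  rw [M.matF_apply, Mesh.ipMat, M.form_self, Finset.mul_sum]
  refine Finset.sum_le_sum fun T _ => ?_
  rw [← integral_const_mul]
  refine integral_mono_ae (M.integrable_matForm hΩ hB T (q.2 T) (q.2 T))
    ((q.2 T).norm.integrable_sq.const_mul b) ?_
  filter_upwards [M.ae_cell hΩ hB.elliptic T] with x hx
  exact hx.ge _

theorem Mesh.matF_self_nonneg (q : M.L2 (Euc (n + 1))) : 0 ≤ M.matF hΩ hB q q :=
  (mul_nonneg hB.pos.le (M.form_self_nonneg q)).trans (M.le_matF hΩ hB q)

theorem Mesh.matF_sq_le (q r : M.L2 (Euc (n + 1))) :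
    M.matF hΩ hB q r ^ 2 ≤ M.matF hΩ hB q q * M.matF hΩ hB r r :=
  LinearMap.BilinForm.apply_sq_le_of_symm (M.matF hΩ hB) (M.matF_self_nonneg hΩ hB)
    ⟨M.matF_comm hΩ hB⟩ q r

end TensorForm

/-! ### Definiteness on the finite element spaces -/

section Pos

variable {κ : CellKind} {n : ℕ} {Ω : Set (Euc (n + 1))} {M : Mesh κ n Ω} {p : ℕ}

theorem Mesh.eq_zero_of_form_eq_zero {V : Type*} [NormedAddCommGroup V] [InnerProductSpace ℝ V]
    {v : M.L2 V} (hv : ∀ T, Continuous (v.1 T)) (h : M.form V v v = 0) (T : M.Cell) :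
    ∀ x ∈ interior (M.cell T), v.1 T x = 0 := by
  rw [M.form_self, Finset.sum_eq_zero_iff_of_nonneg fun T _ => integral_nonneg fun x =>
    sq_nonneg _] at h
  intro x hx
  have h1 := eq_zero_of_setIntegral_eq_zero (M.isCompact_cell T) (f := fun x => ‖v.1 T x‖ ^ 2)
    ((hv T).norm.pow 2) (fun x => sq_nonneg _) (h T (Finset.mem_univ T)) x hx
  exact norm_eq_zero.1 (pow_eq_zero_iff two_ne_zero |>.1 h1)

theorem Mesh.eq_zero_of_forall_interior {v : M.Cell → Euc (n + 1) → ℝ} (hv : v ∈ M.VSub p)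
    (h : ∀ T, ∀ x ∈ interior (M.cell T), v T x = 0) : v = 0 := by
  refine funext fun T => funext fun x => ?_
  rw [M.eq_pull T v, eq_zero_of_mem_polySub (Mesh.mem_VSub.1 hv T) (isOpen_refOpen κ _)
    (refOpen_nonempty κ _) (fun y hy => h T _ (M.mem_interior_cell.2 (by simpa using hy)))]
  rfl

theorem Mesh.eq_zero_of_formV {v : M.VSub p} (h : M.form ℝ (M.incV p v) (M.incV p v) = 0) :
    v = 0 :=
  Subtype.ext (Mesh.eq_zero_of_forall_interior v.2 (Mesh.eq_zero_of_form_eq_zero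
    (fun T => (Mesh.contDiff_V v.2 T (k := 0)).continuous) h))

theorem Mesh.eq_zero_of_formS {r : M.SigSub p} (h : M.form _ (M.incS p r) (M.incS p r) = 0) :
    r = 0 := by
  have h1 := Mesh.eq_zero_of_form_eq_zero
    (fun T => (Mesh.contDiff_Sig r.2 T (k := 0)).continuous) h
  refine Subtype.ext (funext fun T => funext fun x => ?_)
  rw [M.eq_piola T r.1, eq_zero_of_mem_rtSub (Mesh.mem_SigSub.1 r.2 T) (isOpen_refOpen κ _)
    (refOpen_nonempty κ _) (fun y hy => ?_)]
  · simp
  · change M.jac T • (M.cellMap T).linear.symm (r.1 T _) = 0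
    have h2 : r.1 T (M.cellMap T y) = 0 :=
      h1 T _ (M.mem_interior_cell.2 (by simpa using hy))
    rw [h2, map_zero, smul_zero]

end Pos

end

/-! ### Measurability, monotonicity and the convex potential of `𝒰`. -/

section

/-! ### Superposition operators -/

section Caratheodory

variable {E : Type*} [MeasurableSpace E] {μ : Measure E} {Υ : E → ℝ → ℝ}

/-- For a simple function the superposition is a finite sum of measurable pieces; continuity in the
second variable passes to pointwise limits. -/
theorem aestronglyMeasurable_superpose (hc : ∀ᵐ x ∂μ, Continuous (Υ x))
    (hm : ∀ z, AEStronglyMeasurable (fun x => Υ x z) μ) {h : E → ℝ} (hh : StronglyMeasurable h) :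
    AEStronglyMeasurable (fun x => Υ x (h x)) μ := by
  have hs : ∀ s : SimpleFunc E ℝ, AEStronglyMeasurable (fun x => Υ x (s x)) μ := fun s => by
    have h1 : (fun x => Υ x (s x)) =
        fun x => ∑ z ∈ s.range, (s ⁻¹' {z}).indicator (fun x => Υ x z) x := by
      funext x
      rw [Finset.sum_eq_single (s x)]
      · rw [indicator_of_mem (by exact rfl)]
      · intro z _ hz
        exact indicator_of_notMem (fun hx => hz hx.symm) _
      · exact fun hx => absurd (s.mem_range_self x) hx
    rw [h1]
    exact Finset.aestronglyMeasurable_fun_sum _ fun z _ =>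
      (hm z).indicator (s.measurableSet_fiber z)
  refine aestronglyMeasurable_of_tendsto_ae atTop (fun k => hs (hh.approx k)) ?_
  filter_upwards [hc] with x hx
  exact (hx.tendsto (h x)).comp (hh.tendsto_approx x)

/-- On bounded arguments a monotone function is dominated by its two extreme values. Integrability
of `Υ(·, z)` for constants `z` thus supplies an `L^1` majorant for every bounded argument. -/
theorem abs_le_of_monotone {f : ℝ → ℝ} (hf : Monotone f) {m z : ℝ} (hz : |z| ≤ m) :
    |f z| ≤ |f m| + |f (-m)| := by
  have h1 := hf (abs_le.1 hz).1
  have h2 := hf (abs_le.1 hz).2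
  rw [abs_le]
  constructor
  · linarith [neg_abs_le (f (-m)), abs_nonneg (f m)]
  · linarith [le_abs_self (f m), abs_nonneg (f (-m))]

/-- The primitive of an increasing function is convex, with that function as subgradient. -/
theorem subgradient_integral {f : ℝ → ℝ} (hf : Monotone f) (hc : Continuous f) (y z : ℝ) :
    (∫ t in (0 : ℝ)..z, f t) + f z * (y - z) ≤ ∫ t in (0 : ℝ)..y, f t := by
  have hi : ∀ a b, IntervalIntegrable f volume a b := fun a b => hc.intervalIntegrable a b
  have h1 := intervalIntegral.integral_add_adjacent_intervals (hi 0 z) (hi z y)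
  rw [← h1, add_le_add_iff_left]
  rcases le_total z y with h | h
  · have h2 := intervalIntegral.integral_mono_on h (f := fun _ => f z) (by simp) (hi z y)
      fun t ht => hf ht.1
    rw [intervalIntegral.integral_const, smul_eq_mul] at h2
    linarith
  · have h2 := intervalIntegral.integral_mono_on h (g := fun _ => f z) (hi y z) (by simp)
      fun t ht => hf ht.2
    rw [intervalIntegral.integral_const, smul_eq_mul] at h2
    rw [intervalIntegral.integral_symm]
    linarith

end Caratheodory

section Superpose

variable {κ : CellKind} {n : ℕ} {Ω : Set (Euc (n + 1))} {M : Mesh κ n Ω} {p : ℕ}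
  {lo hi : Euc (n + 1) → EReal} {Υ : Euc (n + 1) → ℝ → ℝ}

theorem Mesh.exists_bound_V (v : M.VSub p) (T : M.Cell) : ∃ m : ℝ, 0 ≤ m ∧
    ∀ x ∈ M.cell T, |v.1 T x| ≤ m := by
  obtain ⟨m, hm⟩ := (M.isCompact_cell T).exists_bound_of_continuousOn
    (Mesh.contDiff_V v.2 T (k := 0)).continuous.continuousOn
  exact ⟨max m 0, le_max_right _ _, fun x hx => (hm x hx).trans (le_max_left _ _)⟩

theorem Mesh.continuous_V (v : M.VSub p) (T : M.Cell) : Continuous (v.1 T) :=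
  (Mesh.contDiff_V v.2 T (k := 0)).continuous

theorem Mesh.integrable_latent (hΩ : IsRegularDomain Ω)
    (hΥ : IsLatentMap Ω lo hi Υ) (T : M.Cell) (z : ℝ) : IntegrableOn (fun x => Υ x z) (M.cell T) :=
  (hΥ.integrable z).mono_measure (M.restrict_cell_le hΩ T)

theorem Mesh.ae_superpose_le (hΩ : IsRegularDomain Ω)
    (hΥ : IsLatentMap Ω lo hi Υ) (ψ : M.VSub p) (T : M.Cell) {m : ℝ}
    (hm : ∀ x ∈ M.cell T, |ψ.1 T x| ≤ m) : ∀ᵐ x ∂volume.restrict (M.cell T),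
      |Υ x (ψ.1 T x)| ≤ |Υ x m| + |Υ x (-m)| := by
  filter_upwards [M.ae_cell hΩ hΥ.strictMono T, ae_restrict_mem (M.measurableSet_cell T)]
    with x hx hxT
  exact abs_le_of_monotone hx.monotone (hm x hxT)

theorem Mesh.aestronglyMeasurable_superpose (hΩ : IsRegularDomain Ω)
    (hΥ : IsLatentMap Ω lo hi Υ) (ψ : M.VSub p) (T : M.Cell) :
    AEStronglyMeasurable (fun x => Υ x (ψ.1 T x)) (volume.restrict (M.cell T)) :=
  FOSPG.aestronglyMeasurable_superpose (M.ae_cell hΩ hΥ.continuous T)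
    (fun z => (Mesh.integrable_latent hΩ hΥ T z).1) (Mesh.continuous_V ψ T).stronglyMeasurable

theorem Mesh.integrable_superpose (hΩ : IsRegularDomain Ω)
    (hΥ : IsLatentMap Ω lo hi Υ) (ψ : M.VSub p) (T : M.Cell) :
    IntegrableOn (fun x => Υ x (ψ.1 T x)) (M.cell T) := by
  obtain ⟨m, -, hm⟩ := Mesh.exists_bound_V ψ T
  exact ((Mesh.integrable_latent hΩ hΥ T m).abs.add
    (Mesh.integrable_latent hΩ hΥ T (-m)).abs).mono'
    (Mesh.aestronglyMeasurable_superpose hΩ hΥ ψ T) (Mesh.ae_superpose_le hΩ hΥ ψ T hm)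

theorem Mesh.integrable_superpose_mul (hΩ : IsRegularDomain Ω)
    (hΥ : IsLatentMap Ω lo hi Υ) (ψ w : M.VSub p) (T : M.Cell) :
    IntegrableOn (fun x => Υ x (ψ.1 T x) * w.1 T x) (M.cell T) := by
  obtain ⟨m, -, hm⟩ := Mesh.exists_bound_V w T
  exact (Mesh.integrable_superpose hΩ hΥ ψ T).mul_bdd (c := m)
    (Mesh.continuous_V w T).aestronglyMeasurable
    ((ae_restrict_iff' (M.measurableSet_cell T)).2 (ae_of_all _ hm))

/-- The superposition operator as a map from `V_h^p` to its dual. -/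
def Mesh.superU (hΩ : IsRegularDomain Ω)
    (hΥ : IsLatentMap Ω lo hi Υ) (ψ : M.VSub p) : M.VSub p →ₗ[ℝ] ℝ where
  toFun w := M.ip (M.superpose Υ ψ.1) w.1
  map_add' v w := by
    simp only [Mesh.ip, ← Finset.sum_add_distrib]
    refine Finset.sum_congr rfl fun T _ => ?_
    refine Eq.trans ?_ (integral_add (Mesh.integrable_superpose_mul hΩ hΥ ψ v T)
      (Mesh.integrable_superpose_mul hΩ hΥ ψ w T))
    exact integral_congr_ae (ae_of_all _ fun x => mul_add _ _ _)
  map_smul' c w := by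
    simp only [Mesh.ip, RingHom.id_apply, smul_eq_mul, Finset.mul_sum, ← integral_const_mul]
    refine Finset.sum_congr rfl fun T _ => ?_
    exact integral_congr_ae (ae_of_all _ fun x => mul_left_comm _ _ _)

theorem Mesh.superU_apply (hΩ : IsRegularDomain Ω)
    (hΥ : IsLatentMap Ω lo hi Υ) (ψ w : M.VSub p) :
    Mesh.superU hΩ hΥ ψ w = ∑ T, ∫ x in M.cell T, Υ x (ψ.1 T x) * w.1 T x := rfl

theorem Mesh.superU_sub_nonneg (hΩ : IsRegularDomain Ω)
    (hΥ : IsLatentMap Ω lo hi Υ) (ψ φ : M.VSub p) :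
    0 ≤ Mesh.superU hΩ hΥ ψ (ψ - φ) - Mesh.superU hΩ hΥ φ (ψ - φ) := by
  rw [Mesh.superU_apply, Mesh.superU_apply, ← Finset.sum_sub_distrib]
  refine Finset.sum_nonneg fun T _ => ?_
  rw [← integral_sub (Mesh.integrable_superpose_mul hΩ hΥ _ _ T)
    (Mesh.integrable_superpose_mul hΩ hΥ _ _ T)]
  refine integral_nonneg_of_ae ?_
  filter_upwards [M.ae_cell hΩ hΥ.strictMono T] with x hx
  change 0 ≤ Υ x (ψ.1 T x) * (ψ.1 T x - φ.1 T x) - Υ x (φ.1 T x) * (ψ.1 T x - φ.1 T x)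
  rcases le_total (ψ.1 T x) (φ.1 T x) with h | h
  · nlinarith [hx.monotone h]
  · nlinarith [hx.monotone h]

/-- The integrand `(Υ(x, ψ) - Υ(x, φ)) (ψ - φ)` is nonnegative and has vanishing integral. Strict
monotonicity gives equality almost everywhere, and elements of `V_h^p` that agree almost everywhere
on the elements coincide as polynomials. -/
theorem Mesh.eq_of_superU_sub_le (hΩ : IsRegularDomain Ω)
    (hΥ : IsLatentMap Ω lo hi Υ) {ψ φ : M.VSub p}
    (h : Mesh.superU hΩ hΥ ψ (ψ - φ) - Mesh.superU hΩ hΥ φ (ψ - φ) ≤ 0) : ψ = φ := by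
  rw [Mesh.superU_apply, Mesh.superU_apply, ← Finset.sum_sub_distrib] at h
  have hnn : ∀ T, 0 ≤ᵐ[volume.restrict (M.cell T)] fun x =>
      Υ x (ψ.1 T x) * (ψ - φ).1 T x - Υ x (φ.1 T x) * (ψ - φ).1 T x := fun T => by
    filter_upwards [M.ae_cell hΩ hΥ.strictMono T] with x hx
    change 0 ≤ Υ x (ψ.1 T x) * (ψ.1 T x - φ.1 T x) - Υ x (φ.1 T x) * (ψ.1 T x - φ.1 T x)
    rcases le_total (ψ.1 T x) (φ.1 T x) with h | h
    · nlinarith [hx.monotone h]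
    · nlinarith [hx.monotone h]
  have hint : ∀ T, IntegrableOn (fun x =>
      Υ x (ψ.1 T x) * (ψ - φ).1 T x - Υ x (φ.1 T x) * (ψ - φ).1 T x) (M.cell T) := fun T =>
    (Mesh.integrable_superpose_mul hΩ hΥ _ _ T).sub (Mesh.integrable_superpose_mul hΩ hΥ _ _ T)
  simp only [← integral_sub (Mesh.integrable_superpose_mul hΩ hΥ _ _ _)
    (Mesh.integrable_superpose_mul hΩ hΥ _ _ _)] at h
  have h1 := (Finset.sum_eq_zero_iff_of_nonneg fun T _ => integral_nonneg_of_ae (hnn T)).1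
    (le_antisymm h (Finset.sum_nonneg fun T _ => integral_nonneg_of_ae (hnn T)))
  have h2 : ∀ T, (ψ - φ).1 T =ᵐ[volume.restrict (M.cell T)] 0 := fun T => by
    have h3 := (integral_eq_zero_iff_of_nonneg_ae (hnn T) (hint T)).1 (h1 T (Finset.mem_univ T))
    filter_upwards [h3, M.ae_cell hΩ hΥ.strictMono T] with x hx hxm
    have h4 : (Υ x (ψ.1 T x) - Υ x (φ.1 T x)) * (ψ.1 T x - φ.1 T x) = 0 :=
      (sub_mul _ _ _).trans hx
    rcases mul_eq_zero.1 h4 with h5 | h5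
    · exact sub_eq_zero.2 (hxm.injective (sub_eq_zero.1 h5))
    · exact h5
  refine sub_eq_zero.1 (Mesh.eq_zero_of_formV ?_)
  rw [M.form_self]
  refine Finset.sum_eq_zero fun T _ => integral_eq_zero_of_ae ?_
  filter_upwards [h2 T] with x hx
  change ‖(ψ - φ).1 T x‖ ^ 2 = 0
  rw [hx, Pi.zero_apply, norm_zero, zero_pow two_ne_zero]

/-- Dominated convergence. For `0 < t < 1` the arguments stay in a fixed bounded interval, whose end
points provide the majorant. -/
theorem Mesh.tendsto_superU (hΩ : IsRegularDomain Ω)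
    (hΥ : IsLatentMap Ω lo hi Υ) (ψ η w : M.VSub p) :
    Tendsto (fun t : ℝ => Mesh.superU hΩ hΥ (ψ + t • η) w) (𝓝[>] 0)
      (𝓝 (Mesh.superU hΩ hΥ ψ w)) := by
  simp only [Mesh.superU_apply]
  refine tendsto_finsetSum _ fun T _ => ?_
  obtain ⟨m₁, hm₁0, hm₁⟩ := Mesh.exists_bound_V ψ T
  obtain ⟨m₂, hm₂0, hm₂⟩ := Mesh.exists_bound_V η T
  obtain ⟨m₃, hm₃0, hm₃⟩ := Mesh.exists_bound_V w T
  refine tendsto_integral_filter_of_dominated_convergence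
    (fun x => (|Υ x (m₁ + m₂)| + |Υ x (-(m₁ + m₂))|) * m₃)
    (Eventually.of_forall fun t => (Mesh.integrable_superpose_mul hΩ hΥ _ _ T).1) ?_
    (((Mesh.integrable_latent hΩ hΥ T _).abs.add
      (Mesh.integrable_latent hΩ hΥ T _).abs).mul_const _) ?_
  · have h1 : ∀ᶠ t : ℝ in 𝓝[>] 0, t ∈ Ioo (0 : ℝ) 1 := Ioo_mem_nhdsGT one_pos
    filter_upwards [h1] with t ht
    have hb : ∀ x ∈ M.cell T, |(ψ + t • η).1 T x| ≤ m₁ + m₂ := fun x hx => by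
      change |ψ.1 T x + t * η.1 T x| ≤ _
      refine (abs_add_le _ _).trans (add_le_add (hm₁ x hx) ?_)
      rw [abs_mul, abs_of_pos ht.1]
      exact (mul_le_of_le_one_left (abs_nonneg _) ht.2.le).trans (hm₂ x hx)
    filter_upwards [Mesh.ae_superpose_le hΩ hΥ _ T hb, ae_restrict_mem (M.measurableSet_cell T)]
      with x hx hxT
    rw [Real.norm_eq_abs, abs_mul]
    exact mul_le_mul hx (hm₃ x hxT) (abs_nonneg _) (by positivity)
  · filter_upwards [M.ae_cell hΩ hΥ.continuous T] with x hx
    have h1 : Continuous fun t : ℝ => Υ x (ψ.1 T x + t * η.1 T x) * w.1 T x := by fun_prop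
    have h2 := (h1.tendsto 0).mono_left (nhdsWithin_le_nhds (s := Ioi 0))
    simp only [zero_mul, add_zero] at h2
    exact h2

/-- The potential of the superposition operator. -/
theorem Mesh.exists_potential (hΩ : IsRegularDomain Ω)
    (hΥ : IsLatentMap Ω lo hi Υ) : ∃ E : M.VSub p → ℝ, ∀ ψ φ : M.VSub p,
    E ψ + Mesh.superU hΩ hΥ ψ (φ - ψ) ≤ E φ := by
  have hmeas : ∀ (ψ : M.VSub p) T, AEStronglyMeasurable
      (fun x => ∫ t in (0 : ℝ)..ψ.1 T x, Υ x t) (volume.restrict (M.cell T)) := fun ψ T => by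
    -- The upper limit depends on `x`. Rescaling to the unit interval exhibits the function as a
    -- partial integral of a jointly measurable function, namely a superposition on the product
    -- space.
    have h1 : (fun x => ∫ t in (0 : ℝ)..ψ.1 T x, Υ x t) =
        fun x => ∫ t in Ioc (0 : ℝ) 1, ψ.1 T x * Υ x (t * ψ.1 T x) := by
      funext x
      rw [integral_const_mul, ← intervalIntegral.integral_of_le zero_le_one,
        intervalIntegral.mul_integral_comp_mul_right, zero_mul, one_mul]
    rw [h1]
    refine AEStronglyMeasurable.integral_prod_right'
      (f := fun z : Euc (n + 1) × ℝ => ψ.1 T z.1 * Υ z.1 (z.2 * ψ.1 T z.1)) ?_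
    have hψ := Mesh.continuous_V ψ T
    refine (hψ.comp continuous_fst).aestronglyMeasurable.mul ?_
    refine FOSPG.aestronglyMeasurable_superpose (Υ := fun z : Euc (n + 1) × ℝ => Υ z.1)
      (Measure.quasiMeasurePreserving_fst.ae (M.ae_cell hΩ hΥ.continuous T))
      (fun c => (Mesh.integrable_latent hΩ hΥ T c).1.comp_fst) ?_
    exact (continuous_snd.mul (hψ.comp continuous_fst)).stronglyMeasurable
  have hint : ∀ (ψ : M.VSub p) T, IntegrableOn
      (fun x => ∫ t in (0 : ℝ)..ψ.1 T x, Υ x t) (M.cell T) := fun ψ T => by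
    obtain ⟨m, hm0, hm⟩ := Mesh.exists_bound_V ψ T
    refine (((Mesh.integrable_latent hΩ hΥ T m).abs.add
      (Mesh.integrable_latent hΩ hΥ T (-m)).abs).mul_const m).mono' (hmeas ψ T) ?_
    filter_upwards [M.ae_cell hΩ hΥ.strictMono T, ae_restrict_mem (M.measurableSet_cell T)]
      with x hx hxT
    have h1 := intervalIntegral.norm_integral_le_of_norm_le_const (a := 0) (b := ψ.1 T x)
      (f := Υ x) (C := |Υ x m| + |Υ x (-m)|) (fun t ht => by
        refine abs_le_of_monotone hx.monotone ((?_ : |t| ≤ |ψ.1 T x|).trans (hm x hxT))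
        have h2 := abs_sub_left_of_mem_uIcc (uIoc_subset_uIcc ht)
        simpa using h2)
    refine h1.trans ?_
    rw [sub_zero]
    exact mul_le_mul_of_nonneg_left (hm x hxT) (by positivity)
  refine ⟨fun ψ => ∑ T, ∫ x in M.cell T, ∫ t in (0 : ℝ)..ψ.1 T x, Υ x t, fun ψ φ => ?_⟩
  rw [Mesh.superU_apply, ← Finset.sum_add_distrib]
  refine Finset.sum_le_sum fun T _ => ?_
  rw [← integral_add (hint ψ T) (Mesh.integrable_superpose_mul hΩ hΥ _ _ T)]
  refine integral_mono_ae ((hint ψ T).add (Mesh.integrable_superpose_mul hΩ hΥ _ _ T))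
    (hint φ T) ?_
  filter_upwards [M.ae_cell hΩ hΥ.strictMono T, M.ae_cell hΩ hΥ.continuous T] with x hx hxc
  exact subgradient_integral hx.monotone hxc _ _

end Superpose

end

/-! ### Solvability of the mixed problem and recovery of the facet unknown. -/

section

variable {κ : CellKind} {n : ℕ} {Ω : Set (Euc (n + 1))} {M : Mesh κ n Ω} {p : ℕ}

/-! ### Fields with prescribed normal traces -/

variable (M) in
/-- The field of `Σ_h^p` with given Piola pull-backs. -/
def Mesh.mkSig (w : M.Cell → Euc (n + 1) → Euc (n + 1)) :
    M.Cell → Euc (n + 1) → Euc (n + 1) :=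
  fun T x => (M.jac T)⁻¹ • (M.cellMap T).linear (w T ((M.cellMap T).symm x))

theorem Mesh.piola_mkSig (w : M.Cell → Euc (n + 1) → Euc (n + 1)) (T : M.Cell) :
    M.piola T (M.mkSig w) = w T := funext fun y => by
  change M.jac T • (M.cellMap T).linear.symm ((M.jac T)⁻¹ • (M.cellMap T).linear
    (w T ((M.cellMap T).symm (M.cellMap T y)))) = _
  rw [AffineEquiv.symm_apply_apply, map_smul, LinearEquiv.symm_apply_apply, smul_smul,
    mul_inv_cancel₀ (M.jac_ne_zero T), one_smul]

theorem Mesh.mkSig_mem {w : M.Cell → Euc (n + 1) → Euc (n + 1)}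
    (hw : ∀ T, w T ∈ rtSub κ (n + 1) p) : M.mkSig w ∈ M.SigSub p :=
  Mesh.mem_SigSub.2 fun T => by rw [Mesh.piola_mkSig]; exact hw T

theorem Mesh.comp_aut_symm_mem {e : Euc n → ℝ} (he : e ∈ polySub κ n p) (T : M.Cell)
    (i : LocalFacet κ (n + 1)) : (fun y => e ((M.aut T i).symm y)) ∈ polySub κ n p := by
  refine (isCellMap_aut (σ := (M.aut T i).symm) ?_).comp_mem he
  have h := M.image_aut T i
  conv_lhs => rw [← h]
  ext y
  constructor
  · rintro ⟨_, ⟨z, hz, rfl⟩, rfl⟩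
    rwa [AffineEquiv.symm_apply_apply]
  · exact fun hy => ⟨_, mem_image_of_mem _ hy, AffineEquiv.symm_apply_apply _ y⟩

/-- Fields in `Σ_h^p` need not be continuous, so the normal trace on one side of one facet can be
prescribed while all others vanish. -/
theorem Mesh.exists_Sig_extension (T : M.Cell) (i : LocalFacet κ (n + 1)) {e : Euc n → ℝ}
    (he : e ∈ polySub κ n p) : ∃ r : M.SigSub p, (M.nfl p r).1 T i = e ∧
      ∀ T' i', (T', i') ≠ (T, i) → (M.nfl p r).1 T' i' = 0 := by
  classical
  -- The factor undoes the Piola scaling and the normalization of the normal in `Mesh.nfl_eq`; the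
  -- inverse automorphism undoes the change of facet parameters.
  obtain ⟨w, hw, h1, h2⟩ := exists_rt_extension i (smul_mem_polySub_ite
    (Mesh.comp_aut_symm_mem he T i) (M.jac T * ‖M.nvec T i‖))
  refine ⟨⟨M.mkSig fun T' => if T' = T then w else 0, Mesh.mkSig_mem fun T' => ?_⟩, ?_, ?_⟩
  · split_ifs
    · exact hw
    · exact Submodule.zero_mem _
  · funext y
    rw [Mesh.nfl_eq, Mesh.piola_mkSig, if_pos rfl, h1, AffineEquiv.symm_apply_apply]
    have := M.jac_ne_zero T
    have := (M.norm_nvec_pos T i).ne'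
    field_simp
  · intro T' i' hne
    funext y
    rw [Mesh.nfl_eq, Mesh.piola_mkSig]
    by_cases hT : T' = T
    · subst hT
      rw [if_pos rfl, h2 i' fun h => hne (by rw [h]), mul_zero]
      rfl
    · rw [if_neg hT, Pi.zero_apply, inner_zero_left, mul_zero]
      rfl

/-- A flux whose only normal trace is `μ` itself, on one side of one facet, isolates the square of
`μ` there. -/
theorem Mesh.eq_zero_of_bform {μ : M.MSub p}
    (h : ∀ r, M.bform (M.trM p μ) (M.nfl p r) = 0) : μ = 0 := by
  refine Subtype.ext (funext fun F => ?_)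
  obtain ⟨T, i, rfl⟩ := M.facet_surj F
  have he := Mesh.mem_MSub.1 μ.2 (M.facetOf T i)
  obtain ⟨r, hr, hr'⟩ := Mesh.exists_Sig_extension T i he
  refine eq_zero_of_facetInt_sq (F := M.facetOf T i) he ?_
  rw [← h r]
  have h1 : M.bform (M.trM p μ) (M.nfl p r) = ∑ T', ∑ i', M.facetInt (M.facetOf T' i')
      fun y => μ.1 (M.facetOf T' i') y * (M.nfl p r).1 T' i' y := rfl
  rw [h1, ← Fintype.sum_prod_type' (f := fun T' i' => M.facetInt (M.facetOf T' i')
      fun y => μ.1 (M.facetOf T' i') y * (M.nfl p r).1 T' i' y),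
    Finset.sum_eq_single (T, i) (fun s _ hs => ?_) (fun h => absurd (Finset.mem_univ _) h)]
  · simp only [hr]
  · rw [hr' s.1 s.2 hs]
    simp [M.facetInt_def]

/-! ### Existence and uniqueness -/

variable (M p) in
/-- The `L²` inner product of `V_h^p`. -/
def Mesh.fV : M.VSub p →ₗ[ℝ] M.VSub p →ₗ[ℝ] ℝ := (M.form ℝ).compl₁₂ (M.incV p) (M.incV p)

theorem Mesh.fV_apply (v w : M.VSub p) : M.fV p v w = M.form ℝ (M.incV p v) (M.incV p w) := rfl

theorem Mesh.fV_eq (v w : M.VSub p) : M.fV p v w = M.ip v.1 w.1 := M.form_eq_ip _ _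

theorem Mesh.fV_comm (v w : M.VSub p) : M.fV p v w = M.fV p w v := M.form_comm _ _

theorem Mesh.exists_fV_eq (ℓ : M.VSub p →ₗ[ℝ] ℝ) : ∃ v, ∀ w, M.fV p v w = ℓ w :=
  exists_riesz _ (fun _ h => Mesh.eq_zero_of_formV h) ℓ

variable {a b : ℝ} {B : Euc (n + 1) → Matrix (Fin (n + 1)) (Fin (n + 1)) ℝ}
  {lo hi : Euc (n + 1) → EReal} {Υ : Euc (n + 1) → ℝ → ℝ}
  (hΩ : IsRegularDomain Ω) (hB : IsTensor Ω a b B) (hΥ : IsLatentMap Ω lo hi Υ)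

variable (M p) in
/-- The weighted inner product of `Σ_h^p`. -/
def Mesh.mS : M.SigSub p →ₗ[ℝ] M.SigSub p →ₗ[ℝ] ℝ :=
  (M.matF hΩ hB).compl₁₂ (M.incS p) (M.incS p)

theorem Mesh.mS_apply (q r : M.SigSub p) :
    M.mS p hΩ hB q r = M.matF hΩ hB (M.incS p q) (M.incS p r) := rfl

theorem Mesh.mS_eq (q r : M.SigSub p) : M.mS p hΩ hB q r = M.ipMat B q.1 r.1 := rfl

theorem Mesh.mS_comm (q r : M.SigSub p) : M.mS p hΩ hB q r = M.mS p hΩ hB r q :=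
  M.matF_comm hΩ hB _ _

theorem Mesh.mS_self_nonneg (q : M.SigSub p) : 0 ≤ M.mS p hΩ hB q q :=
  M.matF_self_nonneg hΩ hB _

theorem Mesh.eq_zero_of_mS {q : M.SigSub p} (h : M.mS p hΩ hB q q = 0) : q = 0 := by
  refine Mesh.eq_zero_of_formS (le_antisymm ?_ (M.form_self_nonneg _))
  have h1 := M.le_matF hΩ hB (M.incS p q)
  rw [← M.mS_apply hΩ hB, h] at h1
  exact nonpos_of_mul_nonpos_right h1 hB.pos

theorem Mesh.mS_pos {q : M.SigSub p} (h : q ≠ 0) : 0 < M.mS p hΩ hB q q :=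
  lt_of_le_of_ne (M.mS_self_nonneg hΩ hB q) fun h0 => h (M.eq_zero_of_mS hΩ hB h0.symm)

/-- The mixed subproblem with general right-hand sides. -/
structure Mesh.IsMixedSol (α : ℝ) (ℓ : M.VSub p →ₗ[ℝ] ℝ) (G : M.SigSub p → ℝ)
    (q : M.SigSub p) (u ψ : M.VSub p) : Prop where
  mem : q ∈ M.SDiv p
  balance : ∀ v, α * M.fV p (M.divS p q) v + M.fV p ψ v = ℓ v
  flux : ∀ r ∈ M.SDiv p, M.mS p hΩ hB q r - M.fV p (M.divS p r) u = G r
  latent : ∀ w, M.fV p u w = Mesh.superU hΩ hΥ ψ w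

/-- For the differences the three equations combine to `α (A⁻¹ δq, δq) + (𝒰(ψ) - 𝒰(ψ'), ψ - ψ') = 0`
with two nonnegative terms; here the weight `A⁻¹` is `B`. The second term settles `ψ`, the first
`q`, and the latent equation then `u`. -/
theorem Mesh.IsMixedSol.unique {α : ℝ} (hα : 0 < α) {ℓ : M.VSub p →ₗ[ℝ] ℝ}
    {G : M.SigSub p → ℝ} {q q' : M.SigSub p} {u u' ψ ψ' : M.VSub p}
    (h : Mesh.IsMixedSol hΩ hB hΥ α ℓ G q u ψ) (h' : Mesh.IsMixedSol hΩ hB hΥ α ℓ G q' u' ψ') :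
    q' = q ∧ u' = u ∧ ψ' = ψ := by
  have h1 := h.flux (q - q') (Submodule.sub_mem _ h.mem h'.mem)
  have h2 := h'.flux (q - q') (Submodule.sub_mem _ h.mem h'.mem)
  have h3 := h.balance (u - u')
  have h4 := h'.balance (u - u')
  have h5 := h.latent (ψ - ψ')
  have h6 := h'.latent (ψ - ψ')
  have e1 : M.mS p hΩ hB (q - q') (q - q') = M.fV p (M.divS p (q - q')) (u - u') := by
    rw [map_sub (M.fV p (M.divS p (q - q'))), map_sub (M.mS p hΩ hB) q q', LinearMap.sub_apply]
    linarith
  have e2 : α * M.fV p (M.divS p (q - q')) (u - u') + M.fV p (ψ - ψ') (u - u') = 0 := by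
    rw [map_sub (M.divS p) q q', map_sub (M.fV p), map_sub (M.fV p) ψ ψ', LinearMap.sub_apply,
      LinearMap.sub_apply]
    linarith
  have e3 : M.fV p (ψ - ψ') (u - u') =
      Mesh.superU hΩ hΥ ψ (ψ - ψ') - Mesh.superU hΩ hΥ ψ' (ψ - ψ') := by
    rw [M.fV_comm, map_sub (M.fV p) u u', LinearMap.sub_apply, h5, h6]
  have e4 := M.superU_sub_nonneg hΩ hΥ ψ ψ'
  have e5 := mul_nonneg hα.le (M.mS_self_nonneg hΩ hB (q - q'))
  have hψ : ψ = ψ' := M.eq_of_superU_sub_le hΩ hΥ (by rw [← e3]; nlinarith)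
  have hq : q - q' = 0 := M.eq_zero_of_mS hΩ hB (by
    have h7 : α * M.mS p hΩ hB (q - q') (q - q') = 0 := by
      refine le_antisymm ?_ e5
      rw [e1]
      linarith
    exact (mul_eq_zero.1 h7).resolve_left hα.ne')
  have hu : u - u' = 0 := by
    refine Mesh.eq_zero_of_formV ?_
    rw [← M.fV_apply, map_sub (M.fV p) u u', LinearMap.sub_apply, h.latent, h'.latent, hψ, sub_self]
  exact ⟨(sub_eq_zero.1 hq).symm, (sub_eq_zero.1 hu).symm, hψ.symm⟩

/-- Minimization of `½ B x x + α⁻¹ E(v₀ - α D x) - G x`. The factor `α⁻¹` compensates for the one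
produced by the chain rule, so that the subgradient of the middle term is `-U(v₀ - α D x) ∘ D`. -/
theorem exists_saddle {X V : Type*} [AddCommGroup X] [Module ℝ X] [FiniteDimensional ℝ X]
    [AddCommGroup V] [Module ℝ V] (B : X →ₗ[ℝ] X →ₗ[ℝ] ℝ) (hsymm : ∀ x y, B x y = B y x)
    (hB : ∀ x, x ≠ 0 → 0 < B x x) (G : X →ₗ[ℝ] ℝ) (D : X →ₗ[ℝ] V) (E : V → ℝ)
    (U : V → V →ₗ[ℝ] ℝ) (hE : ∀ v w, E v + U v (w - v) ≤ E w)
    (hU : ∀ v w z, Tendsto (fun t : ℝ => U (v + t • w) z) (𝓝[>] 0) (𝓝 (U v z))) (v₀ : V)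
    {α : ℝ} (hα : 0 < α) : ∃ x, ∀ y, B x y - U (v₀ - α • D x) (D y) = G y := by
  refine (exists_minimizer B hsymm hB G (fun x => α⁻¹ * E (v₀ - α • D x))
    (fun x => -(U (v₀ - α • D x) ∘ₗ D)) (fun x y => ?_) (fun x y => ?_)).imp
    fun x hx y => (sub_eq_add_neg _ _).trans (hx y)
  · have h1 := hE (v₀ - α • D x) (v₀ - α • D y)
    have h2 : v₀ - α • D y - (v₀ - α • D x) = -(α • D (y - x)) := by
      rw [map_sub, smul_sub]
      abel
    rw [h2, map_neg, map_smul, smul_eq_mul] at h1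
    have h3 := mul_le_mul_of_nonneg_left h1 (inv_nonneg.2 hα.le)
    rw [mul_add, mul_neg, inv_mul_cancel_left₀ hα.ne'] at h3
    exact h3
  · refine ((hU (v₀ - α • D x) (-(α • D y)) (D y)).neg).congr fun t => ?_
    have h2 : v₀ - α • D (x + t • y) = v₀ - α • D x + t • -(α • D y) := by
      rw [map_add, map_smul, smul_add, smul_neg, smul_comm t α]
      abel
    rw [← h2]
    rfl

/-- The balance equation determines `ψ` from `q`, the latent equation determines `u` from `ψ`, and
the flux equation becomes a convex minimization problem for `q` alone. -/
theorem Mesh.exists_isMixedSol {α : ℝ} (hα : 0 < α) (ℓ : M.VSub p →ₗ[ℝ] ℝ)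
    (G : M.SigSub p →ₗ[ℝ] ℝ) : ∃ q u ψ, Mesh.IsMixedSol hΩ hB hΥ α ℓ G q u ψ := by
  obtain ⟨ψ₀, hψ₀⟩ := Mesh.exists_fV_eq ℓ
  obtain ⟨E, hE⟩ := Mesh.exists_potential (M := M) (p := p) hΩ hΥ
  let D : M.SDiv p →ₗ[ℝ] M.VSub p := M.divS p ∘ₗ (M.SDiv p).subtype
  let G' : M.SDiv p →ₗ[ℝ] ℝ := G ∘ₗ (M.SDiv p).subtype
  let m : M.SDiv p →ₗ[ℝ] M.SDiv p →ₗ[ℝ] ℝ :=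
    (M.mS p hΩ hB).compl₁₂ (M.SDiv p).subtype (M.SDiv p).subtype
  have h1 : ∀ q r, m q r = m r q := fun q r => M.mS_comm hΩ hB q.1 r.1
  have h2 : ∀ q, q ≠ 0 → 0 < m q q := fun q h => M.mS_pos hΩ hB fun h0 => h (Subtype.ext h0)
  have h3 := exists_saddle (X := M.SDiv p) (V := M.VSub p) m h1 h2 G' D E (Mesh.superU hΩ hΥ) hE (M.tendsto_superU hΩ hΥ) ψ₀ hα
  obtain ⟨q, hq⟩ := h3
  obtain ⟨u, hu⟩ := Mesh.exists_fV_eq (Mesh.superU hΩ hΥ (ψ₀ - α • M.divS p q.1))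
  refine ⟨q.1, u, ψ₀ - α • M.divS p q.1, q.2, fun v => ?_, fun r hr => ?_, hu⟩
  · rw [map_sub, map_smul, LinearMap.sub_apply, LinearMap.smul_apply, smul_eq_mul, hψ₀]
    ring
  · have h1 : M.mS p hΩ hB q.1 r - Mesh.superU hΩ hΥ (ψ₀ - α • M.divS p q.1) (M.divS p r) = G r :=
      hq ⟨r, hr⟩
    rw [M.fV_comm, hu, h1]

/-- The hybridized subproblem with general right-hand side. -/
structure Mesh.IsHybridSol (α : ℝ) (ℓ : M.VSub p →ₗ[ℝ] ℝ) (μ₀ : M.MSub p)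
    (q : M.SigSub p) (u : M.VSub p) (μ : M.MSub p) (ψ : M.VSub p) : Prop where
  mem : μ - μ₀ ∈ M.M0 p
  balance : ∀ v, ∀ ν ∈ M.M0 p, -α * M.bh p q (v, ν) + M.fV p ψ v = ℓ v
  flux : ∀ r, M.mS p hΩ hB q r + M.bh p r (u, μ) = 0
  latent : ∀ w, M.fV p u w = Mesh.superU hΩ hΥ ψ w

theorem Mesh.bform_congr {r : M.SigSub p} (hr : r ∈ M.SDiv p) {μ μ₀ : M.MSub p}
    (h : μ - μ₀ ∈ M.M0 p) :
    M.bform (M.trM p μ) (M.nfl p r) = M.bform (M.trM p μ₀) (M.nfl p r) := by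
  have := hr _ h
  rwa [map_sub, map_sub, LinearMap.sub_apply, sub_eq_zero] at this

/-- The test pairs `(0, ν)` express normal continuity of `q`, and the pairs `(v, 0)` give the mixed
balance equation. Against a flux with continuous normal components the facet unknown enters only
through its boundary data. -/
theorem Mesh.IsHybridSol.isMixedSol {α : ℝ} (hα : 0 < α) {ℓ : M.VSub p →ₗ[ℝ] ℝ} {μ₀ : M.MSub p}
    {q : M.SigSub p} {u : M.VSub p} {μ : M.MSub p} {ψ : M.VSub p}
    (h : Mesh.IsHybridSol hΩ hB hΥ α ℓ μ₀ q u μ ψ) :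
    Mesh.IsMixedSol hΩ hB hΥ α ℓ (fun r => -M.bform (M.trM p μ₀) (M.nfl p r)) q u ψ := by
  refine ⟨fun ν hν => ?_, fun v => ?_, fun r hr => ?_, h.latent⟩
  · have h1 := h.balance 0 ν hν
    rw [M.bh_eq_div, map_zero, map_zero, map_zero, map_zero, neg_zero, zero_add, add_zero] at h1
    exact (mul_eq_zero.1 h1).resolve_left (neg_ne_zero.2 hα.ne')
  · have h1 := h.balance v 0 (Submodule.zero_mem _)
    rw [M.bh_eq_div, map_zero, map_zero, LinearMap.zero_apply, add_zero, ← M.fV_apply] at h1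
    linarith
  · have h1 := h.flux r
    rw [M.bh_eq_div, M.bform_congr hr h.mem, ← M.fV_apply] at h1
    linarith

/-- The residual of the flux equation annihilates `Σ_{h,div}^p`, which is the kernel of the pairing
with `M_{h,0}^p`, so it is represented by a facet function: the correction of the boundary lifting
`μ₀`. -/
theorem Mesh.IsMixedSol.exists_isHybridSol {α : ℝ} {ℓ : M.VSub p →ₗ[ℝ] ℝ} {μ₀ : M.MSub p}
    {q : M.SigSub p} {u ψ : M.VSub p}
    (h : Mesh.IsMixedSol hΩ hB hΥ α ℓ (fun r => -M.bform (M.trM p μ₀) (M.nfl p r)) q u ψ) :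
    ∃ μ, Mesh.IsHybridSol hΩ hB hΥ α ℓ μ₀ q u μ ψ := by
  obtain ⟨ν, hν⟩ := exists_of_forall_ker (X := M.M0 p) (S := M.SigSub p)
    (-(M.bform.compl₁₂ (M.trM p ∘ₗ (M.M0 p).subtype) (M.nfl p)))
    (M.mS p hΩ hB q + (M.bh p).flip (u, μ₀)) (fun r hr => by
      have h1 : r ∈ M.SDiv p := fun μ hμ => neg_eq_zero.1 (hr ⟨μ, hμ⟩)
      have h2 := h.flux r h1
      change M.mS p hΩ hB q r + M.bh p r (u, μ₀) = 0
      rw [M.bh_eq_div, ← M.fV_apply]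
      linarith)
  refine ⟨μ₀ + ν.1, by rw [add_sub_cancel_left]; exact ν.2, fun v ρ hρ => ?_, fun r => ?_, h.latent⟩
  · rw [M.bh_eq_div, h.mem ρ hρ, add_zero, ← h.balance v, ← M.fV_apply]
    ring
  · have h1 : M.mS p hΩ hB q r + M.bh p r (u, μ₀) = -M.bform (M.trM p ν.1) (M.nfl p r) := hν r
    rw [M.bh_eq_div] at h1 ⊢
    simp only [map_add, LinearMap.add_apply]
    linarith

/-- With `q` and `u` fixed, the flux equation determines the pairing of the facet unknown with all
normal traces. -/
theorem Mesh.IsHybridSol.unique_facet {α : ℝ} {ℓ : M.VSub p →ₗ[ℝ] ℝ} {μ₀ : M.MSub p}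
    {q : M.SigSub p} {u ψ : M.VSub p} {μ μ' : M.MSub p}
    (h : Mesh.IsHybridSol hΩ hB hΥ α ℓ μ₀ q u μ ψ)
    (h' : Mesh.IsHybridSol hΩ hB hΥ α ℓ μ₀ q u μ' ψ) : μ' = μ := by
  refine sub_eq_zero.1 (Mesh.eq_zero_of_bform fun r => ?_)
  have h1 := h.flux r
  have h2 := h'.flux r
  rw [M.bh_eq_div] at h1 h2
  rw [map_sub, map_sub, LinearMap.sub_apply]
  linarith

/-! ### The subproblems of the method -/

theorem toBroken_mem {f : Euc (n + 1) → ℝ} (hΩ : IsRegularDomain Ω)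
    (hf : MemLp f 2 (volume.restrict Ω)) : M.toBroken f ∈ M.L2 ℝ := fun T =>
  hf.mono_measure (M.restrict_cell_le hΩ T)

variable {A : Euc (n + 1) → Matrix (Fin (n + 1)) (Fin (n + 1)) ℝ} {f g : Euc (n + 1) → ℝ}
  (hA : IsTensor Ω a b fun x => (A x)⁻¹) (hf : MemLp f 2 (volume.restrict Ω))

variable (M p) in
/-- The load functional. -/
def Mesh.load : M.VSub p →ₗ[ℝ] ℝ := M.form ℝ ⟨M.toBroken f, toBroken_mem hΩ hf⟩ ∘ₗ M.incV p

theorem Mesh.load_apply (v : M.VSub p) : M.load p hΩ hf v = M.ip (M.toBroken f) v.1 :=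
  M.form_eq_ip _ _

theorem Mesh.solvesHybrid_iff {μ₀ : M.MSub p} (hμ₀ : ∀ ν : M.MSub p, ν.1 ∈ M.MSpace p g ↔
    ν - μ₀ ∈ M.M0 p) {α : ℝ} {ψ₀ : M.VSub p} {q : M.SigSub p} {u : M.VSub p} {μ : M.MSub p}
    {ψ : M.VSub p} : M.SolvesHybrid p A f g Υ α ψ₀.1 q.1 u.1 μ.1 ψ.1 ↔
      Mesh.IsHybridSol hΩ hA hΥ α (α • M.load p hΩ hf + M.fV p ψ₀) μ₀ q u μ ψ := by
  constructor
  · intro h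
    refine ⟨(hμ₀ μ).1 h.mem_uh, fun v ν hν => ?_, fun r => ?_, fun w => ?_⟩
    · have h1 := h.balance v.1 (Mesh.mem_VSpace.2 v.2) ν.1 (Mesh.mem_MSpace_zero'.2 hν)
      rw [M.bh_eq, M.fV_eq, LinearMap.add_apply, LinearMap.smul_apply, M.fV_eq, M.load_apply,
        smul_eq_mul]
      exact h1
    · rw [M.bh_eq]
      exact h.flux r.1 (Mesh.mem_SigmaSpace.2 r.2)
    · rw [M.fV_eq]
      exact sub_eq_zero.1 (h.latent w.1 (Mesh.mem_VSpace.2 w.2))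
  · intro h
    refine ⟨Mesh.mem_SigmaSpace.2 q.2, Mesh.mem_VSpace.2 u.2, (hμ₀ μ).2 h.mem,
      Mesh.mem_VSpace.2 ψ.2, fun v hv ν hν => ?_, fun r hr => ?_, fun w hw => ?_⟩
    · have hν' := (Mesh.mem_MSpace_zero.1 hν).1
      have h1 := h.balance ⟨v, Mesh.mem_VSpace.1 hv⟩ ⟨ν, hν'⟩ (Mesh.mem_MSpace_zero'.1 hν)
      rw [M.bh_eq, M.fV_eq, LinearMap.add_apply, LinearMap.smul_apply, M.fV_eq, M.load_apply,
        smul_eq_mul] at h1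
      exact h1
    · have h1 := h.flux ⟨r, Mesh.mem_SigmaSpace.1 hr⟩
      rw [M.bh_eq] at h1
      exact h1
    · have h1 := h.latent ⟨w, Mesh.mem_VSpace.1 hw⟩
      rw [M.fV_eq] at h1
      exact sub_eq_zero.2 h1

theorem Mesh.solvesMixed_iff {μ₀ : M.MSub p} (hμ₀ : μ₀.1 ∈ M.MSpace p g) {α : ℝ} {ψ₀ : M.VSub p}
    {q : M.SigSub p} {u ψ : M.VSub p} : M.SolvesMixed p A f g Υ α ψ₀.1 q.1 u.1 ψ.1 ↔
      Mesh.IsMixedSol hΩ hA hΥ α (α • M.load p hΩ hf + M.fV p ψ₀)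
        (fun r => -M.bform (M.trM p μ₀) (M.nfl p r)) q u ψ := by
  have hb : ∀ v : M.VSub p, (α * M.fV p (M.divS p q) v + M.fV p ψ v =
      (α • M.load p hΩ hf + M.fV p ψ₀) v ↔ α * M.ip (M.brokenDiv q.1) v.1 + M.ip ψ.1 v.1 =
        α * M.ip (M.toBroken f) v.1 + M.ip ψ₀.1 v.1) := fun v => by
    rw [M.fV_eq, M.fV_eq, LinearMap.add_apply, LinearMap.smul_apply, M.fV_eq, M.load_apply,
      smul_eq_mul]
    rfl
  constructor
  · intro h
    refine ⟨Mesh.mem_SigmaDivSpace.1 h.mem_q, fun v => (hb v).2 (h.balance v.1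
      (Mesh.mem_VSpace.2 v.2)), fun r hr => ?_, fun w => ?_⟩
    · simp only [Mesh.bform_eq_domainBdryInt hr hμ₀]
      rw [M.fV_eq]
      exact h.flux r.1 (Mesh.mem_SigmaDivSpace.2 hr)
    · rw [M.fV_eq]
      exact sub_eq_zero.1 (h.latent w.1 (Mesh.mem_VSpace.2 w.2))
  · intro h
    refine ⟨Mesh.mem_SigmaDivSpace.2 h.mem, Mesh.mem_VSpace.2 u.2, Mesh.mem_VSpace.2 ψ.2,
      fun v hv => (hb ⟨v, Mesh.mem_VSpace.1 hv⟩).1 (h.balance _), fun r hr => ?_, fun w hw => ?_⟩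
    · have hr' : (⟨r, Mesh.mem_SigmaSpace.1 hr.1⟩ : M.SigSub p) ∈ M.SDiv p :=
        Mesh.mem_SigmaDivSpace.1 hr
      have h1 := h.flux _ hr'
      simp only [Mesh.bform_eq_domainBdryInt hr' hμ₀] at h1
      rw [M.fV_eq] at h1
      exact h1
    · have h1 := h.latent ⟨w, Mesh.mem_VSpace.1 hw⟩
      rw [M.fV_eq] at h1
      exact sub_eq_zero.2 h1

theorem Mesh.existsUnique_solution (hΩ : IsRegularDomain Ω) (hA : IsTensor Ω a b fun x => (A x)⁻¹)
    (hf : MemLp f 2 (volume.restrict Ω)) (hΥ : IsLatentMap Ω lo hi Υ) (hg : M.MemL2Boundary g)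
    {α : ℝ} (hα : 0 < α) {ψ₀ : M.Cell → Euc (n + 1) → ℝ} (hψ₀ : ψ₀ ∈ M.VSpace p) :
    ∃ q u uh ψ, M.SolvesHybrid p A f g Υ α ψ₀ q u uh ψ ∧
      (∀ q' u' uh' ψ', M.SolvesHybrid p A f g Υ α ψ₀ q' u' uh' ψ' →
        q' = q ∧ u' = u ∧ uh' = uh ∧ ψ' = ψ) ∧
      M.SolvesMixed p A f g Υ α ψ₀ q u ψ ∧
      (∀ q' u' ψ', M.SolvesMixed p A f g Υ α ψ₀ q' u' ψ' → q' = q ∧ u' = u ∧ ψ' = ψ) := by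
  lift ψ₀ to M.VSub p using Mesh.mem_VSpace.1 hψ₀
  obtain ⟨μ₀, hμ₀⟩ := Mesh.exists_mem_MSpace (M := M) p hg
  have hμ₀' : μ₀.1 ∈ M.MSpace p g := (hμ₀ μ₀).2 (by rw [sub_self]; exact Submodule.zero_mem _)
  obtain ⟨q, u, ψ, hmix⟩ := Mesh.exists_isMixedSol hΩ hA hΥ hα
    (α • M.load p hΩ hf + M.fV p ψ₀) (-(M.bform (M.trM p μ₀) ∘ₗ M.nfl p))
  obtain ⟨μ, hhyb⟩ := Mesh.IsMixedSol.exists_isHybridSol hΩ hA hΥ hmix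
  refine ⟨q.1, u.1, μ.1, ψ.1, (Mesh.solvesHybrid_iff hΩ hΥ hA hf hμ₀).2 hhyb,
    fun q' u' μ' ψ' h => ?_, (Mesh.solvesMixed_iff hΩ hΥ hA hf hμ₀').2 hmix, fun q' u' ψ' h => ?_⟩
  · lift q' to M.SigSub p using Mesh.mem_SigmaSpace.1 h.mem_q
    lift u' to M.VSub p using Mesh.mem_VSpace.1 h.mem_u
    lift μ' to M.MSub p using Mesh.mem_MSub.2 fun F => mem_polySub.2 (h.mem_uh.1 F)
    lift ψ' to M.VSub p using Mesh.mem_VSpace.1 h.mem_psi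
    have h' := (Mesh.solvesHybrid_iff hΩ hΥ hA hf hμ₀).1 h
    obtain ⟨rfl, rfl, rfl⟩ := Mesh.IsMixedSol.unique hΩ hA hΥ hα hmix
      (Mesh.IsHybridSol.isMixedSol hΩ hA hΥ hα h')
    rw [Mesh.IsHybridSol.unique_facet hΩ hA hΥ hhyb h']
    exact ⟨rfl, rfl, rfl, rfl⟩
  · lift q' to M.SigSub p using Mesh.mem_SigmaSpace.1 h.mem_q.1
    lift u' to M.VSub p using Mesh.mem_VSpace.1 h.mem_u
    lift ψ' to M.VSub p using Mesh.mem_VSpace.1 h.mem_psi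
    obtain ⟨rfl, rfl, rfl⟩ := Mesh.IsMixedSol.unique hΩ hA hΥ hα hmix
      ((Mesh.solvesMixed_iff hΩ hΥ hA hf hμ₀').1 h)
    exact ⟨rfl, rfl, rfl⟩

end

/-! ### Shape regularity, scaling, and discrete trace inequalities on elements. -/

section

/-! ### Shape regularity -/

theorem norm_map_le_of_ball {d : ℕ} (L : Euc d →ₗ[ℝ] Euc d) {ρ C : ℝ} (hρ : 0 < ρ)
    (h : ∀ y, ‖y‖ ≤ ρ → ‖L y‖ ≤ C) (x : Euc d) : ‖L x‖ ≤ C / ρ * ‖x‖ := by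
  rcases eq_or_ne x 0 with rfl | hx
  · simp
  have hx' := norm_pos_iff.2 hx
  have h1 := h ((ρ / ‖x‖) • x) (by
    rw [norm_smul, norm_div, norm_norm, Real.norm_of_nonneg hρ.le, div_mul_cancel₀ _ hx'.ne'])
  rw [map_smul, norm_smul, norm_div, norm_norm, Real.norm_of_nonneg hρ.le] at h1
  rw [div_mul_eq_mul_div, le_div_iff₀ hρ]
  rw [div_mul_eq_mul_div, div_le_iff₀ hx'] at h1
  linarith

theorem affineEquiv_sub {d : ℕ} (Φ : Euc d ≃ᵃ[ℝ] Euc d) (x y : Euc d) :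
    Φ (x + y) - Φ x = Φ.linear y := by
  rw [affineEquiv_apply, affineEquiv_apply Φ x, map_add]
  abel

section

variable {κ : CellKind} {n : ℕ} {Ω : Set (Euc (n + 1))} {M : Mesh κ n Ω} {p : ℕ}

/-- Quantitative form of shape regularity, in terms of the maps to the reference element. -/
structure Mesh.IsReg (M : Mesh κ n Ω) (K : ℝ) : Prop where
  one_le : 1 ≤ K
  pos : ∀ T, 0 < M.hCell T
  norm_le : ∀ T x, ‖(M.cellMap T).linear x‖ ≤ K * M.hCell T * ‖x‖
  norm_symm_le : ∀ T x, ‖(M.cellMap T).linear.symm x‖ ≤ K * (M.hCell T)⁻¹ * ‖x‖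
  nvec_le : ∀ T i, M.hCell T * ‖M.nvec T i‖ ≤ K
  le_nvec : ∀ T i, 1 ≤ K * (M.hCell T * ‖M.nvec T i‖)

theorem Mesh.dist_le_hCell {T : M.Cell} {x y : Euc (n + 1)} (hx : x ∈ M.cell T)
    (hy : y ∈ M.cell T) : ‖x - y‖ ≤ M.hCell T := by
  rw [← dist_eq_norm]
  exact Metric.dist_le_diam_of_mem (M.isCompact_cell T).isBounded hx hy

/-- A ball in the reference element is mapped into `T`, which bounds the Jacobian by `h_T`. The ball
of radius `r` in `T` is mapped back into the reference element, which bounds the inverse Jacobian by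
a multiple of `1 / r ≤ σ / h_T`. The bounds for the normals follow by duality. -/
theorem exists_isReg (κ : CellKind) (n : ℕ) (σ : ℝ) :
    ∃ K : ℝ, ∀ {Ω : Set (Euc (n + 1))} (M : Mesh κ n Ω), M.ShapeRegular σ → M.IsReg K := by
  obtain ⟨c, ρ, hρ, hball⟩ : ∃ c ρ, 0 < ρ ∧ Metric.closedBall c ρ ⊆ refCell κ (n + 1) := by
    obtain ⟨c, hc⟩ := refOpen_nonempty κ (n + 1)
    obtain ⟨ε, hε, h⟩ := Metric.isOpen_iff.1 (isOpen_refOpen κ (n + 1)) c hc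
    exact ⟨c, ε / 2, half_pos hε, (Metric.closedBall_subset_ball (half_lt_self hε)).trans
      (h.trans (refOpen_subset _ _))⟩
  set D := Metric.diam (refCell κ (n + 1))
  have hD : 0 ≤ D := Metric.diam_nonneg
  obtain ⟨N, hN⟩ : ∃ N : ℝ, ∀ i : LocalFacet κ (n + 1), ‖refNormal κ i‖ ≤ N ∧
      ‖refNormal κ i‖⁻¹ ≤ N := by
    obtain ⟨N, hN⟩ := Finite.exists_le fun i : LocalFacet κ (n + 1) =>
      max ‖refNormal κ i‖ ‖refNormal κ i‖⁻¹
    exact ⟨N, fun i => ⟨(le_max_left _ _).trans (hN i), (le_max_right _ _).trans (hN i)⟩⟩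
  -- `ρ⁻¹` controls the Jacobian and `D σ` its inverse; the constant `N` below accounts for the
  -- lengths of the reference normals.
  set K₀ := max 1 (max ρ⁻¹ (D * σ)) with hK₀
  have hK₀1 : 1 ≤ K₀ := le_max_left _ _
  refine ⟨K₀ * max N 1, fun {Ω} M hM => ?_⟩
  have hNK : K₀ ≤ K₀ * max N 1 := le_mul_of_one_le_right (by linarith) (le_max_right _ _)
  have hpos : ∀ T, 0 < M.hCell T := fun T => by
    obtain ⟨x, r, hr, hsub, -⟩ := hM T
    have h1 := M.dist_le_hCell (hsub (show x + EuclideanSpace.single 0 r ∈ _ by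
      rw [mem_closedBall_iff_norm, add_sub_cancel_left, PiLp.norm_single,
        Real.norm_of_nonneg hr.le])) (hsub (Metric.mem_closedBall_self hr.le))
    rw [add_sub_cancel_left, PiLp.norm_single, Real.norm_of_nonneg hr.le] at h1
    exact hr.trans_le h1
  have hL : ∀ T x, ‖(M.cellMap T).linear x‖ ≤ K₀ * M.hCell T * ‖x‖ := fun T x => by
    have h1 := norm_map_le_of_ball ((M.cellMap T).linear : Euc (n + 1) →ₗ[ℝ] Euc (n + 1)) hρ
      (C := M.hCell T) (fun y hy => by
        change ‖(M.cellMap T).linear y‖ ≤ _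
        rw [← affineEquiv_sub (M.cellMap T) c y]
        refine M.dist_le_hCell (mem_image_of_mem _ (hball ?_))
          (mem_image_of_mem _ (hball (Metric.mem_closedBall_self hρ.le)))
        rwa [mem_closedBall_iff_norm, add_sub_cancel_left]) x
    refine h1.trans (mul_le_mul_of_nonneg_right ?_ (norm_nonneg _))
    rw [div_eq_inv_mul]
    exact mul_le_mul_of_nonneg_right ((le_max_left _ _).trans (le_max_right _ _)) (hpos T).le
  have hLs : ∀ T x, ‖(M.cellMap T).linear.symm x‖ ≤ K₀ * (M.hCell T)⁻¹ * ‖x‖ := fun T x => by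
    obtain ⟨z, r, hr, hsub, hσ⟩ := hM T
    have h1 := norm_map_le_of_ball ((M.cellMap T).symm.linear : Euc (n + 1) →ₗ[ℝ] Euc (n + 1)) hr
      (C := D) (fun y hy => by
        change ‖(M.cellMap T).symm.linear y‖ ≤ _
        rw [← affineEquiv_sub (M.cellMap T).symm z y, ← dist_eq_norm]
        refine Metric.dist_le_diam_of_mem (isBounded_refCell κ (n + 1)) (M.mem_cell.1 (hsub ?_))
          (M.mem_cell.1 (hsub (Metric.mem_closedBall_self hr.le)))
        rwa [mem_closedBall_iff_norm, add_sub_cancel_left]) x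
    refine h1.trans (mul_le_mul_of_nonneg_right ?_ (norm_nonneg _))
    rw [← div_eq_mul_inv, div_le_div_iff₀ hr (hpos T)]
    have h2 : D * M.hCell T ≤ D * (σ * r) := mul_le_mul_of_nonneg_left hσ hD
    have h3 : D * σ * r ≤ K₀ * r :=
      mul_le_mul_of_nonneg_right ((le_max_right _ _).trans (le_max_right _ _)) hr.le
    linarith
  have hmono : ∀ {s t : ℝ}, 0 ≤ s → 0 ≤ t → K₀ * s * t ≤ K₀ * max N 1 * s * t := fun hs ht =>
    mul_le_mul_of_nonneg_right (mul_le_mul_of_nonneg_right hNK hs) ht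
  refine ⟨hK₀1.trans hNK, hpos, fun T x => (hL T x).trans (hmono (hpos T).le (norm_nonneg _)),
    fun T x => (hLs T x).trans (hmono (inv_nonneg.2 (hpos T).le) (norm_nonneg _)),
    fun T i => ?_, fun T i => ?_⟩
  · have h1 : ‖M.nvec T i‖ ^ 2 ≤ ‖refNormal κ i‖ * (K₀ * (M.hCell T)⁻¹ * ‖M.nvec T i‖) := by
      rw [← real_inner_self_eq_norm_sq, ← M.inner_refNormal_symm]
      exact (real_inner_le_norm _ _).trans (mul_le_mul_of_nonneg_left (hLs T _) (norm_nonneg _))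
    have h2 := M.norm_nvec_pos T i
    have h3 : ‖M.nvec T i‖ ≤ ‖refNormal κ i‖ * (K₀ * (M.hCell T)⁻¹) := by
      refine le_of_mul_le_mul_right ?_ h2
      rw [← sq]
      linarith
    have h4 := mul_le_mul_of_nonneg_left h3 (hpos T).le
    have h5 : M.hCell T * (‖refNormal κ i‖ * (K₀ * (M.hCell T)⁻¹)) = K₀ * ‖refNormal κ i‖ := by
      have := (hpos T).ne'
      field_simp
    rw [h5] at h4
    exact h4.trans (mul_le_mul_of_nonneg_left ((hN i).1.trans (le_max_left _ _)) (by linarith))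
  · have h0 : 0 < ‖refNormal κ i‖ := norm_pos_iff.2 (refNormal_ne_zero κ i)
    have h1 : ‖refNormal κ i‖ * ‖refNormal κ i‖ ≤
        K₀ * M.hCell T * ‖refNormal κ i‖ * ‖M.nvec T i‖ := by
      rw [← sq, ← real_inner_self_eq_norm_sq, ← M.inner_nvec]
      exact (real_inner_le_norm _ _).trans (mul_le_mul_of_nonneg_right (hL T _) (norm_nonneg _))
    have h2 : ‖refNormal κ i‖ ≤ K₀ * M.hCell T * ‖M.nvec T i‖ := by
      refine le_of_mul_le_mul_right ?_ h0
      linarith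
    have h3 : 1 ≤ max N 1 * ‖refNormal κ i‖ := by
      rw [← inv_mul_cancel₀ h0.ne']
      exact mul_le_mul_of_nonneg_right ((hN i).2.trans (le_max_left _ _)) h0.le
    calc (1 : ℝ) ≤ max N 1 * ‖refNormal κ i‖ := h3
      _ ≤ max N 1 * (K₀ * M.hCell T * ‖M.nvec T i‖) :=
        mul_le_mul_of_nonneg_left h2 (zero_le_one.trans (le_max_right _ _))
      _ = K₀ * max N 1 * (M.hCell T * ‖M.nvec T i‖) := by ring

/-! ### Local scaling -/

variable {K : ℝ}

theorem Mesh.setIntegral_norm_sq (r : M.SigSub p) (T : M.Cell) :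
    ∫ x in M.cell T, ‖r.1 T x‖ ^ 2 = |M.jac T|⁻¹ *
      ∫ y in refCell κ (n + 1), ‖(M.cellMap T).linear (M.piola T r.1 y)‖ ^ 2 := by
  rw [setIntegral_cell, smul_eq_mul, ← integral_const_mul, ← integral_const_mul]
  refine integral_congr_ae (ae_of_all _ fun y => ?_)
  have h1 : r.1 T (M.cellMap T y) = (M.jac T)⁻¹ • (M.cellMap T).linear (M.piola T r.1 y) := by
    rw [M.eq_piola T r.1, AffineEquiv.symm_apply_apply]
  have h2 := abs_ne_zero.2 (M.jac_ne_zero T)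
  simp only [h1, norm_smul, norm_inv, Real.norm_eq_abs]
  field_simp

theorem Mesh.continuous_piola (r : M.SigSub p) (T : M.Cell) : Continuous (M.piola T r.1) :=
  continuous_of_mem_rtSub (Mesh.mem_SigSub.1 r.2 T)

theorem Mesh.continuous_linear (T : M.Cell) : Continuous (M.cellMap T).linear :=
  (linCLE (M.cellMap T)).continuous

theorem integrableOn_refCell {V : Type*} [NormedAddCommGroup V] {m : ℕ} {f : Euc m → V}
    (hf : Continuous f) : IntegrableOn f (refCell κ m) :=
  hf.continuousOn.integrableOn_compact (isCompact_refCell κ _)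

theorem Mesh.setIntegral_norm_sq_le (hM : M.IsReg K) (r : M.SigSub p) (T : M.Cell) :
    ∫ x in M.cell T, ‖r.1 T x‖ ^ 2 ≤ |M.jac T|⁻¹ * ((K * M.hCell T) ^ 2 *
      ∫ y in refCell κ (n + 1), ‖M.piola T r.1 y‖ ^ 2) := by
  rw [M.setIntegral_norm_sq]
  have hc := Mesh.continuous_piola r T
  have hL := M.continuous_linear T
  refine mul_le_mul_of_nonneg_left ?_ (inv_nonneg.2 (abs_nonneg _))
  rw [← integral_const_mul]
  refine integral_mono (integrableOn_refCell (by fun_prop))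
    (integrableOn_refCell (by fun_prop)) fun y => ?_
  change _ ≤ (K * M.hCell T) ^ 2 * ‖M.piola T r.1 y‖ ^ 2
  rw [← mul_pow]
  exact pow_le_pow_left₀ (norm_nonneg _) (hM.norm_le T _) 2

theorem Mesh.piola_norm_sq_le (hM : M.IsReg K) (r : M.SigSub p) (T : M.Cell) :
    |M.jac T|⁻¹ * ∫ y in refCell κ (n + 1), ‖M.piola T r.1 y‖ ^ 2 ≤
      (K * (M.hCell T)⁻¹) ^ 2 * ∫ x in M.cell T, ‖r.1 T x‖ ^ 2 := by
  rw [M.setIntegral_norm_sq, mul_left_comm]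
  refine mul_le_mul_of_nonneg_left ?_ (inv_nonneg.2 (abs_nonneg _))
  rw [← integral_const_mul]
  have hc := Mesh.continuous_piola r T
  have hL := M.continuous_linear T
  refine integral_mono (integrableOn_refCell (by fun_prop))
    (integrableOn_refCell (by fun_prop)) fun y => ?_
  change _ ≤ (K * (M.hCell T)⁻¹) ^ 2 * ‖(M.cellMap T).linear (M.piola T r.1 y)‖ ^ 2
  rw [← mul_pow]
  refine pow_le_pow_left₀ (norm_nonneg _) ?_ 2
  have := hM.norm_symm_le T ((M.cellMap T).linear (M.piola T r.1 y))
  rwa [LinearEquiv.symm_apply_apply] at this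

/-- Discrete trace inequality for normal components. -/
theorem Mesh.exists_nfl_le (κ : CellKind) (n p : ℕ) (K : ℝ) : ∃ C : ℝ, 0 ≤ C ∧
    ∀ {Ω : Set (Euc (n + 1))} (M : Mesh κ n Ω), M.IsReg K → ∀ (r : M.SigSub p) (T : M.Cell),
      M.hCell T * ∑ i, M.facetInt (M.facetOf T i) (fun y => (M.nfl p r).1 T i y ^ 2) ≤
        C * ∫ x in M.cell T, ‖r.1 T x‖ ^ 2 := by
  obtain ⟨C, hC, h⟩ := exists_normalTrace_le κ n p
  -- The sign of `K` is known only once a regular mesh is given; the absolute value keeps the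
  -- constant nonnegative beforehand.
  refine ⟨Fintype.card (LocalFacet κ (n + 1)) * (C * |K| ^ 3), by positivity,
    fun {Ω} M hM r T => ?_⟩
  have hK : 0 ≤ K := zero_le_one.trans hM.one_le
  have hh := hM.pos T
  have key : ∀ i, M.hCell T * M.facetInt (M.facetOf T i) (fun y => (M.nfl p r).1 T i y ^ 2) ≤
      C * |K| ^ 3 * ∫ x in M.cell T, ‖r.1 T x‖ ^ 2 := fun i => by
    have hj := abs_pos.2 (M.jac_ne_zero T)
    have hnv := M.norm_nvec_pos T i
    have h1 : M.facetInt (M.facetOf T i) (fun y => (M.nfl p r).1 T i y ^ 2) =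
        ‖M.nvec T i‖⁻¹ * (|M.jac T|⁻¹ * ∫ y in refCell κ n,
          inner ℝ (M.piola T r.1 (stdFacet κ i y)) (refNormal κ i) ^ 2) := by
      rw [M.facetInt_eq, ← M.setIntegral_aut T i fun y =>
        inner ℝ (M.piola T r.1 (stdFacet κ i y)) (refNormal κ i) ^ 2]
      simp only [Mesh.nfl_eq, mul_pow, integral_const_mul, inv_pow, ← sq_abs (M.jac T)]
      field_simp
    rw [h1]
    have h2 := h i _ (Mesh.mem_SigSub.1 r.2 T)
    have h3 := Mesh.piola_norm_sq_le hM r T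
    -- The unnormalized normal has length of order `1 / h_T`, so this factor is of order `h_T²`. It
    -- cancels the factor `h_T⁻²` lost in passing from the Piola pull-back to `r`.
    have h4 : M.hCell T * ‖M.nvec T i‖⁻¹ ≤ K * M.hCell T ^ 2 := by
      rw [← div_eq_mul_inv, div_le_iff₀ hnv]
      nlinarith [mul_le_mul_of_nonneg_left (hM.le_nvec T i) hh.le]
    rw [abs_of_nonneg hK]
    calc M.hCell T * (‖M.nvec T i‖⁻¹ * (|M.jac T|⁻¹ * ∫ y in refCell κ n,
          inner ℝ (M.piola T r.1 (stdFacet κ i y)) (refNormal κ i) ^ 2))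
        = M.hCell T * ‖M.nvec T i‖⁻¹ * (|M.jac T|⁻¹ * ∫ y in refCell κ n,
          inner ℝ (M.piola T r.1 (stdFacet κ i y)) (refNormal κ i) ^ 2) := by ring
      _ ≤ K * M.hCell T ^ 2 * (|M.jac T|⁻¹ * (C * ∫ x in refCell κ (n + 1),
          ‖M.piola T r.1 x‖ ^ 2)) := by
        refine mul_le_mul h4 (mul_le_mul_of_nonneg_left h2 (inv_nonneg.2 hj.le)) ?_ (by positivity)
        exact mul_nonneg (inv_nonneg.2 hj.le) (integral_nonneg fun _ => sq_nonneg _)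
      _ = K * M.hCell T ^ 2 * C * (|M.jac T|⁻¹ * ∫ x in refCell κ (n + 1),
          ‖M.piola T r.1 x‖ ^ 2) := by ring
      _ ≤ K * M.hCell T ^ 2 * C * ((K * (M.hCell T)⁻¹) ^ 2 * ∫ x in M.cell T, ‖r.1 T x‖ ^ 2) :=
        mul_le_mul_of_nonneg_left h3 (by positivity)
      _ = C * K ^ 3 * ∫ x in M.cell T, ‖r.1 T x‖ ^ 2 := by field_simp
  rw [Finset.mul_sum]
  refine (Finset.sum_le_sum fun i _ => key i).trans ?_
  rw [Finset.sum_const, Finset.card_univ, nsmul_eq_mul]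
  linarith

/-- Discrete trace inequality. -/
theorem Mesh.exists_trV_le (κ : CellKind) (n p : ℕ) (K : ℝ) : ∃ C : ℝ, 0 ≤ C ∧
    ∀ {Ω : Set (Euc (n + 1))} (M : Mesh κ n Ω), M.IsReg K → ∀ (v : M.VSub p) (T : M.Cell),
      M.hCell T * ∑ i, M.facetInt (M.facetOf T i) (fun y => (M.trV p v).1 T i y ^ 2) ≤
        C * ∫ x in M.cell T, v.1 T x ^ 2 := by
  obtain ⟨C, hC, h⟩ := exists_trace_le κ n p
  refine ⟨Fintype.card (LocalFacet κ (n + 1)) * (C * |K|), by positivity, fun {Ω} M hM v T => ?_⟩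
  have hK : 0 ≤ K := zero_le_one.trans hM.one_le
  have key : ∀ i, M.hCell T * M.facetInt (M.facetOf T i) (fun y => (M.trV p v).1 T i y ^ 2) ≤
      C * |K| * ∫ x in M.cell T, v.1 T x ^ 2 := fun i => by
    rw [M.facetInt_eq, setIntegral_cell, smul_eq_mul, abs_of_nonneg hK]
    simp only [Mesh.trV_eq]
    rw [M.setIntegral_aut T i fun y => M.pull T v.1 (stdFacet κ i y) ^ 2]
    have h2 : ∫ y in refCell κ n, M.pull T v.1 (stdFacet κ i y) ^ 2 ≤
        C * ∫ x in refCell κ (n + 1), v.1 T (M.cellMap T x) ^ 2 :=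
      h i _ (Mesh.mem_VSub.1 v.2 T)
    have h0 : 0 ≤ ∫ y in refCell κ n, M.pull T v.1 (stdFacet κ i y) ^ 2 :=
      integral_nonneg fun _ => sq_nonneg _
    have h3 := mul_le_mul (hM.nvec_le T i) h2 h0 hK
    nlinarith [mul_le_mul_of_nonneg_left h3 (abs_nonneg (M.jac T))]
  rw [Finset.mul_sum]
  refine (Finset.sum_le_sum fun i _ => key i).trans ?_
  rw [Finset.sum_const, Finset.card_univ, nsmul_eq_mul]
  linarith

end

end

/-! ### Scaling of the inf-sup condition to meshes. -/

section

variable {κ : CellKind} {n : ℕ} {Ω : Set (Euc (n + 1))} {M : Mesh κ n Ω} {p : ℕ} {K : ℝ}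

/-! ### The inf-sup condition -/

/-- The square of the mesh dependent norm of `(v, v̂)`. -/
def Mesh.nSq (x : M.VSub p × M.MSub p) : ℝ :=
  M.form _ (M.gradV p x.1) (M.gradV p x.1) + ∑ T, (M.hCell T)⁻¹ * ∑ i,
    M.facetInt (M.facetOf T i) fun y => ((M.trV p x.1).1 T i y - (M.trM p x.2).1 T i y) ^ 2

theorem Mesh.fderiv_pull (v : M.VSub p) (T : M.Cell) (y w : Euc (n + 1)) :
    fderiv ℝ (M.pull T v.1) y w =
      fderiv ℝ (v.1 T) (M.cellMap T y) ((M.cellMap T).linear w) := by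
  have h1 : HasFDerivAt (v.1 T) (fderiv ℝ (v.1 T) (M.cellMap T y)) (M.cellMap T y) :=
    ((Mesh.contDiff_V v.2 T (k := 1)).differentiable one_ne_zero _).hasFDerivAt
  have h2 := h1.comp y (hasFDerivAt_affine (M.cellMap T) y)
  have h3 : fderiv ℝ (M.pull T v.1) y = _ := h2.fderiv
  rw [h3]
  rfl

theorem Mesh.contDiff_pull (v : M.VSub p) (T : M.Cell) : ContDiff ℝ 1 (M.pull T v.1) :=
  contDiff_of_mem_polySub (Mesh.mem_VSub.1 v.2 T)

theorem Mesh.continuous_grad (v : M.VSub p) (T : M.Cell) : Continuous (gradient (v.1 T)) :=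
  continuous_gradient (Mesh.contDiff_V v.2 T)

/-- The chain rule, tested with the gradient itself, reduces the bound to the one for the inverse
Jacobian. -/
theorem Mesh.norm_grad_le (hM : M.IsReg K) (v : M.VSub p) (T : M.Cell) (y : Euc (n + 1)) :
    ‖gradient (v.1 T) (M.cellMap T y)‖ ≤ K * (M.hCell T)⁻¹ * ‖gradient (M.pull T v.1) y‖ := by
  set g := gradient (v.1 T) (M.cellMap T y) with hg
  have h1 : ‖g‖ ^ 2 = inner ℝ ((M.cellMap T).linear.symm g) (gradient (M.pull T v.1) y) := by
    rw [inner_gradient, Mesh.fderiv_pull, LinearEquiv.apply_symm_apply, ← inner_gradient,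
      ← hg, real_inner_self_eq_norm_sq]
  have h2 := real_inner_le_norm ((M.cellMap T).linear.symm g) (gradient (M.pull T v.1) y)
  have h3 := mul_le_mul_of_nonneg_right (hM.norm_symm_le T g)
    (norm_nonneg (gradient (M.pull T v.1) y))
  rcases (norm_nonneg g).eq_or_lt with h0 | h0
  · rw [← h0]
    exact mul_nonneg (mul_nonneg (zero_le_one.trans hM.one_le) (inv_nonneg.2 (hM.pos T).le))
      (norm_nonneg _)
  · refine le_of_mul_le_mul_right ?_ h0
    rw [← sq]
    linarith

/-- The difference of the trace and of the facet function, on a reference facet. -/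
def Mesh.refJump (x : M.VSub p × M.MSub p) (T : M.Cell) (i : LocalFacet κ (n + 1)) (y : Euc n) :
    ℝ := M.pull T x.1.1 (stdFacet κ i y) - x.2.1 (M.facetOf T i) ((M.aut T i).symm y)

theorem Mesh.refJump_mem (x : M.VSub p × M.MSub p) (T : M.Cell) (i : LocalFacet κ (n + 1)) :
    Mesh.refJump x T i ∈ polySub κ n p :=
  Submodule.sub_mem _ ((isCellMap_stdFacet i).comp_mem (Mesh.mem_VSub.1 x.1.2 T))
    (Mesh.comp_aut_symm_mem (Mesh.mem_MSub.1 x.2.2 _) T i)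

theorem Mesh.jump_eq (x : M.VSub p × M.MSub p) (T : M.Cell) (i : LocalFacet κ (n + 1))
    (y : Euc n) : (M.trV p x.1).1 T i y - (M.trM p x.2).1 T i y =
      Mesh.refJump x T i (M.aut T i y) := by
  rw [Mesh.trV_eq, Mesh.refJump, AffineEquiv.symm_apply_apply]
  rfl

/-- The Piola transform preserves both the pairing with gradients and the normal fluxes up to one
common factor, so the local part of `ℬ_h` is a multiple of its reference counterpart. -/
theorem Mesh.bh_local {r : M.SigSub p} {w : Euc (n + 1) → Euc (n + 1)} {T : M.Cell} {c : ℝ}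
    (hr : M.piola T r.1 = (M.jac T * c) • w) (x : M.VSub p × M.MSub p) :
    (∫ z in M.cell T, inner ℝ (r.1 T z) (gradient (x.1.1 T) z)) -
      ∑ i, M.facetInt (M.facetOf T i) (fun y => (M.nfl p r).1 T i y *
        ((M.trV p x.1).1 T i y - (M.trM p x.2).1 T i y)) =
      |M.jac T| * c * ((∫ y in refCell κ (n + 1), inner ℝ (w y) (gradient (M.pull T x.1.1) y)) -
        ∑ i, ∫ y in refCell κ n, Mesh.refJump x T i y *
          inner ℝ (w (stdFacet κ i y)) (refNormal κ i)) := by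
  have hj := M.jac_ne_zero T
  rw [mul_sub, Finset.mul_sum]
  congr 1
  · rw [setIntegral_cell, smul_eq_mul, mul_assoc, ← integral_const_mul c]
    congr 1
    refine integral_congr_ae (ae_of_all _ fun y => ?_)
    simp only
    rw [inner_gradient, inner_gradient, Mesh.fderiv_pull, M.eq_piola T r.1,
      AffineEquiv.symm_apply_apply, hr, Pi.smul_apply, map_smul, map_smul,
      map_smul, smul_eq_mul, smul_eq_mul, mul_assoc, inv_mul_cancel_left₀ hj]
  · refine Finset.sum_congr rfl fun i _ => ?_
    rw [M.facetInt_eq, ← M.setIntegral_aut T i fun y => Mesh.refJump x T i y *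
      inner ℝ (w (stdFacet κ i y)) (refNormal κ i), ← integral_const_mul, ← integral_const_mul]
    refine integral_congr_ae (ae_of_all _ fun y => ?_)
    simp only
    have hnv := (M.norm_nvec_pos T i).ne'
    rw [Mesh.jump_eq, Mesh.nfl_eq, hr, Pi.smul_apply, real_inner_smul_left]
    field_simp

/-- No continuity couples the elements in `Σ_h^p`, so the optimal reference fields can be chosen
element by element and assembled. -/
theorem Mesh.exists_inf_sup (κ : CellKind) (n p : ℕ) (K : ℝ) : ∃ C : ℝ, 0 ≤ C ∧
    ∀ {Ω : Set (Euc (n + 1))} (M : Mesh κ n Ω), M.IsReg K → ∀ x : M.VSub p × M.MSub p,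
      ∃ r : M.SigSub p, M.form _ (M.incS p r) (M.incS p r) ≤ C * M.bh p r x ∧
        Mesh.nSq x ≤ C * M.bh p r x := by
  obtain ⟨C, hC, h⟩ := exists_inf_sup_refCell κ n p
  refine ⟨K ^ 2 * (1 + C), by positivity, fun {Ω} M hM x => ?_⟩
  have hK : 0 ≤ K := zero_le_one.trans hM.one_le
  choose w hw h1 h2 using fun T => h (M.pull T x.1.1) (Mesh.mem_VSub.1 x.1.2 T)
    (Mesh.refJump x T) (Mesh.refJump_mem x T)
  -- The weight `h_T⁻²` balances the two estimates: with it, the local parts of `‖r‖²`, of `ℬ_h` and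
  -- of the norm of `(v, v̂)` are all controlled by `|det Φ_T'| h_T⁻² s T`.
  set c : M.Cell → ℝ := fun T => (M.hCell T ^ 2)⁻¹ with hc
  set s : M.Cell → ℝ := fun T => ∫ y in refCell κ (n + 1), ‖w T y‖ ^ 2 with hs
  have hs0 : ∀ T, 0 ≤ s T := fun T => integral_nonneg fun _ => sq_nonneg _
  have hc0 : ∀ T, 0 ≤ c T := fun T => inv_nonneg.2 (sq_nonneg _)
  let r : M.SigSub p := ⟨M.mkSig fun T => (M.jac T * c T) • w T,
    Mesh.mkSig_mem fun T => Submodule.smul_mem _ _ (hw T)⟩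
  have hr : ∀ T, M.piola T r.1 = (M.jac T * c T) • w T := fun T => Mesh.piola_mkSig _ T
  have hX : M.bh p r x = ∑ T, |M.jac T| * c T * s T := by
    rw [Mesh.bh_apply, M.form_apply, M.bform_apply, Mesh.bdryInt, ← Finset.sum_sub_distrib]
    refine Finset.sum_congr rfl fun T _ => ?_
    refine (Mesh.bh_local (hr T) x).trans ?_
    rw [h1]
  refine ⟨r, ?_, ?_⟩
  · rw [hX, M.form_self, Finset.mul_sum]
    refine Finset.sum_le_sum fun T _ => (Mesh.setIntegral_norm_sq_le hM r T).trans ?_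
    have hj := abs_pos.2 (M.jac_ne_zero T)
    have hh := hM.pos T
    rw [hr]
    simp only [Pi.smul_apply, norm_smul, mul_pow, integral_const_mul, Real.norm_eq_abs, abs_mul,
      abs_of_nonneg (hc0 T)]
    have h3 : |M.jac T|⁻¹ * (K ^ 2 * M.hCell T ^ 2 * (|M.jac T| ^ 2 * c T ^ 2 * s T)) =
        K ^ 2 * (|M.jac T| * c T * s T) := by
      simp only [hc]
      field_simp
    refine h3.le.trans (mul_le_mul_of_nonneg_right ?_
      (mul_nonneg (mul_nonneg hj.le (hc0 T)) (hs0 T)))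
    exact le_mul_of_one_le_right (sq_nonneg _) (by linarith)
  · rw [hX, Mesh.nSq, M.form_self, Finset.mul_sum, ← Finset.sum_add_distrib]
    refine Finset.sum_le_sum fun T _ => ?_
    have hj := abs_pos.2 (M.jac_ne_zero T)
    have hh := hM.pos T
    have hcont := continuous_gradient (Mesh.contDiff_pull x.1 T)
    have e1 : ∫ z in M.cell T, ‖gradient (x.1.1 T) z‖ ^ 2 ≤ K ^ 2 * (|M.jac T| * c T) *
        ∫ y in refCell κ (n + 1), ‖gradient (M.pull T x.1.1) y‖ ^ 2 := by
      rw [setIntegral_cell, smul_eq_mul]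
      have hcv := (Mesh.continuous_grad x.1 T).comp (M.continuous_cellMap T)
      have e2 : ∫ y in refCell κ (n + 1), ‖gradient (x.1.1 T) (M.cellMap T y)‖ ^ 2 ≤
          ∫ y in refCell κ (n + 1), (K * (M.hCell T)⁻¹) ^ 2 * ‖gradient (M.pull T x.1.1) y‖ ^ 2 := by
        refine integral_mono (integrableOn_refCell (hcv.norm.pow 2))
          (integrableOn_refCell (continuous_const.mul (hcont.norm.pow 2))) fun y => ?_
        change _ ≤ (K * (M.hCell T)⁻¹) ^ 2 * ‖gradient (M.pull T x.1.1) y‖ ^ 2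
        rw [← mul_pow]
        exact pow_le_pow_left₀ (norm_nonneg _) (Mesh.norm_grad_le hM x.1 T y) 2
      rw [integral_const_mul, mul_pow, inv_pow] at e2
      have e3 := mul_le_mul_of_nonneg_left e2 hj.le
      linarith
    have e4 : ∀ i, (M.hCell T)⁻¹ * M.facetInt (M.facetOf T i)
        (fun y => ((M.trV p x.1).1 T i y - (M.trM p x.2).1 T i y) ^ 2) ≤
          K ^ 2 * (|M.jac T| * c T) * ∫ y in refCell κ n, Mesh.refJump x T i y ^ 2 := fun i => by
      rw [M.facetInt_eq]
      simp only [Mesh.jump_eq]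
      rw [M.setIntegral_aut T i fun y => Mesh.refJump x T i y ^ 2, ← mul_assoc]
      refine mul_le_mul_of_nonneg_right ?_ (integral_nonneg fun _ => sq_nonneg _)
      have e5 := hM.nvec_le T i
      have e6 : (M.hCell T)⁻¹ * (|M.jac T| * ‖M.nvec T i‖) =
          (M.hCell T * ‖M.nvec T i‖) * (|M.jac T| * c T) := by
        simp only [hc]
        field_simp
      rw [e6]
      refine mul_le_mul_of_nonneg_right (e5.trans ?_) (mul_nonneg hj.le (hc0 T))
      nlinarith [hM.one_le]
    rw [Finset.mul_sum]
    have e7 := add_le_add e1 (Finset.sum_le_sum (s := Finset.univ) fun i _ => e4 i)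
    refine e7.trans ?_
    rw [← Finset.mul_sum, ← mul_add]
    refine (mul_le_mul_of_nonneg_left (h2 T)
      (mul_nonneg (sq_nonneg K) (mul_nonneg hj.le (hc0 T)))).trans ?_
    have e8 : 0 ≤ K ^ 2 * (|M.jac T| * c T * s T) :=
      mul_nonneg (sq_nonneg K) (mul_nonneg (mul_nonneg hj.le (hc0 T)) (hs0 T))
    simp only [hs] at e8 ⊢
    linarith

/-- Dual characterization of the mesh dependent norm. -/
theorem Mesh.exists_nSq_le (κ : CellKind) (n p : ℕ) (K : ℝ) : ∃ C : ℝ, 0 ≤ C ∧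
    ∀ {Ω : Set (Euc (n + 1))} (M : Mesh κ n Ω), M.IsReg K → ∀ (x : M.VSub p × M.MSub p) (D : ℝ),
      0 ≤ D → (∀ r, M.bh p r x ^ 2 ≤ D * M.form _ (M.incS p r) (M.incS p r)) →
        Mesh.nSq x ≤ C * D := by
  obtain ⟨C, hC, h⟩ := Mesh.exists_inf_sup κ n p K
  refine ⟨C ^ 2, by positivity, fun {Ω} M hM x D hD0 hD => ?_⟩
  obtain ⟨r, h1, h2⟩ := h M hM x
  have h3 := hD r
  rcases le_or_gt (M.bh p r x) 0 with h5 | h5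
  · exact (h2.trans (mul_nonpos_of_nonneg_of_nonpos hC h5)).trans (mul_nonneg (sq_nonneg _) hD0)
  · have h6 : M.bh p r x ≤ C * D := by
      have h8 : M.bh p r x * M.bh p r x ≤ M.bh p r x * (C * D) := by
        nlinarith [mul_le_mul_of_nonneg_left h1 hD0]
      exact le_of_mul_le_mul_left h8 h5
    calc Mesh.nSq x ≤ C * M.bh p r x := h2
      _ ≤ C * (C * D) := mul_le_mul_of_nonneg_left h6 hC
      _ = C ^ 2 * D := by ring

end

/-! ### A Poincaré inequality for pairs of element and facet functions. -/

section

variable {κ : CellKind} {n : ℕ} {Ω : Set (Euc (n + 1))} {M : Mesh κ n Ω} {p : ℕ} {K : ℝ}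

/-! ### The discrete Poincaré inequality -/

theorem Mesh.facetInt_mono (F : M.Facet) {a b : Euc n → ℝ} (ha : Continuous a)
    (hb : Continuous b) (h : ∀ y ∈ refCell κ n, a y ≤ b y) : M.facetInt F a ≤ M.facetInt F b := by
  rw [M.facetInt_def, M.facetInt_def]
  exact mul_le_mul_of_nonneg_left (setIntegral_mono_on (integrableOn_refCell ha)
    (integrableOn_refCell hb) (isCompact_refCell κ n).measurableSet h) (M.area_pos F).le

theorem divergence_id {d : ℕ} (x : Euc d) : divergence (fun x : Euc d => x) x = d := by
  simp only [divergence, fderiv_fun_id, ContinuousLinearMap.id_apply]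
  simp

/-- For `t = u - μ` the first factor is `u² - μ²`. Young's inequality with weights `h` and `1 / h`
splits off a small multiple of the trace and a multiple of the jump, in the powers of `h` that the
trace inequality and the norm of `(v, v̂)` provide. -/
theorem boundary_term_le {u t s ε h R : ℝ} (hε : 0 < ε) (hh : 0 < h) (hhR : h ≤ 2 * R)
    (hs : |s| ≤ R) : (2 * u * t - t ^ 2) * s ≤
      ε * h * u ^ 2 + (R ^ 2 / ε + 2 * R ^ 2) * h⁻¹ * t ^ 2 := by
  have hR : 0 ≤ R := (abs_nonneg s).trans hs
  have h1 : s ^ 2 ≤ R ^ 2 := by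
    rw [← sq_abs s]
    exact pow_le_pow_left₀ (abs_nonneg _) hs 2
  have h2 : 2 * u * t * s ≤ ε * h * u ^ 2 + s ^ 2 / ε * h⁻¹ * t ^ 2 := by
    have h3 : ε * h * u ^ 2 + s ^ 2 / ε * h⁻¹ * t ^ 2 - 2 * u * t * s =
        (ε * h * u - s * t) ^ 2 / (ε * h) := by
      field_simp
      ring
    have h4 : 0 ≤ (ε * h * u - s * t) ^ 2 / (ε * h) := by positivity
    linarith
  have h5 : s ^ 2 / ε * h⁻¹ * t ^ 2 ≤ R ^ 2 / ε * h⁻¹ * t ^ 2 := by gcongr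
  have h6 : -(t ^ 2 * s) ≤ t ^ 2 * R := by
    have := mul_le_mul_of_nonneg_left ((neg_le_abs s).trans hs) (sq_nonneg t)
    linarith
  have h7 : t ^ 2 * R ≤ 2 * R ^ 2 * h⁻¹ * t ^ 2 := by
    have h8 : R ≤ 2 * R ^ 2 * h⁻¹ := by
      rw [← div_eq_mul_inv, le_div_iff₀ hh]
      nlinarith
    nlinarith [mul_le_mul_of_nonneg_left h8 (sq_nonneg t)]
  linarith

theorem Mesh.norm_le_of_mem {R : ℝ} (hR : ∀ x ∈ closure Ω, ‖x‖ ≤ R) {T : M.Cell}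
    {x : Euc (n + 1)} (hx : x ∈ M.cell T) : ‖x‖ ≤ R :=
  hR x (M.iUnion_cell ▸ mem_iUnion_of_mem T hx)

/-- Green's formula for `v²` and the field `x`, whose divergence is the dimension: `d ∫ v² = -∫ 2 v
x · ∇v + ∫_{∂T} v² x · n`. On the boundary `v²` is replaced by `μ²`, because the terms with `μ²`
cancel after summation over the elements. -/
theorem Mesh.poincare_cell (hM : M.IsReg K) {R : ℝ} (hR : ∀ x ∈ closure Ω, ‖x‖ ≤ R) {ε : ℝ}
    (hε : 0 < ε) (v : M.VSub p) (μ : M.MSub p) (T : M.Cell) :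
    (n + 1 : ℕ) * ∫ x in M.cell T, v.1 T x ^ 2 ≤ 1 / 4 * (∫ x in M.cell T, v.1 T x ^ 2) +
      4 * R ^ 2 * (∫ x in M.cell T, ‖gradient (v.1 T) x‖ ^ 2) +
      (∑ i, M.facetInt (M.facetOf T i) fun y => μ.1 (M.facetOf T i) y ^ 2 *
        inner ℝ (M.pt T i y) (M.normal T i)) +
      ε * (M.hCell T * ∑ i, M.facetInt (M.facetOf T i) fun y => (M.trV p v).1 T i y ^ 2) +
      (R ^ 2 / ε + 2 * R ^ 2) * ((M.hCell T)⁻¹ * ∑ i, M.facetInt (M.facetOf T i)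
        fun y => ((M.trV p v).1 T i y - (M.trM p μ).1 T i y) ^ 2) := by
  have hv : ContDiff ℝ 1 (v.1 T) := Mesh.contDiff_V v.2 T
  have hvc := hv.continuous
  have hg := Mesh.continuous_grad v T
  have h0 := M.green T (v := fun x => v.1 T x ^ 2) (φ := fun x => x) (hv.pow 2) contDiff_id
  have hint : ∀ {a : Euc (n + 1) → ℝ}, Continuous a → IntegrableOn a (M.cell T) := fun ha =>
    ha.continuousOn.integrableOn_compact (M.isCompact_cell T)
  have h1 : ∫ x in M.cell T, v.1 T x ^ 2 * divergence (fun x : Euc (n + 1) => x) x =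
      (n + 1 : ℕ) * ∫ x in M.cell T, v.1 T x ^ 2 := by
    simp only [divergence_id]
    rw [integral_mul_const, mul_comm]
  have h2 : -(∫ x in M.cell T, fderiv ℝ (fun x => v.1 T x ^ 2) x x) ≤
      1 / 4 * (∫ x in M.cell T, v.1 T x ^ 2) +
      4 * R ^ 2 * (∫ x in M.cell T, ‖gradient (v.1 T) x‖ ^ 2) := by
    have d1 : Continuous fun x => 1 / 4 * v.1 T x ^ 2 := continuous_const.mul (hvc.pow 2)
    have d2 : Continuous fun x => 4 * R ^ 2 * ‖gradient (v.1 T) x‖ ^ 2 :=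
      continuous_const.mul (hg.norm.pow 2)
    rw [← integral_neg, ← integral_const_mul, ← integral_const_mul, ← integral_add
      (hint d1) (hint d2)]
    have h3 : ∀ x, fderiv ℝ (fun x => v.1 T x ^ 2) x x =
        2 * v.1 T x * inner ℝ x (gradient (v.1 T) x) := fun x => by
      have h4 := ((hv.differentiable one_ne_zero x).hasFDerivAt.pow 2).fderiv
      rw [h4, inner_gradient]
      simp
    simp only [h3]
    refine setIntegral_mono_on (hint ?_) (hint (d1.add d2)) (M.measurableSet_cell T) fun x hx => ?_
    · exact ((continuous_const.mul hvc).mul (continuous_id.inner hg)).neg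
    · have h5 := abs_real_inner_le_norm x (gradient (v.1 T) x)
      have h6 := mul_le_mul_of_nonneg_right (Mesh.norm_le_of_mem hR hx)
        (norm_nonneg (gradient (v.1 T) x))
      have h7 := abs_le.1 (h5.trans h6)
      have h8 := sq_le_sq' h7.1 h7.2
      nlinarith [sq_nonneg (v.1 T x + 4 * inner ℝ x (gradient (v.1 T) x))]
  have h3 : ∀ i, M.facetInt (M.facetOf T i) (fun y => v.1 T (M.pt T i y) ^ 2 *
      inner ℝ (M.pt T i y) (M.normal T i)) ≤
      M.facetInt (M.facetOf T i) (fun y => μ.1 (M.facetOf T i) y ^ 2 *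
        inner ℝ (M.pt T i y) (M.normal T i)) +
      ε * (M.hCell T * M.facetInt (M.facetOf T i) fun y => (M.trV p v).1 T i y ^ 2) +
      (R ^ 2 / ε + 2 * R ^ 2) * ((M.hCell T)⁻¹ * M.facetInt (M.facetOf T i)
        fun y => ((M.trV p v).1 T i y - (M.trM p μ).1 T i y) ^ 2) := fun i => by
    have c1 : Continuous fun y => inner ℝ (M.pt T i y) (M.normal T i) :=
      (continuous_pt M T i).inner continuous_const
    have c2 : Continuous fun y => v.1 T (M.pt T i y) := hvc.comp (continuous_pt M T i)
    have c3 := Mesh.continuous_facet μ (M.facetOf T i)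
    have c4 : Continuous fun y => ((M.trV p v).1 T i y - (M.trM p μ).1 T i y) ^ 2 :=
      (c2.sub c3).pow 2
    have c5 : Continuous fun y => (M.trV p v).1 T i y ^ 2 := c2.pow 2
    have d1 : Continuous fun y => μ.1 (M.facetOf T i) y ^ 2 *
        inner ℝ (M.pt T i y) (M.normal T i) := (c3.pow 2).mul c1
    have d2 : Continuous fun y => ε * M.hCell T * (M.trV p v).1 T i y ^ 2 :=
      continuous_const.mul c5
    have d3 : Continuous fun y => (R ^ 2 / ε + 2 * R ^ 2) * (M.hCell T)⁻¹ *
      ((M.trV p v).1 T i y - (M.trM p μ).1 T i y) ^ 2 := continuous_const.mul c4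
    have d4 : Continuous fun y => μ.1 (M.facetOf T i) y ^ 2 *
        inner ℝ (M.pt T i y) (M.normal T i) + ε * M.hCell T * (M.trV p v).1 T i y ^ 2 := d1.add d2
    rw [← mul_assoc, ← mul_assoc, ← M.facetInt_const_mul, ← M.facetInt_const_mul,
      ← M.facetInt_add _ (integrableOn_refCell d1) (integrableOn_refCell d2),
      ← M.facetInt_add _ (integrableOn_refCell d4) (integrableOn_refCell d3)]
    refine M.facetInt_mono _ ((c2.pow 2).mul c1) (d4.add d3) fun y hy => ?_
    change (M.trV p v).1 T i y ^ 2 * _ ≤ (M.trM p μ).1 T i y ^ 2 * _ + _ + _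
    have hs : |inner ℝ (M.pt T i y) (M.normal T i)| ≤ R := by
      refine (abs_real_inner_le_norm _ _).trans ?_
      rw [M.norm_normal, mul_one]
      exact Mesh.norm_le_of_mem hR (M.pt_mem_cell hy)
    have hhR : M.hCell T ≤ 2 * R := by
      have h0R : 0 ≤ R := (abs_nonneg _).trans hs
      refine Metric.diam_le_of_forall_dist_le (by linarith) fun x hx z hz => ?_
      rw [dist_eq_norm]
      have := norm_sub_le x z
      linarith [Mesh.norm_le_of_mem hR hx, Mesh.norm_le_of_mem hR hz]
    have := boundary_term_le (u := (M.trV p v).1 T i y)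
      (t := (M.trV p v).1 T i y - (M.trM p μ).1 T i y) hε (hM.pos T) hhR hs
    linarith
  have h4 := Finset.sum_le_sum (s := Finset.univ) fun i _ => h3 i
  rw [Finset.sum_add_distrib, Finset.sum_add_distrib, ← Finset.mul_sum, ← Finset.mul_sum,
    ← Finset.mul_sum, ← Finset.mul_sum] at h4
  linarith

/-- Facet functions are single valued and the two normals of an interior facet are opposite, so its
two contributions cancel; on boundary facets `μ` vanishes. -/
theorem Mesh.bdryInt_sq_inner_pt {μ : M.MSub p} (hμ : μ ∈ M.M0 p) :
    (M.bdryInt fun T i y => μ.1 (M.facetOf T i) y ^ 2 *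
      inner ℝ (M.pt T i y) (M.normal T i)) = 0 := by
  rw [Mesh.bdryInt_eq_sum]
  refine Finset.sum_eq_zero fun F _ => ?_
  by_cases hF : M.IsBoundary F
  · refine Finset.sum_eq_zero fun s hs => ?_
    rw [(M.mem_sides).1 hs, hμ F hF, M.facetInt_def]
    simp
  · classical
    obtain ⟨s, s', hne, hs, hn⟩ := M.sides_of_not_isBoundary hF
    have h1 : M.facetOf s.1 s.2 = F := (M.mem_sides).1 (hs ▸ by simp)
    have h2 : M.facetOf s'.1 s'.2 = F := (M.mem_sides).1 (hs ▸ by simp)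
    rw [hs, Finset.sum_pair hne, h1, h2, hn]
    simp only [inner_neg_right, M.pt_eq_pt (h2.trans h1.symm), mul_neg]
    rw [M.facetInt_def, M.facetInt_def, integral_neg]
    ring

theorem Mesh.exists_poincare (hΩ : IsRegularDomain Ω) (κ : CellKind) (p : ℕ) (K : ℝ) :
    ∃ C : ℝ, 0 ≤ C ∧ ∀ M : Mesh κ n Ω, M.IsReg K → ∀ (v : M.VSub p) (μ : M.MSub p), μ ∈ M.M0 p →
      M.fV p v v ≤ C * Mesh.nSq (v, μ) := by
  obtain ⟨C, hC, hCT⟩ := Mesh.exists_trV_le κ n p K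
  obtain ⟨R, hR⟩ := hΩ.isBounded.closure.exists_norm_le
  -- With this `ε` the trace term is at most a quarter of `‖v‖²`. Together with the quarter from the
  -- volume term, half of `‖v‖²` is absorbed, which explains the factor `2` in the constant.
  have hε : (0 : ℝ) < (4 * (C + 1))⁻¹ := by positivity
  set ε := (4 * (C + 1))⁻¹ with hεd
  refine ⟨2 * (4 * R ^ 2 + (R ^ 2 / ε + 2 * R ^ 2)), by positivity, fun M hM v μ hμ => ?_⟩
  have h1 := Finset.sum_le_sum (s := Finset.univ) fun T _ => M.poincare_cell hM hR hε v μ T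
  simp only [Finset.sum_add_distrib, ← Finset.mul_sum] at h1
  have h2 : ∑ T, ∑ i, (M.facetInt (M.facetOf T i) fun y => μ.1 (M.facetOf T i) y ^ 2 *
      inner ℝ (M.pt T i y) (M.normal T i)) = 0 := Mesh.bdryInt_sq_inner_pt hμ
  have h3 := Finset.sum_le_sum (s := Finset.univ) fun T _ => hCT M hM v T
  rw [← Finset.mul_sum] at h3
  have h4 : M.fV p v v = ∑ T, ∫ x in M.cell T, v.1 T x ^ 2 := by
    rw [M.fV_apply, M.form_self]
    simp only [Real.norm_eq_abs, sq_abs]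
    rfl
  have h5 : M.form _ (M.gradV p v) (M.gradV p v) =
      ∑ T, ∫ x in M.cell T, ‖gradient (v.1 T) x‖ ^ 2 := M.form_self _
  rw [Mesh.nSq, h5, h4]
  set I := ∑ T, ∫ x in M.cell T, v.1 T x ^ 2
  set G := ∑ T, ∫ x in M.cell T, ‖gradient (v.1 T) x‖ ^ 2
  set J := ∑ T, (M.hCell T)⁻¹ * ∑ i, M.facetInt (M.facetOf T i)
        fun y => ((M.trV p v).1 T i y - (M.trM p μ).1 T i y) ^ 2
  have hI : 0 ≤ I := Finset.sum_nonneg fun T _ => integral_nonneg fun x => sq_nonneg _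
  have hG : 0 ≤ G := Finset.sum_nonneg fun T _ => integral_nonneg fun x => sq_nonneg _
  have hJ : 0 ≤ J := Finset.sum_nonneg fun T _ => mul_nonneg (inv_nonneg.2 (hM.pos T).le)
    (Finset.sum_nonneg fun i _ => M.facetInt_nonneg _ fun y => sq_nonneg _)
  have h6 := mul_le_mul_of_nonneg_left h3 hε.le
  have h7 : ε * (C * I) ≤ 1 / 4 * I := by
    rw [← mul_assoc]
    refine mul_le_mul_of_nonneg_right ?_ hI
    rw [hεd, inv_mul_le_iff₀ (by positivity)]
    linarith
  have h8 : I ≤ (n + 1 : ℕ) * I := le_mul_of_one_le_left hI (by push_cast; linarith [n.cast_nonneg (α := ℝ)])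
  have hc : 0 ≤ R ^ 2 / ε + 2 * R ^ 2 := by positivity
  nlinarith [mul_nonneg hc hG, mul_nonneg (sq_nonneg R) hJ]

end

/-! ### Projection of broken `H^1` functions to pairs `(v, v̂)`. -/

section

variable {κ : CellKind} {n : ℕ} {Ω : Set (Euc (n + 1))} {M : Mesh κ n Ω} {p : ℕ} {K : ℝ}

/-! ### Projection of broken `H^1` functions -/

/-- In space dimension one a facet is a point and has diameter zero, so `n > 0` is essential for the
weights `h_E⁻¹`. -/
theorem Mesh.hFacet_pos (hn : 0 < n) (F : M.Facet) : 0 < M.hFacet F := by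
  obtain ⟨x, hx⟩ := refOpen_nonempty κ n
  obtain ⟨ε, hε, h⟩ := Metric.isOpen_iff.1 (isOpen_refOpen κ n) x hx
  have hy : x + EuclideanSpace.single ⟨0, hn⟩ (ε / 2) ∈ refCell κ n := refOpen_subset _ _ (h (by
    rw [mem_ball_iff_norm, add_sub_cancel_left, PiLp.norm_single,
      Real.norm_of_nonneg (half_pos hε).le]
    exact half_lt_self hε))
  have hne : x + EuclideanSpace.single ⟨0, hn⟩ (ε / 2) ≠ x := fun h0 => by
    rw [add_eq_left] at h0
    have h1 := congrArg norm h0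
    rw [PiLp.norm_single, Real.norm_of_nonneg (half_pos hε).le, norm_zero] at h1
    linarith
  have hb : Bornology.IsBounded (M.facetMap F '' refCell κ n) :=
    ((isCompact_refCell κ n).image (M.facetMap F).continuous_of_finiteDimensional).isBounded
  exact (dist_pos.2 fun h0 => hne (M.facetMap_injective F h0)).trans_le
    (Metric.dist_le_diam_of_mem hb (mem_image_of_mem _ hy)
      (mem_image_of_mem _ (refOpen_subset _ _ hx)))

theorem Mesh.hFacet_le (T : M.Cell) (i : LocalFacet κ (n + 1)) :
    M.hFacet (M.facetOf T i) ≤ M.hCell T := by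
  refine Metric.diam_mono ?_ (M.isCompact_cell T).isBounded
  rintro - ⟨y, hy, rfl⟩
  exact M.pt_mem_cell hy

theorem Mesh.jumpSq_of_isBoundary (w : M.BrokenH1) {F : M.Facet} (hF : M.IsBoundary F) :
    M.jumpSq w F = ∑ s ∈ M.sides F, M.facetInt F fun y => w.trace s.1 s.2 y ^ 2 := by
  rw [Mesh.jumpSq, if_pos hF, Mesh.sides, Finset.sum_filter]

theorem Mesh.jumpSq_of_not_isBoundary (w : M.BrokenH1) {F : M.Facet} (hF : ¬M.IsBoundary F) :
    M.jumpSq w F = 1 / 2 * ∑ s ∈ M.sides F, ∑ s' ∈ M.sides F,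
      M.facetInt F fun y => (w.trace s.1 s.2 y - w.trace s'.1 s'.2 y) ^ 2 := by
  rw [Mesh.jumpSq, if_neg hF, Mesh.sides, Finset.sum_filter]
  congr 1
  refine Finset.sum_congr rfl fun s _ => ?_
  split_ifs with h
  · rw [Finset.sum_filter]
    refine Finset.sum_congr rfl fun s' _ => ?_
    by_cases h' : M.facetOf s'.1 s'.2 = F
    · rw [if_pos ⟨h, h'⟩, if_pos h']
    · rw [if_neg fun hh => h' hh.2, if_neg h']
  · simp only [h, false_and, if_false, Finset.sum_const_zero]

theorem Mesh.jumpSq_nonneg (w : M.BrokenH1) (F : M.Facet) : 0 ≤ M.jumpSq w F := by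
  by_cases hF : M.IsBoundary F
  · rw [Mesh.jumpSq_of_isBoundary w hF]
    exact Finset.sum_nonneg fun s _ => M.facetInt_nonneg F fun y => sq_nonneg _
  · rw [Mesh.jumpSq_of_not_isBoundary w hF]
    exact mul_nonneg (by norm_num) (Finset.sum_nonneg fun s _ => Finset.sum_nonneg fun s' _ =>
      M.facetInt_nonneg F fun y => sq_nonneg _)

/-- The average of the traces on interior facets, and zero on boundary facets. -/
def Mesh.BrokenH1.avg (w : M.BrokenH1) (F : M.Facet) (y : Euc n) : ℝ :=
  open Classical in
  if M.IsBoundary F then 0 else (1 / 2) * ∑ s ∈ M.sides F, w.trace s.1 s.2 y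

theorem Mesh.BrokenH1.memLp_avg (w : M.BrokenH1) (F : M.Facet) :
    MemLp (w.avg F) 2 (volume.restrict (refCell κ n)) := by
  by_cases hF : M.IsBoundary F
  · have : w.avg F = fun _ => 0 := funext fun y => if_pos hF
    rw [this]
    exact MemLp.zero'
  · have : w.avg F = fun y => (1 / 2) * ∑ s ∈ M.sides F, w.trace s.1 s.2 y :=
      funext fun y => if_neg hF
    have h1 : MemLp (fun y => ∑ s ∈ M.sides F, w.trace s.1 s.2 y) 2
        (volume.restrict (refCell κ n)) := memLp_finsetSum _ fun s _ => w.memLp_trace s.1 s.2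
    rw [this]
    exact h1.const_mul (1 / 2)

def Mesh.BrokenH1.toL2 (w : M.BrokenH1) : M.L2 ℝ := ⟨w.val, w.memLp_val⟩

def Mesh.BrokenH1.gradL2 (w : M.BrokenH1) : M.L2 (Euc (n + 1)) := ⟨w.grad, w.memLp_grad⟩

def Mesh.BrokenH1.traceL2 (w : M.BrokenH1) : M.L2b := ⟨w.trace, w.memLp_trace⟩

def Mesh.BrokenH1.avgL2 (w : M.BrokenH1) : M.L2b :=
  ⟨fun T i => w.avg (M.facetOf T i), fun _ _ => w.memLp_avg _⟩

/-- On an interior facet each trace differs from the average by half the jump, so the two sides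
together give half of the squared jump. On a boundary facet the average is zero and there is
equality. -/
theorem Mesh.BrokenH1.sum_sides_le (w : M.BrokenH1) (F : M.Facet) :
    ∑ s ∈ M.sides F, M.facetInt F (fun y => (w.trace s.1 s.2 y - w.avg F y) ^ 2) ≤
      M.jumpSq w F := by
  by_cases hF : M.IsBoundary F
  · rw [Mesh.jumpSq_of_isBoundary w hF]
    refine (Finset.sum_congr rfl fun s _ => congrArg _ (funext fun y => ?_)).le
    rw [Mesh.BrokenH1.avg, if_pos hF, sub_zero]
  · classical
    obtain ⟨s, s', hne, hs, -⟩ := M.sides_of_not_isBoundary hF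
    have havg : ∀ y, w.avg F y = 1 / 2 * (w.trace s.1 s.2 y + w.trace s'.1 s'.2 y) := fun y => by
      rw [Mesh.BrokenH1.avg, if_neg hF, hs, Finset.sum_pair hne]
    rw [Mesh.jumpSq_of_not_isBoundary w hF, hs, Finset.sum_pair hne, Finset.sum_pair hne,
      Finset.sum_pair hne, Finset.sum_pair hne]
    have h0 : (M.facetInt F fun y => (w.trace s.1 s.2 y - w.avg F y) ^ 2) = 1 / 4 *
        M.facetInt F fun y => (w.trace s.1 s.2 y - w.trace s'.1 s'.2 y) ^ 2 := by
      rw [← M.facetInt_const_mul]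
      congr 1 with y
      rw [havg]
      ring
    have h1 : (M.facetInt F fun y => (w.trace s'.1 s'.2 y - w.avg F y) ^ 2) = 1 / 4 *
        M.facetInt F fun y => (w.trace s.1 s.2 y - w.trace s'.1 s'.2 y) ^ 2 := by
      rw [← M.facetInt_const_mul]
      congr 1 with y
      rw [havg]
      ring
    have h2 : (M.facetInt F fun y => (w.trace s'.1 s'.2 y - w.trace s.1 s.2 y) ^ 2) =
        M.facetInt F fun y => (w.trace s.1 s.2 y - w.trace s'.1 s'.2 y) ^ 2 := by
      congr 1 with y
      ring
    have h3 := M.facetInt_nonneg F fun y =>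
      sq_nonneg (w.trace s.1 s.2 y - w.trace s'.1 s'.2 y)
    rw [h0, h1, h2]
    simp only [sub_self, M.facetInt_def F fun _ => (0 : ℝ) ^ 2]
    norm_num
    linarith

theorem Mesh.BrokenH1.bdry_le (hn : 0 < n) (w : M.BrokenH1) :
    ∑ T, (M.hCell T)⁻¹ * ∑ i, M.facetInt (M.facetOf T i)
      (fun y => (w.trace T i y - w.avg (M.facetOf T i) y) ^ 2) ≤
        ∑ F, (M.hFacet F)⁻¹ * M.jumpSq w F := by
  simp only [Finset.mul_sum]
  rw [M.sum_sides fun T i => (M.hCell T)⁻¹ * M.facetInt (M.facetOf T i)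
      (fun y => (w.trace T i y - w.avg (M.facetOf T i) y) ^ 2)]
  refine Finset.sum_le_sum fun F _ => ?_
  refine le_trans ?_ (mul_le_mul_of_nonneg_left (w.sum_sides_le F)
    (inv_nonneg.2 (Mesh.hFacet_pos hn F).le))
  rw [Finset.mul_sum]
  refine Finset.sum_le_sum fun s hs => ?_
  have h1 := M.mem_sides.1 hs
  rw [h1]
  exact mul_le_mul_of_nonneg_right
    (inv_anti₀ (Mesh.hFacet_pos hn F) (h1 ▸ Mesh.hFacet_le s.1 s.2))
    (M.facetInt_nonneg F fun y => sq_nonneg _)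

theorem Mesh.BrokenH1.form_div (w : M.BrokenH1) (r : M.SigSub p) :
    M.form ℝ (M.incV p (M.divS p r)) w.toL2 =
      -M.form _ (M.incS p r) w.gradL2 + M.bform w.traceL2 (M.nfl p r) := by
  rw [M.form_apply, M.form_apply, M.bform_apply, Mesh.bdryInt, ← Finset.sum_neg_distrib,
    ← Finset.sum_add_distrib]
  refine Finset.sum_congr rfl fun T _ => ?_
  have h := w.isTrace T (r.1 T) (Mesh.contDiff_Sig r.2 T)
  refine Eq.trans (integral_congr_ae (ae_of_all _ fun x => ?_)) (h.trans ?_)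
  · rfl
  · congr 2
    exact integral_congr_ae (ae_of_all _ fun x => real_inner_comm _ _)

/-- Normal fluxes of `Σ_h^p` are polynomials on each facet and do not distinguish the average from
its `L²` projection. -/
theorem Mesh.BrokenH1.exists_projection_facet (w : M.BrokenH1) (p : ℕ) :
    ∃ μ ∈ M.M0 p, ∀ r, M.bform (M.trM p μ) (M.nfl p r) = M.bform w.avgL2 (M.nfl p r) := by
  choose e he h using fun F => exists_polySub_projection κ p (w.memLp_avg F)
  refine ⟨⟨e, Mesh.mem_MSub.2 he⟩, fun F hF => ?_, fun r => ?_⟩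
  · refine eq_zero_of_integral_sq (he F) ((h F _ (he F)).trans ?_)
    have : ∀ y, w.avg F y = 0 := fun y => if_pos hF
    simp only [this, zero_mul, integral_zero]
  · refine Finset.sum_congr rfl fun T _ => Finset.sum_congr rfl fun i _ => ?_
    rw [M.facetInt_def, M.facetInt_def]
    exact congrArg _ (h _ _ (Mesh.nfl_mem r T i))

/-- The Cauchy–Schwarz inequality after multiplying the arguments by `h_T^{-1/2}` and `h_T^{1/2}`.
-/
theorem Mesh.bform_sq_le_weighted (hh : ∀ T, 0 < M.hCell T) (v w : M.L2b) :
    M.bform v w ^ 2 ≤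
      (∑ T, (M.hCell T)⁻¹ * ∑ i, M.facetInt (M.facetOf T i) fun y => v.1 T i y ^ 2) *
        ∑ T, M.hCell T * ∑ i, M.facetInt (M.facetOf T i) fun y => w.1 T i y ^ 2 := by
  have hsq : ∀ T, √(M.hCell T) ≠ 0 := fun T => (Real.sqrt_pos.2 (hh T)).ne'
  let a : M.L2b := ⟨fun T i y => (√(M.hCell T))⁻¹ * v.1 T i y, fun T i => (v.2 T i).const_mul _⟩
  let b : M.L2b := ⟨fun T i y => √(M.hCell T) * w.1 T i y, fun T i => (w.2 T i).const_mul _⟩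
  have h1 : M.bform v w = M.bform a b := by
    refine Finset.sum_congr rfl fun T _ => Finset.sum_congr rfl fun i _ => congrArg _
      (funext fun y => ?_)
    have := hsq T
    change v.1 T i y * w.1 T i y = (√(M.hCell T))⁻¹ * v.1 T i y * (√(M.hCell T) * w.1 T i y)
    field_simp
  have h2 : ∑ T, (M.hCell T)⁻¹ * ∑ i, M.facetInt (M.facetOf T i) (fun y => v.1 T i y ^ 2) =
      M.bform a a := by
    refine Finset.sum_congr rfl fun T _ => ?_
    rw [Finset.mul_sum]
    refine Finset.sum_congr rfl fun i _ => ?_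
    rw [← M.facetInt_const_mul]
    refine congrArg _ (funext fun y => ?_)
    change _ = (√(M.hCell T))⁻¹ * v.1 T i y * ((√(M.hCell T))⁻¹ * v.1 T i y)
    rw [mul_mul_mul_comm, ← mul_inv, Real.mul_self_sqrt (hh T).le, sq]
  have h3 : ∑ T, M.hCell T * ∑ i, M.facetInt (M.facetOf T i) (fun y => w.1 T i y ^ 2) =
      M.bform b b := by
    refine Finset.sum_congr rfl fun T _ => ?_
    rw [Finset.mul_sum]
    refine Finset.sum_congr rfl fun i _ => ?_
    rw [← M.facetInt_const_mul]
    refine congrArg _ (funext fun y => ?_)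
    change _ = √(M.hCell T) * w.1 T i y * (√(M.hCell T) * w.1 T i y)
    rw [mul_mul_mul_comm, Real.mul_self_sqrt (hh T).le, sq]
  rw [h1, h2, h3]
  exact M.bform_sq_le a b

variable {a b : ℝ} {A : Euc (n + 1) → Matrix (Fin (n + 1)) (Fin (n + 1)) ℝ}

theorem Mesh.BrokenH1.dgNorm_sq (hΩ : IsRegularDomain Ω) (hA : IsTensor Ω a b A)
    (w : M.BrokenH1) : M.dgNorm A w ^ 2 =
      M.matF hΩ hA w.gradL2 w.gradL2 + ∑ F, (M.hFacet F)⁻¹ * M.jumpSq w F := by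
  rw [Mesh.dgNorm, Real.sq_sqrt]
  · rfl
  · exact add_nonneg (M.matF_self_nonneg (hΩ := hΩ) (hB := hA) w.gradL2) (Finset.sum_nonneg fun F _ =>
      mul_nonneg (inv_nonneg.2 Metric.diam_nonneg) (Mesh.jumpSq_nonneg w F))

/-- Here `v` is the `L²` projection of `w`, and `μ` that of the averaged traces. Duality replaces
approximation theory: `ℬ_h(r, (v, μ))` sees only the original function, so it is bounded by `‖w‖_DG
‖r‖`, and the inf-sup condition converts this into stability of the projection. -/
theorem Mesh.exists_projection (hn : 0 < n) (hΩ : IsRegularDomain Ω) (hA : IsTensor Ω a b A)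
    (κ : CellKind) (p : ℕ) (K : ℝ) : ∃ C : ℝ, 0 ≤ C ∧ ∀ M : Mesh κ n Ω, M.IsReg K →
      ∀ w : M.BrokenH1, ∃ (v : M.VSub p) (μ : M.MSub p), μ ∈ M.M0 p ∧
        (∀ η, M.fV p v η = M.form ℝ (M.incV p η) w.toL2) ∧
        (∀ r, M.bh p r (v, μ) ^ 2 ≤ C * M.dgNorm A w ^ 2 * M.form _ (M.incS p r) (M.incS p r)) ∧
        Mesh.nSq (v, μ) ≤ C * M.dgNorm A w ^ 2 ∧ M.fV p v v ≤ C * M.dgNorm A w ^ 2 := by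
  obtain ⟨C₁, hC₁, h₁⟩ := Mesh.exists_nfl_le κ n p K
  obtain ⟨C₂, hC₂, h₂⟩ := Mesh.exists_nSq_le κ n p K
  obtain ⟨C₃, hC₃, h₃⟩ := Mesh.exists_poincare hΩ κ p K
  have ha := hA.pos
  set D := 2 * (a⁻¹ + C₁) with hD
  have hD0 : 0 ≤ D := by positivity
  refine ⟨max D (max (C₂ * D) (C₃ * (C₂ * D))), le_max_of_le_left hD0, fun M hM w => ?_⟩
  obtain ⟨v, hv⟩ := Mesh.exists_fV_eq ((M.form ℝ w.toL2) ∘ₗ M.incV p)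
  obtain ⟨μ, hμ, hμ'⟩ := w.exists_projection_facet p
  have hdg := w.dgNorm_sq hΩ hA
  have hj : 0 ≤ ∑ F, (M.hFacet F)⁻¹ * M.jumpSq w F := Finset.sum_nonneg fun F _ =>
      mul_nonneg (inv_nonneg.2 Metric.diam_nonneg) (Mesh.jumpSq_nonneg w F)
  have hm := M.matF_self_nonneg (hΩ := hΩ) (hB := hA) w.gradL2
  have hbh : ∀ r, M.bh p r (v, μ) ^ 2 ≤
      D * M.dgNorm A w ^ 2 * M.form _ (M.incS p r) (M.incS p r) := fun r => by
    -- Since `∇·r ∈ V_h^p` and `r · n` is a polynomial on each facet, both projections may be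
    -- removed; Green's formula for `w` then brings back its gradient.
    have e1 : M.bh p r (v, μ) = M.form _ (M.incS p r) w.gradL2 -
        M.bform (w.traceL2 - w.avgL2) (M.nfl p r) := by
      rw [Mesh.bh_eq_div, hμ', M.form_comm, ← M.fV_apply, hv, LinearMap.comp_apply, M.form_comm,
        w.form_div, map_sub, LinearMap.sub_apply]
      ring
    have e2 := M.form_sq_le (M.incS p r) w.gradL2
    have e3 := M.bform_sq_le_weighted hM.pos (w.traceL2 - w.avgL2) (M.nfl p r)
    have e4 : ∑ T, M.hCell T * ∑ i, M.facetInt (M.facetOf T i)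
        (fun y => (M.nfl p r).1 T i y ^ 2) ≤ C₁ * M.form _ (M.incS p r) (M.incS p r) := by
      rw [M.form_self, Finset.mul_sum]
      exact Finset.sum_le_sum fun T _ => h₁ M hM r T
    have e5 := w.bdry_le hn
    have e6 := M.le_matF (hΩ := hΩ) (hB := hA) w.gradL2
    have hr := M.form_self_nonneg (M.incS p r)
    have e7 : M.form _ w.gradL2 w.gradL2 ≤ a⁻¹ * M.matF hΩ hA w.gradL2 w.gradL2 := by
      rw [← div_eq_inv_mul, le_div_iff₀ ha]
      linarith
    have e8 : M.bform (w.traceL2 - w.avgL2) (M.nfl p r) ^ 2 ≤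
        (∑ F, (M.hFacet F)⁻¹ * M.jumpSq w F) * (C₁ * M.form _ (M.incS p r) (M.incS p r)) :=
      e3.trans (mul_le_mul e5 e4 (Finset.sum_nonneg fun T _ => mul_nonneg (hM.pos T).le
        (Finset.sum_nonneg fun i _ => M.facetInt_nonneg _ fun y => sq_nonneg _)) hj)
    have e9 := e2.trans (mul_le_mul_of_nonneg_left e7 hr)
    rw [e1, hdg, hD]
    generalize M.form _ (M.incS p r) w.gradL2 = X at *
    generalize M.bform (w.traceL2 - w.avgL2) (M.nfl p r) = Y at *
    generalize ∑ F, (M.hFacet F)⁻¹ * M.jumpSq w F = J at *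
    generalize M.matF hΩ hA w.gradL2 w.gradL2 = G at *
    generalize M.form _ (M.incS p r) (M.incS p r) = R at *
    have f1 : (X - Y) ^ 2 ≤ 2 * X ^ 2 + 2 * Y ^ 2 := by nlinarith [sq_nonneg (X + Y)]
    have f2 : 0 ≤ a⁻¹ * J * R := by positivity
    have f3 : 0 ≤ C₁ * G * R := by positivity
    linarith
  have hnsq : Mesh.nSq (v, μ) ≤ C₂ * (D * M.dgNorm A w ^ 2) :=
    h₂ M hM (v, μ) _ (mul_nonneg hD0 (sq_nonneg _)) hbh
  have hpo := (h₃ M hM v μ hμ).trans (mul_le_mul_of_nonneg_left hnsq hC₃)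
  have hs := sq_nonneg (M.dgNorm A w)
  refine ⟨v, μ, hμ, fun η => ?_, fun r => (hbh r).trans ?_, hnsq.trans ?_, hpo.trans ?_⟩
  · rw [hv, LinearMap.comp_apply, M.form_comm]
  · exact mul_le_mul_of_nonneg_right (mul_le_mul_of_nonneg_right (le_max_left _ _) hs)
      (M.form_self_nonneg _)
  · rw [← mul_assoc]
    exact mul_le_mul_of_nonneg_right ((le_max_left _ _).trans (le_max_right _ _)) hs
  · rw [← mul_assoc C₂, ← mul_assoc]
    exact mul_le_mul_of_nonneg_right ((le_max_right _ _).trans (le_max_right _ _)) hs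

end

/-! ### Energy decay and mesh independent bounds for the iterates. -/

section

variable {κ : CellKind} {n : ℕ} {Ω : Set (Euc (n + 1))} {M : Mesh κ n Ω} {p : ℕ} {K : ℝ}
  {a b : ℝ} {A B : Euc (n + 1) → Matrix (Fin (n + 1)) (Fin (n + 1)) ℝ}
  {hΩ : IsRegularDomain Ω} {hB : IsTensor Ω a b B}
  {lo hi : Euc (n + 1) → EReal} {Υ : Euc (n + 1) → ℝ → ℝ} {hΥ : IsLatentMap Ω lo hi Υ}
  {f : Euc (n + 1) → ℝ} {hf : MemLp f 2 (volume.restrict Ω)}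

/-! ### Energy decay -/

/-- One step of the method decreases the energy. -/
theorem Mesh.IsHybridSol.energy_le {α : ℝ} (hα : 0 < α) {ℓ : M.VSub p →ₗ[ℝ] ℝ}
    {q q₀ : M.SigSub p} {u u₀ ψ ψ₀ : M.VSub p} {μ μ₀ : M.MSub p}
    (h : Mesh.IsHybridSol hΩ hB hΥ α (α • ℓ + M.fV p ψ₀) 0 q u μ ψ) (hμ₀ : μ₀ ∈ M.M0 p)
    (hq₀ : ∀ r, M.mS p hΩ hB q₀ r + M.bh p r (u₀, μ₀) = 0)
    (hu₀ : ∀ w, M.fV p u₀ w = Mesh.superU hΩ hΥ ψ₀ w) :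
    1 / 2 * M.mS p hΩ hB q q - ℓ u ≤ 1 / 2 * M.mS p hΩ hB q₀ q₀ - ℓ u₀ := by
  have hμ : μ ∈ M.M0 p := by simpa using h.mem
  -- The increment is admissible because both facet functions vanish on the boundary. The two flux
  -- equations turn `ℬ_h(q, ·)` into weighted inner products of fluxes.
  have h1 := h.balance (u - u₀) (μ - μ₀) (Submodule.sub_mem _ hμ hμ₀)
  have h2 : M.bh p q (u - u₀, μ - μ₀) = -M.mS p hΩ hB q q + M.mS p hΩ hB q₀ q := by
    rw [← Prod.mk_sub_mk, map_sub]
    linarith [h.flux q, hq₀ q]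
  have h3 : 0 ≤ M.fV p ψ (u - u₀) - M.fV p ψ₀ (u - u₀) := by
    have h4 := Mesh.superU_sub_nonneg hΩ hΥ ψ ψ₀
    rw [← h.latent, ← hu₀] at h4
    rw [M.fV_comm ψ, M.fV_comm ψ₀, map_sub, LinearMap.sub_apply, LinearMap.sub_apply]
    simp only [map_sub] at h4
    linarith
  -- Polarization: `m(q, q) - m(q₀, q) ≥ ½ m(q, q) - ½ m(q₀, q₀)`.
  have h5 : 0 ≤ M.mS p hΩ hB (q - q₀) (q - q₀) := M.mS_self_nonneg _ _ _
  have h6 := Mesh.mS_comm (hΩ := hΩ) (hB := hB) q q₀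
  simp only [map_sub, LinearMap.sub_apply] at h5
  rw [h2, LinearMap.add_apply, LinearMap.smul_apply, smul_eq_mul, map_sub ℓ] at h1
  have h7 : α * (M.mS p hΩ hB q q - M.mS p hΩ hB q₀ q - (ℓ u - ℓ u₀)) ≤ 0 := by linarith
  have h8 := nonpos_of_mul_nonpos_right h7 hα
  linarith

theorem Mesh.form_load (hΩ : IsRegularDomain Ω) (hf : MemLp f 2 (volume.restrict Ω))
    (v : M.VSub p) : M.load p hΩ hf v ^ 2 ≤ (∫ x in Ω, f x ^ 2) * M.fV p v v := by
  have h1 : ∑ T : M.Cell, ∫ x in M.cell T, f x ^ 2 = ∫ x in Ω, f x ^ 2 :=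
    M.sum_setIntegral_cell hΩ hf.integrable_sq
  have h2 := M.form_sq_le ⟨M.toBroken f, toBroken_mem hΩ hf⟩ (M.incV p v)
  rw [M.form_self ⟨M.toBroken f, toBroken_mem hΩ hf⟩] at h2
  simp only [Real.norm_eq_abs, sq_abs] at h2
  rw [← h1]
  exact h2

/-- The flux equation says that `ℬ_h(·, (u, μ))` is represented by `-q`, so the dual
characterization of the mesh dependent norm applies directly. -/
theorem Mesh.exists_nSq_le_flux (hB : IsTensor Ω a b B) (hΩ : IsRegularDomain Ω) (κ : CellKind)
    (p : ℕ) (K : ℝ) : ∃ C : ℝ, 0 ≤ C ∧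
    ∀ M : Mesh κ n Ω, M.IsReg K → ∀ (q : M.SigSub p) (u : M.VSub p) (μ : M.MSub p), μ ∈ M.M0 p →
      (∀ r, M.mS p hΩ hB q r + M.bh p r (u, μ) = 0) →
        Mesh.nSq (u, μ) ≤ C * M.mS p hΩ hB q q ∧ M.fV p u u ≤ C * M.mS p hΩ hB q q := by
  obtain ⟨C₂, hC₂, h₂⟩ := Mesh.exists_nSq_le κ n p K
  obtain ⟨C₃, hC₃, h₃⟩ := Mesh.exists_poincare hΩ κ p K
  have hb := hB.pos'
  refine ⟨max (C₂ * b) (C₃ * (C₂ * b)), le_max_of_le_left (by positivity),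
    fun M hM q u μ hμ h => ?_⟩
  have hq : 0 ≤ M.mS p hΩ hB q q := M.mS_self_nonneg _ _ _
  have h1 : Mesh.nSq (u, μ) ≤ C₂ * (b * M.mS p hΩ hB q q) := by
    refine h₂ M hM (u, μ) _ (mul_nonneg hb.le hq) fun r => ?_
    have h4 : M.bh p r (u, μ) = -M.mS p hΩ hB q r := by linarith [h r]
    have h5 := M.matF_sq_le (hΩ := hΩ) (hB := hB) (M.incS p q) (M.incS p r)
    have h6 := mul_le_mul_of_nonneg_left (M.matF_le (hΩ := hΩ) (hB := hB) (M.incS p r)) hq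
    rw [h4, neg_sq]
    refine (h5.trans h6).trans (le_of_eq ?_)
    ring
  have h7 := (h₃ M hM u μ hμ).trans (mul_le_mul_of_nonneg_left h1 hC₃)
  rw [← mul_assoc] at h1
  rw [← mul_assoc C₂, ← mul_assoc] at h7
  exact ⟨h1.trans (mul_le_mul_of_nonneg_right (le_max_left _ _) hq),
    h7.trans (mul_le_mul_of_nonneg_right (le_max_right _ _) hq)⟩

/-- Iterates of the hybridized method with homogeneous boundary data. -/
def Mesh.IsIter (hΩ : IsRegularDomain Ω) (hB : IsTensor Ω a b B) (hΥ : IsLatentMap Ω lo hi Υ)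
    (hf : MemLp f 2 (volume.restrict Ω)) (α : ℕ → ℝ) (q : ℕ → M.SigSub p) (u : ℕ → M.VSub p)
    (μ : ℕ → M.MSub p) (ψ : ℕ → M.VSub p) : Prop :=
  ∀ k, Mesh.IsHybridSol hΩ hB hΥ (α (k + 1)) (α (k + 1) • M.load p hΩ hf + M.fV p (ψ k)) 0
    (q (k + 1)) (u (k + 1)) (μ (k + 1)) (ψ (k + 1))

/-- Every iterate satisfies the flux and latent equations and can therefore serve as reference state
for the next step. At the first step this role is played by the discrete triple built from the
initial guess. -/
theorem Mesh.IsIter.energy_le {α : ℕ → ℝ} (hα : ∀ k, 1 ≤ k → 0 < α k) {q : ℕ → M.SigSub p}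
    {u ψ : ℕ → M.VSub p} {μ : ℕ → M.MSub p} (h : M.IsIter hΩ hB hΥ hf α q u μ ψ)
    {q₀ : M.SigSub p} {u₀ : M.VSub p} {μ₀ : M.MSub p} (hμ₀ : μ₀ ∈ M.M0 p)
    (hq₀ : ∀ r, M.mS p hΩ hB q₀ r + M.bh p r (u₀, μ₀) = 0)
    (hu₀ : ∀ w, M.fV p u₀ w = Mesh.superU hΩ hΥ (ψ 0) w) (k : ℕ) :
    1 / 2 * M.mS p hΩ hB (q (k + 1)) (q (k + 1)) - M.load p hΩ hf (u (k + 1)) ≤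
      1 / 2 * M.mS p hΩ hB q₀ q₀ - M.load p hΩ hf u₀ := by
  induction k with
  | zero => exact (h 0).energy_le (hα 1 le_rfl) hμ₀ hq₀ hu₀
  | succ k ih =>
    exact ((h (k + 1)).energy_le (hα (k + 2) (by omega)) (by simpa using (h k).mem)
      (h k).flux (h k).latent).trans ih

/-- The balance equations, summed over the iterations. -/
theorem Mesh.IsIter.sum_balance {α : ℕ → ℝ} {q : ℕ → M.SigSub p} {u ψ : ℕ → M.VSub p}
    {μ : ℕ → M.MSub p} (h : M.IsIter hΩ hB hΥ hf α q u μ ψ) (v : M.VSub p) {ν : M.MSub p}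
    (hν : ν ∈ M.M0 p) (k : ℕ) : M.fV p (ψ k) v = M.fV p (ψ 0) v +
      ∑ l ∈ Finset.Icc 1 k, α l * (M.load p hΩ hf v + M.bh p (q l) (v, ν)) := by
  induction k with
  | zero => simp
  | succ k ih =>
    have h1 := (h k).balance v ν hν
    rw [LinearMap.add_apply, LinearMap.smul_apply, smul_eq_mul] at h1
    rw [Finset.sum_Icc_succ_top (by omega)]
    linarith

/-- The initial guess, in terms of the vector spaces. -/
theorem Mesh.exists_initial (hn : 0 < n) (hA : IsTensor Ω a b A) (hΩ : IsRegularDomain Ω)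
    (hΥ : IsLatentMap Ω lo hi Υ) (κ : CellKind) (p : ℕ) (K : ℝ) : ∃ C : ℝ, 0 ≤ C ∧
    ∀ M : Mesh κ n Ω, M.IsReg K → ∀ (w : M.BrokenH1) (ψ₀ : M.VSub p),
      (∀ T, ∀ᵐ x ∂volume.restrict (M.cell T), w.val T x = M.superpose Υ ψ₀.1 T x) →
      ∃ (q₀ : M.SigSub p) (u₀ : M.VSub p) (μ₀ : M.MSub p), μ₀ ∈ M.M0 p ∧
        (∀ r, M.mS p hΩ hA.inv q₀ r + M.bh p r (u₀, μ₀) = 0) ∧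
        (∀ w, M.fV p u₀ w = Mesh.superU hΩ hΥ ψ₀ w) ∧
        M.mS p hΩ hA.inv q₀ q₀ ≤ C * M.dgNorm A w ^ 2 ∧ M.fV p u₀ u₀ ≤ C * M.dgNorm A w ^ 2 := by
  obtain ⟨C, hC, h⟩ := Mesh.exists_projection hn hΩ hA κ p K
  have hb := hA.pos'
  refine ⟨max C (C * b), le_max_of_le_left hC, fun M hM w ψ₀ hw => ?_⟩
  obtain ⟨u₀, μ₀, hμ₀, h1, h2, -, h4⟩ := h M hM w
  -- The initial flux is defined by the flux equation; no balance equation is required of it.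
  obtain ⟨q₀, hq₀⟩ := exists_riesz (M.mS p hΩ hA.inv) (fun _ h => M.eq_zero_of_mS _ _ h)
    (-(M.bh p).flip (u₀, μ₀))
  have hq : ∀ r, M.mS p hΩ hA.inv q₀ r = -M.bh p r (u₀, μ₀) := hq₀
  have hs := sq_nonneg (M.dgNorm A w)
  have hS : 0 ≤ M.mS p hΩ hA.inv q₀ q₀ := M.mS_self_nonneg _ _ _
  refine ⟨q₀, u₀, μ₀, hμ₀, fun r => by rw [hq]; ring, fun η => ?_, ?_,
    h4.trans (mul_le_mul_of_nonneg_right (le_max_left _ _) hs)⟩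
  · rw [h1, M.form_comm, M.form_eq_ip]
    refine Finset.sum_congr rfl fun T _ => integral_congr_ae ?_
    filter_upwards [hw T] with x hx
    change w.val T x * _ = _
    rw [hx]
    rfl
  -- Testing with `q₀` itself gives `m(q₀, q₀)² ≤ C b ‖w‖_DG² m(q₀, q₀)`, and one factor cancels.
  · have h5 := h2 q₀
    have h6 : b⁻¹ * M.form _ (M.incS p q₀) (M.incS p q₀) ≤ M.mS p hΩ hA.inv q₀ q₀ :=
      M.le_matF (hΩ := hΩ) (hB := hA.inv) (M.incS p q₀)
    rw [inv_mul_le_iff₀ hb] at h6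
    have h7 : M.bh p q₀ (u₀, μ₀) = -M.mS p hΩ hA.inv q₀ q₀ := by linarith [hq q₀]
    have h8 := h5.trans (mul_le_mul_of_nonneg_left h6 (mul_nonneg hC hs))
    rw [h7, neg_sq] at h8
    refine le_trans ?_ (mul_le_mul_of_nonneg_right (le_max_right C (C * b)) hs)
    rcases hS.eq_or_lt with h0 | h0
    · rw [← h0]
      positivity
    · refine le_of_mul_le_mul_right ?_ h0
      linarith

/-- Uniform bound for the energy of the iterates. -/
theorem Mesh.exists_energy_bound (hn : 0 < n) (hA : IsTensor Ω a b A) (hΩ : IsRegularDomain Ω)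
    (hΥ : IsLatentMap Ω lo hi Υ) (hf : MemLp f 2 (volume.restrict Ω)) (κ : CellKind) (p : ℕ)
    (K D : ℝ) : ∃ C : ℝ, 0 ≤ C ∧ ∀ M : Mesh κ n Ω, M.IsReg K → ∀ (w : M.BrokenH1) (α : ℕ → ℝ)
      (q : ℕ → M.SigSub p) (u : ℕ → M.VSub p) (μ : ℕ → M.MSub p) (ψ : ℕ → M.VSub p),
      (∀ k, 1 ≤ k → 0 < α k) → M.IsIter hΩ hA.inv hΥ hf α q u μ ψ → M.dgNorm A w ≤ D →
      (∀ T, ∀ᵐ x ∂volume.restrict (M.cell T), w.val T x = M.superpose Υ (ψ 0).1 T x) →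
      ∀ k, M.mS p hΩ hA.inv (q (k + 1)) (q (k + 1)) ≤ C ∧
        Mesh.nSq (u (k + 1), μ (k + 1)) ≤ C ∧ M.fV p (u (k + 1)) (u (k + 1)) ≤ C := by
  obtain ⟨C₁, hC₁, h₁⟩ := Mesh.exists_initial hn hA hΩ hΥ κ p K
  obtain ⟨C₂, hC₂, h₂⟩ := Mesh.exists_nSq_le_flux hA.inv hΩ κ p K
  set I := ∫ x in Ω, f x ^ 2 with hI
  have hI0 : 0 ≤ I := integral_nonneg fun x => sq_nonneg _
  set E := C₁ * D ^ 2 + I with hE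
  -- Young's inequality absorbs `¼ m(q, q)` out of `(f, u)`, leaving `¼ m(q, q) ≤ C₁ D² + ½ I + C₂
  -- I`.
  set S := 4 * E + 4 * C₂ * I with hS
  have hS0 : 0 ≤ S := by positivity
  refine ⟨max S (C₂ * S), le_max_of_le_left hS0, fun M hM w α q u μ ψ hα h hD hw k => ?_⟩
  obtain ⟨q₀, u₀, μ₀, hμ₀, hq₀, hu₀, e1, e2⟩ := h₁ M hM w (ψ 0) hw
  have e3 := h.energy_le hα hμ₀ hq₀ hu₀ k
  obtain ⟨e4, e5⟩ := h₂ M hM _ _ _ (by simpa using (h k).mem) (h k).flux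
  have e6 := Mesh.form_load hΩ hf u₀
  have e7 := Mesh.form_load hΩ hf (u (k + 1))
  have e8 : C₁ * M.dgNorm A w ^ 2 ≤ C₁ * D ^ 2 :=
    mul_le_mul_of_nonneg_left (pow_le_pow_left₀ (Real.sqrt_nonneg _) hD 2) hC₁
  have hX : 0 ≤ M.mS p hΩ hA.inv (q (k + 1)) (q (k + 1)) := M.mS_self_nonneg _ _ _
  have key : M.mS p hΩ hA.inv (q (k + 1)) (q (k + 1)) ≤ S := by
    rw [← hI] at e6 e7
    have hY : 0 ≤ M.fV p u₀ u₀ := M.form_self_nonneg _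
    generalize M.mS p hΩ hA.inv (q (k + 1)) (q (k + 1)) = X at *
    generalize M.load p hΩ hf (u (k + 1)) = L at *
    generalize M.load p hΩ hf u₀ = L₀ at *
    generalize M.fV p u₀ u₀ = Y at *
    have f1 : -L₀ ≤ 1 / 2 * I + 1 / 2 * Y := by
      refine le_of_abs_le (abs_le_of_sq_le_sq ?_ (by positivity))
      nlinarith [sq_nonneg (I - Y)]
    have f2 : L ≤ C₂ * I + 1 / 4 * X := by
      refine le_of_abs_le (abs_le_of_sq_le_sq ?_ (by positivity))
      nlinarith [sq_nonneg (C₂ * I - 1 / 4 * X), mul_le_mul_of_nonneg_left e5 hI0]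
    rw [hS, hE]
    linarith
  exact ⟨key.trans (le_max_left _ _),
    (e4.trans (mul_le_mul_of_nonneg_left key hC₂)).trans (le_max_right _ _),
    (e5.trans (mul_le_mul_of_nonneg_left key hC₂)).trans (le_max_right _ _)⟩

/-- Uniform bound for the latent variable, in the dual norm. -/
theorem Mesh.exists_dual_bound (hn : 0 < n) (hA : IsTensor Ω a b A) (hΩ : IsRegularDomain Ω)
    (hΥ : IsLatentMap Ω lo hi Υ) (hf : MemLp f 2 (volume.restrict Ω)) (κ : CellKind) (p : ℕ)
    (K S : ℝ) (hS : 0 ≤ S) : ∃ C : ℝ, 0 ≤ C ∧ ∀ M : Mesh κ n Ω, M.IsReg K → ∀ (α : ℕ → ℝ)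
      (q : ℕ → M.SigSub p) (u : ℕ → M.VSub p) (μ : ℕ → M.MSub p) (ψ : ℕ → M.VSub p),
      (∀ k, 1 ≤ k → 0 < α k) → M.IsIter hΩ hA.inv hΥ hf α q u μ ψ →
      (∀ k, M.mS p hΩ hA.inv (q (k + 1)) (q (k + 1)) ≤ S) → ∀ (w : M.BrokenH1) (k : ℕ),
        |M.ip (ψ k).1 w.val| ≤
          C * (M.l2Norm (ψ 0).1 + ∑ l ∈ Finset.Icc 1 k, α l) * M.dgNorm A w := by
  obtain ⟨C, hC, h⟩ := Mesh.exists_projection hn hΩ hA κ p K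
  have hb := hA.pos'
  set I := ∫ x in Ω, f x ^ 2 with hI
  have hI0 : 0 ≤ I := integral_nonneg fun x => sq_nonneg _
  refine ⟨√C * (1 + √I + √(b * S)), by positivity, fun M hM α q u μ ψ hα hit hq w k => ?_⟩
  obtain ⟨v, ν, hν, h1, h2, -, h4⟩ := h M hM w
  have hdg : 0 ≤ M.dgNorm A w := Real.sqrt_nonneg _
  -- As `ψ^k` is discrete, `w` may be replaced by its `L²` projection, which is admissible in the
  -- summed balance equation.
  have e1 : M.ip (ψ k).1 w.val = M.fV p (ψ k) v := by
    rw [M.fV_comm, h1, M.form_eq_ip]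
    rfl
  have e2 : |M.fV p (ψ 0) v| ≤ √C * M.l2Norm (ψ 0).1 * M.dgNorm A w := by
    refine abs_le_of_sq_le_sq ?_ (mul_nonneg (mul_nonneg (Real.sqrt_nonneg _)
      (Real.sqrt_nonneg _)) hdg)
    have f1 := M.form_sq_le (M.incV p (ψ 0)) (M.incV p v)
    have f2 : M.l2Norm (ψ 0).1 ^ 2 = M.fV p (ψ 0) (ψ 0) := by
      rw [Mesh.l2Norm, ← M.fV_eq]
      exact Real.sq_sqrt (M.form_self_nonneg _)
    rw [mul_pow, mul_pow, Real.sq_sqrt hC, f2]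
    have f3 := mul_le_mul_of_nonneg_left h4 (M.form_self_nonneg (M.incV p (ψ 0)))
    refine (f1.trans f3).trans (le_of_eq ?_)
    rw [M.fV_apply]
    ring
  have e3 : |M.load p hΩ hf v| ≤ √C * √I * M.dgNorm A w := by
    refine abs_le_of_sq_le_sq ?_ (by positivity)
    rw [mul_pow, mul_pow, Real.sq_sqrt hC, Real.sq_sqrt hI0]
    refine (Mesh.form_load hΩ hf v).trans ((mul_le_mul_of_nonneg_left h4 hI0).trans (le_of_eq ?_))
    ring
  have e4 : ∀ l ∈ Finset.Icc 1 k, |M.bh p (q l) (v, ν)| ≤ √C * √(b * S) * M.dgNorm A w := by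
    intro l hl
    refine abs_le_of_sq_le_sq ?_ (by positivity)
    rw [mul_pow, mul_pow, Real.sq_sqrt hC, Real.sq_sqrt (by positivity)]
    obtain ⟨j, rfl⟩ : ∃ j, l = j + 1 := ⟨l - 1, by have := (Finset.mem_Icc.1 hl).1; omega⟩
    have h6 : b⁻¹ * M.form _ (M.incS p (q (j + 1))) (M.incS p (q (j + 1))) ≤
        M.mS p hΩ hA.inv (q (j + 1)) (q (j + 1)) := M.le_matF (hΩ := hΩ) (hB := hA.inv) _
    rw [inv_mul_le_iff₀ hb] at h6
    have h7 := h6.trans (mul_le_mul_of_nonneg_left (hq j) hb.le)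
    refine (h2 _).trans ((mul_le_mul_of_nonneg_left h7 (by positivity)).trans (le_of_eq ?_))
    ring
  rw [e1, hit.sum_balance v hν k]
  have e5 : |∑ l ∈ Finset.Icc 1 k, α l * (M.load p hΩ hf v + M.bh p (q l) (v, ν))| ≤
      (∑ l ∈ Finset.Icc 1 k, α l) * (√C * (√I + √(b * S)) * M.dgNorm A w) := by
    rw [Finset.sum_mul]
    refine (Finset.abs_sum_le_sum_abs _ _).trans (Finset.sum_le_sum fun l hl => ?_)
    have hl0 := hα l (Finset.mem_Icc.1 hl).1
    rw [abs_mul, abs_of_pos hl0]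
    refine mul_le_mul_of_nonneg_left ((abs_add_le _ _).trans ?_) hl0.le
    linarith [e4 l hl]
  have hsum : 0 ≤ ∑ l ∈ Finset.Icc 1 k, α l :=
    Finset.sum_nonneg fun l hl => (hα l (Finset.mem_Icc.1 hl).1).le
  have hl2 : 0 ≤ M.l2Norm (ψ 0).1 := Real.sqrt_nonneg _
  refine ((abs_add_le _ _).trans (add_le_add e2 e5)).trans ?_
  have f1 : 0 ≤ √C * (√I + √(b * S)) * M.l2Norm (ψ 0).1 * M.dgNorm A w := by positivity
  have f2 : 0 ≤ √C * (∑ l ∈ Finset.Icc 1 k, α l) * M.dgNorm A w := by positivity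
  linarith

end

/-! ### The energy and dual norm bounds, and testing with `H^1_0` functions. -/

section

variable {κ : CellKind} {n : ℕ} {Ω : Set (Euc (n + 1))} {M : Mesh κ n Ω} {p : ℕ} {K : ℝ}
  {a b : ℝ} {A B : Euc (n + 1) → Matrix (Fin (n + 1)) (Fin (n + 1)) ℝ}
  {lo hi : Euc (n + 1) → EReal} {Υ : Euc (n + 1) → ℝ → ℝ}
  {f : Euc (n + 1) → ℝ}

/-! ### The first stability bound -/

theorem Mesh.IsHybridIterates.exists_isIter (hΩ : IsRegularDomain Ω) (hA : IsTensor Ω a b A)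
    (hΥ : IsLatentMap Ω lo hi Υ) (hf : MemLp f 2 (volume.restrict Ω)) {α : ℕ → ℝ}
    {q : ℕ → M.Cell → Euc (n + 1) → Euc (n + 1)} {u : ℕ → M.Cell → Euc (n + 1) → ℝ}
    {μ : ℕ → M.Facet → Euc n → ℝ} {ψ : ℕ → M.Cell → Euc (n + 1) → ℝ} (h0 : ψ 0 ∈ M.VSpace p)
    (h : M.IsHybridIterates p A f (fun _ => 0) Υ α q u μ ψ) :
    ∃ (q' : ℕ → M.SigSub p) (u' : ℕ → M.VSub p) (μ' : ℕ → M.MSub p) (ψ' : ℕ → M.VSub p),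
      M.IsIter hΩ hA.inv hΥ hf α q' u' μ' ψ' ∧ (∀ k, (ψ' k).1 = ψ k) ∧
        ∀ k, (q' (k + 1)).1 = q (k + 1) ∧ (u' (k + 1)).1 = u (k + 1) ∧
          (μ' (k + 1)).1 = μ (k + 1) := by
  have hs := fun k => h (k + 1) (by omega)
  have hψ : ∀ k, ψ k ∈ M.VSub p := fun k => by
    cases k with
    | zero => exact Mesh.mem_VSpace.1 h0
    | succ k => exact Mesh.mem_VSpace.1 (hs k).mem_psi
  let q' : ℕ → M.SigSub p := fun k => Nat.casesOn k 0 fun k =>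
    ⟨q (k + 1), Mesh.mem_SigmaSpace.1 (hs k).mem_q⟩
  let u' : ℕ → M.VSub p := fun k => Nat.casesOn k 0 fun k =>
    ⟨u (k + 1), Mesh.mem_VSpace.1 (hs k).mem_u⟩
  let μ' : ℕ → M.MSub p := fun k => Nat.casesOn k 0 fun k =>
    ⟨μ (k + 1), Mesh.mem_MSub.2 fun F => mem_polySub.2 ((hs k).mem_uh.1 F)⟩
  refine ⟨q', u', μ', fun k => ⟨ψ k, hψ k⟩, fun k => ?_, fun k => rfl,
    fun k => ⟨rfl, rfl, rfl⟩⟩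
  have hμ₀ : ∀ ν : M.MSub p, ν.1 ∈ M.MSpace p (fun _ => 0) ↔ ν - 0 ∈ M.M0 p := fun ν => by
    rw [sub_zero]
    exact Mesh.mem_MSpace_zero'
  exact (Mesh.solvesHybrid_iff hΩ hΥ hA.inv hf hμ₀ (ψ₀ := ⟨ψ k, hψ k⟩) (q := q' (k + 1))
    (u := u' (k + 1)) (μ := μ' (k + 1)) (ψ := ⟨ψ (k + 1), hψ (k + 1)⟩)).1 (hs k)

theorem Mesh.InitialGuess.exists_brokenH1 (hΩ : IsRegularDomain Ω)
    {ψ₀ : M.Cell → Euc (n + 1) → ℝ} (h : M.InitialGuess p A Υ K ψ₀) : ∃ w : M.BrokenH1,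
      (∀ T, ∀ᵐ x ∂volume.restrict (M.cell T), w.val T x = M.superpose Υ ψ₀ T x) ∧
      M.dgNorm A w ≤ K ∧ ∀ T, ∀ x ∈ M.cell T, |ψ₀ T x| ≤ K := by
  obtain ⟨-, w, m, hw, hm, hK⟩ := h
  have hdg : 0 ≤ M.dgNorm A w := Real.sqrt_nonneg _
  -- A mesh of a nonempty domain has an element with a point in it, where the bound is tested.
  have hm0 : 0 ≤ m := by
    obtain ⟨x, hx⟩ := hΩ.isConnected.nonempty
    have hx' : x ∈ ⋃ T, M.cell T := M.iUnion_cell ▸ subset_closure hx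
    obtain ⟨T, hT⟩ := mem_iUnion.1 hx'
    exact (abs_nonneg _).trans (hm T x hT)
  exact ⟨w, hw, by linarith, fun T x hx => (hm T x hx).trans (by linarith)⟩

theorem Mesh.tripleNorm_le (hΩ : IsRegularDomain Ω) (hA : IsTensor Ω a b A) (hM : M.IsReg K)
    {S : ℝ} {q : M.SigSub p} {u : M.VSub p} {μ : M.MSub p} (h1 : M.mS p hΩ hA.inv q q ≤ S)
    (h2 : Mesh.nSq (u, μ) ≤ S) : M.tripleNorm A q.1 u.1 μ.1 ≤ √(S + (b + 1) * S) := by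
  have hb := hA.pos'
  refine Real.sqrt_le_sqrt ?_
  have h3 : M.ipMat A (M.brokenGrad u.1) (M.brokenGrad u.1) ≤
      b * M.form _ (M.gradV p u) (M.gradV p u) := M.matF_le (hΩ := hΩ) (hB := hA) (M.gradV p u)
  have h4 : Mesh.nSq (u, μ) = M.form _ (M.gradV p u) (M.gradV p u) +
      ∑ T, (M.hCell T)⁻¹ * ∑ i, M.facetInt (M.facetOf T i)
        (fun y => (u.1 T (M.pt T i y) - μ.1 (M.facetOf T i) y) ^ 2) := rfl
  have h5 : 0 ≤ ∑ T, (M.hCell T)⁻¹ * ∑ i, M.facetInt (M.facetOf T i)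
        (fun y => (u.1 T (M.pt T i y) - μ.1 (M.facetOf T i) y) ^ 2) :=
    Finset.sum_nonneg fun T _ => mul_nonneg (inv_nonneg.2 (hM.pos T).le)
      (Finset.sum_nonneg fun i _ => M.facetInt_nonneg _ fun y => sq_nonneg _)
  have h6 := M.form_self_nonneg (M.gradV p u)
  rw [← M.mS_eq hΩ hA.inv]
  have h7 := mul_le_mul_of_nonneg_left h2 (by linarith : 0 ≤ b + 1)
  rw [h4] at h7
  nlinarith [mul_nonneg hb.le h5]

theorem Mesh.dualNorm_le {ψ : M.Cell → Euc (n + 1) → ℝ} {C : ℝ} (hC : 0 ≤ C)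
    (h : ∀ w : M.BrokenH1, |M.ip ψ w.val| ≤ C * M.dgNorm A w) :
    M.dualNorm A ψ ≤ ENNReal.ofReal C := by
  refine iSup_le fun w => ENNReal.ofReal_le_ofReal ?_
  have hdg : 0 ≤ M.dgNorm A w := Real.sqrt_nonneg _
  -- If the norm of `w` is zero, the quotient is zero by convention.
  exact div_le_of_le_mul₀ hdg hC ((le_abs_self _).trans (h w))

theorem exists_stability (hn : 0 < n) (κ : CellKind) (p : ℕ) (hΩ : IsRegularDomain Ω)
    (hA : IsTensor Ω a b A) (hf : MemLp f 2 (volume.restrict Ω)) (hΥ : IsLatentMap Ω lo hi Υ)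
    (σ K : ℝ) : ∃ C₀ : ℝ≥0, ∀ M : Mesh κ n Ω, M.ShapeRegular σ →
      ∀ α : ℕ → ℝ, (∀ k, 1 ≤ k → 0 < α k) → ∀ q u uh ψ, M.InitialGuess p A Υ K (ψ 0) →
        M.IsHybridIterates p A f (fun _ => 0) Υ α q u uh ψ → ∀ k, 1 ≤ k →
          ENNReal.ofReal (M.tripleNorm A (q k) (u k) (uh k)) +
            M.dualNorm A (ψ k) /
              ENNReal.ofReal (M.l2Norm (ψ 0) + ∑ l ∈ Finset.Icc 1 k, α l) ≤ C₀ := by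
  obtain ⟨N, hN⟩ := exists_isReg κ n σ
  obtain ⟨S, hS, h₁⟩ := Mesh.exists_energy_bound hn hA hΩ hΥ hf κ p N K
  obtain ⟨C, hC, h₂⟩ := Mesh.exists_dual_bound hn hA hΩ hΥ hf κ p N S hS
  refine ⟨Real.toNNReal (√(S + (b + 1) * S)) + Real.toNNReal C,
    fun M hM α hα q u μ ψ h0 h k hk => ?_⟩
  obtain ⟨w, hw, hwK, -⟩ := h0.exists_brokenH1 hΩ
  obtain ⟨q', u', μ', ψ', hit, hψ, hqu⟩ := h.exists_isIter hΩ hA hΥ hf h0.1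
  have e := h₁ M (hN M hM) w α q' u' μ' ψ' hα hit hwK (by rwa [hψ])
  have hd := h₂ M (hN M hM) α q' u' μ' ψ' hα hit fun k => (e k).1
  have hsum : 0 ≤ ∑ l ∈ Finset.Icc 1 k, α l :=
    Finset.sum_nonneg fun l hl => (hα l (Finset.mem_Icc.1 hl).1).le
  have hl2 : 0 ≤ M.l2Norm (ψ 0) := Real.sqrt_nonneg _
  obtain ⟨j, rfl⟩ : ∃ j, k = j + 1 := ⟨k - 1, by omega⟩
  rw [ENNReal.coe_add]
  refine add_le_add (ENNReal.ofReal_le_ofReal ?_) (ENNReal.div_le_of_le_mul ?_)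
  · rw [← (hqu j).1, ← (hqu j).2.1, ← (hqu j).2.2]
    exact Mesh.tripleNorm_le hΩ hA (hN M hM) (e j).1 (e j).2.1
  · change _ ≤ ENNReal.ofReal C * _
    rw [← ENNReal.ofReal_mul hC]
    refine Mesh.dualNorm_le (mul_nonneg hC (add_nonneg hl2 hsum)) fun w => ?_
    have := hd w (j + 1)
    rwa [hψ, hψ] at this

/-! ### The second stability bound -/

/-- A smooth function with compact support in `Ω`, as an element of the broken space. -/
def Mesh.ofSmooth (M : Mesh κ n Ω) (φ : Euc (n + 1) → ℝ) (hφ : ContDiff ℝ ∞ φ) : M.BrokenH1 where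
  val _ := φ
  grad _ := gradient φ
  trace T i y := φ (M.pt T i y)
  memLp_val T := M.memL2_of_continuous (v := fun _ => φ) (fun _ => hφ.continuous) T
  memLp_grad T := M.memL2_of_continuous (v := fun _ => gradient φ)
    (fun _ => continuous_gradient (hφ.of_le (by norm_cast))) T
  memLp_trace T i := memLp_refCell_of_continuous (hφ.continuous.comp (continuous_pt M T i))
  isWeakGrad T Φ hΦ _ hsupp := by
    have h := M.green T (hφ.of_le (by norm_cast))
      (hΦ.of_le (by norm_cast))
    refine h.trans ?_
    have h0 : ∀ i y, Φ (M.pt T i y) = 0 := fun i y =>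
      image_eq_zero_of_notMem_tsupport fun h' => M.pt_notMem_interior T i y (hsupp h')
    simp only [h0, inner_zero_left, mul_zero]
    rw [Finset.sum_eq_zero fun i _ => by rw [M.facetInt_def]; simp, add_zero]
    simp only [← inner_gradient, real_inner_comm]
  isTrace T Φ hΦ := by
    have h := M.green T (hφ.of_le (by norm_cast))
      (hΦ.of_le (by norm_cast))
    refine h.trans ?_
    simp only [← inner_gradient, real_inner_comm]

/-- Interior facets see the same value from both sides. One-sided facets lie outside `Ω`, where the
function vanishes; this is the point at which conformity of the mesh enters. -/
theorem Mesh.jumpSq_ofSmooth (hΩ : IsOpen Ω) {φ : Euc (n + 1) → ℝ} (hφ : ContDiff ℝ ∞ φ)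
    (hsupp : tsupport φ ⊆ Ω) (F : M.Facet) : M.jumpSq (M.ofSmooth φ hφ) F = 0 := by
  by_cases hF : M.IsBoundary F
  · rw [Mesh.jumpSq_of_isBoundary _ hF]
    refine Finset.sum_eq_zero fun s hs => ?_
    have hs' := M.mem_sides.1 hs
    rw [M.facetInt_def, setIntegral_eq_zero_of_forall_eq_zero, mul_zero]
    intro y hy
    have h0 : φ (M.pt s.1 s.2 y) = 0 := image_eq_zero_of_notMem_tsupport fun h' =>
      M.pt_notMem_of_isBoundary hΩ (by rwa [hs']) hy (hsupp h')
    change φ (M.pt s.1 s.2 y) ^ 2 = 0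
    rw [h0, sq, zero_mul]
  · rw [Mesh.jumpSq_of_not_isBoundary _ hF, Finset.sum_eq_zero, mul_zero]
    refine fun s hs => Finset.sum_eq_zero fun s' hs' => ?_
    have h0 : ∀ y, M.pt s.1 s.2 y = M.pt s'.1 s'.2 y :=
      M.pt_eq_pt ((M.mem_sides.1 hs).trans (M.mem_sides.1 hs').symm)
    have h1 : ∀ y, ((M.ofSmooth φ hφ).trace s.1 s.2 y - (M.ofSmooth φ hφ).trace s'.1 s'.2 y) ^ 2 =
        0 := fun y => by
      change (φ (M.pt s.1 s.2 y) - φ (M.pt s'.1 s'.2 y)) ^ 2 = 0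
      rw [h0, sub_self, sq, zero_mul]
    rw [M.facetInt_def]
    simp only [h1, integral_zero, mul_zero]

theorem eLpNorm_two_toReal_sq {E V : Type*} [MeasurableSpace E] {μ : Measure E}
    [NormedAddCommGroup V] {g : E → V} (hg : MemLp g 2 μ) :
    (eLpNorm g 2 μ).toReal ^ 2 = ∫ x, ‖g x‖ ^ 2 ∂μ := by
  have h := hg.eLpNorm_eq_integral_rpow_norm two_ne_zero ENNReal.ofNat_ne_top
  have h0 : 0 ≤ ∫ x, ‖g x‖ ^ 2 ∂μ := integral_nonneg fun x => sq_nonneg _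
  rw [h]
  simp only [ENNReal.toReal_ofNat, Real.rpow_ofNat]
  rw [ENNReal.toReal_ofReal (Real.rpow_nonneg h0 _), ← Real.rpow_natCast, ← Real.rpow_mul h0]
  norm_num

theorem Mesh.sum_setIntegral_sq_cell (hΩ : IsRegularDomain Ω) {g : Euc (n + 1) → ℝ}
    (hg : MemLp g 2 (volume.restrict Ω)) :
    ∑ T : M.Cell, ∫ x in M.cell T, g x ^ 2 = (eLpNorm g 2 (volume.restrict Ω)).toReal ^ 2 := by
  rw [M.sum_setIntegral_cell hΩ hg.integrable_sq, eLpNorm_two_toReal_sq hg]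
  simp only [Real.norm_eq_abs, sq_abs]

/-- Functions in `H¹₀(Ω)` are admissible in the dual norm. -/
theorem MemH10.exists_ip_le (hΩ : IsRegularDomain Ω) (hA : IsTensor Ω a b A)
    {g : Euc (n + 1) → ℝ} (hg : MemH10 Ω g) (κ : CellKind) (p : ℕ) : ∃ D : ℝ, 0 ≤ D ∧
      ∀ (M : Mesh κ n Ω) (ψ : M.VSub p) (C : ℝ), 0 ≤ C →
        (∀ w : M.BrokenH1, |M.ip ψ.1 w.val| ≤ C * M.dgNorm A w) →
          |M.ip ψ.1 (M.toBroken g)| ≤ C * D := by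
  obtain ⟨G, hg2, hG2, φ, hφ, hlim, hlim'⟩ := hg
  -- Eventually the smooth gradients are within distance one of `G`, so this number bounds their
  -- norms independently of the mesh.
  set D := (eLpNorm G 2 (volume.restrict Ω)).toReal + 1
  have hD : 0 ≤ D := by positivity
  have hb := hA.pos'
  refine ⟨√b * D, by positivity, fun M ψ C hC h => ?_⟩
  have hφ2 : ∀ j, MemLp (φ j) 2 (volume.restrict Ω) := fun j =>
    ((hφ j).1.continuous.memLp_of_hasCompactSupport (hφ j).2.1).restrict _
  have hgc : ∀ j, Continuous (gradient (φ j)) := fun j =>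
    continuous_gradient ((hφ j).1.of_le (by norm_cast))
  have hgs : ∀ j, MemLp (gradient (φ j)) 2 (volume.restrict Ω) := fun j => by
    have hcs : HasCompactSupport (gradient (φ j)) :=
      ((hφ j).2.1.fderiv (𝕜 := ℝ)).comp_left (g := (InnerProductSpace.toDual ℝ _).symm)
        (map_zero _)
    exact ((hgc j).memLp_of_hasCompactSupport hcs).restrict _
  have h1 : ∀ᶠ j in atTop, |M.ip ψ.1 (M.toBroken (φ j))| ≤ C * (√b * D) := by
    filter_upwards [hlim'.eventually (gt_mem_nhds (zero_lt_one (α := ℝ≥0∞)))] with j hj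
    refine (h (M.ofSmooth (φ j) (hφ j).1)).trans (mul_le_mul_of_nonneg_left ?_ hC)
    have e1 : (eLpNorm (gradient (φ j)) 2 (volume.restrict Ω)).toReal ≤ D := by
      have e2 : eLpNorm (gradient (φ j)) 2 (volume.restrict Ω) ≤
          eLpNorm G 2 (volume.restrict Ω) + 1 := by
        have e3 := eLpNorm_add_le (μ := volume.restrict Ω) (p := 2) hG2.1
          (((hgs j).sub hG2).1) (by norm_num)
        rw [add_sub_cancel] at e3
        exact e3.trans (add_le_add le_rfl hj.le)
      have e4 := ENNReal.toReal_mono (by simp [hG2.2.ne]) e2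
      rwa [ENNReal.toReal_add hG2.2.ne ENNReal.one_ne_top, ENNReal.toReal_one] at e4
    refine abs_le_of_sq_le_sq' ?_ (by positivity) |>.2
    rw [(M.ofSmooth (φ j) (hφ j).1).dgNorm_sq hΩ hA, mul_pow, Real.sq_sqrt hb.le]
    simp only [Mesh.jumpSq_ofSmooth hΩ.isOpen (hφ j).1 (hφ j).2.2, mul_zero,
      Finset.sum_const_zero, add_zero]
    refine (M.matF_le (hΩ := hΩ) (hB := hA) _).trans (mul_le_mul_of_nonneg_left ?_ hb.le)
    rw [M.form_self]
    have e5 := M.sum_setIntegral_cell hΩ (hgs j).norm.integrable_sq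
    refine (e5.trans (eLpNorm_two_toReal_sq (hgs j)).symm).le.trans ?_
    exact pow_le_pow_left₀ ENNReal.toReal_nonneg e1 2
  -- For fixed `ψ` the pairing is continuous in `L²`, so the bound for smooth functions passes to
  -- the limit.
  have h2 : Tendsto (fun j => M.ip ψ.1 (M.toBroken (φ j))) atTop
      (𝓝 (M.ip ψ.1 (M.toBroken g))) := by
    rw [tendsto_iff_norm_sub_tendsto_zero]
    have e1 : Tendsto (fun j => √(M.fV p ψ ψ) *
        (eLpNorm (φ j - g) 2 (volume.restrict Ω)).toReal) atTop (𝓝 0) := by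
      have := (ENNReal.tendsto_toReal ENNReal.zero_ne_top).comp hlim
      simpa using this.const_mul (√(M.fV p ψ ψ))
    refine squeeze_zero (fun _ => norm_nonneg _) (fun j => ?_) e1
    rw [Real.norm_eq_abs]
    have e2 : M.ip ψ.1 (M.toBroken (φ j)) - M.ip ψ.1 (M.toBroken g) =
        M.form ℝ (M.incV p ψ) (⟨M.toBroken (φ j), toBroken_mem hΩ (hφ2 j)⟩ -
          ⟨M.toBroken g, toBroken_mem hΩ hg2⟩) := by
      rw [map_sub, M.form_eq_ip, M.form_eq_ip]
      rfl
    have e3 := M.form_sq_le (M.incV p ψ) (⟨M.toBroken (φ j), toBroken_mem hΩ (hφ2 j)⟩ -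
          ⟨M.toBroken g, toBroken_mem hΩ hg2⟩)
    have e4 : M.form ℝ (⟨M.toBroken (φ j), toBroken_mem hΩ (hφ2 j)⟩ -
          ⟨M.toBroken g, toBroken_mem hΩ hg2⟩) (⟨M.toBroken (φ j), toBroken_mem hΩ (hφ2 j)⟩ -
          ⟨M.toBroken g, toBroken_mem hΩ hg2⟩) =
        (eLpNorm (φ j - g) 2 (volume.restrict Ω)).toReal ^ 2 := by
      rw [← M.sum_setIntegral_sq_cell hΩ ((hφ2 j).sub hg2), M.form_self]
      simp only [Real.norm_eq_abs, sq_abs]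
      rfl
    rw [e2]
    refine abs_le_of_sq_le_sq ?_ (mul_nonneg (Real.sqrt_nonneg _) ENNReal.toReal_nonneg)
    have hψ : 0 ≤ M.fV p ψ ψ := M.form_self_nonneg _
    rw [mul_pow, Real.sq_sqrt hψ, ← e4]
    exact e3
  exact le_of_tendsto h2.abs h1

end

/-! ### Coercivity of the latent map and the `L^1` bound. -/

section

variable {κ : CellKind} {n : ℕ} {Ω : Set (Euc (n + 1))} {M : Mesh κ n Ω} {p : ℕ} {K : ℝ}
  {a b : ℝ} {A B : Euc (n + 1) → Matrix (Fin (n + 1)) (Fin (n + 1)) ℝ}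
  {lo hi : Euc (n + 1) → EReal} {Υ : Euc (n + 1) → ℝ → ℝ}
  {f : Euc (n + 1) → ℝ}

/-! ### Coercivity of the latent map -/

/-- Beyond the points where `Υ₀` takes the values `b / 2` and `a / 2`, its sign agrees with that of
`z` and its modulus is at least `β`. The remaining arguments are bounded and `Υ₀` is bounded, so a
constant compensates. -/
theorem exists_mul_abs_le {Υ₀ : ℝ → ℝ} {a b : ℝ} (hm : StrictMono Υ₀)
    (hr : range Υ₀ = Ioo a b) (ha : a < 0) (hb : 0 < b) :
    ∃ β Z : ℝ, 0 < β ∧ 0 ≤ Z ∧ ∀ z, β * |z| ≤ Υ₀ z * z + Z := by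
  obtain ⟨zp, hp⟩ : b / 2 ∈ range Υ₀ := by
    rw [hr]
    constructor <;> linarith
  obtain ⟨zm, hz⟩ : a / 2 ∈ range Υ₀ := by
    rw [hr]
    constructor <;> linarith
  have hmem : ∀ z, Υ₀ z ∈ Ioo a b := fun z => hr ▸ mem_range_self z
  set β := min (b / 2) (-a / 2)
  have hβ : 0 < β := lt_min (by linarith) (by linarith)
  have hβ1 : β ≤ b / 2 := min_le_left _ _
  have hβ2 : β ≤ -a / 2 := min_le_right _ _
  set N := max b (-a)
  have hN1 : b ≤ N := le_max_left _ _
  have hN2 : -a ≤ N := le_max_right _ _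
  have hZ : 0 ≤ (|zp| + |zm|) * (N + β) :=
    mul_nonneg (by positivity) (by linarith)
  refine ⟨β, (|zp| + |zm|) * (N + β), hβ, hZ, fun z => ?_⟩
  have hsmall : |z| ≤ |zp| + |zm| → β * |z| ≤ Υ₀ z * z + (|zp| + |zm|) * (N + β) := fun h => by
    have h1 : |Υ₀ z| ≤ N := abs_le.2 ⟨by linarith [(hmem z).1], by linarith [(hmem z).2]⟩
    have h2 : |Υ₀ z * z| ≤ N * (|zp| + |zm|) := by
      rw [abs_mul]
      exact mul_le_mul h1 h (abs_nonneg _) (by linarith)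
    have h3 := mul_le_mul_of_nonneg_left h hβ.le
    linarith [neg_abs_le (Υ₀ z * z)]
  rcases le_or_gt 0 z with h0 | h0
  · rcases le_or_gt zp z with h1 | h1
    · have h2 := hm.monotone h1
      rw [hp] at h2
      rw [abs_of_nonneg h0]
      have := mul_le_mul_of_nonneg_right (hβ1.trans h2) h0
      linarith
    · refine hsmall ?_
      rw [abs_of_nonneg h0]
      linarith [le_abs_self zp, abs_nonneg zm]
  · rcases le_or_gt z zm with h1 | h1
    · have h2 := hm.monotone h1
      rw [hz] at h2
      rw [abs_of_neg h0]
      have := mul_le_mul_of_nonneg_right (show β ≤ -Υ₀ z by linarith) (neg_nonneg.2 h0.le)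
      linarith
    · refine hsmall ?_
      rw [abs_of_neg h0]
      linarith [neg_le_abs zm, abs_nonneg zp]

theorem memH10_zero {d : ℕ} (Ω : Set (Euc d)) : MemH10 Ω 0 := by
  refine ⟨0, MemLp.zero, MemLp.zero, fun _ => 0, fun _ => ⟨contDiff_const, ?_, ?_⟩, ?_, ?_⟩
  · exact HasCompactSupport.zero
  · rw [show tsupport (0 : Euc d → ℝ) = ∅ from tsupport_eq_empty_iff.2 rfl]
    exact empty_subset _
  · simp
  · have : gradient (0 : Euc d → ℝ) = 0 := funext fun x => by simp [gradient]
    simp [this]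

/-- A lower bound for `Υ(x, z) z` that is affine in `|z|`, up to an `H¹₀` perturbation. -/
def IsCoercive {d : ℕ} (Ω : Set (Euc d)) (Υ : Euc d → ℝ → ℝ) : Prop :=
  ∃ (β Z : ℝ) (g : Euc d → ℝ), 0 < β ∧ 0 ≤ Z ∧ MemH10 Ω g ∧
    ∀ᵐ x ∂volume.restrict Ω, ∀ z, β * |z| + g x * z ≤ Υ x z * z + Z

theorem IsConstObstacle.isCoercive {d : ℕ} {Ω : Set (Euc d)} {Υ : Euc d → ℝ → ℝ} {a b : ℝ}
    (h : IsConstObstacle Ω Υ a b) : IsCoercive Ω Υ := by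
  obtain ⟨ha, hb, Υ₀, hm, hr, hae⟩ := h
  obtain ⟨β, Z, hβ, hZ, hle⟩ := exists_mul_abs_le hm hr ha hb
  refine ⟨β, Z, 0, hβ, hZ, memH10_zero Ω, ?_⟩
  filter_upwards [hae] with x hx z
  rw [hx z, Pi.zero_apply, zero_mul, add_zero]
  exact hle z

theorem IsAffineLatentMap.isCoercive {d : ℕ} {Ω : Set (Euc d)} {Υ : Euc d → ℝ → ℝ} {c : ℝ}
    (h : IsAffineLatentMap Ω Υ c) : IsCoercive Ω Υ := by
  obtain ⟨hc, φ₀, φ₁, Υ₀, -, hφ₀, -, hφ₁, hm, hr, h0, hae⟩ := h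
  obtain ⟨β, Z, hβ, hZ, hle⟩ := exists_mul_abs_le hm hr (by norm_num) zero_lt_one
  refine ⟨c * β, c * Z, φ₁, mul_pos hc hβ, mul_nonneg hc.le hZ, hφ₁, ?_⟩
  filter_upwards [hae, hφ₀] with x hx hx' z
  -- Nonnegativity, a consequence of `Υ₀(0) = 0`, permits replacing `φ₀` by its lower bound; `φ₁`
  -- becomes the `H^1_0` perturbation.
  have h1 : 0 ≤ Υ₀ z * z := by
    rcases le_total 0 z with hz | hz
    · exact mul_nonneg (h0 ▸ hm.monotone hz) hz
    · exact mul_nonneg_of_nonpos_of_nonpos (h0 ▸ hm.monotone hz) hz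
  have h2 := mul_le_mul_of_nonneg_right hx' h1
  have h3 := mul_le_mul_of_nonneg_left (hle z) hc.le
  rw [hx z]
  linarith

theorem Mesh.mul_l1Norm_le (hΩ : IsRegularDomain Ω) (hΥ : IsLatentMap Ω lo hi Υ) {β Z : ℝ}
    {g : Euc (n + 1) → ℝ} (hg : MemLp g 2 (volume.restrict Ω))
    (h : ∀ᵐ x ∂volume.restrict Ω, ∀ z, β * |z| + g x * z ≤ Υ x z * z + Z) (ψ : M.VSub p) :
    β * M.l1Norm ψ.1 + M.ip ψ.1 (M.toBroken g) ≤
      Mesh.superU hΩ hΥ ψ ψ + Z * volume.real Ω := by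
  have hvol : ∑ T : M.Cell, ∫ _ in M.cell T, Z = Z * volume.real Ω := by
    have hfin : volume Ω ≠ ⊤ := hΩ.isBounded.measure_lt_top.ne
    rw [M.sum_setIntegral_cell hΩ (g := fun _ => Z) (integrableOn_const hfin), setIntegral_const,
      smul_eq_mul, mul_comm]
  rw [Mesh.l1Norm, Mesh.superU_apply, ← hvol, Mesh.ip, Finset.mul_sum, ← Finset.sum_add_distrib,
    ← Finset.sum_add_distrib]
  refine Finset.sum_le_sum fun T _ => ?_
  have i1 : IntegrableOn (fun x => β * |ψ.1 T x|) (M.cell T) :=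
    ((Mesh.continuous_V ψ T).abs.continuousOn.integrableOn_compact (M.isCompact_cell T)).const_mul β
  have i2 : IntegrableOn (fun x => ψ.1 T x * M.toBroken g T x) (M.cell T) :=
    ((M.incV p ψ).2 T).integrable_mul (toBroken_mem hΩ hg T)
  have i3 := Mesh.integrable_superpose_mul hΩ hΥ ψ ψ T
  have i4 : IntegrableOn (fun _ => Z) (M.cell T) :=
    integrableOn_const (M.isCompact_cell T).measure_lt_top.ne
  rw [← integral_const_mul, ← integral_add i1 i2, ← integral_add i3 i4]
  refine integral_mono_ae (i1.add i2) (i3.add i4) ?_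
  filter_upwards [M.ae_cell hΩ h T] with x hx
  have h1 := hx (ψ.1 T x)
  change β * |ψ.1 T x| + ψ.1 T x * g x ≤ Υ x (ψ.1 T x) * ψ.1 T x + Z
  linarith

theorem Mesh.fV_le_of_abs_le (hΩ : IsRegularDomain Ω) {ψ : M.VSub p}
    (h : ∀ T, ∀ x ∈ M.cell T, |ψ.1 T x| ≤ K) : M.fV p ψ ψ ≤ K ^ 2 * volume.real Ω := by
  have hfin : volume Ω ≠ ⊤ := hΩ.isBounded.measure_lt_top.ne
  have hvol : ∑ T : M.Cell, ∫ _ in M.cell T, K ^ 2 = K ^ 2 * volume.real Ω := by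
    rw [M.sum_setIntegral_cell hΩ (g := fun _ => K ^ 2) (integrableOn_const hfin),
      setIntegral_const, smul_eq_mul, mul_comm]
  rw [M.fV_eq, Mesh.ip, ← hvol]
  have hc := fun T => Mesh.continuous_V ψ T
  refine Finset.sum_le_sum fun T _ => setIntegral_mono_on
    (((hc T).mul (hc T)).continuousOn.integrableOn_compact (M.isCompact_cell T))
    (integrableOn_const (M.isCompact_cell T).measure_lt_top.ne) (M.measurableSet_cell T)
    fun x hx => ?_
  rw [← sq, ← sq_abs]
  exact pow_le_pow_left₀ (abs_nonneg _) (h T x hx) 2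

/-- The summed balance equation is tested with the current pair `(u^k, û^k)`. Its flux equation
gives `ℬ_h(q^l, (u^k, û^k)) = -m(q^k, q^l)`, which the energy bound controls for every `l`. -/
theorem Mesh.IsIter.fV_le {hΩ : IsRegularDomain Ω} {hB : IsTensor Ω a b B}
    {hΥ : IsLatentMap Ω lo hi Υ} {hf : MemLp f 2 (volume.restrict Ω)} {α : ℕ → ℝ}
    (hα : ∀ k, 1 ≤ k → 0 < α k) {q : ℕ → M.SigSub p} {u ψ : ℕ → M.VSub p} {μ : ℕ → M.MSub p}
    (h : M.IsIter hΩ hB hΥ hf α q u μ ψ) {S : ℝ}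
    (hq : ∀ k, M.mS p hΩ hB (q (k + 1)) (q (k + 1)) ≤ S)
    (hu : ∀ k, M.fV p (u (k + 1)) (u (k + 1)) ≤ S) (k : ℕ) :
    M.fV p (ψ (k + 1)) (u (k + 1)) ≤ (M.fV p (ψ 0) (ψ 0) + S) +
      (∑ l ∈ Finset.Icc 1 (k + 1), α l) * ((∫ x in Ω, f x ^ 2) + 2 * S) := by
  have hμ : μ (k + 1) ∈ M.M0 p := by simpa using (h k).mem
  have hS : 0 ≤ S := (M.mS_self_nonneg _ _ _).trans (hq 0)
  have hI : 0 ≤ ∫ x in Ω, f x ^ 2 := integral_nonneg fun x => sq_nonneg _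
  rw [h.sum_balance (u (k + 1)) hμ (k + 1), Finset.sum_mul]
  have hprod : ∀ {x y z : ℝ}, 0 ≤ x → 0 ≤ y → z ^ 2 ≤ x * y → z ≤ x + y := fun hx hy hz =>
    le_of_abs_le (abs_le_of_sq_le_sq (by nlinarith) (add_nonneg hx hy))
  refine add_le_add ?_ (Finset.sum_le_sum fun l hl => ?_)
  · have h1 := M.form_sq_le (M.incV p (ψ 0)) (M.incV p (u (k + 1)))
    exact (hprod (M.form_self_nonneg _) (M.form_self_nonneg _) h1).trans
      (add_le_add le_rfl (hu k))
  · have hl1 := (Finset.mem_Icc.1 hl).1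
    refine mul_le_mul_of_nonneg_left ?_ (hα l hl1).le
    obtain ⟨j, rfl⟩ : ∃ j, l = j + 1 := ⟨l - 1, by omega⟩
    have h1 : M.load p hΩ hf (u (k + 1)) ≤ (∫ x in Ω, f x ^ 2) + S :=
      (hprod hI (M.form_self_nonneg _) (Mesh.form_load hΩ hf (u (k + 1)))).trans
        (add_le_add le_rfl (hu k))
    have h2 : M.bh p (q (j + 1)) (u (k + 1), μ (k + 1)) ≤ S := by
      have h3 : M.bh p (q (j + 1)) (u (k + 1), μ (k + 1)) =
          -M.mS p hΩ hB (q (k + 1)) (q (j + 1)) := by linarith [(h k).flux (q (j + 1))]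
      have h4 := M.matF_sq_le (hΩ := hΩ) (hB := hB) (M.incS p (q (k + 1))) (M.incS p (q (j + 1)))
      have h5 : M.mS p hΩ hB (q (k + 1)) (q (j + 1)) ^ 2 ≤ S ^ 2 := by
        rw [sq S]
        exact h4.trans (mul_le_mul (hq k) (hq j) (M.mS_self_nonneg hΩ hB _) hS)
      rw [h3]
      exact (neg_le_abs _).trans (abs_le_of_sq_le_sq h5 hS)
    linarith

/-- Coercivity bounds `β ‖ψ^k‖_{L¹}` by `(𝒰(ψ^k), ψ^k) - (ψ^k, g) + Z |Ω|`. The first term grows at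
most linearly in the sum of the step sizes, and the second does so by the dual norm estimate. -/
theorem exists_l1_stability (hn : 0 < n) (κ : CellKind) (p : ℕ) (hΩ : IsRegularDomain Ω)
    (hA : IsTensor Ω a b A) (hf : MemLp f 2 (volume.restrict Ω)) (hΥ : IsLatentMap Ω lo hi Υ)
    (hc : IsCoercive Ω Υ) {c : ℝ} (hc0 : 0 ≤ c) (σ K : ℝ) :
    ∃ C₁ : ℝ, ∀ M : Mesh κ n Ω, M.ShapeRegular σ →
      ∀ α : ℕ → ℝ, (∀ k, 1 ≤ k → 0 < α k) → ∀ q u uh ψ, M.InitialGuess p A Υ K (ψ 0) →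
        M.IsHybridIterates p A f (fun _ => 0) Υ α q u uh ψ → ∀ k, 1 ≤ k →
          c * M.l1Norm (ψ k) ≤ C₁ * (1 + ∑ l ∈ Finset.Icc 1 k, α l) := by
  obtain ⟨β, Z, g, hβ, hZ, hg, hle⟩ := hc
  obtain ⟨D, hD, h₃⟩ := hg.exists_ip_le hΩ hA κ p
  obtain ⟨N, hN⟩ := exists_isReg κ n σ
  obtain ⟨S, hS, h₁⟩ := Mesh.exists_energy_bound hn hA hΩ hΥ hf κ p N K
  obtain ⟨C, hC, h₂⟩ := Mesh.exists_dual_bound hn hA hΩ hΥ hf κ p N S hS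
  set I := ∫ x in Ω, f x ^ 2 with hI
  have hI0 : 0 ≤ I := integral_nonneg fun x => sq_nonneg _
  set V := volume.real Ω
  have hV : 0 ≤ V := measureReal_nonneg
  set E := K ^ 2 * V with hE
  have hE0 : 0 ≤ E := mul_nonneg (sq_nonneg _) hV
  have hg2 : MemLp g 2 (volume.restrict Ω) := by
    obtain ⟨_, h, _⟩ := hg
    exact h
  -- The factor `c / β` passes from the coercivity constant `β` to the prescribed weight `c`.
  refine ⟨c / β * (E + S + Z * V + C * √E * D + (I + 2 * S) + C * D),
    fun M hM α hα q u μ ψ h0 h k hk => ?_⟩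
  obtain ⟨w, hw, hwK, hψK⟩ := h0.exists_brokenH1 hΩ
  obtain ⟨q', u', μ', ψ', hit, hψ, -⟩ := h.exists_isIter hΩ hA hΥ hf h0.1
  have e := h₁ M (hN M hM) w α q' u' μ' ψ' hα hit hwK (by rwa [hψ])
  have hd := h₂ M (hN M hM) α q' u' μ' ψ' hα hit fun k => (e k).1
  have hs0 : 0 ≤ ∑ l ∈ Finset.Icc 1 k, α l :=
    Finset.sum_nonneg fun l hl => (hα l (Finset.mem_Icc.1 hl).1).le
  have hl2 : M.l2Norm (ψ' 0).1 ≤ √E := by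
    rw [Mesh.l2Norm, ← M.fV_eq]
    exact Real.sqrt_le_sqrt (Mesh.fV_le_of_abs_le hΩ (by rwa [hψ]))
  have hl0 : 0 ≤ M.l2Norm (ψ' 0).1 := Real.sqrt_nonneg _
  have e1 := h₃ M (ψ' k) _ (mul_nonneg hC (add_nonneg hl0 hs0)) fun w => hd w k
  have e2 := Mesh.mul_l1Norm_le hΩ hΥ hg2 hle (ψ' k)
  obtain ⟨j, rfl⟩ : ∃ j, k = j + 1 := ⟨k - 1, by omega⟩
  have e3 := hit.fV_le hα (fun k => (e k).1) (fun k => (e k).2.2) j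
  have e4 : M.fV p (ψ' 0) (ψ' 0) ≤ E := Mesh.fV_le_of_abs_le hΩ (by rwa [hψ])
  -- The latent equation tested with `ψ^k` itself: `(u^k, ψ^k) = (𝒰(ψ^k), ψ^k)`.
  rw [M.fV_comm, (hit j).latent] at e3
  rw [← hψ]
  set s := ∑ l ∈ Finset.Icc 1 (j + 1), α l
  have e5 : β * M.l1Norm (ψ' (j + 1)).1 ≤
      (E + S + Z * V + C * √E * D + (I + 2 * S) + C * D) * (1 + s) := by
    have f1 : C * (M.l2Norm (ψ' 0).1 + s) * D ≤ C * (√E + s) * D := by gcongr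
    have f2 : 0 ≤ (E + S + Z * V + C * √E * D) * s := by positivity
    have f3 : 0 ≤ (I + 2 * S) + C * D := by positivity
    linarith [neg_abs_le (M.ip (ψ' (j + 1)).1 (M.toBroken g))]
  rw [div_mul_eq_mul_div, div_mul_eq_mul_div, le_div_iff₀ hβ, mul_assoc c, mul_assoc c, mul_comm _ β]
  exact mul_le_mul_of_nonneg_left e5 hc0

end

end

end FOSPG

theorem mainTheorem4 {n : ℕ} (hn : n = 1 ∨ n = 2) (κ : CellKind) (p : ℕ)
    {Ω : Set (Euc (n + 1))} (hΩ : IsRegularDomain Ω)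
    {A : Euc (n + 1) → Matrix (Fin (n + 1)) (Fin (n + 1)) ℝ} (hA : IsDiffusionTensor Ω A)
    {f : Euc (n + 1) → ℝ} (hf : MemLp f 2 (volume.restrict Ω))
    {lo hi : Euc (n + 1) → EReal} {Υ : Euc (n + 1) → ℝ → ℝ} (hΥ : IsLatentMap Ω lo hi Υ) :
    -- existence, uniqueness, and agreement with the mixed method
    (∀ (M : Mesh κ n Ω) (g : Euc (n + 1) → ℝ), M.MemL2Boundary g →
      ∀ α : ℝ, 0 < α → ∀ ψ₀ ∈ M.VSpace p,
        ∃ q u uh ψ, M.SolvesHybrid p A f g Υ α ψ₀ q u uh ψ ∧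
          (∀ q' u' uh' ψ', M.SolvesHybrid p A f g Υ α ψ₀ q' u' uh' ψ' →
            q' = q ∧ u' = u ∧ uh' = uh ∧ ψ' = ψ) ∧
          M.SolvesMixed p A f g Υ α ψ₀ q u ψ ∧
          (∀ q' u' ψ', M.SolvesMixed p A f g Υ α ψ₀ q' u' ψ' →
            q' = q ∧ u' = u ∧ ψ' = ψ)) ∧
    -- first stability bound, for homogeneous boundary data
    (∀ σ K : ℝ, ∃ C₀ : ℝ≥0, ∀ M : Mesh κ n Ω, M.ShapeRegular σ →
      ∀ α : ℕ → ℝ, (∀ k, 1 ≤ k → 0 < α k) → ∀ q u uh ψ, M.InitialGuess p A Υ K (ψ 0) →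
        M.IsHybridIterates p A f (fun _ => 0) Υ α q u uh ψ → ∀ k, 1 ≤ k →
          ENNReal.ofReal (M.tripleNorm A (q k) (u k) (uh k)) +
            M.dualNorm A (ψ k) /
              ENNReal.ofReal (M.l2Norm (ψ 0) + ∑ l ∈ Finset.Icc 1 k, α l) ≤ C₀) ∧
    -- second stability bound, for homogeneous boundary data
    (∀ c : ℝ, ((∃ a b : ℝ, IsConstObstacle Ω Υ a b ∧ c = (b - a) / 2) ∨
        IsAffineLatentMap Ω Υ c) →
      ∀ σ K : ℝ, ∃ C₁ : ℝ, ∀ M : Mesh κ n Ω, M.ShapeRegular σ →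
        ∀ α : ℕ → ℝ, (∀ k, 1 ≤ k → 0 < α k) → ∀ q u uh ψ, M.InitialGuess p A Υ K (ψ 0) →
          M.IsHybridIterates p A f (fun _ => 0) Υ α q u uh ψ → ∀ k, 1 ≤ k →
            c * M.l1Norm (ψ k) ≤ C₁ * (1 + ∑ l ∈ Finset.Icc 1 k, α l)) := by
  obtain ⟨a, b, hA'⟩ := hA.isTensor
  have hn' : 0 < n := by omega
  refine ⟨fun M g hg α hα ψ₀ hψ₀ => Mesh.existsUnique_solution hΩ hA'.inv hf hΥ hg hα hψ₀,
    exists_stability hn' κ p hΩ hA' hf hΥ, fun c hc σ K => ?_⟩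
  have hc' : IsCoercive Ω Υ ∧ 0 ≤ c := by
    rcases hc with ⟨l, r, h, rfl⟩ | h
    · exact ⟨h.isCoercive, by linarith [h.1, h.2.1]⟩
    · exact ⟨h.isCoercive, h.1.le⟩
  exact exists_l1_stability hn' κ p hΩ hA' hf hΥ hc'.1 hc'.2 σ K
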